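/- Let $(M,g)$ be a compact smooth Riemannian manifold with smooth boundary, of dimension $m\ge 1$, with interior $M^{\mathrm{int}}$ and unit sphere bundle $SM$. For a unit vector $v$ at $x\in M^{\mathrm{int}}$ we say that $(x,v)$ is nontangential if the unit speed geodesic $\gamma_{x,v}$ with $\gamma_{x,v}(0)=x$, $\dot\gamma_{x,v}(0)=v$ reaches $\partial M$ at a finite time $\tau=\tau(x,v)>0$, stays in $M^{\mathrm{int}}$ on $[0,\tau)$, and $\dot\gamma_{x,v}(\tau)\notin T\partial M$; we put $\alpha(x,v)=\gamma_{x,v}(\tau)\in\partial M$. A geodesic graph structure $(\mathcal V,\mathcal E)$ consists, for each $x\in M^{\mathrm{int}}$, of a set $\mathcal V(x)\subset S_xM$ of nontangential directions and a set $\mathcal E(x)\subset\{(v,w)\in\mathcal V(x)\times\mathcal V(x): v\neq\pm w\}$; we write $\mathcal V=\bigcup_x\mathcal V(x)\subset SM$. It is complete if $\alpha(\mathcal V)$ is dense in $\partial M$ and for every $x\in M^{\mathrm{int}}$: (i) in the directed graph $(\mathcal V(x),\mathcal E(x))$, for any two distinct vertices $v,w$ there is a directed path from $v$ to $w$; (ii)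 there is an embedded submanifold $U_x$ of $SM$ with $U_x\subset\mathcal V$ such that $x$ is an interior point of the projection of $U_x$ to $M$; (iii) there are $v_1,\dots,v_m\in\mathcal V(x)$ spanning $T_xM$ such that $(\gamma_{x,v_i}(t),\dot\gamma_{x,v_i}(t))\in\mathcal V$ for all $t$ in a neighbourhood of $0$. A smooth Hermitian connection on $M\times\mathbb C^n$ is a smooth one-form $A$ on $M$ with values in the skew-Hermitian $n\times n$ matrices. Its parallel transport along $\gamma:[0,\tau]\to M$ is $P^A_\gamma=U(\tau)$, where $\dot U+A_\gamma(\dot\gamma)U=0$, $U(0)=I$. Its broken non-abelian X-ray transform is $$S^A(x,v,w)=P^A_{\gamma_{x,w}}\bigl(P^A_{\gamma_{x,v}}\bigr)^{-1}$$ for nontangential $(x,v)$, $(x,w)$, where $\gamma_{x,v}$ is taken on $[0,\tau(x,v)]$. Two such connections $A_1,A_2$ are gauge equivalent if there is a smooth map $\varphi:M\to \mathrm U(n)$ with $\varphi|_{\partial M}=I$ and $A_2=\varphi^{-1}d\varphi+\varphi^{-1}A_1\varphi$. **Theorem.** Let $A_1,A_2$ be smooth Hermitian connections on $M\times\mathbb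 C^n$. 1. For every complete geodesic graph structure $(\mathcal V,\mathcal E)$ on $(M,g)$: $S^{A_1}(x,v,w)=S^{A_2}(x,v,w)$ for all $x\in M^{\mathrm{int}}$ and $(v,w)\in\mathcal E(x)$ if and only if $A_1$ and $A_2$ are gauge equivalent. 2. Suppose that $m\ge 2$ and that every connected component of $M$ meets $\partial M$ (for instance, $M$ is connected and $\partial M\neq\emptyset$). Then $S^{A_1}(x,v,w)=S^{A_2}(x,v,w)$ for all $x\in M^{\mathrm{int}}$ and all nontangential directions $v,w$ at $x$ with $v\neq\pm w$ if and only if $A_1$ and $A_2$ are gauge equivalent. -/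

import Mathlib

open scoped Manifold ContDiff Bundle Topology

noncomputable section

/-! ### Geometry of a Riemannian manifold with boundary -/

/-- The model vector space `ℝᵐ`. -/
abbrev EucM (m : ℕ) : Type := EuclideanSpace ℝ (Fin m)

/-- Complex `n × n` matrices, as operators on `ℂⁿ` with its standard Hermitian inner product. -/
abbrev EndC (n : ℕ) : Type := EuclideanSpace ℂ (Fin n) →L[ℂ] EuclideanSpace ℂ (Fin n)

/-- Smooth Riemannian metrics on an `m`-dimensional manifold with boundary. -/
abbrev SmoothMetric (m : ℕ) [NeZero m] (M : Type*) [TopologicalSpace M]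
    [ChartedSpace (EuclideanHalfSpace m) M] [IsManifold (𝓡∂ m) ∞ M] : Type _ :=
  Bundle.ContMDiffRiemannianMetric (𝓡∂ m) ∞ (EucM m) (fun x : M => TangentSpace (𝓡∂ m) x)

/-- Velocity at time `t` of a curve defined on the interval `s`
(a one-sided derivative at an endpoint that belongs to `s`). -/
def velocity {m : ℕ} [NeZero m] {M : Type*} [TopologicalSpace M]
    [ChartedSpace (EuclideanHalfSpace m) M] (γ : ℝ → M) (s : Set ℝ) (t : ℝ) :
    TangentSpace (𝓡∂ m) (γ t) :=
  mfderivWithin 𝓘(ℝ, ℝ) (𝓡∂ m) γ s t (1 : ℝ)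

section Riemannian

variable {m : ℕ} [NeZero m] {M : Type*} [TopologicalSpace M]
  [ChartedSpace (EuclideanHalfSpace m) M] [IsManifold (𝓡∂ m) ∞ M]

/-- The metric coefficients `g(a, b)` at the coordinate point `y`, for constant coordinate
vector fields `a`, `b`, in the preferred chart at `p`. -/
def chartMetric (g : SmoothMetric m M) (p : M) (y a b : EucM m) : ℝ :=
  g.inner ((extChartAt (𝓡∂ m) p).symm y)
    (mfderivWithin 𝓘(ℝ, EucM m) (𝓡∂ m) (extChartAt (𝓡∂ m) p).symm (Set.range (𝓡∂ m)) y a)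
    (mfderivWithin 𝓘(ℝ, EucM m) (𝓡∂ m) (extChartAt (𝓡∂ m) p).symm (Set.range (𝓡∂ m)) y b)

/-- The derivative at `y`, in the coordinate direction `u`, of the coefficient `g(a, b)`. -/
def chartMetricDeriv (g : SmoothMetric m M) (p : M) (y u a b : EucM m) : ℝ :=
  fderivWithin ℝ (fun z => chartMetric g p z a b) (Set.range (𝓡∂ m)) y u

/-- Christoffel symbols of the first kind of the Levi-Civita connection in the chart at `p`:
`g(∇_u a, b) = ½ (∂_u g(a, b) + ∂_a g(u, b) - ∂_b g(u, a))` for constant coordinate fields. -/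
def christoffel (g : SmoothMetric m M) (p : M) (y u a b : EucM m) : ℝ :=
  (1 / 2) * (chartMetricDeriv g p y u a b + chartMetricDeriv g p y a u b
    - chartMetricDeriv g p y b u a)

/-- `γ`, restricted to the interval `s`, is a smooth geodesic: at each time `t`, in the chart `c`
of `γ` around `γ t`, the equation `c'' + Γ(c', c') = 0` holds (with the index lowered). -/
def IsGeodesicOn (g : SmoothMetric m M) (γ : ℝ → M) (s : Set ℝ) : Prop :=
  ContMDiffOn 𝓘(ℝ, ℝ) (𝓡∂ m) ∞ γ s ∧
  ∀ t ∈ s, ∀ b : EucM m,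
    chartMetric g (γ t) (extChartAt (𝓡∂ m) (γ t) (γ t))
        (iteratedDerivWithin 2 (fun r => extChartAt (𝓡∂ m) (γ t) (γ r)) s t) b
      + christoffel g (γ t) (extChartAt (𝓡∂ m) (γ t) (γ t))
        (derivWithin (fun r => extChartAt (𝓡∂ m) (γ t) (γ r)) s t)
        (derivWithin (fun r => extChartAt (𝓡∂ m) (γ t) (γ r)) s t) b = 0

/-- For a boundary point `p`: the tangent vector `v` at `p` is tangent to the boundary, i.e. its
coordinate transversal to the boundary of the half-space vanishes. -/
def IsTangentToBoundary (p : M) (v : TangentSpace (𝓡∂ m) p) : Prop :=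
  let w : EucM m := mfderiv (𝓡∂ m) 𝓘(ℝ, EucM m) (extChartAt (𝓡∂ m) p) p v
  w 0 = 0

/-- The unit sphere bundle `SM`, as a subset of the tangent bundle. -/
def unitSphereBundle (g : SmoothMetric m M) : Set (TangentBundle (𝓡∂ m) M) :=
  {p | g.inner p.proj p.snd p.snd = 1}

/-- `γ : [0, τ] → M` is a unit speed nontangential geodesic with `γ(0) = x` and `γ'(0) = v`,
which starts at an interior point, stays in the interior on `[0, τ)`, and hits the boundary
transversally at time `τ`. -/
structure IsNontangentialGeodesic (g : SmoothMetric m M) (x : M) (v : TangentSpace (𝓡∂ m) x)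
    (τ : ℝ) (γ : ℝ → M) : Prop where
  unit_speed : (⟨x, v⟩ : TangentBundle (𝓡∂ m) M) ∈ unitSphereBundle g
  pos : 0 < τ
  geodesic : IsGeodesicOn g γ (Set.Icc 0 τ)
  initial : (⟨γ 0, velocity γ (Set.Icc 0 τ) 0⟩ : TangentBundle (𝓡∂ m) M) = ⟨x, v⟩
  interior : ∀ t ∈ Set.Ico 0 τ, γ t ∈ (𝓡∂ m).interior M
  boundary : γ τ ∈ (𝓡∂ m).boundary M
  transversal : ¬ IsTangentToBoundary (m := m) (γ τ) (velocity γ (Set.Icc 0 τ) τ)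

/-- The direction `v` at `x` generates a nontangential geodesic. -/
def IsNontangential (g : SmoothMetric m M) (x : M) (v : TangentSpace (𝓡∂ m) x) : Prop :=
  ∃ d : ℝ × (ℝ → M), IsNontangentialGeodesic g x v d.1 d.2

open Classical in
/-- The exit time `τ(x, v)` together with the geodesic `γ_{x, v}`, whose values on
`[0, τ(x, v)]` are determined by `(x, v)` (junk if `v` is not nontangential). -/
def exitGeodesic (g : SmoothMetric m M) (x : M) (v : TangentSpace (𝓡∂ m) x) :
    ℝ × (ℝ → M) :=
  if h : IsNontangential g x v then h.choose else (0, fun _ => x)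

/-- The scattering map `α(x, v) = γ_{x, v}(τ(x, v))`. -/
def scatteringMap (g : SmoothMetric m M) (x : M) (v : TangentSpace (𝓡∂ m) x) : M :=
  (exitGeodesic g x v).2 (exitGeodesic g x v).1

/-- Embedded submanifolds (without boundary, of some dimension `k`) of the tangent bundle which
lie over the interior of `M`, through slice charts: around each of its points there is a smooth
chart of the tangent bundle, with values in an open subset of `ℝᵐ × ℝᵐ`, in which `U` is a
`k`-dimensional linear slice. -/
def IsEmbeddedSubmanifold (U : Set (TangentBundle (𝓡∂ m) M)) : Prop :=
  ∃ k : ℕ, ∀ p ∈ U, ∃ (Φ : OpenPartialHomeomorph (TangentBundle (𝓡∂ m) M) (EucM m × EucM m))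
    (L : Submodule ℝ (EucM m × EucM m)),
    p ∈ Φ.source ∧ Module.finrank ℝ L = k ∧
    ContMDiffOn (𝓡∂ m).tangent 𝓘(ℝ, EucM m × EucM m) ∞ Φ Φ.source ∧
    ContMDiffOn 𝓘(ℝ, EucM m × EucM m) (𝓡∂ m).tangent ∞ Φ.symm Φ.target ∧
    ∀ q ∈ Φ.source, q ∈ U ↔ Φ q ∈ L

end Riemannian

/-! ### Hermitian connections, parallel transport and gauge equivalence -/

/-- A smooth Hermitian connection on `M × ℂⁿ`: a smooth one-form on `M` with values in the
skew-Hermitian `n × n` matrices (`star` is the adjoint). Smoothness is that of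
`(x, v) ↦ A_x(v)` on the tangent bundle, i.e. smoothness of the coefficients in charts. -/
structure HermitianConnection (m : ℕ) [NeZero m] (M : Type*) [TopologicalSpace M]
    [ChartedSpace (EuclideanHalfSpace m) M] [IsManifold (𝓡∂ m) ∞ M] (n : ℕ) where
  form : ∀ x : M, TangentSpace (𝓡∂ m) x →L[ℝ] EndC n
  skewHermitian : ∀ (x : M) (v : TangentSpace (𝓡∂ m) x),
    star (form x v) = -form x v
  smooth : ContMDiff (𝓡∂ m).tangent 𝓘(ℝ, EndC n) ∞
    (fun p : TangentBundle (𝓡∂ m) M => form p.proj p.snd)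

section Connection

variable {m : ℕ} [NeZero m] {M : Type*} [TopologicalSpace M]
  [ChartedSpace (EuclideanHalfSpace m) M] [IsManifold (𝓡∂ m) ∞ M] {n : ℕ}

/-- `U` solves `U' + A(γ') U = 0` on `[0, τ]`, `U(0) = I`. -/
def IsTransportSolution (A : HermitianConnection m M n) (γ : ℝ → M) (τ : ℝ)
    (U : ℝ → EndC n) : Prop :=
  U 0 = 1 ∧ ∀ t ∈ Set.Icc 0 τ,
    HasDerivWithinAt U (-(A.form (γ t) (velocity γ (Set.Icc 0 τ) t) * U t)) (Set.Icc 0 τ) t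

open Classical in
/-- Parallel transport `P^A_γ = U(τ)` along `γ : [0, τ] → M`, where `U` is the unique solution of
the transport equation. -/
def parallelTransport (A : HermitianConnection m M n) (γ : ℝ → M) (τ : ℝ) :
    EndC n :=
  if h : ∃ U, IsTransportSolution A γ τ U then h.choose τ else 1

/-- Parallel transport `P^A_{γ_{x, v}}` along the nontangential geodesic generated by `(x, v)`. -/
def geodesicTransport (g : SmoothMetric m M) (A : HermitianConnection m M n) (x : M)
    (v : TangentSpace (𝓡∂ m) x) : EndC n :=
  parallelTransport A (exitGeodesic g x v).2 (exitGeodesic g x v).1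

/-- The broken non-abelian X-ray transform
`S^A(x, v, w) = P^A_{γ_{x, w}} (P^A_{γ_{x, v}})⁻¹`. -/
def brokenXray (g : SmoothMetric m M) (A : HermitianConnection m M n) (x : M)
    (v w : TangentSpace (𝓡∂ m) x) : EndC n :=
  geodesicTransport g A x w * Ring.inverse (geodesicTransport g A x v)

/-- `A₂ = φ⁻¹ dφ + φ⁻¹ A₁ φ` for a smooth `φ : M → U(n)` which is `I` on the boundary. -/
def GaugeEquivalent (A₁ A₂ : HermitianConnection m M n) : Prop :=
  ∃ φ : M → EndC n,
    ContMDiff (𝓡∂ m) 𝓘(ℝ, EndC n) ∞ φ ∧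
    (∀ x, φ x ∈ unitary (EndC n)) ∧
    (∀ x ∈ (𝓡∂ m).boundary M, φ x = 1) ∧
    ∀ (x : M) (v : TangentSpace (𝓡∂ m) x),
      let dφ : EndC n := mfderiv (𝓡∂ m) 𝓘(ℝ, EndC n) φ x v
      A₂.form x v = Ring.inverse (φ x) * dφ + Ring.inverse (φ x) * A₁.form x v * φ x

end Connection

/-! ### Geodesic graph structures -/

section Graph

variable {m : ℕ} [NeZero m] {M : Type*} [TopologicalSpace M]
  [ChartedSpace (EuclideanHalfSpace m) M] [IsManifold (𝓡∂ m) ∞ M]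

/-- A geodesic graph structure: sets `V(x)` of directions of nontangential geodesics starting at
the interior points `x`, and sets `E(x)` of pairs `(v, w)` in `V(x)` with `v ≠ ± w`. -/
structure GeodesicGraph (g : SmoothMetric m M) where
  V : ∀ x : M, Set (TangentSpace (𝓡∂ m) x)
  E : ∀ x : M, TangentSpace (𝓡∂ m) x → TangentSpace (𝓡∂ m) x → Prop
  nontangential : ∀ (x : M), ∀ v ∈ V x, IsNontangential g x v
  edges : ∀ (x : M) (v w : TangentSpace (𝓡∂ m) x),
    E x v w → v ∈ V x ∧ w ∈ V x ∧ v ≠ w ∧ v ≠ -w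

/-- The geodesic graph structure is complete. -/
structure GeodesicGraph.IsComplete {g : SmoothMetric m M} (G : GeodesicGraph g) : Prop where
  /-- The endpoints of the geodesics are dense in the boundary. -/
  dense_endpoints : (𝓡∂ m).boundary M ⊆
    closure {y | ∃ x : M, ∃ v ∈ G.V x, scatteringMap g x v = y}
  /-- Any two distinct vertices of the directed graph `(V(x), E(x))` are joined by a path. -/
  connected : ∀ x ∈ (𝓡∂ m).interior M, ∀ v ∈ G.V x, ∀ w ∈ G.V x,
    v ≠ w → Relation.TransGen (G.E x) v w
  /-- There is an embedded submanifold of `SM`, contained in the set of all vertices, whose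
  projection to `M` is a neighbourhood of `x`. -/
  submanifold : ∀ x ∈ (𝓡∂ m).interior M, ∃ U : Set (TangentBundle (𝓡∂ m) M),
    U ⊆ unitSphereBundle g ∧ IsEmbeddedSubmanifold U ∧ (∀ p ∈ U, p.snd ∈ G.V p.proj) ∧
    x ∈ interior ((fun p : TangentBundle (𝓡∂ m) M => p.proj) '' U)
  /-- There are `m` vertices at `x` which span the tangent space and which remain vertices under
  the geodesic flow for small positive and negative times. -/
  spanning : ∀ x ∈ (𝓡∂ m).interior M, ∃ v : Fin m → TangentSpace (𝓡∂ m) x,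
    (∀ i, v i ∈ G.V x) ∧ Submodule.span ℝ (Set.range v) = ⊤ ∧
    ∀ i, ∃ ε > 0, ∃ γ : ℝ → M, IsGeodesicOn g γ (Set.Ioo (-ε) ε) ∧
      (⟨γ 0, velocity γ (Set.Ioo (-ε) ε) 0⟩ : TangentBundle (𝓡∂ m) M) = ⟨x, v i⟩ ∧
      ∀ t ∈ Set.Ioo (-ε) ε, velocity γ (Set.Ioo (-ε) ε) t ∈ G.V (γ t)

/-- All directions of nontangential geodesics and all pairs `v ≠ ± w` of such directions. -/
def fullGeodesicGraph (g : SmoothMetric m M) : GeodesicGraph g where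
  V x := {v | IsNontangential g x v}
  E x v w := IsNontangential g x v ∧ IsNontangential g x w ∧ v ≠ w ∧ v ≠ -w
  nontangential _ _ hv := hv
  edges _ _ _ h := h

/-- The broken non-abelian X-ray transforms of `A₁` and `A₂` agree on all edges of `G`. -/
def GeodesicGraph.XrayAgree {g : SmoothMetric m M} {n : ℕ} (G : GeodesicGraph g)
    (A₁ A₂ : HermitianConnection m M n) : Prop :=
  ∀ (x : M) (v w : TangentSpace (𝓡∂ m) x), G.E x v w →
    brokenXray g A₁ x v w = brokenXray g A₂ x v w

end Graph

end

/-!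
The broken X-ray transforms of `A₁` and `A₂` agree along two directions `v`, `w` at `x` exactly if
the ratios `(P^{A₁})⁻¹ P^{A₂}` of the parallel transports in these directions agree
(`brokenXray_eq_iff`). If `φ` is a gauge transformation from `A₁` to `A₂` with `φ = 1` on the
boundary, these ratios are all equal to `φ x`, which is the easy implication
(`GaugeEquivalent.xrayAgree`). Conversely, if the ratio at `x` does not depend on the direction, it
defines a function `φ` on the interior, and `φ` is the gauge:

* Along a geodesic which stays in the set `V` of admissible directions, both transports solve linear
  equations, so that `φ' = φ A₂ - A₁ φ` in the direction of the geodesic. Such directions span every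
  tangent space. If `φ` is continuous, it therefore is differentiable with the expected
  differential, by comparison with narrow cones (`hasFDerivAt_of_hasDerivAlongSpanning`).
  Continuity is only available on the members of a countable closed cover, but Baire's theorem
  yields a piece of the set of bad points on which `φ` is continuous, and Lipschitz estimates on
  balls of good points that touch this piece exclude it (`continuousOn_of_hasDerivAlongSpanning`).
* Towards the end of a nontangential geodesic, `φ` tends to `1`, as the remaining transports are
  close to the identity. Since the differential of `φ` is bounded and the endpoints are dense, `φ`
  tends to `1` at every boundary point (`IsTransportRatio.tendsto_one`). The differential equation
  then shows that the extension by `1` is smooth up to the boundary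
  (`IsTransportRatio.gaugeEquivalent`).

These arguments rest on the stability of nontangential geodesics: nontangentiality is an open
condition in the unit sphere bundle, and transport depends continuously on the direction
(`IsNontangential.eventually`).

For a complete geodesic graph structure, connectedness of the graphs gives independence of the
direction, and the closed cover comes from compact pieces of the submanifolds
(`GeodesicGraph.IsComplete.gaugeEquivalent`).

For the family of all nontangential directions one has to produce such directions. An interior point
`x` is joined to a nearest boundary point by a curve along which the distance to the boundary
decreases at unit rate; it is constructed as a limit of discrete approximations
(`exists_curve_boundaryDist_eq`). In the interior it is a geodesic: it coincides with the short
geodesic between any two of its nearby points, because short geodesics minimize the energy and the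
comparison curve does not exceed their speed (`exists_short_geodesic`, `exists_eqOn_of_speed_le`,
`IsBoundaryMinimizing.isSprayAt`). It meets the boundary transversally, since the distance to the
boundary is at most a multiple of the transversal coordinate
(`exists_isNontangential_riemannianDist_le`). By openness, the nontangential directions at `x` span
the tangent space, so for `m ≥ 2` opposite directions can be compared through a third one; the
endpoints are dense because a point near `b ∈ ∂M` has its nearest boundary point near `b`
(`gaugeEquivalent_of_xrayAgree_full`).
-/

/-! ### Functions differentiable along spanning families of curves -/

section SpanningCurves

variable {E W : Type*} [NormedAddCommGroup E] [InnerProductSpace ℝ E]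
  [NormedAddCommGroup W] [NormedSpace ℝ W]

/-- Through `y` there are curves whose velocities span the whole space and along which `φ` is
differentiable at `y`, with the derivative prescribed by the linear map `N`. Nothing is assumed
about `φ` along other curves. -/
def HasDerivAlongSpanning (φ : E → W) (N : E →L[ℝ] W) (y : E) : Prop :=
  ∃ S : Set E, Submodule.span ℝ S = ⊤ ∧ ∀ v ∈ S, ∃ c : ℝ → E, c 0 = y ∧ HasDerivAt c v 0 ∧
    HasDerivAt (fun t => φ (c t)) (N v) 0

/-- At a point where a differentiable function touches `u` from above, its derivative is the
covector that prescribes the derivatives of `u` along the spanning curves. -/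
lemma HasDerivAlongSpanning.eq_of_isLocalMax {u ψ : E → ℝ} {ℓ ψ' : E →L[ℝ] ℝ} {y : E}
    (h : HasDerivAlongSpanning u ℓ y) (hψ : HasFDerivAt ψ ψ' y)
    (hmax : IsLocalMax (fun z => u z - ψ z) y) : ψ' = ℓ := by
  obtain ⟨S, hS, hc⟩ := h
  apply ContinuousLinearMap.coe_injective
  apply LinearMap.ext_on hS
  intro v hv
  obtain ⟨c, hc0, hcv, hu⟩ := hc v hv
  have hcont : Filter.Tendsto c (𝓝 0) (𝓝 y) := by
    have := hcv.continuousAt.tendsto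
    rwa [hc0] at this
  have h1 : IsLocalMax (fun t => u (c t) - ψ (c t)) 0 := by
    have := hcont.eventually hmax
    simpa [IsLocalMax, IsMaxFilter, hc0] using this
  have h2 : HasDerivAt (fun t => ψ (c t)) (ψ' v) 0 := by
    rw [← hc0] at hψ
    exact hψ.comp_hasDerivAt 0 hcv
  have := h1.hasDerivAt_eq_zero (hu.sub h2)
  simp only [ContinuousLinearMap.coe_coe]
  linarith

/-- The derivative of `a ‖z - p‖ + b ‖z - p‖²` at `y ≠ p` in the radial direction. -/
lemma exists_hasFDerivAt_cone {p y : E} (hy : y ≠ p) (a b : ℝ) :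
    ∃ ψ' : E →L[ℝ] ℝ, HasFDerivAt (fun z => a * ‖z - p‖ + b * ‖z - p‖ ^ 2) ψ' y ∧
      ψ' (y - p) = a * ‖y - p‖ + 2 * b * ‖y - p‖ ^ 2 := by
  have hd : y - p ≠ 0 := sub_ne_zero.2 hy
  have h1 : DifferentiableAt ℝ (fun z : E => ‖z - p‖) y :=
    (differentiableAt_id.sub_const p).norm ℝ hd
  have h2 : DifferentiableAt ℝ (fun z => a * ‖z - p‖ + b * ‖z - p‖ ^ 2) y :=
    (h1.const_mul a).add ((h1.pow 2).const_mul b)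
  refine ⟨_, h2.hasFDerivAt, ?_⟩
  set ψ : E → ℝ := fun z => a * ‖z - p‖ + b * ‖z - p‖ ^ 2 with hψ
  have hl : HasDerivAt (fun t : ℝ => y + t • (y - p)) (y - p) 0 := by
    simpa using ((hasDerivAt_id (0 : ℝ)).smul_const (y - p)).const_add y
  have h3 : HasDerivAt (fun t : ℝ => ψ (y + t • (y - p))) (fderiv ℝ ψ y (y - p)) 0 := by
    have : HasFDerivAt ψ (fderiv ℝ ψ y) (y + (0 : ℝ) • (y - p)) := by
      simpa using h2.hasFDerivAt
    exact this.comp_hasDerivAt 0 hl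
  have h4 : HasDerivAt (fun t : ℝ => a * ((1 + t) * ‖y - p‖) + b * ((1 + t) * ‖y - p‖) ^ 2)
      (a * ‖y - p‖ + 2 * b * ‖y - p‖ ^ 2) 0 := by
    have e : HasDerivAt (fun t : ℝ => (1 + t) * ‖y - p‖) ‖y - p‖ 0 := by
      simpa using ((hasDerivAt_id (0 : ℝ)).const_add 1).mul_const ‖y - p‖
    exact ((e.const_mul a).add ((e.pow 2).const_mul b)).congr_deriv (by push_cast; ring)
  refine h3.unique (h4.congr_of_eventuallyEq ?_)
  filter_upwards [Ioi_mem_nhds (show (-1 : ℝ) < 0 by norm_num)] with t ht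
  have : y + t • (y - p) - p = (1 + t) • (y - p) := by module
  simp only [hψ, this, norm_smul, Real.norm_eq_abs,
    abs_of_pos (show (0 : ℝ) < 1 + t by linarith [Set.mem_Ioi.1 ht])]

lemma HasDerivAlongSpanning.sub_comp {φ : E → W} {N : E →L[ℝ] W} {y : E}
    (h : HasDerivAlongSpanning φ N y) (ℓ : W →L[ℝ] ℝ) (N₀ : E →L[ℝ] W) (p : E) :
    HasDerivAlongSpanning (fun z => ℓ (φ z - N₀ (z - p))) (ℓ.comp (N - N₀)) y := by
  obtain ⟨S, hS, hc⟩ := h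
  refine ⟨S, hS, fun v hv => ?_⟩
  obtain ⟨c, hc0, hcv, hu⟩ := hc v hv
  refine ⟨c, hc0, hcv, ?_⟩
  have := ℓ.hasFDerivAt.comp_hasDerivAt (0 : ℝ)
    (hu.sub (N₀.hasFDerivAt.comp_hasDerivAt (0 : ℝ) (hcv.sub_const p)))
  simpa [Function.comp_def] using this

/-- A continuous function which is differentiable along spanning curves through each point, with
continuous prescribed derivatives, is differentiable. A linear functional of the error term at `p`
is compared with a narrow cone `2ε ‖z - p‖ + b ‖z - p‖²` with vertex `p`: the difference cannot
have a maximum at another point, because there the slope of the cone exceeds `ε`. -/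
theorem hasFDerivAt_of_hasDerivAlongSpanning [FiniteDimensional ℝ E] {O : Set E}
    (hO : IsOpen O) {φ : E → W}
    {N : E → E →L[ℝ] W} (hφ : ContinuousOn φ O)
    (hc : ∀ y ∈ O, HasDerivAlongSpanning φ (N y) y) {p : E} (hp : p ∈ O)
    (hN : ContinuousAt N p) : HasFDerivAt φ (N p) p := by
  rw [hasFDerivAt_iff_isLittleO, Asymptotics.isLittleO_iff]
  intro ε' hε'
  obtain ⟨ε, hε, rfl⟩ : ∃ ε : ℝ, 0 < ε ∧ ε' = 3 * ε := ⟨ε' / 3, by positivity, by ring⟩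
  obtain ⟨r, hr, hball⟩ : ∃ r > 0, ∀ y ∈ Metric.closedBall p r, y ∈ O ∧ ‖N y - N p‖ ≤ ε := by
    have h1 : ∀ᶠ y in 𝓝 p, y ∈ O ∧ ‖N y - N p‖ ≤ ε := by
      filter_upwards [hO.mem_nhds hp, Metric.tendsto_nhds.1 hN.tendsto ε hε] with y h1 h2
      exact ⟨h1, by rw [← dist_eq_norm]; exact h2.le⟩
    exact Metric.nhds_basis_closedBall.eventually_iff.1 h1
  have hcont : ContinuousOn (fun y => φ y - N p (y - p)) (Metric.closedBall p r) :=
    (hφ.mono fun y hy => (hball y hy).1).sub (by fun_prop)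
  obtain ⟨M₀, hM₀⟩ := (isCompact_closedBall p r).exists_bound_of_continuousOn
    (hcont.sub (continuousOn_const (c := φ p)))
  set M := max M₀ 0 + 1 with hM
  have hMpos : 0 < M := by positivity
  have hMb : ∀ y ∈ Metric.closedBall p r, ‖φ y - N p (y - p) - φ p‖ < M := fun y hy =>
    ((hM₀ y hy).trans (le_max_left _ _)).trans_lt (lt_add_one _)
  filter_upwards [Metric.closedBall_mem_nhds p (lt_min hr (show 0 < ε * r ^ 2 / M by positivity))]
    with y hy
  obtain ⟨ℓ, hℓ1, hℓ⟩ := exists_dual_vector'' ℝ (φ y - φ p - N p (y - p))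
  set u : E → ℝ := fun z => ℓ (φ z - N p (z - p)) with hu
  set ψ : E → ℝ := fun z => 2 * ε * ‖z - p‖ + M / r ^ 2 * ‖z - p‖ ^ 2 with hψ
  have hyr : y ∈ Metric.closedBall p r := Metric.closedBall_subset_closedBall (min_le_left _ _) hy
  have hucont : ContinuousOn (fun z => u z - ψ z) (Metric.closedBall p r) :=
    (ℓ.continuous.comp_continuousOn hcont).sub (by fun_prop)
  obtain ⟨q, hq, hqmax⟩ := (isCompact_closedBall p r).exists_isMaxOn ⟨y, hyr⟩ hucont
  have hpmem : p ∈ Metric.closedBall p r := Metric.mem_closedBall_self hr.le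
  have hup : u p - ψ p = ℓ (φ p) := by simp [hu, hψ]
  have hqp : q = p := by
    by_contra hne
    have hq' : q ∈ Metric.ball p r := by
      rcases (Metric.mem_closedBall.1 hq).lt_or_eq with h | h
      · exact h
      exfalso
      have h1 := hqmax hpmem
      simp only [Set.mem_ofPred_eq] at h1
      have h2 : u q - ℓ (φ p) ≤ ‖φ q - N p (q - p) - φ p‖ := by
        rw [hu, ← map_sub]
        exact (le_abs_self _).trans ((ℓ.le_opNorm _).trans
          (mul_le_of_le_one_left (norm_nonneg _) hℓ1))
      have h3 := hMb q hq
      rw [dist_eq_norm] at h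
      have h4 : ψ q = 2 * ε * r + M := by
        simp only [hψ, h]; field_simp
      have : 0 < ε * r := by positivity
      linarith [hup]
    have hmax : IsLocalMax (fun z => u z - ψ z) q :=
      hqmax.isLocalMax (Filter.mem_of_superset (Metric.isOpen_ball.mem_nhds hq')
        Metric.ball_subset_closedBall)
    obtain ⟨ψ', hψ', hrad⟩ := exists_hasFDerivAt_cone hne (2 * ε) (M / r ^ 2)
    have heq := ((hc q (hball q hq).1).sub_comp ℓ (N p) p).eq_of_isLocalMax hψ' hmax
    have h5 : ψ' (q - p) ≤ ε * ‖q - p‖ := by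
      rw [heq]
      calc ℓ ((N q - N p) (q - p)) ≤ ‖ℓ ((N q - N p) (q - p))‖ := le_abs_self _
        _ ≤ ‖ℓ‖ * ‖(N q - N p) (q - p)‖ := ℓ.le_opNorm _
        _ ≤ 1 * (ε * ‖q - p‖) := by
          gcongr
          exact (ContinuousLinearMap.le_opNorm _ _).trans
            (mul_le_mul_of_nonneg_right (hball q hq).2 (norm_nonneg _))
        _ = _ := one_mul _
    have h6 : 0 < ‖q - p‖ := norm_pos_iff.2 (sub_ne_zero.2 hne)
    have h7 : 0 < M / r ^ 2 * ‖q - p‖ ^ 2 := by positivity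
    have h8 : 0 < ε * ‖q - p‖ := by positivity
    linarith
  have h1 := hqmax hyr
  rw [hqp] at h1
  simp only [Set.mem_ofPred_eq, hup] at h1
  have h2 : ‖φ y - φ p - N p (y - p)‖ = u y - ℓ (φ p) := by
    have : u y - ℓ (φ p) = ℓ (φ y - φ p - N p (y - p)) := by
      rw [hu, ← map_sub, sub_right_comm]
    rw [this]
    exact_mod_cast hℓ.symm
  rw [h2]
  have h3 : ‖y - p‖ ≤ ε * r ^ 2 / M := by
    rw [← dist_eq_norm]; exact (Metric.mem_closedBall.1 hy).trans (min_le_right _ _)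
  have h4 : M / r ^ 2 * ‖y - p‖ ^ 2 ≤ ε * ‖y - p‖ := by
    calc M / r ^ 2 * ‖y - p‖ ^ 2 = M / r ^ 2 * ‖y - p‖ * ‖y - p‖ := by ring
      _ ≤ M / r ^ 2 * (ε * r ^ 2 / M) * ‖y - p‖ := by gcongr
      _ = _ := by field_simp
  have h5 : ψ y = 2 * ε * ‖y - p‖ + M / r ^ 2 * ‖y - p‖ ^ 2 := rfl
  linarith

/-- Among curves with spanning velocities through a boundary point `y` of a ball, one enters the
ball at times arbitrarily close to `0`. -/
lemma HasDerivAlongSpanning.norm_sub_le_of_ball {φ : E → W} {N : E →L[ℝ] W} {y z : E} {C : ℝ}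
    (h : HasDerivAlongSpanning φ N y) (hyz : y ≠ z)
    (hC : ∀ x ∈ Metric.ball z (dist z y), ‖φ x - φ z‖ ≤ C) : ‖φ y - φ z‖ ≤ C := by
  obtain ⟨S, hS, hc⟩ := h
  obtain ⟨v, hv, hvz⟩ : ∃ v ∈ S, inner ℝ v (y - z) ≠ 0 := by
    by_contra! hcon
    have : y - z ∈ (Submodule.span ℝ S)ᗮ := by
      rw [Submodule.mem_orthogonal]
      intro w hw
      induction hw using Submodule.span_induction with
      | mem x hx => exact hcon x hx
      | zero => simp
      | add x y _ _ hx hy => rw [inner_add_left, hx, hy, add_zero]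
      | smul a x _ hx => rw [inner_smul_left, hx, mul_zero]
    rw [hS, Submodule.top_orthogonal_eq_bot, Submodule.mem_bot] at this
    exact hyz (sub_eq_zero.1 this)
  obtain ⟨c, hc0, hcv, hu⟩ := hc v hv
  have hd : HasDerivAt (fun t => ‖c t - z‖ ^ 2) (2 * inner ℝ (c 0 - z) v) 0 :=
    (hcv.sub_const z).norm_sq
  have hnot : ¬ IsLocalMin (fun t => ‖c t - z‖ ^ 2) 0 := fun hmin => by
    have := hmin.hasDerivAt_eq_zero hd
    rw [hc0, real_inner_comm] at this
    exact hvz (by linarith)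
  have hfreq : ∃ᶠ t in 𝓝 (0 : ℝ), ‖φ (c t) - φ z‖ ≤ C := by
    rw [IsLocalMin, IsMinFilter, Filter.not_eventually] at hnot
    refine hnot.mono fun t ht => hC _ ?_
    rw [not_le, hc0] at ht
    rw [Metric.mem_ball, dist_comm z y, dist_eq_norm, dist_eq_norm]
    exact lt_of_pow_lt_pow_left₀ 2 (norm_nonneg _) ht
  have hlim : Filter.Tendsto (fun t => ‖φ (c t) - φ z‖) (𝓝 0) (𝓝 ‖φ y - φ z‖) := by
    have := hu.continuousAt.tendsto
    simp only [hc0] at this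
    exact (this.sub_const _).norm
  exact le_of_tendsto_of_frequently hlim hfreq

/-- A function which is continuous on each member of a countable closed cover, and differentiable
along spanning curves through each point with bounded prescribed derivatives, is continuous.
By Baire's theorem, otherwise the set `B` of bad points has a relatively open piece on which the
restriction of `φ` is continuous. A good point `z` near that piece is joined with its nearest bad
point `y` through a ball of good points, on which `φ` is Lipschitz, and through a spanning curve
at `y` that enters the ball. -/
theorem continuousOn_of_hasDerivAlongSpanning [FiniteDimensional ℝ E] {O : Set E}
    (hO : IsOpen O) {φ : E → W}
    {N : E → E →L[ℝ] W} {C : ℝ} (hNφ : ∀ y ∈ O, ContinuousAt φ y → ContinuousAt N y)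
    (hNC : ∀ y ∈ O, ‖N y‖ ≤ C) (hc : ∀ y ∈ O, HasDerivAlongSpanning φ (N y) y)
    {K : ℕ → Set E} (hK : ∀ i, IsClosed (K i)) (hcov : O ⊆ ⋃ i, K i)
    (hKφ : ∀ i, ContinuousOn φ (K i ∩ O)) : ContinuousOn φ O := by
  set D : Set E := {y | ∀ᶠ z in 𝓝 y, ContinuousAt φ z} with hD
  have hDo : IsOpen D := isOpen_setOfPred_eventually_nhds
  suffices hsub : O ⊆ D from fun y hy => (hsub hy).self_of_nhds.continuousWithinAt
  by_contra hcon
  obtain ⟨y₀, hy₀O, hy₀D⟩ := Set.not_subset.1 hcon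
  set B : Set E := O ∩ Dᶜ with hB
  have hBl : IsLocallyClosed B := hO.isLocallyClosed.inter hDo.isClosed_compl.isLocallyClosed
  have : LocallyCompactSpace B := hBl.locallyCompactSpace
  have : Nonempty B := ⟨⟨y₀, hy₀O, hy₀D⟩⟩
  obtain ⟨i, ⟨x₀, hx₀B⟩, hx₀⟩ := nonempty_interior_of_iUnion_of_closed
    (f := fun i => ((↑) : B → E) ⁻¹' K i) (fun i => (hK i).preimage continuous_subtype_val)
    (by
      rw [← Set.preimage_iUnion]
      exact Set.eq_univ_of_forall fun b => hcov b.2.1)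
  obtain ⟨W', hW'o, hW'⟩ := isOpen_induced_iff.1
    (isOpen_interior (s := ((↑) : B → E) ⁻¹' K i))
  set V := W' ∩ O with hV
  have hVo : IsOpen V := hW'o.inter hO
  have hx₀V : x₀ ∈ V := ⟨by
    have : (⟨x₀, hx₀B⟩ : B) ∈ ((↑) : B → E) ⁻¹' W' := by rw [hW']; exact hx₀
    exact this, hx₀B.1⟩
  have hVB : ∀ y ∈ V, y ∈ B → y ∈ K i := fun y hy hyB => by
    have : (⟨y, hyB⟩ : B) ∈ ((↑) : B → E) ⁻¹' W' := hy.1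
    rw [hW'] at this
    exact interior_subset (s := ((↑) : B → E) ⁻¹' K i) this
  refine hx₀B.2 ?_
  filter_upwards [hVo.mem_nhds hx₀V] with x hxV
  by_cases hxD : x ∈ D
  · exact hxD.self_of_nhds
  have hxB : x ∈ B := ⟨hxV.2, hxD⟩
  have hC0 : 0 ≤ C := (norm_nonneg _).trans (hNC x hxV.2)
  obtain ⟨ρ, hρ, hρV⟩ := Metric.nhds_basis_closedBall.mem_iff.1 (hVo.mem_nhds hxV)
  rw [Metric.continuousAt_iff]
  intro ε hε
  obtain ⟨δ, hδ, hδφ⟩ := Metric.continuousWithinAt_iff.1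
    (hKφ i x ⟨hVB x hxV hxB, hxV.2⟩) (ε / 2) (by positivity)
  refine ⟨min (δ / 2) (min (ρ / 2) (ε / 2 / (C + 1))), by positivity, fun z hz => ?_⟩
  rw [lt_min_iff, lt_min_iff] at hz
  obtain ⟨hz1, hz2, hz3⟩ := hz
  have hφB : ∀ y ∈ B, dist y x ≤ 2 * dist z x → dist (φ y) (φ x) < ε / 2 := fun y hyB hyx => by
    have hyV : y ∈ V := hρV (by rw [Metric.mem_closedBall]; linarith)
    exact hδφ ⟨hVB y hyV hyB, hyB.1⟩ (by linarith)
  by_cases hzB : z ∈ B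
  · linarith [hφB z hzB (by linarith [dist_nonneg (x := z) (y := x)])]
  have hBc : IsCompact (B ∩ Metric.closedBall x ρ) := by
    have : B ∩ Metric.closedBall x ρ = Dᶜ ∩ Metric.closedBall x ρ := by
      ext w
      simp only [hB, Set.mem_inter_iff]
      exact ⟨fun h => ⟨h.1.2, h.2⟩, fun h => ⟨⟨(hρV h.2).2, h.1⟩, h.2⟩⟩
    rw [this]
    exact (isCompact_closedBall x ρ).inter_left hDo.isClosed_compl
  obtain ⟨y, ⟨hyB, hyρ⟩, hymin⟩ := hBc.exists_isMinOn
    ⟨x, hxB, Metric.mem_closedBall_self hρ.le⟩ (f := fun y => dist z y) (by fun_prop)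
  have hzy : dist z y ≤ dist z x := hymin ⟨hxB, Metric.mem_closedBall_self hρ.le⟩
  have hballD : ∀ w ∈ Metric.ball z (dist z y), w ∈ O ∩ D := fun w hw => by
    rw [Metric.mem_ball] at hw
    have hwx : w ∈ Metric.closedBall x ρ := by
      rw [Metric.mem_closedBall]
      linarith [dist_triangle w z x]
    refine ⟨(hρV hwx).2, by_contra fun hwD => ?_⟩
    have := hymin (show w ∈ B ∩ Metric.closedBall x ρ from ⟨⟨(hρV hwx).2, hwD⟩, hwx⟩)
    simp only [Set.mem_ofPred_eq] at this
    rw [dist_comm z w] at this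
    linarith
  have hlip : ∀ w ∈ Metric.ball z (dist z y), ‖φ w - φ z‖ ≤ C * dist z y := by
    intro w hw
    have hyz : 0 < dist z y := lt_of_le_of_lt dist_nonneg (Metric.mem_ball.1 hw)
    have := (convex_ball z (dist z y)).norm_image_sub_le_of_norm_hasFDerivWithin_le
      (f := φ) (f' := N) (C := C)
      (fun a ha => (hasFDerivAt_of_hasDerivAlongSpanning (hO.inter hDo)
        (fun b hb => hb.2.self_of_nhds.continuousWithinAt) (fun b hb => hc b hb.1) (hballD a ha)
        (hNφ a (hballD a ha).1 (hballD a ha).2.self_of_nhds)).hasFDerivWithinAt)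
      (fun a ha => hNC a (hballD a ha).1) (Metric.mem_ball_self hyz) hw
    refine this.trans ?_
    gcongr
    rw [← dist_eq_norm]
    exact (Metric.mem_ball.1 hw).le
  have hyz : y ≠ z := fun h => hzB (h ▸ hyB)
  have h1 := (hc y hyB.1).norm_sub_le_of_ball hyz hlip
  have h2 := hφB y hyB (by linarith [dist_triangle y z x, dist_comm y z])
  have h3 : C * dist z y < ε / 2 := by
    calc C * dist z y ≤ (C + 1) * dist z x := by gcongr; linarith
      _ < (C + 1) * (ε / 2 / (C + 1)) := by gcongr
      _ = ε / 2 := by field_simp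
  calc dist (φ z) (φ x) ≤ dist (φ z) (φ y) + dist (φ y) (φ x) := dist_triangle _ _ _
    _ < ε / 2 + ε / 2 := by
      rw [dist_comm (φ z), dist_eq_norm (φ y) (φ z)]
      linarith
    _ = ε := by ring

end SpanningCurves

/-! ### Linear transport equations with skew-adjoint coefficients -/

section LinearTransport

variable {n : ℕ}

lemma EndC.norm_one_le : ‖(1 : EndC n)‖ ≤ 1 := ContinuousLinearMap.norm_id_le

lemma EndC.norm_le_one_of_star_mul_self {U : EndC n} (h : star U * U = 1) : ‖U‖ ≤ 1 := by
  have h1 : ‖U‖ * ‖U‖ ≤ 1 := by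
    rw [← CStarRing.norm_star_mul_self, h]
    exact EndC.norm_one_le
  nlinarith [norm_nonneg U]

lemma EndC.norm_le_one_of_mem_unitary {U : EndC n} (h : U ∈ unitary (EndC n)) : ‖U‖ ≤ 1 :=
  EndC.norm_le_one_of_star_mul_self (Unitary.star_mul_self_of_mem h)

lemma EndC.mul_eq_one_comm {a b : EndC n} (h : a * b = 1) : b * a = 1 := by
  have h1 : (a : EuclideanSpace ℂ (Fin n) →ₗ[ℂ] EuclideanSpace ℂ (Fin n)) * b = 1 := by
    ext1 x
    exact congrArg (fun c : EndC n => c x) h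
  rw [_root_.mul_eq_one_comm] at h1
  ext1 x
  exact congrArg (fun c : EuclideanSpace ℂ (Fin n) →ₗ[ℂ] EuclideanSpace ℂ (Fin n) => c x) h1

lemma EndC.mem_unitary_of_star_mul_self {U : EndC n} (h : star U * U = 1) :
    U ∈ unitary (EndC n) :=
  Unitary.mem_iff.2 ⟨h, EndC.mul_eq_one_comm h⟩

lemma EndC.ringInverse_eq_star {U : EndC n} (h : U ∈ unitary (EndC n)) :
    Ring.inverse U = star U := by
  have h1 := Unitary.star_mul_self_of_mem h
  have h2 := Unitary.mul_star_self_of_mem h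
  exact Ring.inverse_unit (⟨U, star U, h2, h1⟩ : (EndC n)ˣ)

/-- `U` solves `U' = -a U` on the interval `[s, t]`. -/
def IsLinearSolution (a : ℝ → EndC n) (s t : ℝ) (U : ℝ → EndC n) : Prop :=
  ∀ r ∈ Set.Icc s t, HasDerivWithinAt U (-(a r * U r)) (Set.Icc s t) r

lemma eq_left_of_hasDerivWithinAt_zero {f : ℝ → EndC n} {s t : ℝ}
    (h : ∀ r ∈ Set.Icc s t, HasDerivWithinAt f 0 (Set.Icc s t) r) :
    ∀ r ∈ Set.Icc s t, f r = f s := by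
  intro r hr
  have := norm_image_sub_le_of_norm_deriv_le_segment' (C := 0) h (by simp) r hr
  rw [zero_mul] at this
  exact sub_eq_zero.1 (norm_le_zero_iff.1 this)

lemma skew_cancel {R : Type*} [Ring R] (x a y : R) : -(x * -a) * y + x * -(a * y) = 0 := by
  noncomm_ring

lemma skew_cancel_conj {R : Type*} [Ring R] (x a p b y : R) :
    (-(x * -a) * p + x * (p * b - a * p)) * y + x * p * -(b * y) = 0 := by
  noncomm_ring

lemma IsLinearSolution.star_mul_self {a : ℝ → EndC n} {s t : ℝ} {U : ℝ → EndC n}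
    (hU : IsLinearSolution a s t U) (ha : ∀ r ∈ Set.Icc s t, star (a r) = -a r) :
    ∀ r ∈ Set.Icc s t, star (U r) * U r = star (U s) * U s :=
  eq_left_of_hasDerivWithinAt_zero (f := fun r => star (U r) * U r) fun r hr =>
    ((hU r hr).star.mul (hU r hr)).congr_deriv (by
      rw [star_neg, StarMul.star_mul, ha r hr]
      exact skew_cancel _ _ _)

lemma IsLinearSolution.mem_unitary {a : ℝ → EndC n} {s t : ℝ} {U : ℝ → EndC n}
    (hU : IsLinearSolution a s t U) (ha : ∀ r ∈ Set.Icc s t, star (a r) = -a r)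
    (hs : U s ∈ unitary (EndC n)) {r : ℝ} (hr : r ∈ Set.Icc s t) : U r ∈ unitary (EndC n) :=
  EndC.mem_unitary_of_star_mul_self
    (by rw [hU.star_mul_self ha r hr, Unitary.star_mul_self_of_mem hs])

/-- Solutions of `φ' = φ b - a φ` are conjugates of their initial values by the solutions of
`U' = -a U` and `V' = -b V`. -/
lemma IsLinearSolution.conj_eq {a b : ℝ → EndC n} {s t : ℝ} {U V φ : ℝ → EndC n}
    (hU : IsLinearSolution a s t U) (hV : IsLinearSolution b s t V)
    (ha : ∀ r ∈ Set.Icc s t, star (a r) = -a r)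
    (hφ : ∀ r ∈ Set.Icc s t, HasDerivWithinAt φ (φ r * b r - a r * φ r) (Set.Icc s t) r) :
    ∀ r ∈ Set.Icc s t, star (U r) * φ r * V r = star (U s) * φ s * V s :=
  eq_left_of_hasDerivWithinAt_zero (f := fun r => star (U r) * φ r * V r) fun r hr =>
    (((hU r hr).star.mul (hφ r hr)).mul (hV r hr)).congr_deriv (by
      rw [star_neg, StarMul.star_mul, ha r hr]
      exact skew_cancel_conj _ _ _ _ _)

lemma IsLinearSolution.star_mul {a : ℝ → EndC n} {s t : ℝ} {U V : ℝ → EndC n}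
    (hU : IsLinearSolution a s t U) (hV : IsLinearSolution a s t V)
    (ha : ∀ r ∈ Set.Icc s t, star (a r) = -a r) :
    ∀ r ∈ Set.Icc s t, star (U r) * V r = star (U s) * V s :=
  eq_left_of_hasDerivWithinAt_zero (f := fun r => star (U r) * V r) fun r hr =>
    ((hU r hr).star.mul (hV r hr)).congr_deriv (by
      rw [star_neg, StarMul.star_mul, ha r hr]
      exact skew_cancel _ _ _)

lemma IsLinearSolution.eq {a : ℝ → EndC n} {s t : ℝ} {U V : ℝ → EndC n}
    (hU : IsLinearSolution a s t U) (hV : IsLinearSolution a s t V)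
    (ha : ∀ r ∈ Set.Icc s t, star (a r) = -a r) (hs : U s ∈ unitary (EndC n))
    {r : ℝ} (hr : r ∈ Set.Icc s t) : V r = U r * (star (U s) * V s) := by
  rw [← hU.star_mul hV ha r hr, ← mul_assoc,
    Unitary.mul_star_self_of_mem (hU.mem_unitary ha hs hr), one_mul]

/-- Radial retraction of the algebra onto its unit ball. -/
noncomputable def unitBallRetraction (x : EndC n) : EndC n := (((max 1 ‖x‖)⁻¹ : ℝ) : ℂ) • x

lemma norm_unitBallRetraction_le (x : EndC n) : ‖unitBallRetraction x‖ ≤ 1 := by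
  have h : 0 < max 1 ‖x‖ := lt_of_lt_of_le one_pos (le_max_left _ _)
  rw [unitBallRetraction, norm_smul, Complex.norm_real, norm_inv, Real.norm_of_nonneg h.le,
    inv_mul_le_iff₀ h]
  simp

lemma norm_unitBallRetraction_sub_le (x y : EndC n) :
    ‖unitBallRetraction x - unitBallRetraction y‖ ≤ 2 * ‖x - y‖ := by
  have hx : 1 ≤ max 1 ‖x‖ := le_max_left _ _
  have hy : 1 ≤ max 1 ‖y‖ := le_max_left _ _
  have hxy : |max 1 ‖y‖ - max 1 ‖x‖| ≤ ‖x - y‖ :=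
    (by rw [max_comm 1, max_comm 1]; exact abs_max_sub_max_le_abs _ _ _ :
      |max 1 ‖y‖ - max 1 ‖x‖| ≤ |‖y‖ - ‖x‖|).trans
      ((abs_norm_sub_norm_le y x).trans (norm_sub_rev y x).le)
  have hyn : ‖y‖ ≤ max 1 ‖y‖ := le_max_right _ _
  unfold unitBallRetraction
  generalize max 1 ‖x‖ = α at *
  generalize max 1 ‖y‖ = β at *
  have e : ((α⁻¹ : ℝ) : ℂ) • x - ((β⁻¹ : ℝ) : ℂ) • y =
      ((α⁻¹ : ℝ) : ℂ) • (x - y) + ((α⁻¹ - β⁻¹ : ℝ) : ℂ) • y := by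
    push_cast
    module
  have h1 : ‖((α⁻¹ : ℝ) : ℂ) • (x - y)‖ ≤ ‖x - y‖ := by
    rw [norm_smul, Complex.norm_real, norm_inv, Real.norm_of_nonneg (by linarith)]
    exact mul_le_of_le_one_left (norm_nonneg _) (inv_le_one_of_one_le₀ hx)
  have h2 : ‖((α⁻¹ - β⁻¹ : ℝ) : ℂ) • y‖ ≤ ‖x - y‖ := by
    have : α⁻¹ - β⁻¹ = (β - α) * (α⁻¹ * β⁻¹) := by
      have : α ≠ 0 := by positivity
      have : β ≠ 0 := by positivity
      field_simp
    rw [norm_smul, this, Complex.norm_real, Real.norm_eq_abs, abs_mul,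
      abs_of_pos (by positivity : 0 < α⁻¹ * β⁻¹)]
    have h3 : α⁻¹ * β⁻¹ * ‖y‖ ≤ 1 := by
      rw [mul_assoc]
      refine mul_le_one₀ (inv_le_one_of_one_le₀ hx) (by positivity) ?_
      rw [inv_mul_le_iff₀ (by linarith)]
      linarith
    calc |β - α| * (α⁻¹ * β⁻¹) * ‖y‖ = |β - α| * (α⁻¹ * β⁻¹ * ‖y‖) := by ring
      _ ≤ ‖x - y‖ * 1 := by gcongr
      _ = _ := mul_one _
  rw [e]
  exact (norm_add_le _ _).trans (by linarith)

/-- Global solvability. The equation is solved with the unknown on the right replaced by its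
retraction to the unit ball; the solution stays unitary, so the replacement has no effect. -/
theorem exists_isLinearSolution {a : ℝ → EndC n} {τ : ℝ} (hτ : 0 ≤ τ)
    (hc : ContinuousOn a (Set.Icc 0 τ)) (ha : ∀ r ∈ Set.Icc 0 τ, star (a r) = -a r) :
    ∃ U, U 0 = 1 ∧ IsLinearSolution a 0 τ U := by
  obtain ⟨C₀, hC₀⟩ := isCompact_Icc.exists_bound_of_continuousOn hc
  obtain ⟨C, hC⟩ : ∃ C : NNReal, ∀ r ∈ Set.Icc 0 τ, ‖a r‖ ≤ C :=
    ⟨C₀.toNNReal, fun r hr => (hC₀ r hr).trans (Real.le_coe_toNNReal _)⟩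
  have hPL : IsPicardLindelof (fun t x => -(a t * unitBallRetraction x))
      (⟨0, Set.left_mem_Icc.2 hτ⟩ : Set.Icc (0 : ℝ) τ) (1 : EndC n) (C * τ.toNNReal) 0 C
      (C * 2) := by
    refine ⟨fun t ht => LipschitzOnWith.of_dist_le_mul fun x _ y _ => ?_, fun x _ =>
      (hc.mul continuousOn_const).neg, fun t ht x _ => ?_, ?_⟩
    · rw [dist_eq_norm, dist_eq_norm, neg_sub_neg, ← mul_sub, norm_sub_rev x y]
      calc ‖a t * (unitBallRetraction y - unitBallRetraction x)‖
          ≤ ‖a t‖ * ‖unitBallRetraction y - unitBallRetraction x‖ := norm_mul_le _ _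
        _ ≤ C * (2 * ‖y - x‖) := by
          gcongr
          · exact hC t ht
          · exact norm_unitBallRetraction_sub_le _ _
        _ = _ := by push_cast; ring
    · rw [norm_neg]
      calc _ ≤ ‖a t‖ * ‖unitBallRetraction x‖ := norm_mul_le _ _
        _ ≤ C * 1 := by
          gcongr
          · exact hC t ht
          · exact norm_unitBallRetraction_le _
        _ = _ := mul_one _
    · simp [hτ]
  obtain ⟨U, hU0, hU⟩ := hPL.exists_eq_forall_mem_Icc_hasDerivWithinAt₀
  simp only at hU0
  set b : ℝ → EndC n := fun r => (((max 1 ‖U r‖)⁻¹ : ℝ) : ℂ) • a r with hb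
  have hUb : IsLinearSolution b 0 τ U := fun r hr => (hU r hr).congr_deriv (by
    simp only [unitBallRetraction, hb, smul_mul_assoc, mul_smul_comm])
  have hbs : ∀ r ∈ Set.Icc 0 τ, star (b r) = -b r := fun r hr => by
    simp only [hb]
    rw [star_smul, ha r hr, smul_neg, RCLike.star_def, Complex.conj_ofReal]
  refine ⟨U, hU0, fun r hr => (hUb r hr).congr_deriv ?_⟩
  have hn : ‖U r‖ ≤ 1 := EndC.norm_le_one_of_mem_unitary
    (hUb.mem_unitary hbs (by rw [hU0]; exact one_mem _) hr)
  simp [hb, max_eq_left hn]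

end LinearTransport

/-! ### Normed structures on spaces of multilinear forms

Shortcut instances: the synthesis of the norm on trilinear forms does not succeed unaided. -/

section Instances

variable (m : ℕ)

noncomputable instance EucM.normedAddCommGroupForm : NormedAddCommGroup (EucM m →L[ℝ] ℝ) :=
  ContinuousLinearMap.toNormedAddCommGroup

noncomputable instance EucM.normedSpaceForm : NormedSpace ℝ (EucM m →L[ℝ] ℝ) :=
  ContinuousLinearMap.toNormedSpace

noncomputable instance EucM.normedAddCommGroupForm₂ :
    NormedAddCommGroup (EucM m →L[ℝ] EucM m →L[ℝ] ℝ) :=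
  ContinuousLinearMap.toNormedAddCommGroup

noncomputable instance EucM.normedSpaceForm₂ : NormedSpace ℝ (EucM m →L[ℝ] EucM m →L[ℝ] ℝ) :=
  ContinuousLinearMap.toNormedSpace

noncomputable instance EucM.normedAddCommGroupForm₃ :
    NormedAddCommGroup (EucM m →L[ℝ] EucM m →L[ℝ] EucM m →L[ℝ] ℝ) :=
  ContinuousLinearMap.toNormedAddCommGroup

noncomputable instance EucM.normedSpaceForm₃ :
    NormedSpace ℝ (EucM m →L[ℝ] EucM m →L[ℝ] EucM m →L[ℝ] ℝ) :=
  ContinuousLinearMap.toNormedSpace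

end Instances

/-! ### Tangent bundle charts and the coordinate form of the metric -/

section Charts

variable {m : ℕ} [NeZero m] {M : Type*} [TopologicalSpace M]
  [ChartedSpace (EuclideanHalfSpace m) M] [IsManifold (𝓡∂ m) ∞ M]

/-- The chart of the tangent bundle induced by the preferred chart at `p`: position and velocity
coordinates. -/
noncomputable def tangentChart (p : M) :
    PartialEquiv (TangentBundle (𝓡∂ m) M) (EucM m × EucM m) :=
  extChartAt (𝓡∂ m).tangent (⟨p, 0⟩ : TangentBundle (𝓡∂ m) M)

lemma mem_tangentChart_source {p : M} {q : TangentBundle (𝓡∂ m) M} :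
    q ∈ (tangentChart p).source ↔ q.proj ∈ (extChartAt (𝓡∂ m) p).source := by
  rw [tangentChart, extChartAt_source, extChartAt_source, TangentBundle.mem_chart_source_iff]

lemma isOpen_tangentChart_source (p : M) :
    IsOpen (tangentChart (m := m) p).source := isOpen_extChartAt_source _

lemma tangentChart_apply {p : M} {q : TangentBundle (𝓡∂ m) M}
    (hq : q.proj ∈ (extChartAt (𝓡∂ m) p).source) :
    tangentChart p q = (extChartAt (𝓡∂ m) p q.proj,
      (mfderiv (𝓡∂ m) 𝓘(ℝ, EucM m) (extChartAt (𝓡∂ m) p) q.proj q.snd : EucM m)) := by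
  rw [extChartAt_source] at hq
  have h : (trivializationAt (EucM m) (TangentSpace (𝓡∂ m)) p q).2 =
      (trivializationAt (EucM m) (TangentSpace (𝓡∂ m)) p).continuousLinearMapAt ℝ q.proj q.snd := by
    rw [Bundle.Trivialization.continuousLinearMapAt_apply,
      Bundle.Trivialization.coe_linearMapAt_of_mem _ hq]
  rw [TangentBundle.continuousLinearMapAt_trivializationAt hq] at h
  rw [tangentChart, FiberBundle.extChartAt]
  exact Prod.ext rfl h

lemma tangentChart_target (p : M) :
    (tangentChart (m := m) p).target = (extChartAt (𝓡∂ m) p).target ×ˢ Set.univ := by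
  rw [tangentChart, FiberBundle.extChartAt]
  ext ⟨y, w⟩
  simp only [PartialEquiv.trans_target, PartialEquiv.prod_target, PartialEquiv.refl_target,
    Set.mem_inter_iff, Set.mem_prod, Set.mem_univ, and_true, and_iff_left_iff_imp]
  intro hy
  have : (extChartAt (𝓡∂ m) p).symm y ∈ (chartAt (EuclideanHalfSpace m) p).source := by
    rw [← extChartAt_source (𝓡∂ m)]; exact (extChartAt (𝓡∂ m) p).map_target hy
  exact Set.mem_prod.2 ⟨this, Set.mem_univ _⟩

lemma mem_tangentChart_target {p : M} {z : EucM m × EucM m} :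
    z ∈ (tangentChart (m := m) p).target ↔ z.1 ∈ (extChartAt (𝓡∂ m) p).target := by
  rw [tangentChart_target]; simp

lemma tangentChart_symm_apply {p : M} {y w : EucM m}
    (hy : y ∈ (extChartAt (𝓡∂ m) p).target) :
    (tangentChart p).symm (y, w) = (⟨(extChartAt (𝓡∂ m) p).symm y,
      (mfderivWithin 𝓘(ℝ, EucM m) (𝓡∂ m) (extChartAt (𝓡∂ m) p).symm (Set.range (𝓡∂ m)) y w :
        TangentSpace (𝓡∂ m) ((extChartAt (𝓡∂ m) p).symm y))⟩ : TangentBundle (𝓡∂ m) M) := by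
  have hx : (extChartAt (𝓡∂ m) p).symm y ∈ (chartAt (EuclideanHalfSpace m) p).source := by
    rw [← extChartAt_source (𝓡∂ m)]; exact (extChartAt (𝓡∂ m) p).map_target hy
  have h := TangentBundle.symmL_trivializationAt (I := 𝓡∂ m) hx
  rw [(extChartAt (𝓡∂ m) p).right_inv hy] at h
  have h1 := ((trivializationAt (EucM m) (TangentSpace (𝓡∂ m)) p).mk_symm hx w).symm
  have h2 : (trivializationAt (EucM m) (TangentSpace (𝓡∂ m)) p).symm
      ((extChartAt (𝓡∂ m) p).symm y) w =
    (trivializationAt (EucM m) (TangentSpace (𝓡∂ m)) p).symmL ℝ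
      ((extChartAt (𝓡∂ m) p).symm y) w :=
    (Bundle.Trivialization.symmL_apply _ hx w).symm
  rw [h2, h] at h1
  rw [tangentChart, FiberBundle.extChartAt]
  exact h1

lemma tangentChart_symm_proj {p : M} {z : EucM m × EucM m} :
    ((tangentChart p).symm z).proj = (extChartAt (𝓡∂ m) p).symm z.1 := rfl

/-- The velocity with coordinates `a` at the coordinate point `y`. -/
noncomputable def chartVector (p : M) (y : EucM m) :
    EucM m →L[ℝ] TangentSpace (𝓡∂ m) ((extChartAt (𝓡∂ m) p).symm y) :=
  mfderivWithin 𝓘(ℝ, EucM m) (𝓡∂ m) (extChartAt (𝓡∂ m) p).symm (Set.range (𝓡∂ m)) y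

/-- The coordinate expression of the metric in the preferred chart at `p`, as a bilinear form. -/
noncomputable def chartForm (g : SmoothMetric m M) (p : M) (y : EucM m) :
    EucM m →L[ℝ] EucM m →L[ℝ] ℝ :=
  LinearMap.toContinuousLinearMap
    { toFun := fun a => (g.inner _ (chartVector p y a)).comp (chartVector p y)
      map_add' := fun a b => by rw [map_add, map_add, ContinuousLinearMap.add_comp]
      map_smul' := fun a b => by
        rw [map_smul, map_smul, ContinuousLinearMap.smul_comp]; rfl }

lemma chartForm_symm (g : SmoothMetric m M) (p : M) (y a b : EucM m) :
    chartForm g p y a b = chartForm g p y b a :=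
  g.symm _ (chartVector p y a) (chartVector p y b)

/-- The metric in terms of the tangent bundle chart. -/
lemma inner_tangentChart_symm (g : SmoothMetric m M) {p : M} {y : EucM m}
    (hy : y ∈ (extChartAt (𝓡∂ m) p).target) (w : EucM m) :
    g.inner ((tangentChart p).symm (y, w)).proj ((tangentChart p).symm (y, w)).snd
      ((tangentChart p).symm (y, w)).snd = chartForm g p y w w := by
  rw [tangentChart_symm_apply hy]
  rfl

lemma contDiffOn_chartForm (g : SmoothMetric m M) (p : M) :
    ContDiffOn ℝ ∞ (chartForm g p) (extChartAt (𝓡∂ m) p).target := by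
  refine contDiffOn_clm_apply.2 fun a => contDiffOn_clm_apply.2 fun b => ?_
  have hv : ∀ a : EucM m, ContMDiffOn 𝓘(ℝ, EucM m) (𝓡∂ m).tangent ∞
      (fun y : EucM m => (tangentChart (M := M) p).symm (y, a))
      (extChartAt (𝓡∂ m) p).target := fun a =>
    (contMDiffOn_extChartAt_symm (n := ∞) (I := (𝓡∂ m).tangent)
      (⟨p, 0⟩ : TangentBundle (𝓡∂ m) M)).comp
      (contMDiff_iff_contDiff.2 (contDiff_id.prodMk contDiff_const)).contMDiffOn
      fun y hy => mem_tangentChart_target.2 hy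
  have hg : ContMDiffOn 𝓘(ℝ, EucM m) ((𝓡∂ m).prod 𝓘(ℝ, EucM m →L[ℝ] EucM m →L[ℝ] ℝ)) ∞
      (fun y : EucM m => Bundle.TotalSpace.mk' (EucM m →L[ℝ] EucM m →L[ℝ] ℝ)
        (E := fun x : M => TangentSpace (𝓡∂ m) x →L[ℝ] TangentSpace (𝓡∂ m) x →L[ℝ] ℝ)
        ((extChartAt (𝓡∂ m) p).symm y) (g.inner ((extChartAt (𝓡∂ m) p).symm y)))
      (extChartAt (𝓡∂ m) p).target :=
    g.contMDiff.comp_contMDiffOn (contMDiffOn_extChartAt_symm p)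
  have hv' : ∀ a : EucM m, ContMDiffOn 𝓘(ℝ, EucM m) (𝓡∂ m).tangent ∞
      (fun y : EucM m => (⟨(extChartAt (𝓡∂ m) p).symm y, mfderivWithin 𝓘(ℝ, EucM m) (𝓡∂ m)
        (extChartAt (𝓡∂ m) p).symm (Set.range (𝓡∂ m)) y a⟩ : TangentBundle (𝓡∂ m) M))
      (extChartAt (𝓡∂ m) p).target := fun a =>
    (hv a).congr fun y hy => (tangentChart_symm_apply hy).symm
  have := ContMDiffOn.clm_bundle_apply₂ (F₁ := EucM m) (F₂ := EucM m) (F₃ := ℝ)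
    (E₁ := fun x : M => TangentSpace (𝓡∂ m) x) (E₂ := fun x : M => TangentSpace (𝓡∂ m) x)
    (E₃ := Bundle.Trivial M ℝ) hg (hv' a) (hv' b)
  intro y hy
  exact (Bundle.contMDiffWithinAt_totalSpace.1 (this y hy)).2.contDiffWithinAt

end Charts

/-! ### Change of charts and the geodesic spray -/

section Spray

set_option linter.unusedSectionVars false

variable {m : ℕ} [NeZero m] {M : Type*} [TopologicalSpace M]
  [ChartedSpace (EuclideanHalfSpace m) M] [IsManifold (𝓡∂ m) ∞ M]

/-- The coordinate change from the chart at `p` to the chart at `p'`. -/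
noncomputable def chartTrans (p p' : M) : EucM m → EucM m :=
  extChartAt (𝓡∂ m) p' ∘ (extChartAt (𝓡∂ m) p).symm

/-- The domain of the coordinate change from the chart at `p` to the chart at `p'`. -/
noncomputable def chartOverlap (p p' : M) : Set (EucM m) :=
  ((extChartAt (𝓡∂ m) p).symm ≫ extChartAt (𝓡∂ m) p').source

lemma mem_chartOverlap {p p' : M} {y : EucM m} : y ∈ chartOverlap p p' ↔
    y ∈ (extChartAt (𝓡∂ m) p).target ∧
      (extChartAt (𝓡∂ m) p).symm y ∈ (extChartAt (𝓡∂ m) p').source := by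
  simp only [chartOverlap, PartialEquiv.trans_source, PartialEquiv.symm_source, Set.mem_inter_iff,
    Set.mem_preimage]

lemma extChartAt_mem_range (p x : M) : extChartAt (𝓡∂ m) p x ∈ Set.range (𝓡∂ m) :=
  Set.mem_range_self _

lemma mem_range_of_mem_target {p : M} {y : EucM m} (hy : y ∈ (extChartAt (𝓡∂ m) p).target) :
    y ∈ Set.range (𝓡∂ m) := extChartAt_target_subset_range p hy

lemma uniqueDiffWithinAt_of_mem_target {p : M} {y : EucM m}
    (hy : y ∈ (extChartAt (𝓡∂ m) p).target) :
    UniqueDiffWithinAt ℝ (Set.range (𝓡∂ m)) y :=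
  (𝓡∂ m).uniqueDiffOn y (mem_range_of_mem_target hy)

lemma extChartAt_mem_chartOverlap {p p' x : M} (hx : x ∈ (extChartAt (𝓡∂ m) p).source)
    (hx' : x ∈ (extChartAt (𝓡∂ m) p').source) : extChartAt (𝓡∂ m) p x ∈ chartOverlap p p' :=
  mem_chartOverlap.2 ⟨(extChartAt (𝓡∂ m) p).map_source hx, by
    rwa [(extChartAt (𝓡∂ m) p).left_inv hx]⟩

lemma contDiffWithinAt_chartTrans {p p' : M} {y : EucM m} (hy : y ∈ chartOverlap p p') :
    ContDiffWithinAt ℝ ∞ (chartTrans p p') (Set.range (𝓡∂ m)) y :=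
  contDiffWithinAt_ext_coord_change p' p hy

lemma chartOverlap_mem_nhdsWithin {p p' : M} {y : EucM m} (hy : y ∈ chartOverlap p p') :
    chartOverlap p p' ∈ 𝓝[Set.range (𝓡∂ m)] y := by
  rw [mem_chartOverlap] at hy
  have h1 : (extChartAt (𝓡∂ m) p).target ∈ 𝓝[Set.range (𝓡∂ m)] y :=
    extChartAt_target_mem_nhdsWithin_of_mem hy.1
  have h2 : (extChartAt (𝓡∂ m) p).symm ⁻¹' (extChartAt (𝓡∂ m) p').source ∈ 𝓝 y :=
    (continuousAt_extChartAt_symm'' hy.1).preimage_mem_nhds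
      ((isOpen_extChartAt_source p').mem_nhds hy.2)
  filter_upwards [h1, mem_nhdsWithin_of_mem_nhds h2] with z hz1 hz2
  exact mem_chartOverlap.2 ⟨hz1, hz2⟩

lemma tangentChart_trans {p p' : M} {y : EucM m} (hy : y ∈ chartOverlap p p') (w : EucM m) :
    tangentChart p' ((tangentChart p).symm (y, w)) =
      (chartTrans p p' y, fderivWithin ℝ (chartTrans p p') (Set.range (𝓡∂ m)) y w) := by
  have hy' := mem_chartOverlap.1 hy
  rw [tangentChart_apply (by rw [tangentChart_symm_proj]; exact hy'.2),
    tangentChart_symm_apply hy'.1]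
  refine Prod.ext rfl ?_
  have h1 := mdifferentiableWithinAt_extChartAt_symm (I := 𝓡∂ m) hy'.1
  have h2 : MDifferentiableAt (𝓡∂ m) 𝓘(ℝ, EucM m) (extChartAt (𝓡∂ m) p')
      ((extChartAt (𝓡∂ m) p).symm y) :=
    mdifferentiableAt_extChartAt (by rw [← extChartAt_source (𝓡∂ m)]; exact hy'.2)
  have h3 := mfderiv_comp_mfderivWithin y h2 h1
    ((uniqueDiffWithinAt_of_mem_target hy'.1).uniqueMDiffWithinAt)
  rw [mfderivWithin_eq_fderivWithin] at h3
  exact (congrArg (fun L : EucM m →L[ℝ] EucM m => L w) h3).symm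

lemma chartTrans_mem_target {p p' : M} {y : EucM m} (hy : y ∈ chartOverlap p p') :
    chartTrans p p' y ∈ (extChartAt (𝓡∂ m) p').target :=
  (extChartAt (𝓡∂ m) p').map_source (mem_chartOverlap.1 hy).2

lemma tangentChart_symm_trans {p p' : M} {y : EucM m} (hy : y ∈ chartOverlap p p') (w : EucM m) :
    (tangentChart p').symm
      (chartTrans p p' y, fderivWithin ℝ (chartTrans p p') (Set.range (𝓡∂ m)) y w) =
      (tangentChart p).symm (y, w) := by
  rw [← tangentChart_trans hy, (tangentChart p').left_inv]
  rw [mem_tangentChart_source, tangentChart_symm_proj]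
  exact (mem_chartOverlap.1 hy).2

lemma inner_congr_of_mk_eq (g : SmoothMetric m M) {x x' : M} {u v : TangentSpace (𝓡∂ m) x}
    {u' v' : TangentSpace (𝓡∂ m) x'} (hu : (⟨x, u⟩ : TangentBundle (𝓡∂ m) M) = ⟨x', u'⟩)
    (hv : (⟨x, v⟩ : TangentBundle (𝓡∂ m) M) = ⟨x', v'⟩) : g.inner x u v = g.inner x' u' v' := by
  cases hu
  cases hv
  rfl

lemma chartForm_trans (g : SmoothMetric m M) {p p' : M} {y : EucM m}
    (hy : y ∈ chartOverlap p p') (a b : EucM m) :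
    chartForm g p y a b = chartForm g p' (chartTrans p p' y)
      (fderivWithin ℝ (chartTrans p p') (Set.range (𝓡∂ m)) y a)
      (fderivWithin ℝ (chartTrans p p') (Set.range (𝓡∂ m)) y b) := by
  have key : ∀ a : EucM m, _ := fun a => (tangentChart_symm_trans hy a).symm
  simp only [tangentChart_symm_apply (mem_chartOverlap.1 hy).1,
    tangentChart_symm_apply (chartTrans_mem_target hy)] at key
  exact inner_congr_of_mk_eq g (key a) (key b)

lemma chartForm_pos (g : SmoothMetric m M) {p : M} {y : EucM m}
    (hy : y ∈ (extChartAt (𝓡∂ m) p).target) {a : EucM m} (ha : a ≠ 0) :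
    0 < chartForm g p y a a := by
  refine g.pos _ (chartVector p y a) fun h0 => ha ?_
  have h1 : (tangentChart p).symm (y, a) = (tangentChart p).symm (y, 0) := by
    rw [tangentChart_symm_apply hy, tangentChart_symm_apply hy]
    congr 1
    exact h0.trans (map_zero (chartVector p y)).symm
  have := (tangentChart p).symm.injOn (mem_tangentChart_target.2 hy)
    (mem_tangentChart_target.2 hy) h1
  exact (Prod.ext_iff.1 this).2

lemma isInvertible_chartForm (g : SmoothMetric m M) {p : M} {y : EucM m}
    (hy : y ∈ (extChartAt (𝓡∂ m) p).target) : (chartForm g p y).IsInvertible := by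
  have hinj : Function.Injective (chartForm g p y : EucM m →ₗ[ℝ] EucM m →L[ℝ] ℝ) := by
    rw [← LinearMap.ker_eq_bot, LinearMap.ker_eq_bot']
    intro a ha
    by_contra hne
    have := chartForm_pos g hy hne
    rw [show chartForm g p y a = 0 from ha] at this
    simp at this
  have hfin : Module.finrank ℝ (EucM m) = Module.finrank ℝ (EucM m →L[ℝ] ℝ) := by
    rw [← (LinearMap.toContinuousLinearMap (𝕜 := ℝ) (E := EucM m) (F' := ℝ)).finrank_eq,
      Module.finrank_linearMap, Module.finrank_self, mul_one]
  refine ⟨(LinearEquiv.ofInjectiveOfFinrankEq _ hinj hfin).toContinuousLinearEquiv, ?_⟩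
  ext a b
  rfl

/-- The derivative of the metric coefficients within the half space. -/
noncomputable def chartFormDeriv (g : SmoothMetric m M) (p : M) (y : EucM m) :
    EucM m →L[ℝ] EucM m →L[ℝ] EucM m →L[ℝ] ℝ :=
  fderivWithin ℝ (chartForm g p) (Set.range (𝓡∂ m)) y

lemma contDiffWithinAt_chartForm (g : SmoothMetric m M) {p : M} {y : EucM m}
    (hy : y ∈ (extChartAt (𝓡∂ m) p).target) :
    ContDiffWithinAt ℝ ∞ (chartForm g p) (Set.range (𝓡∂ m)) y :=
  (contDiffOn_chartForm g p y hy).mono_of_mem_nhdsWithin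
    (extChartAt_target_mem_nhdsWithin_of_mem hy)

lemma contDiffWithinAt_chartFormDeriv (g : SmoothMetric m M) {p : M} {y : EucM m}
    (hy : y ∈ (extChartAt (𝓡∂ m) p).target) :
    ContDiffWithinAt ℝ ∞ (chartFormDeriv g p) (Set.range (𝓡∂ m)) y :=
  (contDiffWithinAt_chartForm g hy).fderivWithin_right (𝓡∂ m).uniqueDiffOn (by simp)
    (mem_range_of_mem_target hy)

lemma hasFDerivWithinAt_chartForm (g : SmoothMetric m M) {p : M} {y : EucM m}
    (hy : y ∈ (extChartAt (𝓡∂ m) p).target) :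
    HasFDerivWithinAt (chartForm g p) (chartFormDeriv g p y) (Set.range (𝓡∂ m)) y :=
  ((contDiffWithinAt_chartForm g hy).differentiableWithinAt (by simp)).hasFDerivWithinAt

lemma chartMetricDeriv_eq (g : SmoothMetric m M) {p : M} {y : EucM m}
    (hy : y ∈ (extChartAt (𝓡∂ m) p).target) (u a b : EucM m) :
    chartMetricDeriv g p y u a b = chartFormDeriv g p y u a b := by
  have h1 := ((hasFDerivWithinAt_chartForm g hy).clm_apply
    (hasFDerivWithinAt_const a y (Set.range (𝓡∂ m)))).clm_apply
      (hasFDerivWithinAt_const b y (Set.range (𝓡∂ m)))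
  have h2 := h1.fderivWithin (uniqueDiffWithinAt_of_mem_target hy)
  have h3 : chartMetricDeriv g p y u a b =
    fderivWithin ℝ (fun z => chartForm g p z a b) (Set.range (𝓡∂ m)) y u := rfl
  rw [h3, h2]
  simp

lemma christoffel_eq (g : SmoothMetric m M) {p : M} {y : EucM m}
    (hy : y ∈ (extChartAt (𝓡∂ m) p).target) (u a b : EucM m) :
    christoffel g p y u a b = 1 / 2 * (chartFormDeriv g p y u a b + chartFormDeriv g p y a u b
      - chartFormDeriv g p y b u a) := by
  rw [christoffel, chartMetricDeriv_eq g hy, chartMetricDeriv_eq g hy, chartMetricDeriv_eq g hy]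

/-- Transformation law of the metric derivatives. -/
lemma chartFormDeriv_trans (g : SmoothMetric m M) {p p' : M} {y : EucM m}
    (hy : y ∈ chartOverlap p p') (u a b : EucM m) :
    let ψ' := fderivWithin ℝ (chartTrans p p') (Set.range (𝓡∂ m)) y
    let ψ'' := fderivWithin ℝ (fderivWithin ℝ (chartTrans p p') (Set.range (𝓡∂ m)))
      (Set.range (𝓡∂ m)) y
    chartFormDeriv g p y u a b = chartFormDeriv g p' (chartTrans p p' y) (ψ' u) (ψ' a) (ψ' b)
      + chartForm g p' (chartTrans p p' y) (ψ'' u a) (ψ' b)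
      + chartForm g p' (chartTrans p p' y) (ψ' a) (ψ'' u b) := by
  intro ψ' ψ''
  have hyt := (mem_chartOverlap.1 hy).1
  have hU := uniqueDiffWithinAt_of_mem_target hyt
  have hψ : HasFDerivWithinAt (chartTrans p p') ψ' (Set.range (𝓡∂ m)) y :=
    ((contDiffWithinAt_chartTrans hy).differentiableWithinAt (by simp)).hasFDerivWithinAt
  have hψ2 : HasFDerivWithinAt (fderivWithin ℝ (chartTrans p p') (Set.range (𝓡∂ m))) ψ''
      (Set.range (𝓡∂ m)) y :=
    (((contDiffWithinAt_chartTrans hy).fderivWithin_right (m := ∞) (𝓡∂ m).uniqueDiffOn (by simp)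
      (mem_range_of_mem_target hyt)).differentiableWithinAt (by simp)).hasFDerivWithinAt
  have hG := (hasFDerivWithinAt_chartForm g (chartTrans_mem_target hy)).comp y hψ
    (fun z _ => extChartAt_mem_range p' _)
  have h1 := (hG.clm_apply (hψ2.clm_apply (hasFDerivWithinAt_const a y _))).clm_apply
    (hψ2.clm_apply (hasFDerivWithinAt_const b y _))
  have h2 : HasFDerivWithinAt (fun z => chartForm g p z a b) _ (Set.range (𝓡∂ m)) y :=
    h1.congr_of_eventuallyEq
      (by filter_upwards [chartOverlap_mem_nhdsWithin hy] with z hz using chartForm_trans g hz a b)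
      (chartForm_trans g hy a b)
  rw [← chartMetricDeriv_eq g hyt]
  have h3 : chartMetricDeriv g p y u a b =
    fderivWithin ℝ (fun z => chartForm g p z a b) (Set.range (𝓡∂ m)) y u := rfl
  rw [h3, h2.fderivWithin hU]
  simp [ψ', ψ'']
  ring

/-- Transformation law of the Christoffel symbols. -/
lemma christoffel_trans (g : SmoothMetric m M) {p p' : M} {y : EucM m}
    (hy : y ∈ chartOverlap p p') (w b : EucM m) :
    let ψ' := fderivWithin ℝ (chartTrans p p') (Set.range (𝓡∂ m)) y
    let ψ'' := fderivWithin ℝ (fderivWithin ℝ (chartTrans p p') (Set.range (𝓡∂ m)))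
      (Set.range (𝓡∂ m)) y
    christoffel g p y w w b = christoffel g p' (chartTrans p p' y) (ψ' w) (ψ' w) (ψ' b)
      + chartForm g p' (chartTrans p p' y) (ψ'' w w) (ψ' b) := by
  intro ψ' ψ''
  have hyt := (mem_chartOverlap.1 hy).1
  have hsymm : ψ'' w b = ψ'' b w :=
    ((contDiffWithinAt_chartTrans hy).isSymmSndFDerivWithinAt (by
        simp only [minSmoothness_of_isRCLikeNormedField]; exact WithTop.coe_le_coe.2 le_top)
      (𝓡∂ m).uniqueDiffOn (by
        have := (𝓡∂ m).range_subset_closure_interior (mem_range_of_mem_target hyt)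
        exact this) (mem_range_of_mem_target hyt)).eq w b
  rw [christoffel_eq g hyt, christoffel_eq g (chartTrans_mem_target hy),
    chartFormDeriv_trans g hy, chartFormDeriv_trans g hy]
  change 1 / 2 * (_ + chartForm g p' _ (ψ'' w w) (ψ' b) + chartForm g p' _ (ψ' w) (ψ'' w b) +
    (_ + chartForm g p' _ (ψ'' w w) (ψ' b) + chartForm g p' _ (ψ' w) (ψ'' w b)) -
    (_ + chartForm g p' _ (ψ'' b w) (ψ' w) + chartForm g p' _ (ψ' w) (ψ'' b w))) = _
  rw [hsymm, chartForm_symm g p' _ (ψ'' b w) (ψ' w)]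
  ring

/-- The covector `b ↦ Γ(w, w, b)`. -/
noncomputable def christoffelForm (g : SmoothMetric m M) (p : M) (y w : EucM m) :
    EucM m →L[ℝ] ℝ :=
  chartFormDeriv g p y w w - (1 / 2 : ℝ) • ((chartFormDeriv g p y).flip w).flip w

lemma christoffelForm_apply (g : SmoothMetric m M) {p : M} {y : EucM m}
    (hy : y ∈ (extChartAt (𝓡∂ m) p).target) (w b : EucM m) :
    christoffelForm g p y w b = christoffel g p y w w b := by
  rw [christoffel_eq g hy]
  simp [christoffelForm]
  ring

/-- The coordinate acceleration of the geodesic with position `y` and velocity `w`. -/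
noncomputable def geodesicAcc (g : SmoothMetric m M) (p : M) (y w : EucM m) : EucM m :=
  -(chartForm g p y).inverse (christoffelForm g p y w)

lemma eq_geodesicAcc_iff (g : SmoothMetric m M) {p : M} {y : EucM m}
    (hy : y ∈ (extChartAt (𝓡∂ m) p).target) (w a : EucM m) :
    a = geodesicAcc g p y w ↔ ∀ b, chartForm g p y a b + christoffel g p y w w b = 0 := by
  obtain ⟨e, he⟩ := isInvertible_chartForm g hy
  have h1 : a = geodesicAcc g p y w ↔ chartForm g p y a = -christoffelForm g p y w := by
    rw [geodesicAcc, ← he, ContinuousLinearMap.inverse_equiv]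
    constructor
    · rintro rfl
      simp
    · intro h
      apply e.injective
      simpa using h
  rw [h1, ContinuousLinearMap.ext_iff]
  refine forall_congr' fun b => ?_
  rw [← christoffelForm_apply g hy, neg_apply, eq_neg_iff_add_eq_zero]

lemma contDiffWithinAt_geodesicAcc (g : SmoothMetric m M) {p : M} {z : EucM m × EucM m}
    (hz : z.1 ∈ (extChartAt (𝓡∂ m) p).target) :
    ContDiffWithinAt ℝ ∞ (fun z : EucM m × EucM m => geodesicAcc g p z.1 z.2)
      (Set.range (𝓡∂ m) ×ˢ Set.univ) z := by
  have hfst : ContDiffWithinAt ℝ ∞ (Prod.fst : EucM m × EucM m → EucM m)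
      (Set.range (𝓡∂ m) ×ˢ Set.univ) z := contDiffWithinAt_fst
  have hsnd : ContDiffWithinAt ℝ ∞ (Prod.snd : EucM m × EucM m → EucM m)
      (Set.range (𝓡∂ m) ×ˢ Set.univ) z := contDiffWithinAt_snd
  have hmaps : Set.MapsTo (Prod.fst : EucM m × EucM m → EucM m)
      (Set.range (𝓡∂ m) ×ˢ Set.univ) (Set.range (𝓡∂ m)) := fun _ h => h.1
  have hG := (contDiffWithinAt_chartForm g hz).comp z hfst hmaps
  have hD := (contDiffWithinAt_chartFormDeriv g hz).comp z hfst hmaps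
  have hinv : ContDiffWithinAt ℝ ∞
      (fun z : EucM m × EucM m => (chartForm g p z.1).inverse)
      (Set.range (𝓡∂ m) ×ˢ Set.univ) z :=
    ContDiffAt.comp_contDiffWithinAt (g := ContinuousLinearMap.inverse) z
      (isInvertible_chartForm g hz).contDiffAt_map_inverse hG
  have hchr : ContDiffWithinAt ℝ ∞
      (fun z : EucM m × EucM m => christoffelForm g p z.1 z.2)
      (Set.range (𝓡∂ m) ×ˢ Set.univ) z := by
    refine ((hD.clm_apply hsnd).clm_apply hsnd).sub (ContDiffWithinAt.const_smul _ ?_)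
    have hf : ContDiff ℝ ∞ (ContinuousLinearMap.flipₗᵢ ℝ (EucM m) (EucM m) (EucM m →L[ℝ] ℝ)) :=
      (ContinuousLinearMap.flipₗᵢ ℝ (EucM m) (EucM m) (EucM m →L[ℝ] ℝ)).contDiff
    have hf' : ContDiff ℝ ∞ (ContinuousLinearMap.flipₗᵢ ℝ (EucM m) (EucM m) ℝ) :=
      (ContinuousLinearMap.flipₗᵢ ℝ (EucM m) (EucM m) ℝ).contDiff
    exact ((hf'.contDiffAt.comp_contDiffWithinAt z
      ((hf.contDiffAt.comp_contDiffWithinAt z hD).clm_apply hsnd)).clm_apply hsnd)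
  exact (hinv.clm_apply hchr).neg

/-- The geodesic spray in coordinates. -/
noncomputable def sprayField (g : SmoothMetric m M) (p : M) (z : EucM m × EucM m) :
    EucM m × EucM m := (z.2, geodesicAcc g p z.1 z.2)

lemma contDiffWithinAt_sprayField (g : SmoothMetric m M) {p : M} {z : EucM m × EucM m}
    (hz : z.1 ∈ (extChartAt (𝓡∂ m) p).target) :
    ContDiffWithinAt ℝ ∞ (sprayField g p) (Set.range (𝓡∂ m) ×ˢ Set.univ) z :=
  contDiffWithinAt_snd.prodMk (contDiffWithinAt_geodesicAcc g hz)

end Spray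

/-! ### Geodesics as integral curves of the spray -/

section SprayCurves

variable {m : ℕ} [NeZero m] {M : Type*} [TopologicalSpace M]
  [ChartedSpace (EuclideanHalfSpace m) M] [IsManifold (𝓡∂ m) ∞ M]

/-- The coordinate change of velocities is onto. -/
lemma exists_fderivWithin_chartTrans_eq {p p' : M} {y : EucM m} (hy : y ∈ chartOverlap p p')
    (b' : EucM m) : ∃ b, fderivWithin ℝ (chartTrans p p') (Set.range (𝓡∂ m)) y b = b' := by
  have hy' := mem_chartOverlap.1 hy
  have hψ := chartTrans_mem_target hy
  have hproj : (extChartAt (𝓡∂ m) p').symm (chartTrans p p' y) =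
      (extChartAt (𝓡∂ m) p).symm y := (extChartAt (𝓡∂ m) p').left_inv hy'.2
  have hsrc : ((tangentChart p').symm (chartTrans p p' y, b')).proj ∈
      (extChartAt (𝓡∂ m) p).source := by
    rw [tangentChart_symm_proj, hproj]
    exact (extChartAt (𝓡∂ m) p).map_target hy'.1
  set q := (tangentChart p').symm (chartTrans p p' y, b') with hq
  refine ⟨(tangentChart p q).2, ?_⟩
  have h1 : tangentChart p q = (y, (tangentChart p q).2) := by
    refine Prod.ext ?_ rfl
    rw [tangentChart_apply hsrc]
    change extChartAt (𝓡∂ m) p q.proj = y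
    rw [hq, tangentChart_symm_proj, hproj]
    exact (extChartAt (𝓡∂ m) p).right_inv hy'.1
  have h2 := tangentChart_trans hy (tangentChart p q).2
  rw [← h1, (tangentChart p).left_inv (mem_tangentChart_source.2 hsrc), hq,
    (tangentChart p').right_inv (mem_tangentChart_target.2 hψ)] at h2
  exact (Prod.ext_iff.1 h2).2.symm

/-- Transformation law of the geodesic equation. -/
lemma geodesicAcc_trans (g : SmoothMetric m M) {p p' : M} {y : EucM m}
    (hy : y ∈ chartOverlap p p') (w : EucM m) :
    let ψ' := fderivWithin ℝ (chartTrans p p') (Set.range (𝓡∂ m)) y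
    let ψ'' := fderivWithin ℝ (fderivWithin ℝ (chartTrans p p') (Set.range (𝓡∂ m)))
      (Set.range (𝓡∂ m)) y
    ψ'' w w + ψ' (geodesicAcc g p y w) = geodesicAcc g p' (chartTrans p p' y) (ψ' w) := by
  intro ψ' ψ''
  rw [eq_geodesicAcc_iff g (chartTrans_mem_target hy)]
  intro b'
  obtain ⟨b, rfl⟩ := exists_fderivWithin_chartTrans_eq hy b'
  have h1 := christoffel_trans g hy w b
  have h2 := (eq_geodesicAcc_iff g (mem_chartOverlap.1 hy).1 w _).1 rfl b
  rw [chartForm_trans g hy, h1] at h2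
  rw [map_add, add_apply]
  change chartForm g p' _ (ψ' _) (ψ' b) + (_ + chartForm g p' _ (ψ'' w w) (ψ' b)) = 0 at h2
  linear_combination h2

/-- At time `t`, the curve `Q` of velocity vectors is an integral curve, within `s`, of the
geodesic spray; expressed in the preferred chart at the base point. -/
def IsSprayAt (g : SmoothMetric m M) (Q : ℝ → TangentBundle (𝓡∂ m) M) (s : Set ℝ) (t : ℝ) :
    Prop :=
  ContinuousWithinAt Q s t ∧
    HasDerivWithinAt (fun r => tangentChart (Q t).proj (Q r))
      (sprayField g (Q t).proj (tangentChart (Q t).proj (Q t))) s t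


/-- The equation of integral curves of the spray is independent of the chart. -/
lemma hasDerivWithinAt_sprayField_trans {g : SmoothMetric m M} {Q : ℝ → TangentBundle (𝓡∂ m) M}
    {s : Set ℝ} {t : ℝ} (hc : ContinuousWithinAt Q s t) {p p' : M}
    (hp : (Q t).proj ∈ (extChartAt (𝓡∂ m) p).source)
    (hp' : (Q t).proj ∈ (extChartAt (𝓡∂ m) p').source)
    (h : HasDerivWithinAt (fun r => tangentChart p (Q r))
      (sprayField g p (tangentChart p (Q t))) s t) :
    HasDerivWithinAt (fun r => tangentChart p' (Q r))
      (sprayField g p' (tangentChart p' (Q t))) s t := by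
  have hev : ∀ᶠ r in 𝓝[s] t, (Q r).proj ∈ (extChartAt (𝓡∂ m) p).source ∧
      (Q r).proj ∈ (extChartAt (𝓡∂ m) p').source := by
    have h1 := hc.preimage_mem_nhdsWithin ((isOpen_tangentChart_source p).mem_nhds
      (mem_tangentChart_source.2 hp))
    have h2 := hc.preimage_mem_nhdsWithin ((isOpen_tangentChart_source p').mem_nhds
      (mem_tangentChart_source.2 hp'))
    filter_upwards [h1, h2] with r h1 h2
    exact ⟨mem_tangentChart_source.1 h1, mem_tangentChart_source.1 h2⟩
  have key : ∀ q : TangentBundle (𝓡∂ m) M, q.proj ∈ (extChartAt (𝓡∂ m) p).source →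
      q.proj ∈ (extChartAt (𝓡∂ m) p').source → (tangentChart p q).1 ∈ chartOverlap p p' ∧
      tangentChart p' q = (chartTrans p p' (tangentChart p q).1,
        fderivWithin ℝ (chartTrans p p') (Set.range (𝓡∂ m)) (tangentChart p q).1
          (tangentChart p q).2) := by
    intro q hq hq'
    have h1 : (tangentChart p q).1 ∈ chartOverlap p p' := by
      rw [tangentChart_apply hq]
      exact extChartAt_mem_chartOverlap hq hq'
    refine ⟨h1, ?_⟩
    rw [← tangentChart_trans h1, Prod.mk.eta,
      (tangentChart p).left_inv (mem_tangentChart_source.2 hq)]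
  obtain ⟨hy, hQt⟩ := key _ hp hp'
  have hyt := (mem_chartOverlap.1 hy).1
  have hψ : HasFDerivWithinAt (chartTrans p p') _ (Set.range (𝓡∂ m)) (tangentChart p (Q t)).1 :=
    ((contDiffWithinAt_chartTrans hy).differentiableWithinAt (by simp)).hasFDerivWithinAt
  have hψ2 : HasFDerivWithinAt (fderivWithin ℝ (chartTrans p p') (Set.range (𝓡∂ m))) _
      (Set.range (𝓡∂ m)) (tangentChart p (Q t)).1 :=
    (((contDiffWithinAt_chartTrans hy).fderivWithin_right (m := ∞) (𝓡∂ m).uniqueDiffOn (by simp)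
      (mem_range_of_mem_target hyt)).differentiableWithinAt (by simp)).hasFDerivWithinAt
  have h1 : HasDerivWithinAt (fun r => (tangentChart p (Q r)).1)
      (tangentChart p (Q t)).2 s t := h.fst
  have h2 : HasDerivWithinAt (fun r => (tangentChart p (Q r)).2)
      (geodesicAcc g p (tangentChart p (Q t)).1 (tangentChart p (Q t)).2) s t := h.snd
  set S : Set ℝ := s ∩ {r | (Q r).proj ∈ (extChartAt (𝓡∂ m) p).source ∧
      (Q r).proj ∈ (extChartAt (𝓡∂ m) p').source}
  have hS : S ∈ 𝓝[s] t := Filter.inter_mem self_mem_nhdsWithin hev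
  have hmaps : Set.MapsTo (fun r => (tangentChart p (Q r)).1) S (Set.range (𝓡∂ m)) :=
    fun r hr => mem_range_of_mem_target (mem_chartOverlap.1 (key _ hr.2.1 hr.2.2).1).1
  have h1' := h1.mono (Set.inter_subset_left : S ⊆ s)
  have h2' := h2.mono (Set.inter_subset_left : S ⊆ s)
  have h3 := hψ.comp_hasDerivWithinAt t h1' hmaps
  have h4 := (hψ2.comp_hasDerivWithinAt t h1' hmaps).clm_apply h2'
  have h5 := (h3.prodMk h4).mono_of_mem_nhdsWithin hS
  refine (h5.congr_of_eventuallyEq ?_ hQt).congr_deriv ?_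
  · filter_upwards [hev] with r hr using (key _ hr.1 hr.2).2
  · rw [hQt, sprayField]
    exact Prod.ext rfl (geodesicAcc_trans g hy _)

lemma IsSprayAt.hasDerivWithinAt {g : SmoothMetric m M} {Q : ℝ → TangentBundle (𝓡∂ m) M}
    {s : Set ℝ} {t : ℝ} (hQ : IsSprayAt g Q s t) {p : M}
    (hp : (Q t).proj ∈ (extChartAt (𝓡∂ m) p).source) :
    HasDerivWithinAt (fun r => tangentChart p (Q r)) (sprayField g p (tangentChart p (Q t)))
      s t := by
  exact hasDerivWithinAt_sprayField_trans hQ.1 (mem_extChartAt_source _) hp hQ.2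

lemma IsSprayAt.of_hasDerivWithinAt {g : SmoothMetric m M} {Q : ℝ → TangentBundle (𝓡∂ m) M}
    {s : Set ℝ} {t : ℝ} (hc : ContinuousWithinAt Q s t) {p : M}
    (hp : (Q t).proj ∈ (extChartAt (𝓡∂ m) p).source)
    (h : HasDerivWithinAt (fun r => tangentChart p (Q r))
      (sprayField g p (tangentChart p (Q t))) s t) : IsSprayAt g Q s t :=
  ⟨hc, hasDerivWithinAt_sprayField_trans hc hp (mem_extChartAt_source _) h⟩

lemma IsSprayAt.mono {g : SmoothMetric m M} {Q : ℝ → TangentBundle (𝓡∂ m) M}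
    {s s' : Set ℝ} {t : ℝ} (hQ : IsSprayAt g Q s t) (h : s' ⊆ s) : IsSprayAt g Q s' t :=
  ⟨hQ.1.mono h, hQ.2.mono h⟩

/-- The curve of velocity vectors of `γ`. -/
noncomputable def tangentLift (γ : ℝ → M) (s : Set ℝ) (t : ℝ) : TangentBundle (𝓡∂ m) M :=
  ⟨γ t, velocity γ s t⟩

lemma tangentChart_tangentLift {γ : ℝ → M} {s : Set ℝ} {t : ℝ} {p : M}
    (hγ : MDifferentiableWithinAt 𝓘(ℝ, ℝ) (𝓡∂ m) γ s t) (hs : UniqueDiffWithinAt ℝ s t)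
    (hp : γ t ∈ (extChartAt (𝓡∂ m) p).source) :
    tangentChart p (tangentLift (m := m) γ s t) = (extChartAt (𝓡∂ m) p (γ t),
      derivWithin (fun r => extChartAt (𝓡∂ m) p (γ r)) s t) := by
  rw [tangentChart_apply (show (tangentLift (m := m) γ s t).proj ∈ _ from hp)]
  refine Prod.ext rfl ?_
  have h2 : MDifferentiableAt (𝓡∂ m) 𝓘(ℝ, EucM m) (extChartAt (𝓡∂ m) p) (γ t) :=
    mdifferentiableAt_extChartAt (by rwa [← extChartAt_source (𝓡∂ m)])
  have h3 := mfderiv_comp_mfderivWithin t h2 hγ hs.uniqueMDiffWithinAt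
  rw [mfderivWithin_eq_fderivWithin] at h3
  exact (congrArg (fun L : ℝ →L[ℝ] EucM m => L 1) h3).symm

lemma contDiffWithinAt_extChartAt_comp {γ : ℝ → M} {s : Set ℝ} {t : ℝ} {p : M}
    (hγ : ContMDiffWithinAt 𝓘(ℝ, ℝ) (𝓡∂ m) ∞ γ s t)
    (hp : γ t ∈ (extChartAt (𝓡∂ m) p).source) :
    ContDiffWithinAt ℝ ∞ (fun r => extChartAt (𝓡∂ m) p (γ r)) s t :=
  ((contMDiffAt_extChartAt' (by rwa [← extChartAt_source (𝓡∂ m)])).comp_contMDiffWithinAt t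
    hγ).contDiffWithinAt

/-- The velocity curve of a geodesic is an integral curve of the spray. -/
theorem IsGeodesicOn.isSprayAt {g : SmoothMetric m M} {γ : ℝ → M} {s : Set ℝ}
    (hγ : IsGeodesicOn g γ s) (hs : UniqueDiffOn ℝ s) {t : ℝ} (ht : t ∈ s) :
    IsSprayAt g (tangentLift γ s) s t := by
  set p := γ t with hp
  have hpt : γ t ∈ (extChartAt (𝓡∂ m) p).source := mem_extChartAt_source _
  set c : ℝ → EucM m := fun r => extChartAt (𝓡∂ m) p (γ r) with hc
  have hcd : ContDiffWithinAt ℝ ∞ c s t := contDiffWithinAt_extChartAt_comp (hγ.1 t ht) hpt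
  have hd : ∀ r ∈ s, MDifferentiableWithinAt 𝓘(ℝ, ℝ) (𝓡∂ m) γ s r := fun r hr =>
    (hγ.1 r hr).mdifferentiableWithinAt (by simp)
  have hev : ∀ᶠ r in 𝓝[s] t, r ∈ s ∧ γ r ∈ (extChartAt (𝓡∂ m) p).source :=
    Filter.Eventually.and self_mem_nhdsWithin
      ((hγ.1 t ht).continuousWithinAt.preimage_mem_nhdsWithin
      (extChartAt_source_mem_nhds (I := 𝓡∂ m) p))
  have hlift : ∀ r ∈ s, γ r ∈ (extChartAt (𝓡∂ m) p).source →
      tangentChart p (tangentLift (m := m) γ s r) = (c r, derivWithin c s r) := fun r hr hr' =>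
    tangentChart_tangentLift (hd r hr) (hs r hr) hr'
  have hcd' : ContDiffWithinAt ℝ ∞ (derivWithin c s) s t := by
    have := (hcd.fderivWithin_right (m := ∞) hs (by simp) ht).clm_apply
      (contDiffWithinAt_const (c := (1 : ℝ)))
    exact this
  have hc1 : HasDerivWithinAt c (derivWithin c s t) s t :=
    (hcd.differentiableWithinAt (by simp)).hasDerivWithinAt
  have hc2 : HasDerivWithinAt (derivWithin c s) (iteratedDerivWithin 2 c s t) s t := by
    have h1 := (hcd'.differentiableWithinAt (by simp)).hasDerivWithinAt
    have h2 : iteratedDerivWithin 2 c s t = derivWithin (derivWithin c s) s t := by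
      rw [iteratedDerivWithin_succ, iteratedDerivWithin_one]
    rwa [h2]
  have hcur : HasDerivWithinAt (fun r => (c r, derivWithin c s r))
      (derivWithin c s t, iteratedDerivWithin 2 c s t) s t := hc1.prodMk hc2
  have hz : HasDerivWithinAt (fun r => tangentChart p (tangentLift (m := m) γ s r))
      (sprayField g p (tangentChart p (tangentLift (m := m) γ s t))) s t := by
    refine (hcur.congr_of_eventuallyEq ?_ (hlift t ht hpt)).congr_deriv ?_
    · filter_upwards [hev] with r hr using hlift r hr.1 hr.2
    · rw [hlift t ht hpt]
      refine Prod.ext rfl ?_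
      exact (eq_geodesicAcc_iff g ((extChartAt (𝓡∂ m) p).map_source hpt) _ _).2 (hγ.2 t ht)
  refine ⟨?_, hz⟩
  have h0 : ContinuousAt (tangentChart p).symm
      (tangentChart p (tangentLift (m := m) γ s t)) :=
    continuousAt_extChartAt_symm' (mem_tangentChart_source.2 hpt)
  have h1 : ContinuousWithinAt (fun r => (tangentChart p).symm
      (tangentChart p (tangentLift (m := m) γ s r))) s t :=
    h0.comp_continuousWithinAt (f := fun r => tangentChart p (tangentLift (m := m) γ s r))
      hz.continuousWithinAt
  refine h1.congr_of_eventuallyEq ?_ ?_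
  · filter_upwards [hev] with r hr
    exact ((tangentChart p).left_inv (mem_tangentChart_source.2 hr.2)).symm
  · exact ((tangentChart p).left_inv (mem_tangentChart_source.2 hpt)).symm

lemma continuous_tangentBundle_proj :
    Continuous (fun q : TangentBundle (𝓡∂ m) M => q.proj) :=
  FiberBundle.continuous_proj (EucM m) (TangentSpace (𝓡∂ m))

lemma tangentChart_fst {p : M} {q : TangentBundle (𝓡∂ m) M}
    (hq : q.proj ∈ (extChartAt (𝓡∂ m) p).source) :
    (tangentChart p q).1 = extChartAt (𝓡∂ m) p q.proj := by rw [tangentChart_apply hq]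

lemma contDiffWithinAt_of_isSprayAt {g : SmoothMetric m M} {Q : ℝ → TangentBundle (𝓡∂ m) M}
    {a b : ℝ} (hQ : ∀ t ∈ Set.Icc a b, IsSprayAt g Q (Set.Icc a b) t) {t : ℝ}
    (ht : t ∈ Set.Icc a b) :
    ContDiffWithinAt ℝ ∞ (fun r => tangentChart (Q t).proj (Q r)) (Set.Icc a b) t := by
  set p := (Q t).proj with hp
  have hev : ∀ᶠ r in 𝓝[Set.Icc a b] t, (Q r).proj ∈ (extChartAt (𝓡∂ m) p).source := by
    have h1 := (hQ t ht).1.preimage_mem_nhdsWithin ((isOpen_tangentChart_source p).mem_nhds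
      (mem_tangentChart_source.2 (mem_extChartAt_source (I := 𝓡∂ m) p)))
    filter_upwards [h1] with r h1 using mem_tangentChart_source.1 h1
  obtain ⟨δ, hδ, hδs⟩ := Metric.mem_nhdsWithin_iff.1 hev
  have hsub : Set.Icc (max a (t - δ / 2)) (min b (t + δ / 2)) ⊆ Set.Icc a b :=
    Set.Icc_subset_Icc (le_max_left _ _) (min_le_left _ _)
  have hsrc : ∀ r ∈ Set.Icc (max a (t - δ / 2)) (min b (t + δ / 2)),
      (Q r).proj ∈ (extChartAt (𝓡∂ m) p).source := by
    intro r hr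
    refine hδs ⟨?_, hsub hr⟩
    rw [Metric.mem_ball, Real.dist_eq, abs_lt]
    have h1 := (le_max_right _ _).trans hr.1
    have h2 := hr.2.trans (min_le_right _ _)
    constructor <;> linarith
  have hmem : Set.Icc (max a (t - δ / 2)) (min b (t + δ / 2)) ∈ 𝓝[Set.Icc a b] t := by
    rw [← Set.Icc_inter_Icc]
    exact Filter.inter_mem self_mem_nhdsWithin
      (mem_nhdsWithin_of_mem_nhds (Icc_mem_nhds (by linarith) (by linarith)))
  have hF : ContDiffOn ℝ ∞ (Function.uncurry fun (_ : ℝ) z => sprayField g p z)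
      (Set.Icc (max a (t - δ / 2)) (min b (t + δ / 2)) ×ˢ
        ((extChartAt (𝓡∂ m) p).target ×ˢ Set.univ)) := by
    intro x hx
    have h1 : ContDiffWithinAt ℝ ∞ (sprayField g p) (Set.range (𝓡∂ m) ×ˢ Set.univ) x.2 :=
      contDiffWithinAt_sprayField g hx.2.1
    exact h1.comp x contDiffWithinAt_snd fun y hy => ⟨mem_range_of_mem_target hy.2.1, trivial⟩
  have hcd := ODE.contDiffOn_enat_Icc_of_hasDerivWithinAt hF
    (α := fun r => tangentChart p (Q r))
    (fun r hr => ((hQ r (hsub hr)).hasDerivWithinAt (hsrc r hr)).mono hsub)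
    (fun r hr => by
      have := (tangentChart p).map_source (mem_tangentChart_source.2 (hsrc r hr))
      rwa [tangentChart_target] at this)
  exact (hcd t (mem_of_mem_nhdsWithin ht hmem)).mono_of_mem_nhdsWithin hmem

/-- Integral curves of the spray are the velocity curves of geodesics. -/
theorem isGeodesicOn_of_isSprayAt {g : SmoothMetric m M} {Q : ℝ → TangentBundle (𝓡∂ m) M}
    {a b : ℝ} (hab : a < b) (hQ : ∀ t ∈ Set.Icc a b, IsSprayAt g Q (Set.Icc a b) t) :
    IsGeodesicOn g (fun t => (Q t).proj) (Set.Icc a b) ∧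
      ∀ t ∈ Set.Icc a b, tangentLift (fun t => (Q t).proj) (Set.Icc a b) t = Q t := by
  have hs : UniqueDiffOn ℝ (Set.Icc a b) := uniqueDiffOn_Icc hab
  have hev : ∀ t ∈ Set.Icc a b, ∀ᶠ r in 𝓝[Set.Icc a b] t,
      (Q r).proj ∈ (extChartAt (𝓡∂ m) (Q t).proj).source := fun t ht => by
    have h1 := (hQ t ht).1.preimage_mem_nhdsWithin ((isOpen_tangentChart_source (Q t).proj).mem_nhds
      (mem_tangentChart_source.2 (mem_extChartAt_source (I := 𝓡∂ m) _)))
    filter_upwards [h1] with r h1 using mem_tangentChart_source.1 h1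
  have hsm : ContMDiffOn 𝓘(ℝ, ℝ) (𝓡∂ m) ∞ (fun t => (Q t).proj) (Set.Icc a b) := by
    intro t ht
    refine contMDiffWithinAt_iff_target.2
      ⟨continuous_tangentBundle_proj.continuousAt.comp_continuousWithinAt (hQ t ht).1, ?_⟩
    have h1 := ((contDiffWithinAt_of_isSprayAt hQ ht).fst).contMDiffWithinAt
    refine h1.congr_of_eventuallyEq ?_ ?_
    · filter_upwards [hev t ht] with r hr using (tangentChart_fst hr).symm
    · exact (tangentChart_fst (mem_extChartAt_source _)).symm
  -- in the chart at `Q t`, the velocity coordinate of `Q` is the derivative of the position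
  have hder : ∀ t ∈ Set.Icc a b, ∀ p : M, (Q t).proj ∈ (extChartAt (𝓡∂ m) p).source →
      HasDerivWithinAt (fun r => extChartAt (𝓡∂ m) p (Q r).proj) (tangentChart p (Q t)).2
        (Set.Icc a b) t := by
    intro t ht p hp
    have h1 : HasDerivWithinAt (fun r => (tangentChart p (Q r)).1) (tangentChart p (Q t)).2
      (Set.Icc a b) t := ((hQ t ht).hasDerivWithinAt hp).fst
    have h2 := (hQ t ht).1.preimage_mem_nhdsWithin ((isOpen_tangentChart_source p).mem_nhds
      (mem_tangentChart_source.2 hp))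
    refine h1.congr_of_eventuallyEq ?_ (tangentChart_fst hp).symm
    filter_upwards [h2] with r hr using (tangentChart_fst (mem_tangentChart_source.1 hr)).symm
  have hlift : ∀ t ∈ Set.Icc a b,
      tangentLift (m := m) (fun t => (Q t).proj) (Set.Icc a b) t = Q t := by
    intro t ht
    have h0 : (Q t).proj ∈ (extChartAt (𝓡∂ m) (Q t).proj).source := mem_extChartAt_source _
    refine (tangentChart (Q t).proj).injOn ((mem_tangentChart_source
      (q := tangentLift (m := m) (fun t => (Q t).proj) (Set.Icc a b) t)).2 h0)
      (mem_tangentChart_source.2 h0) ?_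
    rw [tangentChart_tangentLift ((hsm t ht).mdifferentiableWithinAt (by simp)) (hs t ht) h0,
      (hder t ht _ h0).derivWithin (hs t ht), ← tangentChart_fst h0]
  refine ⟨⟨hsm, fun t ht => ?_⟩, hlift⟩
  have h0 : (Q t).proj ∈ (extChartAt (𝓡∂ m) (Q t).proj).source := mem_extChartAt_source _
  refine (eq_geodesicAcc_iff g ((extChartAt (𝓡∂ m) (Q t).proj).map_source h0) _ _).1 ?_
  rw [iteratedDerivWithin_succ, iteratedDerivWithin_one, (hder t ht _ h0).derivWithin (hs t ht),
    ← tangentChart_fst h0]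
  have h1 : HasDerivWithinAt (fun r => (tangentChart (Q t).proj (Q r)).2)
      (geodesicAcc g (Q t).proj (tangentChart (Q t).proj (Q t)).1
        (tangentChart (Q t).proj (Q t)).2) (Set.Icc a b) t :=
    ((hQ t ht).hasDerivWithinAt h0).snd
  rw [← h1.derivWithin (hs t ht)]
  refine Filter.EventuallyEq.derivWithin_eq ?_ ((hder t ht _ h0).derivWithin (hs t ht))
  filter_upwards [hev t ht, self_mem_nhdsWithin] with r hr hrs
  exact (hder r hrs _ hr).derivWithin (hs r hrs)

end SprayCurves

/-! ### Boundary charts and uniqueness of integral curves of the spray -/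

section Boundary

variable {m : ℕ} [NeZero m] {M : Type*} [TopologicalSpace M]
  [ChartedSpace (EuclideanHalfSpace m) M]

lemma mem_range_halfSpace {y : EucM m} : y ∈ Set.range (𝓡∂ m) ↔ 0 ≤ y 0 := by
  rw [range_modelWithCornersEuclideanHalfSpace]; rfl

lemma extChartAt_zero_nonneg (p x : M) : 0 ≤ extChartAt (𝓡∂ m) p x 0 :=
  mem_range_halfSpace.1 (Set.mem_range_self _)

variable [IsManifold (𝓡∂ m) ∞ M]

lemma mem_interior_iff_extChartAt {p x : M} (hx : x ∈ (extChartAt (𝓡∂ m) p).source) :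
    x ∈ (𝓡∂ m).interior M ↔ 0 < extChartAt (𝓡∂ m) p x 0 := by
  have h1 : x ∈ (𝓡∂ m).interior M ↔ extChartAt (𝓡∂ m) p x ∈
      interior (extChartAt (𝓡∂ m) p).target :=
    (𝓡∂ m).isInteriorPoint_iff_of_mem_atlas (n := ∞) (by simp) (chart_mem_atlas _ p)
      (by rwa [← extChartAt_source (𝓡∂ m)])
  have h2 : extChartAt (𝓡∂ m) p x ∈ interior (Set.range (𝓡∂ m)) ↔
      0 < extChartAt (𝓡∂ m) p x 0 := by
    rw [interior_range_modelWithCornersEuclideanHalfSpace]; rfl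
  rw [h1, ← h2]
  refine ⟨fun h => interior_mono (extChartAt_target_subset_range p) h, fun h => ?_⟩
  have h3 := extChartAt_target_mem_nhdsWithin' (I := 𝓡∂ m) hx
  rw [nhdsWithin_eq_nhds.2 (mem_interior_iff_mem_nhds.1 h)] at h3
  exact mem_interior_iff_mem_nhds.2 h3

lemma mem_boundary_iff_extChartAt {p x : M} (hx : x ∈ (extChartAt (𝓡∂ m) p).source) :
    x ∈ (𝓡∂ m).boundary M ↔ extChartAt (𝓡∂ m) p x 0 = 0 := by
  rw [← (𝓡∂ m).compl_interior, Set.mem_compl_iff, mem_interior_iff_extChartAt hx, not_lt]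
  exact ⟨fun h => le_antisymm h (extChartAt_zero_nonneg p x), fun h => h.le⟩

/-- A coordinate change maps vectors pointing into the half space to such vectors. -/
lemma fderivWithin_chartTrans_nonneg {p p' : M} {y : EucM m} (hy : y ∈ chartOverlap p p')
    (hy0 : y 0 = 0) {w : EucM m} (hw : 0 ≤ w 0) :
    0 ≤ fderivWithin ℝ (chartTrans p p') (Set.range (𝓡∂ m)) y w 0 := by
  have hψ : HasFDerivWithinAt (chartTrans p p')
      (fderivWithin ℝ (chartTrans p p') (Set.range (𝓡∂ m)) y) (Set.range (𝓡∂ m))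
      (y + (0 : ℝ) • w) := by
    rw [zero_smul, add_zero]
    exact ((contDiffWithinAt_chartTrans hy).differentiableWithinAt (by simp)).hasFDerivWithinAt
  have hsrc := (mem_chartOverlap.1 hy)
  have hbd : chartTrans p p' y 0 = 0 := by
    refine (mem_boundary_iff_extChartAt hsrc.2).1 ((mem_boundary_iff_extChartAt
      ((extChartAt (𝓡∂ m) p).map_target hsrc.1)).2 ?_)
    rw [(extChartAt (𝓡∂ m) p).right_inv hsrc.1, hy0]
  have hline : HasDerivWithinAt (fun r : ℝ => y + r • w) w (Set.Ici 0) 0 :=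
    (((hasDerivAt_id (0 : ℝ)).smul_const w).const_add y).hasDerivWithinAt.congr_deriv (by simp)
  have hmaps : Set.MapsTo (fun r : ℝ => y + r • w) (Set.Ici 0) (Set.range (𝓡∂ m)) := by
    intro r hr
    rw [mem_range_halfSpace]
    have : (y + r • w) 0 = r * w 0 := by simp [hy0]
    rw [this]
    exact mul_nonneg hr hw
  have h1 := hψ.comp_hasDerivWithinAt (0 : ℝ) hline hmaps
  have h2 : HasDerivWithinAt (fun r : ℝ => chartTrans p p' (y + r • w) 0)
      (fderivWithin ℝ (chartTrans p p') (Set.range (𝓡∂ m)) y w 0)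
      (Set.Ici 0) 0 :=
    (EuclideanSpace.proj (𝕜 := ℝ) (0 : Fin m)).hasFDerivAt.comp_hasDerivWithinAt (0 : ℝ) h1
  have h3 := (hasDerivWithinAt_iff_tendsto_slope' (by simp)).1 (h2.mono Set.Ioi_subset_Ici_self)
  refine ge_of_tendsto h3 ?_
  filter_upwards [self_mem_nhdsWithin] with r hr
  rw [slope_def_field]
  refine div_nonneg ?_ (by simpa using le_of_lt hr)
  rw [zero_smul, add_zero, hbd, sub_zero]
  exact extChartAt_zero_nonneg _ _

lemma tangentChart_snd_zero_eq_zero {p p' : M} {q : TangentBundle (𝓡∂ m) M}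
    (hp : q.proj ∈ (extChartAt (𝓡∂ m) p).source) (hp' : q.proj ∈ (extChartAt (𝓡∂ m) p').source)
    (hq : q.proj ∈ (𝓡∂ m).boundary M) (h : (tangentChart p q).2 0 = 0) :
    (tangentChart p' q).2 0 = 0 := by
  have hy : (tangentChart p q).1 ∈ chartOverlap p p' := by
    rw [tangentChart_fst hp]
    exact extChartAt_mem_chartOverlap hp hp'
  have h0 : (tangentChart p q).1 0 = 0 := by
    rw [tangentChart_fst hp]
    exact (mem_boundary_iff_extChartAt hp).1 hq
  have h1 := tangentChart_trans hy (tangentChart p q).2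
  rw [Prod.mk.eta, (tangentChart p).left_inv (mem_tangentChart_source.2 hp)] at h1
  rw [h1]
  have h2 := fderivWithin_chartTrans_nonneg hy h0 h.ge
  have h3 := fderivWithin_chartTrans_nonneg hy h0 (w := -(tangentChart p q).2) (by simp [h])
  rw [map_neg] at h3
  have h4 : 0 ≤ -(fderivWithin ℝ (chartTrans p p') (Set.range (𝓡∂ m)) (tangentChart p q).1
    (tangentChart p q).2 0) := h3
  exact le_antisymm (by linarith) h2

/-- Tangency to the boundary can be tested in any chart. -/
lemma isTangentToBoundary_iff {p : M} {q : TangentBundle (𝓡∂ m) M}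
    (hp : q.proj ∈ (extChartAt (𝓡∂ m) p).source) (hq : q.proj ∈ (𝓡∂ m).boundary M) :
    IsTangentToBoundary q.proj q.snd ↔ (tangentChart p q).2 0 = 0 := by
  have h0 : q.proj ∈ (extChartAt (𝓡∂ m) q.proj).source := mem_extChartAt_source _
  have h1 : IsTangentToBoundary q.proj q.snd ↔ (tangentChart q.proj q).2 0 = 0 := by
    rw [tangentChart_apply h0]; rfl
  rw [h1]
  exact ⟨tangentChart_snd_zero_eq_zero h0 hp hq, tangentChart_snd_zero_eq_zero hp h0 hq⟩

/-- The nearest point retraction onto the half space. -/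
noncomputable def halfSpaceRetraction (y : EucM m) : EucM m := (𝓡∂ m) ((𝓡∂ m).symm y)

lemma halfSpaceRetraction_mem (y : EucM m) : halfSpaceRetraction y ∈ Set.range (𝓡∂ m) :=
  Set.mem_range_self _

lemma halfSpaceRetraction_of_mem {y : EucM m} (hy : y ∈ Set.range (𝓡∂ m)) :
    halfSpaceRetraction y = y := (𝓡∂ m).right_inv hy

lemma lipschitzWith_halfSpaceRetraction : LipschitzWith 1 (halfSpaceRetraction (m := m)) := by
  refine LipschitzWith.of_dist_le_mul fun x y => ?_
  rw [NNReal.coe_one, one_mul, EuclideanSpace.dist_eq, EuclideanSpace.dist_eq]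
  refine Real.sqrt_le_sqrt (Finset.sum_le_sum fun i _ => ?_)
  refine pow_le_pow_left₀ dist_nonneg ?_ 2
  have h : ∀ z : EucM m, halfSpaceRetraction z i = Function.update z 0 (max (z 0) 0) i :=
    fun z => rfl
  rw [h, h]
  by_cases hi : i = 0
  · subst hi
    rw [Function.update_self, Function.update_self, Real.dist_eq, Real.dist_eq]
    exact abs_max_sub_max_le_abs _ _ _
  · rw [Function.update_of_ne hi, Function.update_of_ne hi]

end Boundary

section Unique

variable {m : ℕ} [NeZero m] {M : Type*} [TopologicalSpace M]
  [ChartedSpace (EuclideanHalfSpace m) M] [IsManifold (𝓡∂ m) ∞ M]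

lemma continuousAt_tangentChart {p : M} {q : TangentBundle (𝓡∂ m) M}
    (hq : q.proj ∈ (extChartAt (𝓡∂ m) p).source) : ContinuousAt (tangentChart p) q :=
  continuousAt_extChartAt' (mem_tangentChart_source.2 hq)

lemma t2Space_tangentBundle [T2Space M] : T2Space (TangentBundle (𝓡∂ m) M) := by
  refine ⟨fun q q' hne => ?_⟩
  by_cases h : q.proj = q'.proj
  · have hq : q.proj ∈ (extChartAt (𝓡∂ m) q.proj).source := mem_extChartAt_source _
    have hq' : q'.proj ∈ (extChartAt (𝓡∂ m) q.proj).source := h ▸ hq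
    have hne' : tangentChart q.proj q ≠ tangentChart q.proj q' := fun he =>
      hne ((tangentChart q.proj).injOn (mem_tangentChart_source.2 hq)
        (mem_tangentChart_source.2 hq') he)
    obtain ⟨u, v, hu, hv, hqu, hqv, huv⟩ := t2_separation hne'
    have hco : ContinuousOn (tangentChart (m := m) q.proj) (tangentChart q.proj).source :=
      continuousOn_extChartAt _
    refine ⟨_, _, hco.isOpen_inter_preimage (isOpen_tangentChart_source (m := m) _) hu,
      hco.isOpen_inter_preimage (isOpen_tangentChart_source (m := m) _) hv,
      ⟨mem_tangentChart_source.2 hq, hqu⟩, ⟨mem_tangentChart_source.2 hq', hqv⟩, ?_⟩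
    exact (huv.preimage _).mono Set.inter_subset_right Set.inter_subset_right
  · exact separated_by_continuous continuous_tangentBundle_proj h

lemma exists_lipschitzOnWith_sprayField (g : SmoothMetric m M) {p : M} {z : EucM m × EucM m}
    (hz : z.1 ∈ (extChartAt (𝓡∂ m) p).target) :
    ∃ K : NNReal, ∃ W ∈ 𝓝[Set.range (𝓡∂ m) ×ˢ Set.univ] z, LipschitzOnWith K (sprayField g p) W :=
  ((contDiffWithinAt_sprayField g hz).of_le (by simp)).exists_lipschitzOnWith
    ((𝓡∂ m).convex_range.prod convex_univ)

/-- Integral curves of the spray are determined by their starting point. -/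
theorem eqOn_of_isSprayAt [T2Space M] {g : SmoothMetric m M} {Q Q' : ℝ → TangentBundle (𝓡∂ m) M}
    {a b : ℝ} (hQ : ∀ t ∈ Set.Icc a b, IsSprayAt g Q (Set.Icc a b) t)
    (hQ' : ∀ t ∈ Set.Icc a b, IsSprayAt g Q' (Set.Icc a b) t) (h0 : Q a = Q' a) :
    Set.EqOn Q Q' (Set.Icc a b) := by
  have hT2 : T2Space (TangentBundle (𝓡∂ m) M) := t2Space_tangentBundle
  have hcl : IsClosed ({t | Q t = Q' t} ∩ Set.Icc a b) := by
    have hc : ContinuousOn (fun t => (Q t, Q' t)) (Set.Icc a b) := fun t ht =>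
      (hQ t ht).1.prodMk (hQ' t ht).1
    have := hc.preimage_isClosed_of_isClosed isClosed_Icc isClosed_diagonal
    rw [Set.inter_comm]
    exact this
  refine hcl.Icc_subset_of_forall_exists_gt h0 ?_
  rintro x ⟨hx, hxI⟩ y hy
  have hxI' : x ∈ Set.Icc a b := ⟨hxI.1, hxI.2.le⟩
  set p := (Q x).proj
  have hp : (Q x).proj ∈ (extChartAt (𝓡∂ m) p).source := mem_extChartAt_source _
  obtain ⟨K, W, hW, hlip⟩ := exists_lipschitzOnWith_sprayField g
    (z := tangentChart p (Q x)) (p := p)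
    (by rw [tangentChart_fst hp]; exact (extChartAt (𝓡∂ m) p).map_source hp)
  have hev : ∀ R : ℝ → TangentBundle (𝓡∂ m) M, R x = Q x → ContinuousWithinAt R (Set.Icc a b) x →
      ∀ᶠ r in 𝓝[Set.Icc a b] x, (R r).proj ∈ (extChartAt (𝓡∂ m) p).source ∧
        tangentChart p (R r) ∈ W := by
    intro R hR hRc
    have hp' : (R x).proj ∈ (extChartAt (𝓡∂ m) p).source := hR ▸ hp
    have h1 := hRc.preimage_mem_nhdsWithin ((isOpen_tangentChart_source p).mem_nhds
      (mem_tangentChart_source.2 hp'))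
    have h2 : Filter.Tendsto (fun r => tangentChart p (R r)) (𝓝[Set.Icc a b] x)
        (𝓝[Set.range (𝓡∂ m) ×ˢ Set.univ] (tangentChart p (Q x))) := by
      rw [← hR]
      refine tendsto_nhdsWithin_iff.2
        ⟨(continuousAt_tangentChart hp').comp_continuousWithinAt hRc, ?_⟩
      filter_upwards [h1] with r hr
      refine ⟨?_, trivial⟩
      rw [tangentChart_fst (mem_tangentChart_source.1 hr)]
      exact extChartAt_mem_range _ _
    filter_upwards [h1, h2 hW] with r h1 h2 using ⟨mem_tangentChart_source.1 h1, h2⟩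
  obtain ⟨δ, hδ, hδs⟩ := Metric.mem_nhdsWithin_iff.1
    ((hev Q rfl (hQ x hxI').1).and (hev Q' hx.symm (hQ' x hxI').1))
  set c := min (min b y) (x + δ / 2) with hc
  have hxc : x < c := lt_min (lt_min hxI.2 hy) (by linarith)
  have hsub : Set.Icc x c ⊆ Set.Icc a b := Set.Icc_subset_Icc hxI.1
    ((min_le_left _ _).trans (min_le_left _ _))
  have hmem : ∀ r ∈ Set.Icc x c, ((Q r).proj ∈ (extChartAt (𝓡∂ m) p).source ∧
      tangentChart p (Q r) ∈ W) ∧ (Q' r).proj ∈ (extChartAt (𝓡∂ m) p).source ∧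
      tangentChart p (Q' r) ∈ W := by
    intro r hr
    refine hδs ⟨?_, hsub hr⟩
    have := hr.2.trans (min_le_right _ _)
    rw [Metric.mem_ball, Real.dist_eq, abs_lt]
    constructor <;> linarith [hr.1]
  have hder : ∀ R : ℝ → TangentBundle (𝓡∂ m) M,
      (∀ t ∈ Set.Icc a b, IsSprayAt g R (Set.Icc a b) t) →
      (∀ r ∈ Set.Icc x c, (R r).proj ∈ (extChartAt (𝓡∂ m) p).source) →
      ContinuousOn (fun r => tangentChart p (R r)) (Set.Icc x c) ∧ ∀ r ∈ Set.Ico x c,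
        HasDerivWithinAt (fun r => tangentChart p (R r)) (sprayField g p (tangentChart p (R r)))
          (Set.Ici r) r := by
    intro R hR hRs
    have h1 : ∀ r ∈ Set.Icc x c, HasDerivWithinAt (fun r => tangentChart p (R r))
        (sprayField g p (tangentChart p (R r))) (Set.Icc x c) r := fun r hr =>
      ((hR r (hsub hr)).hasDerivWithinAt (hRs r hr)).mono hsub
    refine ⟨fun r hr => (h1 r hr).continuousWithinAt, fun r hr => ?_⟩
    exact (h1 r ⟨hr.1, hr.2.le⟩).mono_of_mem_nhdsWithin (Icc_mem_nhdsGE_of_mem hr)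
  obtain ⟨hc1, hd1⟩ := hder Q hQ fun r hr => (hmem r hr).1.1
  obtain ⟨hc2, hd2⟩ := hder Q' hQ' fun r hr => (hmem r hr).2.1
  have heq := ODE_solution_unique_of_mem_Icc_right (v := fun _ => sprayField g p) (s := fun _ => W)
    (fun _ _ => hlip) hc1 hd1 (fun r hr => (hmem r ⟨hr.1, hr.2.le⟩).1.2) hc2 hd2
    (fun r hr => (hmem r ⟨hr.1, hr.2.le⟩).2.2) (congrArg (tangentChart p) hx)
  have hcc : c ∈ Set.Icc x c := ⟨hxc.le, le_rfl⟩
  refine ⟨c, ?_, hxc, (min_le_left _ _).trans (min_le_right _ _)⟩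
  exact (tangentChart p).injOn (mem_tangentChart_source.2 (hmem c hcc).1.1)
    (mem_tangentChart_source.2 (hmem c hcc).2.1) (heq hcc)

end Unique

/-! ### Local flows of vector fields on convex sets -/

section ODE

/-- A vector field `F` which is `C¹` on a convex set `D` has a local flow near each point of `D`,
even at the boundary of `D`, if it is first extended by a Lipschitz retraction `ρ` onto `D`. -/
theorem exists_local_flow {X : Type*} [NormedAddCommGroup X] [NormedSpace ℝ X] [CompleteSpace X]
    {F ρ : X → X} {D : Set X} (hD : Convex ℝ D) {c : NNReal} (hρ : LipschitzWith c ρ)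
    (hρD : ∀ x, ρ x ∈ D) {x₀ : X} (hx₀ : ρ x₀ = x₀) (hF : ContDiffWithinAt ℝ 1 F D x₀)
    {N : Set X} (hN : N ∈ 𝓝 x₀) :
    ∃ B ∈ 𝓝 x₀, B ⊆ N ∧ ∃ K : NNReal, LipschitzOnWith K (F ∘ ρ) B ∧ ∃ ε > 0, ∀ᶠ x in 𝓝 x₀,
      ∃ α : ℝ → X, α 0 = x ∧ ∀ t ∈ Set.Icc 0 ε, α t ∈ B ∧
        HasDerivWithinAt α (F (ρ (α t))) (Set.Icc 0 ε) t := by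
  obtain ⟨K, W, hW, hlip⟩ := hF.exists_lipschitzOnWith hD
  have hpre : ρ ⁻¹' W ∈ 𝓝 x₀ := by
    have : Filter.Tendsto ρ (𝓝 x₀) (𝓝[D] x₀) := tendsto_nhdsWithin_iff.2
      ⟨by simpa [hx₀] using hρ.continuous.tendsto x₀, Filter.Eventually.of_forall hρD⟩
    exact this hW
  obtain ⟨a', ha', hball⟩ := Metric.nhds_basis_closedBall.mem_iff.1 (Filter.inter_mem hpre hN)
  lift a' to NNReal using ha'.le
  rename' a' => a, ha' => ha
  have ha0 : (0 : ℝ) < a := ha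
  have hlipB : LipschitzOnWith (K * c) (F ∘ ρ) (Metric.closedBall x₀ a) :=
    hlip.comp (hρ.lipschitzOnWith (s := Metric.closedBall x₀ a)) fun x hx => (hball hx).1
  set L : NNReal := ‖F (ρ x₀)‖₊ + K * c * a with hL
  have hbound : ∀ x ∈ Metric.closedBall x₀ (a : ℝ), ‖(F ∘ ρ) x‖ ≤ L := by
    intro x hx
    have h1 := hlipB.dist_le_mul x hx x₀ (Metric.mem_closedBall_self ha0.le)
    have h2 : (K * c : NNReal) * dist x x₀ ≤ ((K * c : NNReal) : ℝ) * a := by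
      gcongr
      exact hx
    have h3 : ‖(F ∘ ρ) x‖ ≤ ‖(F ∘ ρ) x₀‖ + dist ((F ∘ ρ) x) ((F ∘ ρ) x₀) := by
      rw [dist_eq_norm]
      exact norm_le_norm_add_norm_sub' _ _
    have h4 : (L : ℝ) = ‖(F ∘ ρ) x₀‖ + ((K * c : NNReal) : ℝ) * a := by
      rw [hL]; push_cast; rfl
    linarith
  set ε : ℝ := a / (2 * (L + 1)) with hε
  have hε0 : 0 < ε := by positivity
  have hLε : L * ε ≤ a - a / 2 := by
    have h1 : (L + 1 : ℝ) * ε = a / 2 := by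
      rw [hε]
      field_simp
    linarith
  refine ⟨Metric.closedBall x₀ a, Metric.closedBall_mem_nhds _ ha0, fun x hx => (hball hx).2,
    K * c, hlipB, ε, hε0, ?_⟩
  have hpl : IsPicardLindelof (fun _ => F ∘ ρ) (tmin := 0) (tmax := ε)
      ⟨0, le_rfl, hε0.le⟩ x₀ a (a / 2) L (K * c) := by
    refine IsPicardLindelof.of_time_independent hbound hlipB ?_
    simp only [sub_zero, sub_self, max_eq_left hε0.le, NNReal.coe_div, NNReal.coe_ofNat]
    exact hLε
  filter_upwards [Metric.closedBall_mem_nhds x₀ (show (0 : ℝ) < ((a / 2 : NNReal) : ℝ) by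
    rw [NNReal.coe_div]; positivity)] with x hx
  obtain ⟨α, hα⟩ := ODE.FunSpace.exists_isFixedPt_next hpl hx
  refine ⟨α.compProj, ?_, fun t ht => ⟨α.compProj_mem_closedBall hpl.mul_max_le, ?_⟩⟩
  · have h := ODE.FunSpace.compProj_val (α := α)
      (t := (⟨0, le_rfl, hε0.le⟩ : Set.Icc (0 : ℝ) ε))
    rw [← hα, ODE.FunSpace.next_apply₀] at h
    rw [← hα]
    exact h
  · refine (ODE.hasDerivWithinAt_picard_Icc (f := fun _ => F ∘ ρ) (t₀ := 0) ⟨le_rfl, hε0.le⟩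
      hpl.continuousOn_uncurry
      α.continuous_compProj.continuousOn (fun _ _ => α.compProj_mem_closedBall hpl.mul_max_le)
      x ht).congr_of_mem (fun r hr => ?_) ht
    have h1 := ODE.FunSpace.compProj_of_mem (α := α) hr
    have h2 := congrArg (fun β => β ⟨r, hr⟩) hα
    rw [h1, ← h2]
    exact ODE.FunSpace.next_apply hpl hx α

end ODE

/-! ### Parallel transport along geodesics as a flow -/

section Transport

variable {m : ℕ} [NeZero m] {M : Type*} [TopologicalSpace M]
  [ChartedSpace (EuclideanHalfSpace m) M] [IsManifold (𝓡∂ m) ∞ M] {n : ℕ}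

/-- The connection as a function on the tangent bundle. -/
noncomputable def HermitianConnection.eval (A : HermitianConnection m M n)
    (q : TangentBundle (𝓡∂ m) M) : EndC n := A.form q.proj q.snd

lemma HermitianConnection.star_eval (A : HermitianConnection m M n)
    (q : TangentBundle (𝓡∂ m) M) : star (A.eval q) = -A.eval q := A.skewHermitian _ _

lemma HermitianConnection.continuous_eval (A : HermitianConnection m M n) :
    Continuous A.eval := A.smooth.continuous

/-- The connection in position and velocity coordinates. -/
noncomputable def connectionChart (A : HermitianConnection m M n) (p : M)
    (z : EucM m × EucM m) : EndC n := A.eval ((tangentChart p).symm z)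

lemma contDiffWithinAt_connectionChart (A : HermitianConnection m M n) {p : M}
    {z : EucM m × EucM m} (hz : z.1 ∈ (extChartAt (𝓡∂ m) p).target) :
    ContDiffWithinAt ℝ ∞ (connectionChart A p) (Set.range (𝓡∂ m) ×ˢ Set.univ) z := by
  have h1 : ContMDiffOn 𝓘(ℝ, EucM m × EucM m) 𝓘(ℝ, EndC n) ∞ (connectionChart A p)
      (tangentChart (M := M) p).target :=
    A.smooth.comp_contMDiffOn (contMDiffOn_extChartAt_symm (n := ∞) (I := (𝓡∂ m).tangent)
      (⟨p, 0⟩ : TangentBundle (𝓡∂ m) M))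
  have h2 := h1 z (mem_tangentChart_target.2 hz)
  refine (contMDiffWithinAt_iff_contDiffWithinAt.1 h2).mono_of_mem_nhdsWithin ?_
  rw [tangentChart_target, nhdsWithin_prod_eq, nhdsWithin_univ]
  exact Filter.prod_mem_prod (extChartAt_target_mem_nhdsWithin_of_mem hz) Filter.univ_mem

/-- The vector field, in coordinates, whose integral curves are geodesics together with solutions
of the parallel transport equation along them. -/
noncomputable def transportField (g : SmoothMetric m M) (A : HermitianConnection m M n) (p : M)
    (x : (EucM m × EucM m) × EndC n) : (EucM m × EucM m) × EndC n :=
  (sprayField g p x.1, -(connectionChart A p x.1 * x.2))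

lemma contDiffWithinAt_transportField (g : SmoothMetric m M) (A : HermitianConnection m M n)
    {p : M} {x : (EucM m × EucM m) × EndC n} (hx : x.1.1 ∈ (extChartAt (𝓡∂ m) p).target) :
    ContDiffWithinAt ℝ ∞ (transportField g A p)
      ((Set.range (𝓡∂ m) ×ˢ Set.univ) ×ˢ Set.univ) x := by
  have hm : Set.MapsTo (Prod.fst : (EucM m × EucM m) × EndC n → _)
      ((Set.range (𝓡∂ m) ×ˢ Set.univ) ×ˢ Set.univ) (Set.range (𝓡∂ m) ×ˢ Set.univ) :=
    fun y hy => hy.1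
  have h1 := (contDiffWithinAt_sprayField g hx).comp x contDiffWithinAt_fst hm
  have h2 := (contDiffWithinAt_connectionChart A hx).comp x contDiffWithinAt_fst hm
  exact h1.prodMk (h2.mul contDiffWithinAt_snd).neg

/-- The extension of the retraction onto the half space to velocities and matrices. -/
noncomputable def stateRetraction (x : (EucM m × EucM m) × EndC n) : (EucM m × EucM m) × EndC n :=
  ((halfSpaceRetraction x.1.1, x.1.2), x.2)

lemma lipschitzWith_stateRetraction :
    LipschitzWith 1 (stateRetraction (m := m) (n := n)) := by
  have h1 : LipschitzWith 1 (Prod.fst : (EucM m × EucM m) × EndC n → _) := LipschitzWith.prod_fst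
  have h2 : LipschitzWith 1 (Prod.snd : (EucM m × EucM m) × EndC n → _) := LipschitzWith.prod_snd
  have h3 : LipschitzWith 1 (Prod.fst : EucM m × EucM m → _) := LipschitzWith.prod_fst
  have h4 : LipschitzWith 1 (Prod.snd : EucM m × EucM m → _) := LipschitzWith.prod_snd
  have h5 := ((lipschitzWith_halfSpaceRetraction.comp (h3.comp h1)).prodMk (h4.comp h1)).prodMk h2
  simp only [mul_one, max_self] at h5
  exact h5

/-- Coordinates of a tangent vector together with a matrix. -/
noncomputable def stateChart (p : M) (y : TangentBundle (𝓡∂ m) M × EndC n) :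
    (EucM m × EucM m) × EndC n := (tangentChart p y.1, y.2)

/-- The inverse of `stateChart`. -/
noncomputable def stateChartSymm (p : M) (x : (EucM m × EucM m) × EndC n) :
    TangentBundle (𝓡∂ m) M × EndC n := ((tangentChart p).symm x.1, x.2)

/-- At time `t`, the curve `f` of velocity vectors and matrices consists, within `s`, of a curve of
the geodesic flow and of a solution of the parallel transport equation along it. -/
def IsTransportAt (g : SmoothMetric m M) (A : HermitianConnection m M n)
    (f : ℝ → TangentBundle (𝓡∂ m) M × EndC n) (s : Set ℝ) (t : ℝ) : Prop :=
  IsSprayAt g (fun r => (f r).1) s t ∧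
    HasDerivWithinAt (fun r => (f r).2) (-(A.eval (f t).1 * (f t).2)) s t

variable {g : SmoothMetric m M} {A : HermitianConnection m M n}
  {f : ℝ → TangentBundle (𝓡∂ m) M × EndC n} {s : Set ℝ} {t : ℝ} {p : M}

lemma IsTransportAt.continuousWithinAt (hf : IsTransportAt g A f s t) :
    ContinuousWithinAt f s t := hf.1.1.prodMk hf.2.continuousWithinAt

lemma IsTransportAt.hasDerivWithinAt (hf : IsTransportAt g A f s t)
    (hp : (f t).1.proj ∈ (extChartAt (𝓡∂ m) p).source) :
    HasDerivWithinAt (fun r => stateChart p (f r)) (transportField g A p (stateChart p (f t)))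
      s t := by
  refine ((hf.1.hasDerivWithinAt hp).prodMk hf.2).congr_deriv ?_
  rw [transportField, connectionChart, stateChart,
    (tangentChart p).left_inv (mem_tangentChart_source.2 hp)]

lemma IsTransportAt.of_hasDerivWithinAt (hc : ContinuousWithinAt f s t)
    (hp : (f t).1.proj ∈ (extChartAt (𝓡∂ m) p).source)
    (h : HasDerivWithinAt (fun r => stateChart p (f r))
      (transportField g A p (stateChart p (f t))) s t) : IsTransportAt g A f s t := by
  refine ⟨IsSprayAt.of_hasDerivWithinAt hc.fst hp h.fst, ?_⟩
  have h2 : HasDerivWithinAt (fun r => (f r).2)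
    (-(connectionChart A p (stateChart p (f t)).1 * (f t).2)) s t := h.snd
  rwa [connectionChart, stateChart,
    (tangentChart p).left_inv (mem_tangentChart_source.2 hp)] at h2

lemma IsTransportAt.mono {s' : Set ℝ} (hf : IsTransportAt g A f s t) (h : s' ⊆ s) :
    IsTransportAt g A f s' t := ⟨hf.1.mono h, hf.2.mono h⟩

lemma IsTransportAt.mono_of_mem_nhdsWithin {s' : Set ℝ} (hf : IsTransportAt g A f s t)
    (h : s ∈ 𝓝[s'] t) : IsTransportAt g A f s' t :=
  ⟨⟨hf.1.1.mono_of_mem_nhdsWithin h, hf.1.2.mono_of_mem_nhdsWithin h⟩,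
    hf.2.mono_of_mem_nhdsWithin h⟩

lemma IsTransportAt.union {s' : Set ℝ} (hf : IsTransportAt g A f s t)
    (hf' : IsTransportAt g A f s' t) : IsTransportAt g A f (s ∪ s') t :=
  ⟨⟨hf.1.1.union hf'.1.1, hf.1.2.union hf'.1.2⟩, hf.2.union hf'.2⟩

lemma IsTransportAt.congr {f' : ℝ → TangentBundle (𝓡∂ m) M × EndC n}
    (hf : IsTransportAt g A f s t) (h : ∀ r ∈ s, f' r = f r) (ht : f' t = f t) :
    IsTransportAt g A f' s t := by
  refine ⟨⟨hf.1.1.congr (fun r hr => by rw [h r hr]) (by rw [ht]), ?_⟩, ?_⟩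
  · simp only [ht]
    exact hf.1.2.congr (fun r hr => by rw [h r hr]) (by rw [ht])
  · rw [ht]
    exact hf.2.congr (fun r hr => by rw [h r hr]) (by rw [ht])

lemma IsTransportAt.of_subset_singleton {t₀ : ℝ} (f : ℝ → TangentBundle (𝓡∂ m) M × EndC n)
    (hs : s ⊆ {t₀}) (ht : t ∈ s) : IsTransportAt g A f s t := by
  obtain rfl := hs ht
  have hd : ∀ {X : Type _} [NormedAddCommGroup X] [NormedSpace ℝ X] (h : ℝ → X) (h' : X),
      HasDerivWithinAt h h' s t := fun h h' =>
    hasDerivWithinAt_iff_hasFDerivWithinAt.2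
      (HasFDerivWithinAt.of_subsingleton (Set.subsingleton_of_subset_singleton hs))
  exact ⟨⟨(continuousWithinAt_singleton (f := fun r => (f r).1)).mono hs, hd _ _⟩, hd _ _⟩

lemma continuousAt_stateChart {y : TangentBundle (𝓡∂ m) M × EndC n}
    (hy : y.1.proj ∈ (extChartAt (𝓡∂ m) p).source) :
    ContinuousAt (stateChart (n := n) p) y :=
  (ContinuousAt.comp (f := Prod.fst) (continuousAt_tangentChart hy) continuousAt_fst).prodMk
    continuousAt_snd

lemma stateChartSymm_stateChart {y : TangentBundle (𝓡∂ m) M × EndC n}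
    (hy : y.1.proj ∈ (extChartAt (𝓡∂ m) p).source) :
    stateChartSymm p (stateChart p y) = y :=
  Prod.ext ((tangentChart p).left_inv (mem_tangentChart_source.2 hy)) rfl

lemma stateChart_stateChartSymm {x : (EucM m × EucM m) × EndC n}
    (hx : x.1.1 ∈ (extChartAt (𝓡∂ m) p).target) :
    stateChart p (stateChartSymm p x) = x :=
  Prod.ext ((tangentChart p).right_inv (mem_tangentChart_target.2 hx)) rfl

lemma continuousAt_stateChartSymm {x : (EucM m × EucM m) × EndC n}
    (hx : x.1.1 ∈ (extChartAt (𝓡∂ m) p).target) :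
    ContinuousAt (stateChartSymm (n := n) p) x := by
  have h1 : ContinuousAt (tangentChart p).symm x.1 :=
    continuousAt_extChartAt_symm'' (mem_tangentChart_target.2 hx)
  exact (ContinuousAt.comp (f := Prod.fst) h1 continuousAt_fst).prodMk continuousAt_snd

lemma stateRetraction_mem (x : (EucM m × EucM m) × EndC n) : stateRetraction x ∈
    ((Set.range (𝓡∂ m) ×ˢ Set.univ) ×ˢ Set.univ : Set ((EucM m × EucM m) × EndC n)) :=
  ⟨⟨halfSpaceRetraction_mem _, trivial⟩, trivial⟩

lemma stateRetraction_of_mem {x : (EucM m × EucM m) × EndC n}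
    (hx : x.1.1 ∈ Set.range (𝓡∂ m)) : stateRetraction x = x := by
  rw [stateRetraction, halfSpaceRetraction_of_mem hx]

/-- A curve in coordinates which stays in the chart domain and follows the (extended) vector field
is a geodesic with a parallel transport solution. -/
lemma isTransportAt_of_coordinates {α : ℝ → (EucM m × EucM m) × EndC n}
    (ht : t ∈ s) (hα : HasDerivWithinAt α (transportField g A p (stateRetraction (α t))) s t)
    (hs : ∀ r ∈ s, (α r).1.1 ∈ (extChartAt (𝓡∂ m) p).target) :
    IsTransportAt g A (fun r => stateChartSymm p (α r)) s t := by
  refine IsTransportAt.of_hasDerivWithinAt (p := p)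
    ((continuousAt_stateChartSymm (hs t ht)).comp_continuousWithinAt hα.continuousWithinAt)
    ((extChartAt (𝓡∂ m) p).map_target (hs t ht)) ?_
  rw [stateRetraction_of_mem (mem_range_of_mem_target (hs t ht))] at hα
  rw [stateChart_stateChartSymm (hs t ht)]
  exact hα.congr (fun r hr => stateChart_stateChartSymm (hs r hr))
    (stateChart_stateChartSymm (hs t ht))

set_option maxHeartbeats 1000000 in
/-- Continuous dependence, locally in time and expressed in coordinates: curves of the extended
flow starting close to a given curve exist for a uniform time and stay close to it. -/
theorem exists_coordinate_flow {τ t₀ : ℝ}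
    (hf : ∀ t ∈ Set.Icc 0 τ, IsTransportAt g A f (Set.Icc 0 τ) t) (ht₀ : t₀ ∈ Set.Icc 0 τ)
    (hp : (f t₀).1.proj ∈ (extChartAt (𝓡∂ m) p).source)
    {N : Set ((EucM m × EucM m) × EndC n)} (hN : N ∈ 𝓝 (stateChart p (f t₀))) :
    ∃ δ > 0, ∃ C : ℝ, (∀ r ∈ Set.Icc 0 τ, |r - t₀| ≤ δ →
        (f r).1.proj ∈ (extChartAt (𝓡∂ m) p).source ∧ stateChart p (f r) ∈ N) ∧
      ∀ s ∈ Set.Icc 0 τ, |s - t₀| ≤ δ → ∀ᶠ x in 𝓝 (stateChart p (f s)),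
        ∃ α : ℝ → (EucM m × EucM m) × EndC n, α s = x ∧
          (∀ r ∈ Set.Icc s (s + 4 * δ), α r ∈ N ∧ HasDerivWithinAt α
            (transportField g A p (stateRetraction (α r))) (Set.Icc s (s + 4 * δ)) r) ∧
          ∀ r ∈ Set.Icc s (s + 4 * δ), r ∈ Set.Icc 0 τ → |r - t₀| ≤ δ →
            dist (α r) (stateChart p (f r)) ≤ dist x (stateChart p (f s)) * C := by
  have htar : (stateChart p (f t₀)).1.1 ∈ (extChartAt (𝓡∂ m) p).target := by
    rw [stateChart, tangentChart_fst hp]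
    exact (extChartAt (𝓡∂ m) p).map_source hp
  obtain ⟨B, hB, hBN, K, hK, ε, hε, hflow⟩ := exists_local_flow
    (((𝓡∂ m).convex_range.prod convex_univ).prod (convex_univ (E := EndC n)))
    (lipschitzWith_stateRetraction (m := m) (n := n))
    stateRetraction_mem
    (stateRetraction_of_mem (mem_range_of_mem_target htar))
    ((contDiffWithinAt_transportField g A htar).of_le (by simp)) hN
  set P : ℝ → Prop := fun r => (f r).1.proj ∈ (extChartAt (𝓡∂ m) p).source ∧
      stateChart p (f r) ∈ B ∧ ∀ᶠ x in 𝓝 (stateChart p (f r)),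
        ∃ α : ℝ → (EucM m × EucM m) × EndC n, α 0 = x ∧ ∀ t ∈ Set.Icc 0 ε, α t ∈ B ∧
          HasDerivWithinAt α (transportField g A p (stateRetraction (α t))) (Set.Icc 0 ε) t with hP
  have hev : ∀ᶠ r in 𝓝[Set.Icc 0 τ] t₀, P r := by
    have hc := (hf t₀ ht₀).continuousWithinAt
    have h1 := hc.fst.preimage_mem_nhdsWithin ((isOpen_tangentChart_source p).mem_nhds
      (mem_tangentChart_source.2 hp))
    have h2 := (continuousAt_stateChart hp).comp_continuousWithinAt hc
    filter_upwards [h1, h2 hB, h2.eventually hflow.eventually_nhds] with r h1 h2 h3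
    exact ⟨mem_tangentChart_source.1 h1, h2, h3⟩
  obtain ⟨δ', hδ', hδs⟩ := Metric.mem_nhdsWithin_iff.1 hev
  obtain ⟨δ, hδ, hδ1, hδ2⟩ : ∃ δ > 0, δ < δ' ∧ 4 * δ ≤ ε :=
    ⟨min (δ' / 2) (ε / 4), lt_min (by linarith) (by linarith),
      (min_le_left _ _).trans_lt (by linarith), by linarith [min_le_right (δ' / 2) (ε / 4)]⟩
  have hprop : ∀ r ∈ Set.Icc 0 τ, |r - t₀| ≤ δ → P r := fun r hr hrδ =>
    hδs ⟨by rw [Metric.mem_ball, Real.dist_eq]; exact hrδ.trans_lt hδ1, hr⟩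
  refine ⟨δ, hδ, Real.exp (K * (4 * δ)),
    fun r hr hrδ => ⟨(hprop r hr hrδ).1, hBN (hprop r hr hrδ).2.1⟩, fun s hs hsδ => ?_⟩
  filter_upwards [(hprop s hs hsδ).2.2] with x hx
  obtain ⟨α, hα0, hα⟩ := hx
  have hshift : ∀ r ∈ Set.Icc s (s + 4 * δ), r - s ∈ Set.Icc 0 ε := fun r hr =>
    ⟨by linarith [hr.1], by linarith [hr.2]⟩
  have hαd : ∀ r ∈ Set.Icc s (s + 4 * δ), HasDerivWithinAt (fun r => α (r - s))
      (transportField g A p (stateRetraction (α (r - s)))) (Set.Icc s (s + 4 * δ)) r := by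
    intro r hr
    have h1 : HasDerivWithinAt (fun r => r - s) 1 (Set.Icc s (s + 4 * δ)) r :=
      ((hasDerivAt_id r).sub_const s).hasDerivWithinAt
    have h2 := (hα _ (hshift r hr)).2.scomp r h1 hshift
    rwa [one_smul] at h2
  refine ⟨fun r => α (r - s), by simp [hα0], fun r hr => ⟨hBN (hα _ (hshift r hr)).1, hαd r hr⟩,
    fun r hr hrτ hrδ => ?_⟩
  have hmem : ∀ r' ∈ Set.Icc s r, r' ∈ Set.Icc 0 τ ∧ |r' - t₀| ≤ δ ∧
      r' ∈ Set.Icc s (s + 4 * δ) := by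
    intro r' hr'
    refine ⟨⟨hs.1.trans hr'.1, hr'.2.trans hrτ.2⟩, ?_, hr'.1, hr'.2.trans hr.2⟩
    rw [abs_le] at hsδ hrδ ⊢
    constructor <;> linarith [hr'.1, hr'.2]
  have hfd : ∀ r' ∈ Set.Icc s r, HasDerivWithinAt (fun r => stateChart p (f r))
      (transportField g A p (stateRetraction (stateChart p (f r')))) (Set.Icc s r) r' := by
    intro r' hr'
    have h1 := hmem r' hr'
    have h2 := (hprop r' h1.1 h1.2.1).1
    rw [stateRetraction_of_mem (by
      rw [stateChart, tangentChart_fst h2]; exact extChartAt_mem_range _ _)]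
    exact ((hf r' h1.1).hasDerivWithinAt h2).mono fun u hu => (hmem u hu).1
  have hαd' : ∀ r' ∈ Set.Icc s r, HasDerivWithinAt (fun r => α (r - s))
      (transportField g A p (stateRetraction (α (r' - s)))) (Set.Icc s r) r' := fun r' hr' =>
    (hαd r' (hmem r' hr').2.2).mono fun u hu => (hmem u hu).2.2
  have hgr := dist_le_of_trajectories_ODE_of_mem
    (v := fun _ => transportField g A p ∘ stateRetraction) (s := fun _ => B) (K := K)
    (a := s) (b := r) (f := fun r => α (r - s)) (g := fun r => stateChart p (f r))
    (fun _ _ => hK) (fun r' hr' => (hαd' r' hr').continuousWithinAt)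
    (fun r' hr' => (hαd' r' ⟨hr'.1, hr'.2.le⟩).mono_of_mem_nhdsWithin (Icc_mem_nhdsGE_of_mem hr'))
    (fun r' hr' => (hα _ (hshift r' (hmem r' ⟨hr'.1, hr'.2.le⟩).2.2)).1)
    (fun r' hr' => (hfd r' hr').continuousWithinAt)
    (fun r' hr' => (hfd r' ⟨hr'.1, hr'.2.le⟩).mono_of_mem_nhdsWithin (Icc_mem_nhdsGE_of_mem hr'))
    (fun r' hr' => (hprop r' (hmem r' ⟨hr'.1, hr'.2.le⟩).1 (hmem r' ⟨hr'.1, hr'.2.le⟩).2.1).2.1)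
    le_rfl r ⟨hr.1, le_rfl⟩
  refine hgr.trans ?_
  simp only [sub_self, hα0]
  gcongr
  linarith [hr.2]

end Transport

/-! ### Continuous dependence of transport along nontangential geodesics -/

/-- Induction along a compact interval. -/
lemma Icc_induction_of_local {P : ℝ → Prop} {b : ℝ} (h0 : P 0)
    (hstep : ∀ t₀ ∈ Set.Icc 0 b, ∃ δ > 0, ∀ s ∈ Set.Icc 0 b, ∀ t ∈ Set.Icc 0 b,
      |s - t₀| ≤ δ → |t - t₀| ≤ δ → s ≤ t → P s → P t) :
    ∀ t ∈ Set.Icc 0 b, P t := by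
  intro t₁ ht₁
  have hb : (0 : ℝ) ≤ b := ht₁.1.trans ht₁.2
  set T : Set ℝ := {t | t ∈ Set.Icc 0 b ∧ ∀ s ∈ Set.Icc 0 t, P s} with hT
  have h0T : (0 : ℝ) ∈ T := ⟨⟨le_rfl, hb⟩, fun s hs => (le_antisymm hs.2 hs.1) ▸ h0⟩
  have hbdd : BddAbove T := ⟨b, fun t ht => ht.1.2⟩
  have hc : sSup T ∈ Set.Icc 0 b := ⟨le_csSup hbdd h0T, csSup_le ⟨0, h0T⟩ fun t ht => ht.1.2⟩
  obtain ⟨δ, hδ, hstep⟩ := hstep _ hc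
  obtain ⟨t, htT, ht⟩ := exists_lt_of_lt_csSup ⟨0, h0T⟩ (show sSup T - δ < sSup T by linarith)
  have htc := le_csSup hbdd htT
  have hmem : min b (sSup T + δ) ∈ T := by
    refine ⟨⟨le_min hb (by linarith [hc.1]), min_le_left _ _⟩, fun s hs => ?_⟩
    rcases le_total s t with h | h
    · exact htT.2 s ⟨hs.1, h⟩
    · have h1 := hs.2.trans (min_le_right _ _)
      refine hstep t htT.1 s ⟨hs.1, hs.2.trans (min_le_left _ _)⟩ ?_ ?_ h
        (htT.2 t ⟨htT.1.1, le_rfl⟩)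
      · rw [abs_le]; constructor <;> linarith
      · rw [abs_le]; constructor <;> linarith
  have hle := le_csSup hbdd hmem
  have hbm : min b (sSup T + δ) = b := by
    rcases min_choice b (sSup T + δ) with h | h
    · exact h
    · rw [h] at hle; linarith
  rw [hbm] at hmem
  exact hmem.2 t₁ ht₁

section Flow

variable {m : ℕ} [NeZero m] {M : Type*} [TopologicalSpace M]
  [ChartedSpace (EuclideanHalfSpace m) M] [IsManifold (𝓡∂ m) ∞ M] {n : ℕ}
  {g : SmoothMetric m M} {A : HermitianConnection m M n}
  {f : ℝ → TangentBundle (𝓡∂ m) M × EndC n}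

lemma extChartAt_mem_interior_target {p x : M} (hx : x ∈ (extChartAt (𝓡∂ m) p).source)
    (h : x ∈ (𝓡∂ m).interior M) :
    extChartAt (𝓡∂ m) p x ∈ interior (extChartAt (𝓡∂ m) p).target :=
  ((𝓡∂ m).isInteriorPoint_iff_of_mem_atlas (n := ∞) (by simp) (chart_mem_atlas _ p)
    (by rwa [← extChartAt_source (𝓡∂ m)])).1 h

lemma extChartAt_symm_mem_interior {p : M} {y : EucM m}
    (hy : y ∈ interior (extChartAt (𝓡∂ m) p).target) :
    (extChartAt (𝓡∂ m) p).symm y ∈ (𝓡∂ m).interior M := by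
  have hy' := interior_subset hy
  rw [mem_interior_iff_extChartAt ((extChartAt (𝓡∂ m) p).map_target hy'),
    (extChartAt (𝓡∂ m) p).right_inv hy']
  have h := interior_mono (extChartAt_target_subset_range p) hy
  rwa [interior_range_modelWithCornersEuclideanHalfSpace] at h

lemma IsTransportAt.glue {f' : ℝ → TangentBundle (𝓡∂ m) M × EndC n} {a b c : ℝ}
    (hf : ∀ t ∈ Set.Icc a b, IsTransportAt g A f (Set.Icc a b) t)
    (hf' : ∀ t ∈ Set.Icc b c, IsTransportAt g A f' (Set.Icc b c) t) (hab : a ≤ b) (hbc : b ≤ c)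
    (h : f b = f' b) :
    ∀ t ∈ Set.Icc a c,
      IsTransportAt g A (fun r => if r ≤ b then f r else f' r) (Set.Icc a c) t := by
  have h1 : ∀ t ∈ Set.Icc a b,
      IsTransportAt g A (fun r => if r ≤ b then f r else f' r) (Set.Icc a b) t := fun t ht =>
    (hf t ht).congr (fun r hr => if_pos hr.2) (if_pos ht.2)
  have heq : ∀ r ∈ Set.Icc b c, (if r ≤ b then f r else f' r) = f' r := by
    intro r hr
    split_ifs with hrb
    · rw [le_antisymm hrb hr.1, h]
    · rfl
  have h2 : ∀ t ∈ Set.Icc b c,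
      IsTransportAt g A (fun r => if r ≤ b then f r else f' r) (Set.Icc b c) t := fun t ht =>
    (hf' t ht).congr heq (heq t ht)
  intro t ht
  rcases lt_trichotomy t b with htb | rfl | htb
  · refine (h1 t ⟨ht.1, htb.le⟩).mono_of_mem_nhdsWithin ?_
    filter_upwards [self_mem_nhdsWithin, mem_nhdsWithin_of_mem_nhds (Iio_mem_nhds htb)]
      with r hr hrb
    exact ⟨hr.1, le_of_lt hrb⟩
  · have := (h1 t ⟨hab, le_rfl⟩).union (h2 t ⟨le_rfl, hbc⟩)
    rwa [Set.Icc_union_Icc_eq_Icc hab hbc] at this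
  · refine (h2 t ⟨htb.le, ht.2⟩).mono_of_mem_nhdsWithin ?_
    filter_upwards [self_mem_nhdsWithin, mem_nhdsWithin_of_mem_nhds (Ioi_mem_nhds htb)]
      with r hr hrb
    exact ⟨le_of_lt hrb, hr.2⟩

/-- The geodesics with parallel transport which start close to `f 0` stay in the interior up to
time `t`, and arrive close to `f t`. -/
def ReachesNear (g : SmoothMetric m M) (A : HermitianConnection m M n)
    (f : ℝ → TangentBundle (𝓡∂ m) M × EndC n) (t : ℝ) : Prop :=
  ∀ 𝒩 ∈ 𝓝 (f t), ∀ᶠ y in 𝓝 (f 0), ∃ f' : ℝ → TangentBundle (𝓡∂ m) M × EndC n, f' 0 = y ∧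
    (∀ r ∈ Set.Icc 0 t, IsTransportAt g A f' (Set.Icc 0 t) r ∧
      (f' r).1.proj ∈ (𝓡∂ m).interior M) ∧ f' t ∈ 𝒩

lemma ReachesNear.local {τ t₀ : ℝ}
    (hf : ∀ t ∈ Set.Icc 0 τ, IsTransportAt g A f (Set.Icc 0 τ) t) (ht₀ : t₀ ∈ Set.Icc 0 τ)
    (hint : (f t₀).1.proj ∈ (𝓡∂ m).interior M) :
    ∃ δ > 0, ∀ s ∈ Set.Icc 0 τ, ∀ t ∈ Set.Icc 0 τ, |s - t₀| ≤ δ → |t - t₀| ≤ δ → s ≤ t →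
      ReachesNear g A f s → ReachesNear g A f t := by
  set p := (f t₀).1.proj with hpdef
  have hp : (f t₀).1.proj ∈ (extChartAt (𝓡∂ m) p).source := mem_extChartAt_source _
  have hN : {x : (EucM m × EucM m) × EndC n | x.1.1 ∈ interior (extChartAt (𝓡∂ m) p).target} ∈
      𝓝 (stateChart p (f t₀)) := by
    refine (isOpen_interior.preimage (continuous_fst.comp continuous_fst)).mem_nhds ?_
    change (tangentChart p (f t₀).1).1 ∈ interior (extChartAt (𝓡∂ m) p).target
    rw [tangentChart_fst hp]
    exact extChartAt_mem_interior_target hp hint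
  obtain ⟨δ, hδ, C, hsrc, hflow⟩ := exists_coordinate_flow hf ht₀ hp hN
  refine ⟨δ, hδ, fun s hs t ht hsδ htδ hst hR 𝒩 h𝒩 => ?_⟩
  have hft := hsrc t ht htδ
  have hfs := hsrc s hs hsδ
  have hcs : ContinuousAt (stateChartSymm (n := n) p) (stateChart p (f t)) :=
    continuousAt_stateChartSymm (interior_subset hft.2)
  have h𝒩' : stateChartSymm (n := n) p ⁻¹' 𝒩 ∈ 𝓝 (stateChart p (f t)) :=
    hcs.preimage_mem_nhds (by rwa [stateChartSymm_stateChart hft.1])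
  obtain ⟨ρ, hρ, hball⟩ := Metric.mem_nhds_iff.1 h𝒩'
  have hclose : ∀ᶠ x in 𝓝 (stateChart p (f s)), dist x (stateChart p (f s)) * C < ρ := by
    have h1 : Filter.Tendsto (fun x => dist x (stateChart p (f s)) * C)
        (𝓝 (stateChart p (f s))) (𝓝 (dist (stateChart p (f s)) (stateChart p (f s)) * C)) :=
      ((continuous_id.dist continuous_const).mul continuous_const).tendsto _
    rw [dist_self, zero_mul] at h1
    exact h1.eventually (gt_mem_nhds hρ)
  have hst4 : s + 4 * δ ≥ t := by
    rw [abs_le] at hsδ htδ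
    linarith
  have hsub : Set.Icc s t ⊆ Set.Icc s (s + 4 * δ) := Set.Icc_subset_Icc le_rfl hst4
  have hev := (continuousAt_stateChart hfs.1).eventually (hclose.and (hflow s hs hsδ))
  have hsrc' : ∀ᶠ y : TangentBundle (𝓡∂ m) M × EndC n in 𝓝 (f s), y.1 ∈ (tangentChart p).source :=
    continuousAt_fst.preimage_mem_nhds ((isOpen_tangentChart_source p).mem_nhds
      (mem_tangentChart_source.2 hfs.1))
  filter_upwards [hR _ (hev.and hsrc')] with y hy
  obtain ⟨f', hf'0, hf', ⟨hf's, α, hαs, hα, hαd⟩, hf'src⟩ := hy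
  have hglue : f' s = stateChartSymm p (α s) := by
    rw [hαs, stateChartSymm_stateChart (mem_tangentChart_source.1 hf'src)]
  have htr := IsTransportAt.glue (g := g) (A := A) (fun r hr => (hf' r hr).1)
    (f' := fun r => stateChartSymm p (α r)) (c := t)
    (fun r hr => isTransportAt_of_coordinates hr ((hα r (hsub hr)).2.mono hsub)
      (fun u hu => interior_subset (hα u (hsub hu)).1)) hs.1 hst hglue
  refine ⟨_, ?_, fun r hr => ⟨htr r hr, ?_⟩, ?_⟩
  · simp only [if_pos hs.1]
    exact hf'0
  · split_ifs with hrs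
    · exact (hf' r ⟨hr.1, hrs⟩).2
    · exact extChartAt_symm_mem_interior (hα r (hsub ⟨(not_le.1 hrs).le, hr.2⟩)).1
  · have h1 : stateChartSymm p (α t) ∈ 𝒩 := by
      refine hball ?_
      rw [Metric.mem_ball]
      exact (hαd t (hsub ⟨hst, le_rfl⟩) ht htδ).trans_lt hf's
    split_ifs with hts
    · rw [le_antisymm hts hst, hglue, ← le_antisymm hts hst]
      exact h1
    · exact h1

lemma reachesNear_of_interior {τ : ℝ}
    (hf : ∀ t ∈ Set.Icc 0 τ, IsTransportAt g A f (Set.Icc 0 τ) t)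
    (hint : ∀ t ∈ Set.Icc 0 τ, (f t).1.proj ∈ (𝓡∂ m).interior M) {t : ℝ}
    (ht : t ∈ Set.Icc 0 τ) : ReachesNear g A f t := by
  refine Icc_induction_of_local (P := ReachesNear g A f) ?_
    (fun t₀ ht₀ => ReachesNear.local hf ht₀ (hint t₀ ht₀)) t ht
  intro 𝒩 h𝒩
  have h0 : (0 : ℝ) ∈ Set.Icc 0 τ := ⟨le_rfl, ht.1.trans ht.2⟩
  have hopen : ∀ᶠ y : TangentBundle (𝓡∂ m) M × EndC n in 𝓝 (f 0),
      y.1.proj ∈ (𝓡∂ m).interior M :=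
    (continuous_tangentBundle_proj.comp continuous_fst).continuousAt.preimage_mem_nhds
      (((𝓡∂ m).isOpen_interior (M := M) (n := ∞) (by simp)).mem_nhds (hint 0 h0))
  filter_upwards [h𝒩, hopen] with y hy hyi
  exact ⟨fun _ => y, rfl, fun r hr => ⟨IsTransportAt.of_subset_singleton _
    (by rw [Set.Icc_self]) hr, hyi⟩, hy⟩

/-- A geodesic with a solution of the parallel transport equation along it, which leaves the
manifold transversally at time `b`. -/
structure IsExitCurve (g : SmoothMetric m M) (A : HermitianConnection m M n)
    (f : ℝ → TangentBundle (𝓡∂ m) M × EndC n) (a b : ℝ) : Prop where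
  lt : a < b
  transport : ∀ t ∈ Set.Icc a b, IsTransportAt g A f (Set.Icc a b) t
  interior : ∀ t ∈ Set.Ico a b, (f t).1.proj ∈ (𝓡∂ m).interior M
  boundary : (f b).1.proj ∈ (𝓡∂ m).boundary M
  transversal : ¬ IsTangentToBoundary (f b).1.proj (f b).1.snd

lemma stateChart_velocity_neg {τ : ℝ} {p : M} (hf : IsExitCurve g A f 0 τ)
    (hp : (f τ).1.proj ∈ (extChartAt (𝓡∂ m) p).source) : (stateChart p (f τ)).1.2 0 < 0 := by
  have hτ : τ ∈ Set.Icc 0 τ := ⟨hf.lt.le, le_rfl⟩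
  refine lt_of_le_of_ne ?_ fun h => hf.transversal ((isTangentToBoundary_iff hp hf.boundary).2 h)
  have h1 : HasDerivWithinAt (fun r => (stateChart p (f r)).1.1) (stateChart p (f τ)).1.2
    (Set.Icc 0 τ) τ := ((hf.transport τ hτ).hasDerivWithinAt hp).fst.fst
  have h2 : HasDerivWithinAt (fun r => (stateChart p (f r)).1.1 0) ((stateChart p (f τ)).1.2 0)
    (Set.Icc 0 τ) τ := (EuclideanSpace.proj (𝕜 := ℝ) (0 : Fin m)).hasFDerivAt.comp_hasDerivWithinAt
      τ h1
  have h0 : (stateChart p (f τ)).1.1 0 = 0 := by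
    change (tangentChart p (f τ).1).1 0 = 0
    rw [tangentChart_fst hp]
    exact (mem_boundary_iff_extChartAt hp).1 hf.boundary
  have hsrc : ∀ᶠ r in 𝓝[Set.Icc 0 τ] τ, (f r).1 ∈ (tangentChart p).source :=
    (hf.transport τ hτ).continuousWithinAt.fst.preimage_mem_nhdsWithin
      ((isOpen_tangentChart_source p).mem_nhds (mem_tangentChart_source.2 hp))
  have hne : (𝓝[Set.Ico 0 τ] τ).NeBot := by
    rw [← mem_closure_iff_nhdsWithin_neBot, closure_Ico hf.lt.ne]
    exact hτ
  have h3 := (hasDerivWithinAt_iff_tendsto_slope' (by simp)).1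
    (h2.mono (Set.Ico_subset_Icc_self))
  refine le_of_tendsto h3 ?_
  filter_upwards [self_mem_nhdsWithin, hsrc.filter_mono (nhdsWithin_mono _ Set.Ico_subset_Icc_self)]
    with r hr hrs
  rw [slope_def_field, h0, sub_zero]
  refine div_nonpos_of_nonneg_of_nonpos ?_ (by linarith [hr.2])
  change 0 ≤ (tangentChart p (f r).1).1 0
  rw [tangentChart_fst (mem_tangentChart_source.1 hrs)]
  exact extChartAt_zero_nonneg _ _

lemma exists_first_zero {h h' : ℝ → ℝ} {s e κ : ℝ}
    (hd : ∀ r ∈ Set.Icc s e, HasDerivWithinAt h (h' r) (Set.Icc s e) r)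
    (hκ : ∀ r ∈ Set.Icc s e, h' r ≤ -κ) (hκ0 : 0 < κ) {t : ℝ} (ht : t ∈ Set.Icc s e)
    (hs : 0 < h s) (hlt : h t < κ * (e - t)) :
    ∃ t' ∈ Set.Ioc s e, h t' = 0 ∧ ∀ r ∈ Set.Ico s t', 0 < h r := by
  have hc : ContinuousOn h (Set.Icc s e) := fun r hr => (hd r hr).continuousWithinAt
  have hanti : AntitoneOn (fun r => h r + κ * r) (Set.Icc s e) := by
    refine antitoneOn_of_hasDerivWithinAt_nonpos (convex_Icc s e)
      (hc.add (continuousOn_const.mul continuousOn_id)) (f' := fun r => h' r + κ) ?_ ?_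
    · intro r hr
      have hr' := interior_subset hr
      exact (((hd r hr').add (((hasDerivAt_id r).const_mul κ).hasDerivWithinAt)).mono
        interior_subset).congr_deriv (by simp)
    · intro r hr
      linarith [hκ r (interior_subset hr)]
  have he : e ∈ Set.Icc s e := ⟨ht.1.trans ht.2, le_rfl⟩
  have hs' : s ∈ Set.Icc s e := ⟨le_rfl, ht.1.trans ht.2⟩
  have h1 : h e < 0 := by
    have := hanti ht he ht.2
    simp only at this
    linarith
  obtain ⟨t', ht', h0⟩ := intermediate_value_Icc' (ht.1.trans ht.2) hc
    (show (0 : ℝ) ∈ Set.Icc (h e) (h s) from ⟨h1.le, hs.le⟩)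
  have hst' : s < t' := lt_of_le_of_ne ht'.1 fun hc => by rw [hc, h0] at hs; exact lt_irrefl _ hs
  refine ⟨t', ⟨hst', ht'.2⟩, h0, fun r hr => ?_⟩
  have := hanti ⟨hr.1, hr.2.le.trans ht'.2⟩ ht' hr.2.le
  simp only [h0] at this
  nlinarith [hr.2]

set_option maxHeartbeats 800000 in
/-- Continuous dependence on the initial data for exit curves: curves starting close to an exit
curve are exit curves, and end close to its end. -/
theorem IsExitCurve.eventually {τ : ℝ} (hf : IsExitCurve g A f 0 τ)
    {𝒩 : Set (TangentBundle (𝓡∂ m) M × EndC n)} (h𝒩 : 𝒩 ∈ 𝓝 (f τ)) :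
    ∀ᶠ y in 𝓝 (f 0), ∃ (τ' : ℝ) (f' : ℝ → TangentBundle (𝓡∂ m) M × EndC n), f' 0 = y ∧
      IsExitCurve g A f' 0 τ' ∧ f' τ' ∈ 𝒩 := by
  set p := (f τ).1.proj with hpdef
  have hp : (f τ).1.proj ∈ (extChartAt (𝓡∂ m) p).source := mem_extChartAt_source _
  have hτ : τ ∈ Set.Icc 0 τ := ⟨hf.lt.le, le_rfl⟩
  obtain ⟨κ, hκ, hκw⟩ : ∃ κ > 0, (stateChart p (f τ)).1.2 0 < -κ := by
    have := stateChart_velocity_neg hf hp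
    exact ⟨-(stateChart p (f τ)).1.2 0 / 2, by linarith, by linarith⟩
  have htar : (stateChart p (f τ)).1.1 ∈ (extChartAt (𝓡∂ m) p).target := by
    change (tangentChart p (f τ).1).1 ∈ _
    rw [tangentChart_fst hp]
    exact (extChartAt (𝓡∂ m) p).map_source hp
  have hN1 : ∀ᶠ x in 𝓝 (stateChart p (f τ)), x.1.2 0 < -κ := by
    have hc : Continuous fun x : (EucM m × EucM m) × EndC n => x.1.2 0 :=
      (EuclideanSpace.proj (𝕜 := ℝ) (0 : Fin m)).continuous.comp
        (continuous_snd.comp continuous_fst)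
    exact hc.continuousAt.eventually (gt_mem_nhds hκw)
  have hN2 : ∀ᶠ x in 𝓝 (stateChart p (f τ)),
      x.1.1 ∈ Set.range (𝓡∂ m) → x.1.1 ∈ (extChartAt (𝓡∂ m) p).target := by
    have h1 := mem_nhdsWithin_iff_eventually.1 (extChartAt_target_mem_nhdsWithin_of_mem htar)
    exact (continuous_fst.comp continuous_fst).continuousAt.eventually h1
  have hN3 : ∀ᶠ x in 𝓝 (stateChart p (f τ)), stateChartSymm p x ∈ 𝒩 :=
    (continuousAt_stateChartSymm htar).preimage_mem_nhds (by rwa [stateChartSymm_stateChart hp])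
  obtain ⟨δ, hδ, C, hsrc, hflow⟩ := exists_coordinate_flow hf.transport hτ hp
    (hN1.and (hN2.and hN3))
  obtain ⟨δ₁, hδ₁, hδδ, hδτ⟩ : ∃ δ₁ > 0, δ₁ ≤ δ ∧ δ₁ < τ :=
    ⟨min δ (τ / 2), lt_min hδ (by linarith [hf.lt]), min_le_left _ _,
      (min_le_right _ _).trans_lt (by linarith [hf.lt])⟩
  set s := τ - δ₁ with hs
  have hsI : s ∈ Set.Icc 0 τ := ⟨by linarith, by linarith⟩
  have hsδ : |s - τ| ≤ δ := by rw [hs, abs_le]; constructor <;> linarith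
  have hint : ∀ r ∈ Set.Icc 0 s, (f r).1.proj ∈ (𝓡∂ m).interior M := fun r hr =>
    hf.interior r ⟨hr.1, by linarith [hr.2]⟩
  have hfs := (hsrc s hsI hsδ).1
  have hclose : ∀ᶠ x in 𝓝 (stateChart p (f s)), dist x (stateChart p (f s)) * C < κ * δ₁ := by
    have h1 : Filter.Tendsto (fun x => dist x (stateChart p (f s)) * C)
        (𝓝 (stateChart p (f s))) (𝓝 (dist (stateChart p (f s)) (stateChart p (f s)) * C)) :=
      ((continuous_id.dist continuous_const).mul continuous_const).tendsto _
    rw [dist_self, zero_mul] at h1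
    exact h1.eventually (gt_mem_nhds (by positivity))
  have hcoord : Continuous fun x : (EucM m × EucM m) × EndC n => x.1.1 0 :=
    (EuclideanSpace.proj (𝕜 := ℝ) (0 : Fin m)).continuous.comp
      (continuous_fst.comp continuous_fst)
  have hpos : ∀ᶠ x in 𝓝 (stateChart p (f s)), 0 < x.1.1 0 := by
    refine hcoord.continuousAt.eventually (lt_mem_nhds ?_)
    change 0 < (tangentChart p (f s).1).1 0
    rw [tangentChart_fst hfs]
    exact (mem_interior_iff_extChartAt hfs).1 (hint s ⟨hsI.1, le_rfl⟩)
  have hev := (continuousAt_stateChart hfs).eventually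
    (hclose.and (hpos.and (hflow s hsI hsδ)))
  have hsrc' : ∀ᶠ y : TangentBundle (𝓡∂ m) M × EndC n in 𝓝 (f s), y.1 ∈ (tangentChart p).source :=
    continuousAt_fst.preimage_mem_nhds ((isOpen_tangentChart_source p).mem_nhds
      (mem_tangentChart_source.2 hfs))
  have hR := reachesNear_of_interior (τ := s)
    (fun t ht => (hf.transport t ⟨ht.1, ht.2.trans hsI.2⟩).mono (Set.Icc_subset_Icc le_rfl hsI.2))
    hint ⟨hsI.1, le_rfl⟩
  filter_upwards [hR _ (hev.and hsrc')] with y hy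
  obtain ⟨f', hf'0, hf', ⟨hf's, hf'pos, α, hαs, hα, hαd⟩, hf'src⟩ := hy
  have hτmem : τ ∈ Set.Icc s (s + 4 * δ) := ⟨hsI.2, by linarith⟩
  have hsub2 : Set.Icc s (τ + δ₁) ⊆ Set.Icc s (s + 4 * δ) :=
    Set.Icc_subset_Icc le_rfl (by linarith)
  have hhd : ∀ r ∈ Set.Icc s (τ + δ₁), HasDerivWithinAt (fun r => (α r).1.1 0) ((α r).1.2 0)
      (Set.Icc s (τ + δ₁)) r := by
    intro r hr
    have h1 : HasDerivWithinAt (fun r => (α r).1.1) (α r).1.2 (Set.Icc s (τ + δ₁)) r :=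
      ((hα r (hsub2 hr)).2.mono hsub2).fst.fst
    exact (EuclideanSpace.proj (𝕜 := ℝ) (0 : Fin m)).hasFDerivAt.comp_hasDerivWithinAt r h1
  have hτlt : (α τ).1.1 0 < κ * (τ + δ₁ - τ) := by
    have h1 := hαd τ hτmem hτ (by simpa using hδ.le)
    have h2 : (stateChart p (f τ)).1.1 0 = 0 := by
      change (tangentChart p (f τ).1).1 0 = 0
      rw [tangentChart_fst hp]
      exact (mem_boundary_iff_extChartAt hp).1 hf.boundary
    have h3 : |(α τ).1.1 0 - (stateChart p (f τ)).1.1 0| ≤ dist (α τ) (stateChart p (f τ)) := by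
      have h4 : dist (α τ).1.1 (stateChart p (f τ)).1.1 ≤ dist (α τ) (stateChart p (f τ)) :=
        (le_max_left _ _).trans (le_max_left _ _)
      refine le_trans ?_ h4
      rw [dist_eq_norm]
      exact PiLp.norm_apply_le ((α τ).1.1 - (stateChart p (f τ)).1.1) 0
    rw [h2, sub_zero] at h3
    have h5 := (le_abs_self _).trans (h3.trans h1)
    rw [add_sub_cancel_left]
    exact h5.trans_lt hf's
  obtain ⟨t', ht', h0, hpos'⟩ := exists_first_zero hhd
    (fun r hr => (hα r (hsub2 hr)).1.1.le) hκ (t := τ) ⟨hsI.2, by linarith⟩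
    (by rw [hαs]; exact hf'pos) hτlt
  have hsub : Set.Icc s t' ⊆ Set.Icc s (s + 4 * δ) :=
    (Set.Icc_subset_Icc le_rfl ht'.2).trans hsub2
  have hnonneg : ∀ r ∈ Set.Icc s t', 0 ≤ (α r).1.1 0 := by
    intro r hr
    rcases eq_or_lt_of_le hr.2 with rfl | h
    · exact h0.ge
    · exact (hpos' r ⟨hr.1, h⟩).le
  have htarget : ∀ r ∈ Set.Icc s t', (α r).1.1 ∈ (extChartAt (𝓡∂ m) p).target := fun r hr =>
    (hα r (hsub hr)).1.2.1 (mem_range_halfSpace.2 (hnonneg r hr))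
  have hglue : f' s = stateChartSymm p (α s) := by
    rw [hαs, stateChartSymm_stateChart (mem_tangentChart_source.1 hf'src)]
  have htr := IsTransportAt.glue (g := g) (A := A) (fun r hr => (hf' r hr).1)
    (f' := fun r => stateChartSymm p (α r)) (c := t')
    (fun r hr => isTransportAt_of_coordinates hr ((hα r (hsub hr)).2.mono hsub)
      htarget) hsI.1 ht'.1.le hglue
  have hend : t' ∈ Set.Icc s t' := ⟨ht'.1.le, le_rfl⟩
  have hsrcend : (stateChartSymm p (α t')).1.proj ∈ (extChartAt (𝓡∂ m) p).source :=
    (extChartAt (𝓡∂ m) p).map_target (htarget t' hend)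
  have hbd : (stateChartSymm p (α t')).1.proj ∈ (𝓡∂ m).boundary M := by
    rw [mem_boundary_iff_extChartAt hsrcend]
    change extChartAt (𝓡∂ m) p ((extChartAt (𝓡∂ m) p).symm (α t').1.1) 0 = 0
    rw [(extChartAt (𝓡∂ m) p).right_inv (htarget t' hend)]
    exact h0
  refine ⟨t', _, ?_, ⟨hsI.1.trans_lt ht'.1, htr, fun r hr => ?_, ?_, ?_⟩, ?_⟩
  · simp only [if_pos hsI.1]
    exact hf'0
  · split_ifs with hrs
    · exact (hf' r ⟨hr.1, hrs⟩).2
    · have hrI : r ∈ Set.Icc s t' := ⟨(not_le.1 hrs).le, hr.2.le⟩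
      have hsrcr : (stateChartSymm p (α r)).1.proj ∈ (extChartAt (𝓡∂ m) p).source :=
        (extChartAt (𝓡∂ m) p).map_target (htarget r hrI)
      rw [mem_interior_iff_extChartAt hsrcr]
      change 0 < extChartAt (𝓡∂ m) p ((extChartAt (𝓡∂ m) p).symm (α r).1.1) 0
      rw [(extChartAt (𝓡∂ m) p).right_inv (htarget r hrI)]
      exact hpos' r ⟨hrI.1, hr.2⟩
  · simp only [if_neg (not_le.2 ht'.1)]
    exact hbd
  · refine mt (isTangentToBoundary_iff (p := p) ?_ ?_).1 ?_
    · simp only [if_neg (not_le.2 ht'.1)]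
      exact hsrcend
    · simp only [if_neg (not_le.2 ht'.1)]
      exact hbd
    simp only [if_neg (not_le.2 ht'.1)]
    have h1 := congrArg Prod.fst (stateChart_stateChartSymm (n := n) (htarget t' hend))
    have h2 : tangentChart p (stateChartSymm p (α t')).1 = (α t').1 := h1
    rw [h2]
    have h3 := (hα t' (hsub hend)).1.1
    exact ne_of_lt (h3.trans (by linarith))
  · simp only [if_neg (not_le.2 ht'.1)]
    exact (hα t' (hsub hend)).1.2.2

end Flow

/-! ### Nontangential geodesics and their parallel transport -/

lemma neg_mul_mul_assoc {R : Type*} [Ring R] (a x w : R) :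
    -(a * x) * w = -(a * (x * w)) := by
  noncomm_ring

section Nontangential

variable {m : ℕ} [NeZero m] {M : Type*} [TopologicalSpace M]
  [ChartedSpace (EuclideanHalfSpace m) M] [IsManifold (𝓡∂ m) ∞ M] {n : ℕ}
  {g : SmoothMetric m M}

lemma IsSprayAt.comp_const_add {Q : ℝ → TangentBundle (𝓡∂ m) M} {s s' : Set ℝ} {b t : ℝ}
    (hQ : IsSprayAt g Q s (b + t)) (hs : Set.MapsTo (fun r => b + r) s' s) :
    IsSprayAt g (fun r => Q (b + r)) s' t := by
  have h1 : HasDerivWithinAt (fun r => b + r) 1 s' t :=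
    ((hasDerivAt_id t).const_add b).hasDerivWithinAt
  refine ⟨ContinuousWithinAt.comp (f := fun r => b + r) hQ.1 h1.continuousWithinAt hs, ?_⟩
  have h2 := hQ.2.scomp t h1 hs
  rwa [one_smul] at h2

lemma IsTransportAt.comp_const_add {A : HermitianConnection m M n}
    {f : ℝ → TangentBundle (𝓡∂ m) M × EndC n} {s s' : Set ℝ} {b t : ℝ}
    (hf : IsTransportAt g A f s (b + t)) (hs : Set.MapsTo (fun r => b + r) s' s) :
    IsTransportAt g A (fun r => f (b + r)) s' t := by
  have h1 : HasDerivWithinAt (fun r => b + r) 1 s' t :=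
    ((hasDerivAt_id t).const_add b).hasDerivWithinAt
  refine ⟨hf.1.comp_const_add hs, ?_⟩
  have h2 := hf.2.scomp t h1 hs
  rwa [one_smul] at h2

lemma IsTransportAt.mul_const {A : HermitianConnection m M n}
    {f : ℝ → TangentBundle (𝓡∂ m) M × EndC n} {s : Set ℝ} {t : ℝ}
    (hf : IsTransportAt g A f s t) (W : EndC n) :
    IsTransportAt g A (fun r => ((f r).1, (f r).2 * W)) s t := by
  refine ⟨hf.1, (hf.2.mul_const W).congr_deriv ?_⟩
  exact neg_mul_mul_assoc _ _ _

lemma IsExitCurve.isLinearSolution {A : HermitianConnection m M n}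
    {f : ℝ → TangentBundle (𝓡∂ m) M × EndC n} {a b : ℝ} (hf : IsExitCurve g A f a b) :
    IsLinearSolution (fun r => A.eval (f r).1) a b (fun r => (f r).2) :=
  fun r hr => (hf.transport r hr).2

lemma IsSprayAt.exists_isExitCurve (A : HermitianConnection m M n)
    {Q : ℝ → TangentBundle (𝓡∂ m) M} {τ : ℝ} (hτ : 0 ≤ τ)
    (hQ : ∀ t ∈ Set.Icc 0 τ, IsSprayAt g Q (Set.Icc 0 τ) t) :
    ∃ U : ℝ → EndC n, U 0 = 1 ∧
      ∀ t ∈ Set.Icc 0 τ, IsTransportAt g A (fun r => (Q r, U r)) (Set.Icc 0 τ) t := by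
  obtain ⟨U, hU0, hU⟩ := exists_isLinearSolution (a := fun r => A.eval (Q r)) hτ
    (fun t ht => A.continuous_eval.continuousAt.comp_continuousWithinAt (hQ t ht).1)
    (fun t _ => A.star_eval _)
  exact ⟨U, hU0, fun t ht => ⟨hQ t ht, hU t ht⟩⟩

/-- A nontangential geodesic, with the solution of the transport equation, is an exit curve. -/
lemma IsNontangentialGeodesic.exists_isExitCurve (A : HermitianConnection m M n) {x : M}
    {v : TangentSpace (𝓡∂ m) x} {τ : ℝ} {γ : ℝ → M} (h : IsNontangentialGeodesic g x v τ γ) :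
    ∃ U : ℝ → EndC n, U 0 = 1 ∧
      IsExitCurve g A (fun r => (tangentLift γ (Set.Icc 0 τ) r, U r)) 0 τ := by
  obtain ⟨U, hU0, hU⟩ := IsSprayAt.exists_isExitCurve A h.pos.le
    (fun t ht => h.geodesic.isSprayAt (uniqueDiffOn_Icc h.pos) ht)
  exact ⟨U, hU0, h.pos, hU, h.interior, h.boundary, h.transversal⟩

/-- Conversely, exit curves of unit speed are nontangential geodesics. -/
lemma IsExitCurve.isNontangentialGeodesic {A : HermitianConnection m M n}
    {f : ℝ → TangentBundle (𝓡∂ m) M × EndC n} {τ : ℝ} (hf : IsExitCurve g A f 0 τ)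
    {q : TangentBundle (𝓡∂ m) M} (h0 : (f 0).1 = q) (h : q ∈ unitSphereBundle g) :
    IsNontangentialGeodesic g q.proj q.snd τ (fun t => (f t).1.proj) := by
  subst h0
  obtain ⟨h1, h2⟩ := isGeodesicOn_of_isSprayAt hf.lt fun t ht => (hf.transport t ht).1
  refine ⟨h, hf.lt, h1, h2 0 ⟨le_rfl, hf.lt.le⟩, hf.interior, hf.boundary, ?_⟩
  have h3 := h2 τ ⟨hf.lt.le, le_rfl⟩
  have h4 := hf.transversal
  rw [← h3] at h4
  exact h4

lemma IsExitCurve.fst_eq [T2Space M] {A A' : HermitianConnection m M n}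
    {f f' : ℝ → TangentBundle (𝓡∂ m) M × EndC n} {τ τ' : ℝ} (hf : IsExitCurve g A f 0 τ)
    (hf' : IsExitCurve g A' f' 0 τ') (h0 : (f 0).1 = (f' 0).1) :
    τ = τ' ∧ ∀ t ∈ Set.Icc 0 τ, (f t).1 = (f' t).1 := by
  -- two exit curves agree as long as both are defined
  have key : ∀ s, s ≤ τ → s ≤ τ' → ∀ t ∈ Set.Icc 0 s, (f t).1 = (f' t).1 := by
    intro s hs hs'
    refine eqOn_of_isSprayAt (g := g) (Q := fun t => (f t).1) (Q' := fun t => (f' t).1)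
      (fun t ht => ?_) (fun t ht => ?_) h0
    · exact (hf.transport t ⟨ht.1, ht.2.trans hs⟩).1.mono (Set.Icc_subset_Icc le_rfl hs)
    · exact (hf'.transport t ⟨ht.1, ht.2.trans hs'⟩).1.mono (Set.Icc_subset_Icc le_rfl hs')
  have hdisj : ∀ x : M, x ∈ (𝓡∂ m).interior M → x ∈ (𝓡∂ m).boundary M → False := by
    intro x hx hx'
    rw [← (𝓡∂ m).compl_interior] at hx'
    exact hx' hx
  have hτ : τ = τ' := by
    rcases lt_trichotomy τ τ' with h | h | h
    · refine (hdisj _ (hf'.interior τ ⟨hf.lt.le, h⟩) ?_).elim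
      rw [← key τ le_rfl h.le τ ⟨hf.lt.le, le_rfl⟩]
      exact hf.boundary
    · exact h
    · refine (hdisj _ (hf.interior τ' ⟨hf'.lt.le, h⟩) ?_).elim
      rw [key τ' h.le le_rfl τ' ⟨hf'.lt.le, le_rfl⟩]
      exact hf'.boundary
  exact ⟨hτ, key τ le_rfl hτ.le⟩

lemma exitGeodesic_spec {x : M} {v : TangentSpace (𝓡∂ m) x} (h : IsNontangential g x v) :
    IsNontangentialGeodesic g x v (exitGeodesic g x v).1 (exitGeodesic g x v).2 := by
  rw [exitGeodesic, dif_pos h]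
  exact h.choose_spec

lemma parallelTransport_eq {A : HermitianConnection m M n} {γ : ℝ → M} {τ : ℝ} (hτ : 0 ≤ τ)
    {U : ℝ → EndC n} (hU : IsTransportSolution A γ τ U) : parallelTransport A γ τ = U τ := by
  have h : ∃ U, IsTransportSolution A γ τ U := ⟨U, hU⟩
  rw [parallelTransport, dif_pos h]
  have hc := h.choose_spec
  have h1 : IsLinearSolution (fun t => A.form (γ t) (velocity γ (Set.Icc 0 τ) t)) 0 τ h.choose :=
    hc.2
  have h2 := h1.eq hU.2 (fun t _ => A.skewHermitian _ _) (by rw [hc.1]; exact one_mem _)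
    ⟨hτ, le_rfl⟩
  rw [h2, hc.1, hU.1, star_one, one_mul, mul_one]

/-- Transport, exit point and exit time are those of any exit curve with the given start. -/
lemma IsExitCurve.geodesicTransport_eq [T2Space M] {A : HermitianConnection m M n}
    {f : ℝ → TangentBundle (𝓡∂ m) M × EndC n} {τ : ℝ} (hf : IsExitCurve g A f 0 τ)
    {q : TangentBundle (𝓡∂ m) M} (hq : (f 0).1 = q) (h : q ∈ unitSphereBundle g)
    (h1 : (f 0).2 = 1) :
    geodesicTransport g A q.proj q.snd = (f τ).2 ∧
      scatteringMap g q.proj q.snd = (f τ).1.proj := by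
  subst hq
  have hn : IsNontangential g (f 0).1.proj (f 0).1.snd :=
    ⟨(τ, _), hf.isNontangentialGeodesic rfl h⟩
  have he := exitGeodesic_spec hn
  obtain ⟨U, hU0, hU⟩ := he.exists_isExitCurve A
  have h0 : tangentLift (exitGeodesic g (f 0).1.proj (f 0).1.snd).2
      (Set.Icc 0 (exitGeodesic g (f 0).1.proj (f 0).1.snd).1) 0 = (f 0).1 := he.initial
  obtain ⟨hτ, heq⟩ := hU.fst_eq hf h0
  have hend := heq _ ⟨hU.lt.le, le_rfl⟩
  refine ⟨?_, ?_⟩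
  · have hsol : IsTransportSolution A (exitGeodesic g (f 0).1.proj (f 0).1.snd).2
      (exitGeodesic g (f 0).1.proj (f 0).1.snd).1 U := ⟨hU0, hU.isLinearSolution⟩
    rw [geodesicTransport, parallelTransport_eq he.pos.le hsol]
    have h2 : IsLinearSolution (fun r => A.eval (f r).1) 0
        (exitGeodesic g (f 0).1.proj (f 0).1.snd).1 U := by
      intro r hr
      dsimp only
      rw [← heq r hr]
      exact hU.isLinearSolution r hr
    rw [hτ] at h2 ⊢
    have h3 := h2.eq hf.isLinearSolution (fun r _ => A.star_eval _)
      (by rw [hU0]; exact one_mem _) ⟨hf.lt.le, le_rfl⟩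
    rw [h3, hU0, h1, star_one, one_mul, mul_one]
  · have h2 : scatteringMap g (f 0).1.proj (f 0).1.snd = _ := congrArg (fun q => q.proj) hend
    rw [h2, hτ]

lemma IsNontangential.mem_unitSphereBundle {q : TangentBundle (𝓡∂ m) M}
    (h : IsNontangential g q.proj q.snd) : q ∈ unitSphereBundle g := h.choose_spec.unit_speed

lemma IsNontangential.exists_isExitCurve [T2Space M] {q : TangentBundle (𝓡∂ m) M}
    (h : IsNontangential g q.proj q.snd) (A : HermitianConnection m M n) :
    ∃ τ f, IsExitCurve g A f 0 τ ∧ f 0 = (q, 1) ∧ (f τ).2 = geodesicTransport g A q.proj q.snd ∧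
      (f τ).1.proj = scatteringMap g q.proj q.snd := by
  obtain ⟨⟨τ, γ⟩, hγ⟩ := h
  obtain ⟨U, hU0, hU⟩ := hγ.exists_isExitCurve A
  have h0 : (tangentLift γ (Set.Icc 0 τ) 0, U 0) = (q, (1 : EndC n)) := Prod.ext hγ.initial hU0
  have h1 := hU.geodesicTransport_eq hγ.initial hγ.unit_speed hU0
  exact ⟨τ, _, hU, h0, h1.1.symm, h1.2.symm⟩

lemma IsNontangential.mem_interior {q : TangentBundle (𝓡∂ m) M}
    (h : IsNontangential g q.proj q.snd) : q.proj ∈ (𝓡∂ m).interior M := by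
  obtain ⟨⟨τ, γ⟩, hγ⟩ := h
  have h1 := hγ.interior 0 ⟨le_rfl, hγ.pos⟩
  have h2 : γ 0 = q.proj := congrArg (fun q => q.proj) hγ.initial
  rw [← h2]
  exact h1

lemma geodesicTransport_mem_unitary [T2Space M] {q : TangentBundle (𝓡∂ m) M}
    (h : IsNontangential g q.proj q.snd) (A : HermitianConnection m M n) :
    geodesicTransport g A q.proj q.snd ∈ unitary (EndC n) := by
  obtain ⟨τ, f, hf, hf0, hfτ, -⟩ := h.exists_isExitCurve A
  rw [← hfτ]
  exact hf.isLinearSolution.mem_unitary (fun r _ => A.star_eval _)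
    (by rw [hf0]; exact one_mem _) ⟨hf.lt.le, le_rfl⟩

/-- The nontangential directions form an open subset of the unit sphere bundle, on which parallel
transport depends continuously on the direction. -/
theorem IsNontangential.eventually [T2Space M] {q : TangentBundle (𝓡∂ m) M}
    (h : IsNontangential g q.proj q.snd) (A : HermitianConnection m M n) {𝒩 : Set (EndC n)}
    (h𝒩 : 𝒩 ∈ 𝓝 (geodesicTransport g A q.proj q.snd)) :
    ∀ᶠ q' in 𝓝[unitSphereBundle g] q, IsNontangential g q'.proj q'.snd ∧
      geodesicTransport g A q'.proj q'.snd ∈ 𝒩 := by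
  obtain ⟨τ, f, hf, hf0, hfτ, -⟩ := h.exists_isExitCurve A
  rw [← hfτ] at h𝒩
  have h1 := hf.eventually (continuousAt_snd.preimage_mem_nhds h𝒩)
  rw [hf0] at h1
  have h2 : Filter.Tendsto (fun q' : TangentBundle (𝓡∂ m) M => (q', (1 : EndC n)))
      (𝓝[unitSphereBundle g] q) (𝓝 (q, 1)) :=
    (continuousAt_id.prodMk continuousAt_const).continuousWithinAt
  filter_upwards [h2.eventually h1, self_mem_nhdsWithin] with q' hq' hq'S
  obtain ⟨τ', f', hf'0, hf', hf'τ⟩ := hq'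
  have h0 : (f' 0).1 = q' := by rw [hf'0]
  have h3 := hf'.isNontangentialGeodesic h0 hq'S
  have h4 := (hf'.geodesicTransport_eq h0 hq'S (by rw [hf'0])).1
  exact ⟨⟨(τ', _), h3⟩, by rw [h4]; exact hf'τ⟩

lemma continuousOn_geodesicTransport [T2Space M] (A : HermitianConnection m M n) :
    ContinuousOn (fun q : TangentBundle (𝓡∂ m) M => geodesicTransport g A q.proj q.snd)
      {q | IsNontangential g q.proj q.snd} := by
  intro q hq 𝒩 h𝒩
  have h1 := (IsNontangential.eventually (q := q) hq A h𝒩).filter_mono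
    (nhdsWithin_mono q fun q' hq' => IsNontangential.mem_unitSphereBundle (q := q') hq')
  exact h1.mono fun q' hq' => hq'.2

lemma IsExitCurve.shift {A : HermitianConnection m M n}
    {f : ℝ → TangentBundle (𝓡∂ m) M × EndC n} {τ s : ℝ} (hf : IsExitCurve g A f 0 τ)
    (hs : s ∈ Set.Ico 0 τ) (W : EndC n) :
    IsExitCurve g A (fun r => ((f (s + r)).1, (f (s + r)).2 * W)) 0 (τ - s) := by
  have hm : Set.MapsTo (fun r => s + r) (Set.Icc 0 (τ - s)) (Set.Icc 0 τ) := fun r hr =>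
    ⟨add_nonneg hs.1 hr.1, by linarith [hr.2]⟩
  refine ⟨by linarith [hs.2], fun t ht => ?_, fun t ht => ?_, ?_, ?_⟩
  · exact ((hf.transport (s + t) (hm ht)).comp_const_add hm).mul_const W
  · exact hf.interior _ ⟨add_nonneg hs.1 ht.1, by linarith [ht.2]⟩
  · simp only [add_sub_cancel]
    exact hf.boundary
  · change ¬ IsTangentToBoundary (f (s + (τ - s))).1.proj (f (s + (τ - s))).1.snd
    rw [add_sub_cancel]
    exact hf.transversal

/-- Transport from an intermediate point of a nontangential geodesic. -/
lemma IsExitCurve.geodesicTransport_shift [T2Space M] {A : HermitianConnection m M n}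
    {f : ℝ → TangentBundle (𝓡∂ m) M × EndC n} {τ s : ℝ} (hf : IsExitCurve g A f 0 τ)
    (hs : s ∈ Set.Ico 0 τ) (h1 : (f 0).2 ∈ unitary (EndC n))
    (hS : (f s).1 ∈ unitSphereBundle g) :
    geodesicTransport g A (f s).1.proj (f s).1.snd = (f τ).2 * star (f s).2 := by
  have h := (hf.shift hs (star (f s).2)).geodesicTransport_eq (q := (f s).1) (by simp) hS (by
    simp only [add_zero]
    exact Unitary.mul_star_self_of_mem
      (hf.isLinearSolution.mem_unitary (fun r _ => A.star_eval _) h1 ⟨hs.1, hs.2.le⟩))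
  simpa only [add_sub_cancel] using h.1

/-- Along a geodesic all of whose velocities are nontangential, the transports to the boundary
are related by the transport equation. -/
theorem exists_geodesicTransport_eq [T2Space M] {Q : ℝ → TangentBundle (𝓡∂ m) M} {ε : ℝ}
    (hε : 0 < ε) (hQ : ∀ t ∈ Set.Ioo (-ε) ε, IsSprayAt g Q (Set.Ioo (-ε) ε) t)
    (hn : ∀ t ∈ Set.Ioo (-ε) ε, IsNontangential g (Q t).proj (Q t).snd)
    (A : HermitianConnection m M n) :
    ∃ (W : EndC n) (U : ℝ → EndC n), ∀ t ∈ Set.Ioo (-(ε / 2)) (ε / 2),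
      HasDerivAt U (-(A.eval (Q t) * U t)) t ∧
      geodesicTransport g A (Q t).proj (Q t).snd = W * star (U t) := by
  have hb : -(ε / 2) ∈ Set.Ioo (-ε) ε := ⟨by linarith, by linarith⟩
  obtain ⟨τ, f, hf, hf0, -, -⟩ := (hn _ hb).exists_isExitCurve A
  have hm : ∀ s, s ≤ ε → Set.MapsTo (fun r => -(ε / 2) + r) (Set.Icc 0 s) (Set.Ioo (-ε) ε) :=
    fun s hs r hr => ⟨by linarith [hr.1], by linarith [hr.2]⟩
  have key : ∀ s, s ≤ τ → s ≤ ε → ∀ r ∈ Set.Icc 0 s, (f r).1 = Q (-(ε / 2) + r) := by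
    intro s hsτ hsε
    refine eqOn_of_isSprayAt (g := g) (Q := fun r => (f r).1) (Q' := fun r => Q (-(ε / 2) + r))
      (fun r hr => ?_) (fun r hr => ?_) ?_
    · exact (hf.transport r ⟨hr.1, hr.2.trans hsτ⟩).1.mono (Set.Icc_subset_Icc le_rfl hsτ)
    · exact (hQ _ (hm s hsε hr)).comp_const_add (hm s hsε)
    · rw [hf0, add_zero]
  have hετ : ε ≤ τ := by
    by_contra hlt
    rw [not_le] at hlt
    have h1 := key τ le_rfl hlt.le τ ⟨hf.lt.le, le_rfl⟩
    have h2 := hf.boundary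
    rw [h1, ← (𝓡∂ m).compl_interior] at h2
    exact h2 (hn _ (hm τ hlt.le ⟨hf.lt.le, le_rfl⟩)).mem_interior
  refine ⟨(f τ).2, fun t => (f (ε / 2 + t)).2, fun t ht => ?_⟩
  have hs : ε / 2 + t ∈ Set.Ioo 0 ε := ⟨by linarith [ht.1], by linarith [ht.2]⟩
  have heq : (f (ε / 2 + t)).1 = Q t := by
    rw [key ε hετ le_rfl _ ⟨hs.1.le, hs.2.le⟩]
    congr 1
    ring
  have hsτ : ε / 2 + t ∈ Set.Ioo 0 τ := ⟨hs.1, hs.2.trans_le hετ⟩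
  have ht' : t ∈ Set.Ioo (-ε) ε := ⟨by linarith [ht.1], by linarith [ht.2]⟩
  constructor
  · have h1 := (hf.transport _ ⟨hsτ.1.le, hsτ.2.le⟩).2.hasDerivAt (Icc_mem_nhds hsτ.1 hsτ.2)
    rw [heq] at h1
    have h2 := h1.scomp t ((hasDerivAt_id t).const_add (ε / 2))
    rwa [one_smul] at h2
  · have h1 := hf.geodesicTransport_shift ⟨hsτ.1.le, hsτ.2⟩ (by rw [hf0]; exact one_mem _)
      (by rw [heq]; exact (hn t ht').mem_unitSphereBundle)
    rwa [heq] at h1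

end Nontangential

/-! ### The gauge equation in charts -/

section Instances

variable (m n : ℕ)

noncomputable instance EndC.normedAddCommGroupForm : NormedAddCommGroup (EucM m →L[ℝ] EndC n) :=
  ContinuousLinearMap.toNormedAddCommGroup

noncomputable instance EndC.normedSpaceForm : NormedSpace ℝ (EucM m →L[ℝ] EndC n) :=
  ContinuousLinearMap.toNormedSpace

end Instances

section GaugeField

variable {m : ℕ} [NeZero m] {M : Type*} [TopologicalSpace M]
  [ChartedSpace (EuclideanHalfSpace m) M] [IsManifold (𝓡∂ m) ∞ M] {n : ℕ}

/-- The coordinate expression of a connection form in the preferred chart at `p`. -/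
noncomputable def connectionForm (A : HermitianConnection m M n) (p : M) (y : EucM m) :
    EucM m →L[ℝ] EndC n :=
  (A.form ((extChartAt (𝓡∂ m) p).symm y)).comp (chartVector p y)

lemma connectionForm_apply (A : HermitianConnection m M n) {p : M} {y : EucM m}
    (hy : y ∈ (extChartAt (𝓡∂ m) p).target) (w : EucM m) :
    connectionForm A p y w = connectionChart A p (y, w) := by
  rw [connectionChart, tangentChart_symm_apply hy]
  rfl

lemma connectionForm_tangentChart (A : HermitianConnection m M n) {p : M}
    {q : TangentBundle (𝓡∂ m) M} (hq : q.proj ∈ (extChartAt (𝓡∂ m) p).source) :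
    connectionForm A p (extChartAt (𝓡∂ m) p q.proj) (tangentChart p q).2 = A.eval q := by
  rw [connectionForm_apply A ((extChartAt (𝓡∂ m) p).map_source hq), ← tangentChart_fst hq,
    Prod.mk.eta, connectionChart, (tangentChart p).left_inv (mem_tangentChart_source.2 hq)]

lemma contDiffOn_connectionForm (A : HermitianConnection m M n) (p : M) :
    ContDiffOn ℝ ∞ (connectionForm A p) (extChartAt (𝓡∂ m) p).target := by
  refine contDiffOn_clm_apply.2 fun w => ?_
  have h1 : ContDiffOn ℝ ∞ (fun y => connectionChart A p (y, w))
      (extChartAt (𝓡∂ m) p).target := by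
    intro y hy
    have hm : Set.MapsTo (fun z : EucM m => (z, w)) (extChartAt (𝓡∂ m) p).target
        (Set.range (𝓡∂ m) ×ˢ Set.univ) := fun z hz => ⟨mem_range_of_mem_target hz, trivial⟩
    exact ContDiffWithinAt.comp (g := connectionChart A p) y
      (contDiffWithinAt_connectionChart A (z := (y, w)) hy)
      (contDiffWithinAt_id.prodMk contDiffWithinAt_const) hm
  exact h1.congr fun y hy => connectionForm_apply A hy w

/-- The right hand side `w ↦ φ A₂(w) - A₁(w) φ` of the gauge equation. -/
noncomputable def gaugeField (A₁ A₂ : HermitianConnection m M n) (p : M) (y : EucM m)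
    (φ : EndC n) : EucM m →L[ℝ] EndC n :=
  (ContinuousLinearMap.mul ℝ (EndC n) φ).comp (connectionForm A₂ p y) -
    ((ContinuousLinearMap.mul ℝ (EndC n)).flip φ).comp (connectionForm A₁ p y)

lemma gaugeField_apply (A₁ A₂ : HermitianConnection m M n) (p : M) (y : EucM m)
    (φ : EndC n) (w : EucM m) : gaugeField A₁ A₂ p y φ w =
      φ * connectionForm A₂ p y w - connectionForm A₁ p y w * φ := rfl

lemma ContDiffOn.gaugeField {A₁ A₂ : HermitianConnection m M n} {p : M} {k : WithTop ℕ∞}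
    (hk : k ≤ ∞) {φ : EucM m → EndC n} {s : Set (EucM m)}
    (hs : s ⊆ (extChartAt (𝓡∂ m) p).target) (hφ : ContDiffOn ℝ k φ s) :
    ContDiffOn ℝ k (fun y => gaugeField A₁ A₂ p y (φ y)) s := by
  refine contDiffOn_clm_apply.2 fun w => ?_
  have h : ∀ A : HermitianConnection m M n, ContDiffOn ℝ k (fun y => connectionForm A p y w) s :=
    fun A => (((contDiffOn_connectionForm A p).mono hs).of_le hk).clm_apply contDiffOn_const
  exact (hφ.mul (h A₂)).sub ((h A₁).mul hφ)

lemma continuousWithinAt_gaugeField {A₁ A₂ : HermitianConnection m M n} {p : M}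
    {φ : EucM m → EndC n} {s : Set (EucM m)} {y : EucM m}
    (hs : s ⊆ (extChartAt (𝓡∂ m) p).target) (hy : y ∈ (extChartAt (𝓡∂ m) p).target)
    (hφ : ContinuousWithinAt φ s y) :
    ContinuousWithinAt (fun z => gaugeField A₁ A₂ p z (φ z)) s y := by
  have h : ∀ A : HermitianConnection m M n, ContinuousWithinAt (connectionForm A p) s y :=
    fun A => ((contDiffOn_connectionForm A p).continuousOn y hy).mono hs
  refine ContinuousWithinAt.sub ?_ ?_
  · exact ((ContinuousLinearMap.mul ℝ (EndC n)).continuous.continuousAt.comp_continuousWithinAt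
      hφ).clm_comp (h A₂)
  · exact ((ContinuousLinearMap.mul ℝ (EndC n)).flip.continuous.continuousAt.comp_continuousWithinAt
      hφ).clm_comp (h A₁)

lemma norm_gaugeField_le (A₁ A₂ : HermitianConnection m M n) (p : M) (y : EucM m)
    {φ : EndC n} (hφ : ‖φ‖ ≤ 1) :
    ‖gaugeField A₁ A₂ p y φ‖ ≤ ‖connectionForm A₁ p y‖ + ‖connectionForm A₂ p y‖ := by
  refine ContinuousLinearMap.opNorm_le_bound _ (by positivity) fun w => ?_
  rw [gaugeField_apply]
  have h1 : ‖φ * connectionForm A₂ p y w‖ ≤ ‖connectionForm A₂ p y‖ * ‖w‖ := by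
    refine (norm_mul_le _ _).trans ?_
    refine (mul_le_mul hφ (ContinuousLinearMap.le_opNorm _ w) (norm_nonneg _) zero_le_one).trans ?_
    rw [one_mul]
  have h2 : ‖connectionForm A₁ p y w * φ‖ ≤ ‖connectionForm A₁ p y‖ * ‖w‖ := by
    refine (norm_mul_le _ _).trans ?_
    refine (mul_le_mul (ContinuousLinearMap.le_opNorm _ w) hφ (norm_nonneg _)
      (by positivity)).trans ?_
    rw [mul_one]
  refine (norm_sub_le _ _).trans ?_
  linarith

/-- Solutions of the gauge equation are smooth. -/
lemma contDiffOn_of_hasFDerivWithinAt_gaugeField {A₁ A₂ : HermitianConnection m M n} {p : M}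
    {φ : EucM m → EndC n} {s : Set (EucM m)} (hs : s ⊆ (extChartAt (𝓡∂ m) p).target)
    (hu : UniqueDiffOn ℝ s)
    (hφ : ∀ y ∈ s, HasFDerivWithinAt φ (gaugeField A₁ A₂ p y (φ y)) s y) :
    ContDiffOn ℝ ∞ φ s := by
  have key : ∀ k : ℕ, ContDiffOn ℝ k φ s := by
    intro k
    induction k with
    | zero => exact contDiffOn_zero.2 fun y hy => (hφ y hy).continuousWithinAt
    | succ k ih =>
      rw [Nat.cast_succ]
      refine (contDiffOn_succ_iff_hasFDerivWithinAt_of_uniqueDiffOn hu).2 ⟨?_, _,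
        ih.gaugeField (WithTop.coe_le_coe.2 le_top) hs, hφ⟩
      intro h
      exact absurd h (WithTop.coe_ne_top (a := (k : ℕ∞)))
  exact contDiffOn_infty.2 key

end GaugeField

/-! ### Smoothness of the gauge in the interior -/

section Gauge

variable {m : ℕ} [NeZero m] {M : Type*} [TopologicalSpace M]
  [ChartedSpace (EuclideanHalfSpace m) M] [IsManifold (𝓡∂ m) ∞ M] {n : ℕ}
  {g : SmoothMetric m M}

lemma IsSprayAt.hasDerivWithinAt_position {Q : ℝ → TangentBundle (𝓡∂ m) M} {s : Set ℝ} {t : ℝ}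
    (hQ : IsSprayAt g Q s t) {p : M} (hp : (Q t).proj ∈ (extChartAt (𝓡∂ m) p).source) :
    HasDerivWithinAt (fun r => extChartAt (𝓡∂ m) p (Q r).proj) (tangentChart p (Q t)).2 s t := by
  have h1 : HasDerivWithinAt (fun r => (tangentChart p (Q r)).1) (tangentChart p (Q t)).2 s t :=
    (hQ.hasDerivWithinAt hp).fst
  have h2 := hQ.1.preimage_mem_nhdsWithin ((isOpen_tangentChart_source p).mem_nhds
    (mem_tangentChart_source.2 hp))
  refine h1.congr_of_eventuallyEq ?_ (tangentChart_fst hp).symm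
  filter_upwards [h2] with r hr using (tangentChart_fst (mem_tangentChart_source.1 hr)).symm

/-- The part of the agreement of the X-ray transforms of `A₁` and `A₂` which determines a gauge:
over each interior point `x` all directions in `V` give the same value
`φ x = (P^{A₁}_γ)⁻¹ P^{A₂}_γ`; `V` is large enough to control the derivatives of `φ` (`spanning`)
and its boundary values (`dense`), and `φ` is continuous on the members of a countable closed
cover. -/
structure IsTransportRatio (g : SmoothMetric m M) (A₁ A₂ : HermitianConnection m M n)
    (V : Set (TangentBundle (𝓡∂ m) M)) (φ : M → EndC n) : Prop where
  nontangential : ∀ q ∈ V, IsNontangential g q.proj q.snd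
  eq : ∀ q ∈ V,
    φ q.proj = star (geodesicTransport g A₁ q.proj q.snd) * geodesicTransport g A₂ q.proj q.snd
  spanning : ∀ x ∈ (𝓡∂ m).interior M, ∃ S : Set (TangentSpace (𝓡∂ m) x),
    Submodule.span ℝ S = ⊤ ∧ ∀ v ∈ S, ∃ ε > 0, ∃ Q : ℝ → TangentBundle (𝓡∂ m) M,
      Q 0 = ⟨x, v⟩ ∧ ∀ t ∈ Set.Ioo (-ε) ε, IsSprayAt g Q (Set.Ioo (-ε) ε) t ∧ Q t ∈ V
  closedCover : ∀ x ∈ (𝓡∂ m).interior M, ∃ O : Set M, IsOpen O ∧ x ∈ O ∧ ∃ K : ℕ → Set M,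
    (∀ i, IsClosed (K i)) ∧ O ⊆ ⋃ i, K i ∧ ∀ i, ContinuousOn φ (K i ∩ O)
  dense : (𝓡∂ m).boundary M ⊆ closure {y | ∃ q ∈ V, scatteringMap g q.proj q.snd = y}

variable {A₁ A₂ : HermitianConnection m M n} {V : Set (TangentBundle (𝓡∂ m) M)} {φ : M → EndC n}

lemma conj_deriv_identity {R : Type*} [Ring R] (a₁ a₂ u₁ u₂ w : R) :
    -(a₁ * u₁) * w * u₂ + u₁ * w * -(u₂ * -a₂) = u₁ * w * u₂ * a₂ - a₁ * (u₁ * w * u₂) := by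
  noncomm_ring

/-- The derivative of the gauge along a geodesic whose velocities belong to `V`. -/
lemma IsTransportRatio.hasDerivAt [T2Space M] (h : IsTransportRatio g A₁ A₂ V φ) {ε : ℝ}
    (hε : 0 < ε) {Q : ℝ → TangentBundle (𝓡∂ m) M}
    (hQ : ∀ t ∈ Set.Ioo (-ε) ε, IsSprayAt g Q (Set.Ioo (-ε) ε) t ∧ Q t ∈ V) :
    HasDerivAt (fun t => φ (Q t).proj)
      (φ (Q 0).proj * A₂.eval (Q 0) - A₁.eval (Q 0) * φ (Q 0).proj) 0 := by
  have hn : ∀ t ∈ Set.Ioo (-ε) ε, IsNontangential g (Q t).proj (Q t).snd := fun t ht =>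
    h.nontangential _ (hQ t ht).2
  obtain ⟨W₁, U₁, h₁⟩ := exists_geodesicTransport_eq hε (fun t ht => (hQ t ht).1) hn A₁
  obtain ⟨W₂, U₂, h₂⟩ := exists_geodesicTransport_eq hε (fun t ht => (hQ t ht).1) hn A₂
  have h0 : (0 : ℝ) ∈ Set.Ioo (-(ε / 2)) (ε / 2) := ⟨by linarith, by linarith⟩
  have hφ : ∀ t ∈ Set.Ioo (-(ε / 2)) (ε / 2),
      φ (Q t).proj = U₁ t * (star W₁ * W₂) * star (U₂ t) := by
    intro t ht
    rw [h.eq _ (hQ t ⟨by linarith [ht.1], by linarith [ht.2]⟩).2, (h₁ t ht).2, (h₂ t ht).2,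
      StarMul.star_mul, star_star, mul_assoc, mul_assoc, mul_assoc]
  have hd := (((h₁ 0 h0).1.mul_const (star W₁ * W₂)).mul (h₂ 0 h0).1.star)
  refine (hd.congr_of_eventuallyEq ?_).congr_deriv ?_
  · filter_upwards [Ioo_mem_nhds h0.1 h0.2] with t ht using hφ t ht
  · rw [hφ 0 h0, star_neg, StarMul.star_mul, A₂.star_eval]
    exact conj_deriv_identity _ _ _ _ _

/-- In coordinates, the gauge equation holds along spanning curves. -/
lemma IsTransportRatio.hasDerivAlongSpanning [T2Space M] (h : IsTransportRatio g A₁ A₂ V φ)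
    {p : M} {y : EucM m} (hy : y ∈ interior (extChartAt (𝓡∂ m) p).target) :
    HasDerivAlongSpanning (φ ∘ (extChartAt (𝓡∂ m) p).symm)
      (gaugeField A₁ A₂ p y (φ ((extChartAt (𝓡∂ m) p).symm y))) y := by
  have hyt := interior_subset hy
  set x := (extChartAt (𝓡∂ m) p).symm y with hx
  have hxs : x ∈ (extChartAt (𝓡∂ m) p).source := (extChartAt (𝓡∂ m) p).map_target hyt
  have hxy : extChartAt (𝓡∂ m) p x = y := (extChartAt (𝓡∂ m) p).right_inv hyt
  obtain ⟨S, hS, hSQ⟩ := h.spanning x (extChartAt_symm_mem_interior hy)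
  set L : TangentSpace (𝓡∂ m) x →L[ℝ] EucM m := mfderiv (𝓡∂ m) 𝓘(ℝ, EucM m) (extChartAt (𝓡∂ m) p) x
  have hsurj : Function.Surjective L := (isInvertible_mfderiv_extChartAt hxs).bijective.2
  refine ⟨L '' S, ?_, ?_⟩
  · have h1 : Submodule.span ℝ ((L : TangentSpace (𝓡∂ m) x →ₗ[ℝ] EucM m) '' S) = ⊤ := by
      rw [Submodule.span_image, hS, Submodule.map_top, LinearMap.range_eq_top]
      exact hsurj
    exact h1
  rintro _ ⟨v, hv, rfl⟩
  obtain ⟨ε, hε, Q, hQ0, hQ⟩ := hSQ v hv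
  have h0 : (0 : ℝ) ∈ Set.Ioo (-ε) ε := ⟨by linarith, hε⟩
  have hnhds : Set.Ioo (-ε) ε ∈ 𝓝 (0 : ℝ) := Ioo_mem_nhds h0.1 h0.2
  have hproj : (Q 0).proj = x := by rw [hQ0]
  have hsrc : (Q 0).proj ∈ (extChartAt (𝓡∂ m) p).source := by rw [hproj]; exact hxs
  have hL : (tangentChart p (Q 0)).2 = L v := by
    rw [hQ0, tangentChart_apply hxs]
    rfl
  refine ⟨fun r => extChartAt (𝓡∂ m) p (Q r).proj, (congrArg _ hproj).trans hxy, ?_, ?_⟩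
  · have := ((hQ 0 h0).1.hasDerivWithinAt_position hsrc).hasDerivAt hnhds
    rwa [hL] at this
  · have hev : ∀ᶠ r in 𝓝 (0 : ℝ), (Q r).1 ∈ (extChartAt (𝓡∂ m) p).source := by
      have h1 := ((hQ 0 h0).1.1.continuousAt hnhds).preimage_mem_nhds
        ((isOpen_tangentChart_source p).mem_nhds (mem_tangentChart_source.2 hsrc))
      filter_upwards [h1] with r hr using mem_tangentChart_source.1 hr
    refine ((h.hasDerivAt hε hQ).congr_of_eventuallyEq ?_).congr_deriv ?_
    · filter_upwards [hev] with r hr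
      exact congrArg φ ((extChartAt (𝓡∂ m) p).left_inv hr)
    · rw [gaugeField_apply, ← hL, ← hxy, ← hproj, connectionForm_tangentChart _ hsrc,
        connectionForm_tangentChart _ hsrc]

lemma IsTransportRatio.mem_unitary [T2Space M] (h : IsTransportRatio g A₁ A₂ V φ) {x : M}
    (hx : x ∈ (𝓡∂ m).interior M) : φ x ∈ unitary (EndC n) := by
  obtain ⟨S, hS, hSQ⟩ := h.spanning x hx
  obtain ⟨v, hv⟩ : S.Nonempty := by
    rw [Set.nonempty_iff_ne_empty]
    rintro rfl
    rw [Submodule.span_empty] at hS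
    have : Nontrivial (TangentSpace (𝓡∂ m) x) :=
      inferInstanceAs (Nontrivial (EucM m))
    exact bot_ne_top hS
  obtain ⟨ε, hε, Q, hQ0, hQ⟩ := hSQ v hv
  have h1 := (hQ 0 ⟨by linarith, hε⟩).2
  have h2 := h.eq _ h1
  have hn := h.nontangential _ h1
  have hproj : (Q 0).proj = x := by rw [hQ0]
  rw [← hproj, h2]
  exact mul_mem (Unitary.star_mem (geodesicTransport_mem_unitary hn A₁))
    (geodesicTransport_mem_unitary hn A₂)

lemma exists_ball_connectionForm_le (A₁ A₂ : HermitianConnection m M n) {p : M} {y : EucM m}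
    (hy : y ∈ (extChartAt (𝓡∂ m) p).target) :
    ∃ C : ℝ, ∃ r > 0, ∀ z ∈ Metric.closedBall y r ∩ Set.range (𝓡∂ m),
      z ∈ (extChartAt (𝓡∂ m) p).target ∧
        ‖connectionForm A₁ p z‖ + ‖connectionForm A₂ p z‖ ≤ C := by
  have hc : ContinuousWithinAt (fun z => ‖connectionForm A₁ p z‖ + ‖connectionForm A₂ p z‖)
      (extChartAt (𝓡∂ m) p).target y :=
    ((contDiffOn_connectionForm A₁ p).continuousOn y hy).norm.add
      ((contDiffOn_connectionForm A₂ p).continuousOn y hy).norm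
  have hev : ∀ᶠ z in 𝓝[Set.range (𝓡∂ m)] y, z ∈ (extChartAt (𝓡∂ m) p).target ∧
      ‖connectionForm A₁ p z‖ + ‖connectionForm A₂ p z‖ <
        ‖connectionForm A₁ p y‖ + ‖connectionForm A₂ p y‖ + 1 := by
    have h1 : (extChartAt (𝓡∂ m) p).target ∈ 𝓝[Set.range (𝓡∂ m)] y :=
      extChartAt_target_mem_nhdsWithin_of_mem hy
    have h2 := hc.mono_of_mem_nhdsWithin h1
    filter_upwards [h1, h2.eventually (gt_mem_nhds (lt_add_one _))] with z h1 h2 using ⟨h1, h2⟩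
  obtain ⟨r, hr, hball⟩ := Metric.mem_nhdsWithin_iff.1 hev
  refine ⟨‖connectionForm A₁ p y‖ + ‖connectionForm A₂ p y‖ + 1, r / 2, half_pos hr, fun z hz => ?_⟩
  have := hball ⟨Metric.closedBall_subset_ball (half_lt_self hr) hz.1, hz.2⟩
  exact ⟨this.1, this.2.le⟩

/-- The gauge is differentiable in the interior and satisfies the gauge equation. -/
theorem IsTransportRatio.hasFDerivAt [T2Space M] (h : IsTransportRatio g A₁ A₂ V φ) {p : M}
    {y : EucM m} (hy : y ∈ interior (extChartAt (𝓡∂ m) p).target) :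
    HasFDerivAt (φ ∘ (extChartAt (𝓡∂ m) p).symm)
      (gaugeField A₁ A₂ p y (φ ((extChartAt (𝓡∂ m) p).symm y))) y := by
  have hyt := interior_subset hy
  obtain ⟨O, hO, hyO, K, hK, hcov, hKφ⟩ := h.closedCover _ (extChartAt_symm_mem_interior hy)
  obtain ⟨C, r₁, hr₁, hC⟩ := exists_ball_connectionForm_le A₁ A₂ hyt
  have hnhds : interior (extChartAt (𝓡∂ m) p).target ∩ (extChartAt (𝓡∂ m) p).symm ⁻¹' O ∈ 𝓝 y :=
    Filter.inter_mem (isOpen_interior.mem_nhds hy)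
      ((continuousAt_extChartAt_symm'' hyt).preimage_mem_nhds (hO.mem_nhds hyO))
  obtain ⟨r₂, hr₂, hball⟩ := Metric.nhds_basis_closedBall.mem_iff.1 hnhds
  obtain ⟨r, hr, hrr₁, hrr₂⟩ : ∃ r > 0, r ≤ r₁ ∧ r ≤ r₂ :=
    ⟨min r₁ r₂, lt_min hr₁ hr₂, min_le_left _ _, min_le_right _ _⟩
  have hint : Metric.closedBall y r ⊆ interior (extChartAt (𝓡∂ m) p).target := fun z hz =>
    (hball (Metric.closedBall_subset_closedBall hrr₂ hz)).1
  have hsub : Metric.ball y r ⊆ interior (extChartAt (𝓡∂ m) p).target :=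
    Metric.ball_subset_closedBall.trans hint
  have hcs : ContinuousOn (extChartAt (𝓡∂ m) p).symm (Metric.closedBall y r) :=
    (continuousOn_extChartAt_symm p).mono (hint.trans interior_subset)
  have hN : ∀ z ∈ Metric.ball y r, ContinuousAt (φ ∘ (extChartAt (𝓡∂ m) p).symm) z →
      ContinuousAt (fun z => gaugeField A₁ A₂ p z (φ ((extChartAt (𝓡∂ m) p).symm z))) z := by
    intro z hz hφ
    refine (continuousWithinAt_gaugeField (p := p) (s := interior (extChartAt (𝓡∂ m) p).target)
      interior_subset (interior_subset (hsub hz))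
      (hφ.continuousWithinAt)).continuousAt (isOpen_interior.mem_nhds (hsub hz))
  have hcont : ContinuousOn (φ ∘ (extChartAt (𝓡∂ m) p).symm) (Metric.ball y r) := by
    refine continuousOn_of_hasDerivAlongSpanning Metric.isOpen_ball
      (N := fun z => gaugeField A₁ A₂ p z (φ ((extChartAt (𝓡∂ m) p).symm z))) (C := C) hN ?_
      (fun z hz => h.hasDerivAlongSpanning (hsub hz))
      (K := fun i => Metric.closedBall y r ∩ (extChartAt (𝓡∂ m) p).symm ⁻¹' K i)
      (fun i => hcs.preimage_isClosed_of_isClosed Metric.isClosed_closedBall (hK i)) ?_ ?_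
    · intro z hz
      have hz' := interior_subset (hsub hz)
      refine (norm_gaugeField_le A₁ A₂ p z ?_).trans
        (hC z ⟨Metric.closedBall_subset_closedBall hrr₁ (Metric.ball_subset_closedBall hz),
          mem_range_of_mem_target hz'⟩).2
      exact EndC.norm_le_one_of_mem_unitary (h.mem_unitary (extChartAt_symm_mem_interior (hsub hz)))
    · intro z hz
      have hz1 := Metric.ball_subset_closedBall hz
      obtain ⟨i, hi⟩ := Set.mem_iUnion.1
        (hcov (hball (Metric.closedBall_subset_closedBall hrr₂ hz1)).2)
      exact Set.mem_iUnion.2 ⟨i, hz1, hi⟩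
    · intro i
      refine (hKφ i).comp (hcs.mono fun z hz => hz.1.1) fun z hz => ⟨hz.1.2, ?_⟩
      exact (hball (Metric.closedBall_subset_closedBall hrr₂ hz.1.1)).2
  have hyb : y ∈ Metric.ball y r := Metric.mem_ball_self hr
  exact hasFDerivAt_of_hasDerivAlongSpanning Metric.isOpen_ball
    (N := fun z => gaugeField A₁ A₂ p z (φ ((extChartAt (𝓡∂ m) p).symm z))) hcont
    (fun z hz => h.hasDerivAlongSpanning (hsub hz)) hyb
    (hN y hyb (hcont.continuousAt (Metric.isOpen_ball.mem_nhds hyb)))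

end Gauge

/-! ### Boundary values of the gauge and gauge equivalence -/

section GaugeBoundary

variable {m : ℕ} [NeZero m] {M : Type*} [TopologicalSpace M]
  [ChartedSpace (EuclideanHalfSpace m) M] [IsManifold (𝓡∂ m) ∞ M] {n : ℕ}
  {g : SmoothMetric m M} {A₁ A₂ : HermitianConnection m M n}

/-- Along geodesics, a solution of the gauge equation has the derivative `φ A₂ - A₁ φ`. -/
lemma IsSprayAt.hasDerivWithinAt_gauge {Q : ℝ → TangentBundle (𝓡∂ m) M} {s : Set ℝ} {t : ℝ}
    (hQ : IsSprayAt g Q s t) {φ : M → EndC n} {p : M}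
    (hp : (Q t).proj ∈ (extChartAt (𝓡∂ m) p).source)
    (hφ : HasFDerivWithinAt (φ ∘ (extChartAt (𝓡∂ m) p).symm)
      (gaugeField A₁ A₂ p (extChartAt (𝓡∂ m) p (Q t).proj) (φ (Q t).proj))
      (Set.range (𝓡∂ m)) (extChartAt (𝓡∂ m) p (Q t).proj)) :
    HasDerivWithinAt (fun r => φ (Q r).proj)
      (φ (Q t).proj * A₂.eval (Q t) - A₁.eval (Q t) * φ (Q t).proj) s t := by
  have h1 := hφ.comp_hasDerivWithinAt t (hQ.hasDerivWithinAt_position hp)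
    (fun r _ => mem_range_halfSpace.2 (extChartAt_zero_nonneg p _))
  refine (h1.congr_of_eventuallyEq ?_ ?_).congr_deriv ?_
  · have h2 := hQ.1.preimage_mem_nhdsWithin ((isOpen_tangentChart_source p).mem_nhds
      (mem_tangentChart_source.2 hp))
    filter_upwards [h2] with r hr
    exact congrArg φ ((extChartAt (𝓡∂ m) p).left_inv (mem_tangentChart_source.1 hr)).symm
  · exact congrArg φ ((extChartAt (𝓡∂ m) p).left_inv hp).symm
  · rw [gaugeField_apply, connectionForm_tangentChart _ hp, connectionForm_tangentChart _ hp]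

lemma tendsto_mul_star_mul_mul_star {l : Filter ℝ} {U V : ℝ → EndC n} {u v : EndC n}
    (hu : u ∈ unitary (EndC n)) (hv : v ∈ unitary (EndC n)) (hU : Filter.Tendsto U l (𝓝 u))
    (hV : Filter.Tendsto V l (𝓝 v)) :
    Filter.Tendsto (fun s => U s * (star u * v) * star (V s)) l (𝓝 1) := by
  have hs : Filter.Tendsto (fun s => star (V s)) l (𝓝 (star v)) := by
    have hc : Continuous (star : EndC n → EndC n) :=
      (NormedStarGroup.to_continuousStar (E := EndC n)).continuous_star
    exact (hc.tendsto v).comp hV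
  have h1 := (hU.mul_const (star u * v)).mul hs
  have h2 : u * (star u * v) * star v = 1 := by
    rw [← mul_assoc, Unitary.mul_star_self_of_mem hu, one_mul, Unitary.mul_star_self_of_mem hv]
  rwa [h2] at h1

lemma eq_of_star_mul_mul_eq {u v w x : EndC n} (hu : u ∈ unitary (EndC n))
    (hv : v ∈ unitary (EndC n)) (h : star u * x * v = w) : x = u * w * star v := by
  rw [← h, mul_assoc, mul_assoc, Unitary.mul_star_self_of_mem hv, mul_one, ← mul_assoc,
    Unitary.mul_star_self_of_mem hu, one_mul]

variable {V : Set (TangentBundle (𝓡∂ m) M)} {φ : M → EndC n}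

/-- The gauge tends to the identity at the end of the geodesics of `V`. -/
lemma IsTransportRatio.exists_norm_sub_one_lt [T2Space M] (h : IsTransportRatio g A₁ A₂ V φ)
    {q : TangentBundle (𝓡∂ m) M} (hq : q ∈ V) {W : Set M}
    (hW : W ∈ 𝓝 (scatteringMap g q.proj q.snd)) {ε : ℝ} (hε : 0 < ε) :
    ∃ z ∈ W, z ∈ (𝓡∂ m).interior M ∧ ‖φ z - 1‖ < ε := by
  have hn := h.nontangential q hq
  obtain ⟨τ, f₁, hf₁, h0₁, hτ₁, hs⟩ := hn.exists_isExitCurve A₁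
  obtain ⟨τ', f₂, hf₂, h0₂, hτ₂, -⟩ := hn.exists_isExitCurve A₂
  obtain ⟨rfl, hff⟩ := hf₁.fst_eq hf₂ (by rw [h0₁, h0₂])
  have hu₁ := geodesicTransport_mem_unitary hn A₁
  have hu₂ := geodesicTransport_mem_unitary hn A₂
  have hL₁ := hf₁.isLinearSolution
  have hL₂ : IsLinearSolution (fun r => A₂.eval (f₁ r).1) 0 τ (fun r => (f₂ r).2) := by
    intro r hr
    have := hf₂.isLinearSolution r hr
    simp only [hff r hr]
    exact this
  have hm₁ : ∀ r ∈ Set.Icc 0 τ, (f₁ r).2 ∈ unitary (EndC n) := fun r hr =>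
    hL₁.mem_unitary (fun r _ => A₁.star_eval _) (by rw [h0₁]; exact one_mem _) hr
  have hm₂ : ∀ r ∈ Set.Icc 0 τ, (f₂ r).2 ∈ unitary (EndC n) := fun r hr =>
    hL₂.mem_unitary (fun r _ => A₂.star_eval _) (by rw [h0₂]; exact one_mem _) hr
  have hφ : ∀ s ∈ Set.Ico 0 τ, φ (f₁ s).1.proj = (f₁ s).2 *
      (star (geodesicTransport g A₁ q.proj q.snd) * geodesicTransport g A₂ q.proj q.snd) *
      star (f₂ s).2 := by
    intro s hs
    have hsub : Set.Icc 0 s ⊆ Set.Icc 0 τ := Set.Icc_subset_Icc_right hs.2.le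
    have hc := IsLinearSolution.conj_eq (φ := fun r => φ (f₁ r).1.proj)
      (fun r hr => (hL₁ r (hsub hr)).mono hsub) (fun r hr => (hL₂ r (hsub hr)).mono hsub)
      (fun r _ => A₁.star_eval _) (fun r hr => ?_) s ⟨hs.1, le_rfl⟩
    · refine eq_of_star_mul_mul_eq (hm₁ s ⟨hs.1, hs.2.le⟩) (hm₂ s ⟨hs.1, hs.2.le⟩) (hc.trans ?_)
      simp only [h0₁, h0₂, star_one, one_mul, mul_one]
      exact h.eq q hq
    · have hint := hf₁.interior r ⟨hr.1, hr.2.trans_lt hs.2⟩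
      have hsrc := mem_extChartAt_source (I := 𝓡∂ m) (f₁ r).1.proj
      refine ((hf₁.transport r (hsub hr)).1.mono hsub).hasDerivWithinAt_gauge hsrc ?_
      have := (h.hasFDerivAt (p := (f₁ r).1.proj) (extChartAt_mem_interior_target hsrc hint))
      rw [(extChartAt (𝓡∂ m) _).left_inv hsrc] at this
      exact this.hasFDerivWithinAt
  have hτ : τ ∈ Set.Icc 0 τ := ⟨hf₁.lt.le, le_rfl⟩
  have hmono : 𝓝[Set.Ico 0 τ] τ ≤ 𝓝[Set.Icc 0 τ] τ := nhdsWithin_mono _ Set.Ico_subset_Icc_self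
  have hlim := tendsto_mul_star_mul_mul_star (l := 𝓝[Set.Ico 0 τ] τ) hu₁ hu₂
    (U := fun r => (f₁ r).2) (V := fun r => (f₂ r).2)
    (by rw [← hτ₁]; exact (hL₁ τ hτ).continuousWithinAt.tendsto.mono_left hmono)
    (by rw [← hτ₂]; exact (hL₂ τ hτ).continuousWithinAt.tendsto.mono_left hmono)
  have hpos : Filter.Tendsto (fun r => (f₁ r).1.proj) (𝓝[Set.Ico 0 τ] τ)
      (𝓝 (scatteringMap g q.proj q.snd)) := by
    rw [← hs]
    exact (continuous_tangentBundle_proj.continuousAt.comp_continuousWithinAt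
      (hf₁.transport τ hτ).1.1).tendsto.mono_left hmono
  have hne : (𝓝[Set.Ico 0 τ] τ).NeBot := by
    rw [← mem_closure_iff_nhdsWithin_neBot, closure_Ico hf₁.lt.ne]
    exact hτ
  obtain ⟨s, hs1, hs2, hs3⟩ := ((hpos.eventually_mem hW).and
    ((Metric.tendsto_nhds.1 hlim ε hε).and self_mem_nhdsWithin)).exists
  refine ⟨(f₁ s).1.proj, hs1, hf₁.interior s hs3, ?_⟩
  rw [hφ s hs3, ← dist_eq_norm]
  exact hs2

/-- The gauge extends continuously by the identity to the boundary. -/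
lemma IsTransportRatio.tendsto_one [T2Space M] (h : IsTransportRatio g A₁ A₂ V φ) {p b : M}
    (hb : b ∈ (𝓡∂ m).boundary M) (hp : b ∈ (extChartAt (𝓡∂ m) p).source) :
    Filter.Tendsto (φ ∘ (extChartAt (𝓡∂ m) p).symm)
      (𝓝[interior (Set.range (𝓡∂ m))] (extChartAt (𝓡∂ m) p b)) (𝓝 1) := by
  set y := extChartAt (𝓡∂ m) p b with hy
  obtain ⟨C, r, hr, hC⟩ := exists_ball_connectionForm_le A₁ A₂
    ((extChartAt (𝓡∂ m) p).map_source hp)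
  set s := Metric.ball y r ∩ interior (Set.range (𝓡∂ m)) with hs
  have hso : IsOpen s := Metric.isOpen_ball.inter isOpen_interior
  have hsc : Convex ℝ s := (convex_ball y r).inter (𝓡∂ m).convex_range.interior
  have hst : ∀ z ∈ s, z ∈ (extChartAt (𝓡∂ m) p).target ∧
      ‖connectionForm A₁ p z‖ + ‖connectionForm A₂ p z‖ ≤ C := fun z hz =>
    hC z ⟨Metric.ball_subset_closedBall hz.1, interior_subset hz.2⟩
  have hsi : s ⊆ interior (extChartAt (𝓡∂ m) p).target :=
    interior_maximal (fun z hz => (hst z hz).1) hso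
  have hlip : ∀ z ∈ s, ∀ z' ∈ s, ‖(φ ∘ (extChartAt (𝓡∂ m) p).symm) z' -
      (φ ∘ (extChartAt (𝓡∂ m) p).symm) z‖ ≤ C * ‖z' - z‖ := fun z hz z' hz' =>
    hsc.norm_image_sub_le_of_norm_hasFDerivWithin_le
      (fun x hx => (h.hasFDerivAt (hsi hx)).hasFDerivWithinAt)
      (fun x hx => (norm_gaugeField_le A₁ A₂ p x (EndC.norm_le_one_of_mem_unitary
        (h.mem_unitary (extChartAt_symm_mem_interior (hsi hx))))).trans (hst x hx).2) hz hz'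
  have hC0 : 0 ≤ C := le_trans (by positivity) (hC y ⟨Metric.mem_closedBall_self hr.le,
    Set.mem_range_self _⟩).2
  rw [Metric.tendsto_nhds]
  intro ε hε
  obtain ⟨δ, hδ, hδr, hδC⟩ : ∃ δ > 0, δ ≤ r ∧ C * (2 * δ) < ε / 2 := by
    refine ⟨min r (ε / (8 * (C + 1))), by positivity, min_le_left _ _, ?_⟩
    have h1 : min r (ε / (8 * (C + 1))) ≤ ε / (8 * (C + 1)) := min_le_right _ _
    have h2 : (C + 1) * (ε / (8 * (C + 1))) = ε / 8 := by field_simp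
    have h3 : 0 < ε / (8 * (C + 1)) := by positivity
    nlinarith
  obtain ⟨z', hz'1, hz'2, hz'3⟩ : ∃ z' ∈ (extChartAt (𝓡∂ m) p).source ∩
      extChartAt (𝓡∂ m) p ⁻¹' Metric.ball y δ, z' ∈ (𝓡∂ m).interior M ∧ ‖φ z' - 1‖ < ε / 2 := by
    have hopen : IsOpen ((extChartAt (𝓡∂ m) p).source ∩
        extChartAt (𝓡∂ m) p ⁻¹' Metric.ball y δ) :=
      (continuousOn_extChartAt p).isOpen_inter_preimage (isOpen_extChartAt_source p)
        Metric.isOpen_ball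
    obtain ⟨_, hmem, q, hq, rfl⟩ := mem_closure_iff.1 (h.dense hb) _ hopen
      ⟨hp, Metric.mem_ball_self hδ⟩
    exact h.exists_norm_sub_one_lt hq (hopen.mem_nhds hmem) (half_pos hε)
  have hz's : extChartAt (𝓡∂ m) p z' ∈ s := by
    refine ⟨Metric.ball_subset_ball hδr hz'1.2, ?_⟩
    rw [interior_range_modelWithCornersEuclideanHalfSpace]
    exact (mem_interior_iff_extChartAt hz'1.1).1 hz'2
  filter_upwards [self_mem_nhdsWithin, mem_nhdsWithin_of_mem_nhds (Metric.ball_mem_nhds y hδ)]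
    with z hz1 hz2
  have hzs : z ∈ s := ⟨Metric.ball_subset_ball hδr hz2, hz1⟩
  have h1 := hlip _ hz's _ hzs
  have h2 : ‖z - extChartAt (𝓡∂ m) p z'‖ ≤ 2 * δ := by
    rw [← dist_eq_norm]
    have h3 : dist (extChartAt (𝓡∂ m) p z') y < δ := hz'1.2
    have h4 : dist z y < δ := hz2
    linarith [dist_triangle_right z (extChartAt (𝓡∂ m) p z') y]
  have h3 : (φ ∘ (extChartAt (𝓡∂ m) p).symm) (extChartAt (𝓡∂ m) p z') = φ z' :=
    congrArg φ ((extChartAt (𝓡∂ m) p).left_inv hz'1.1)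
  rw [h3] at h1
  rw [dist_eq_norm]
  have h5 := norm_sub_le_norm_sub_add_norm_sub ((φ ∘ (extChartAt (𝓡∂ m) p).symm) z) (φ z') 1
  have h6 := mul_le_mul_of_nonneg_left h2 hC0
  linarith

open Classical in
/-- The gauge, extended by the identity to the boundary. -/
noncomputable def boundaryExtension (φ : M → EndC n) (x : M) : EndC n :=
  if x ∈ (𝓡∂ m).boundary M then 1 else φ x

lemma boundaryExtension_of_mem_boundary {φ : M → EndC n} {x : M}
    (hx : x ∈ (𝓡∂ m).boundary M) : boundaryExtension (m := m) φ x = 1 := if_pos hx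

lemma boundaryExtension_of_mem_interior {φ : M → EndC n} {x : M}
    (hx : x ∈ (𝓡∂ m).interior M) : boundaryExtension (m := m) φ x = φ x := by
  refine if_neg fun h => ?_
  rw [← (𝓡∂ m).compl_interior] at h
  exact h hx

lemma eqOn_boundaryExtension {φ : M → EndC n} {p : M} : Set.EqOn
    (boundaryExtension (m := m) φ ∘ (extChartAt (𝓡∂ m) p).symm) (φ ∘ (extChartAt (𝓡∂ m) p).symm)
    (interior (extChartAt (𝓡∂ m) p).target) := fun _ hy =>
  boundaryExtension_of_mem_interior (extChartAt_symm_mem_interior hy)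

/-- The extended gauge satisfies the gauge equation up to the boundary. -/
lemma IsTransportRatio.hasFDerivWithinAt [T2Space M] (h : IsTransportRatio g A₁ A₂ V φ) {p : M}
    {y : EucM m} (hy : y ∈ (extChartAt (𝓡∂ m) p).target) :
    HasFDerivWithinAt (boundaryExtension (m := m) φ ∘ (extChartAt (𝓡∂ m) p).symm)
      (gaugeField A₁ A₂ p y
        ((boundaryExtension (m := m) φ ∘ (extChartAt (𝓡∂ m) p).symm) y)) (Set.range (𝓡∂ m)) y := by
  set ψ := boundaryExtension (m := m) φ ∘ (extChartAt (𝓡∂ m) p).symm with hψ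
  have hint : ∀ z ∈ interior (extChartAt (𝓡∂ m) p).target,
      HasFDerivAt ψ (gaugeField A₁ A₂ p z (ψ z)) z := by
    intro z hz
    have h1 := (h.hasFDerivAt hz).congr_of_eventuallyEq (eqOn_boundaryExtension.eventuallyEq_of_mem
      (isOpen_interior.mem_nhds hz))
    rwa [show φ ((extChartAt (𝓡∂ m) p).symm z) = ψ z from
      (eqOn_boundaryExtension hz).symm] at h1
  by_cases hyi : (extChartAt (𝓡∂ m) p).symm y ∈ (𝓡∂ m).interior M
  · have h1 := extChartAt_mem_interior_target ((extChartAt (𝓡∂ m) p).map_target hy) hyi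
    rw [(extChartAt (𝓡∂ m) p).right_inv hy] at h1
    exact (hint y h1).hasFDerivWithinAt
  obtain ⟨C, r, hr, hC⟩ := exists_ball_connectionForm_le A₁ A₂ hy
  set s := Metric.ball y r ∩ interior (Set.range (𝓡∂ m)) with hs
  have hso : IsOpen s := Metric.isOpen_ball.inter isOpen_interior
  have hsc : Convex ℝ s := (convex_ball y r).inter (𝓡∂ m).convex_range.interior
  have hst : s ⊆ (extChartAt (𝓡∂ m) p).target := fun z hz =>
    (hC z ⟨Metric.ball_subset_closedBall hz.1, interior_subset hz.2⟩).1
  have hsi : s ⊆ interior (extChartAt (𝓡∂ m) p).target := interior_maximal hst hso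
  have hcl : ∀ z ∈ closure s, z ∈ (extChartAt (𝓡∂ m) p).target := fun z hz => by
    refine (hC z ⟨?_, ?_⟩).1
    · exact Metric.closure_ball_subset_closedBall (closure_mono Set.inter_subset_left hz)
    · exact (𝓡∂ m).isClosed_range.closure_subset_iff.2 interior_subset
        (closure_mono Set.inter_subset_right hz)
  have hcont : ∀ z ∈ closure s, ContinuousWithinAt ψ s z := by
    intro z hz
    have hzt := hcl z hz
    by_cases hzi : (extChartAt (𝓡∂ m) p).symm z ∈ (𝓡∂ m).interior M
    · have h1 := extChartAt_mem_interior_target ((extChartAt (𝓡∂ m) p).map_target hzt) hzi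
      rw [(extChartAt (𝓡∂ m) p).right_inv hzt] at h1
      exact (hint z h1).continuousAt.continuousWithinAt
    · have hzb : (extChartAt (𝓡∂ m) p).symm z ∈ (𝓡∂ m).boundary M := by
        rw [← (𝓡∂ m).compl_interior]; exact hzi
      have h1 := h.tendsto_one hzb ((extChartAt (𝓡∂ m) p).map_target hzt)
      rw [(extChartAt (𝓡∂ m) p).right_inv hzt] at h1
      have h2 : ψ z = 1 := boundaryExtension_of_mem_boundary hzb
      rw [ContinuousWithinAt, h2]
      refine (h1.mono_left (nhdsWithin_mono _ Set.inter_subset_right)).congr' ?_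
      filter_upwards [self_mem_nhdsWithin] with x hx using (eqOn_boundaryExtension (hsi hx)).symm
  have hclN : closure s ∈ 𝓝[Set.range (𝓡∂ m)] y := by
    filter_upwards [self_mem_nhdsWithin, mem_nhdsWithin_of_mem_nhds (Metric.ball_mem_nhds y hr)]
      with z hz1 hz2
    exact Metric.isOpen_ball.inter_closure ⟨hz2, (𝓡∂ m).range_subset_closure_interior hz1⟩
  have hys : y ∈ closure s := mem_of_mem_nhdsWithin (mem_range_of_mem_target hy) hclN
  refine (hasFDerivWithinAt_closure_of_tendsto_fderiv
    (fun z hz => (hint z (hsi hz)).differentiableAt.differentiableWithinAt) hsc hso hcont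
    ?_).mono_of_mem_nhdsWithin hclN
  refine ((continuousWithinAt_gaugeField hst hy (hcont y hys)).tendsto).congr' ?_
  filter_upwards [self_mem_nhdsWithin] with z hz using (hint z (hsi hz)).fderiv.symm

lemma gauge_identity {R : Type*} [Ring R] {u v a b : R} (h : v * u = 1) :
    b = v * (u * b - a * u) + v * a * u := by
  rw [mul_sub, ← mul_assoc, h, one_mul, mul_assoc]
  abel

/-- A map which satisfies the gauge equation in charts is a gauge transformation. -/
lemma gaugeEquivalent_of_hasFDerivWithinAt {ψ : M → EndC n}
    (hu : ∀ x, ψ x ∈ unitary (EndC n)) (hb : ∀ x ∈ (𝓡∂ m).boundary M, ψ x = 1)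
    (hψ : ∀ p : M, ∀ y ∈ (extChartAt (𝓡∂ m) p).target,
      HasFDerivWithinAt (ψ ∘ (extChartAt (𝓡∂ m) p).symm)
        (gaugeField A₁ A₂ p y ((ψ ∘ (extChartAt (𝓡∂ m) p).symm) y)) (Set.range (𝓡∂ m)) y) :
    GaugeEquivalent A₁ A₂ := by
  refine ⟨ψ, fun x => ?_, hu, hb, fun x v => ?_⟩
  · have h1 : ContDiffOn ℝ ∞ (ψ ∘ (extChartAt (𝓡∂ m) x).symm) (extChartAt (𝓡∂ m) x).target :=
      contDiffOn_of_hasFDerivWithinAt_gaugeField subset_rfl (uniqueDiffOn_extChartAt_target x)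
        fun y hy => (hψ x y hy).mono fun z hz => mem_range_of_mem_target hz
    have h2 : ContMDiffOn (𝓡∂ m) 𝓘(ℝ, EndC n) ∞
        ((ψ ∘ (extChartAt (𝓡∂ m) x).symm) ∘ extChartAt (𝓡∂ m) x) (chartAt _ x).source :=
      h1.contMDiffOn.comp contMDiffOn_extChartAt fun z hz =>
        (extChartAt (𝓡∂ m) x).map_source (by rwa [extChartAt_source])
    have h3 := (h2 x (mem_chart_source _ x)).contMDiffAt (chart_source_mem_nhds _ x)
    refine h3.congr_of_eventuallyEq ?_
    filter_upwards [extChartAt_source_mem_nhds (I := 𝓡∂ m) x] with z hz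
    exact congrArg ψ ((extChartAt (𝓡∂ m) x).left_inv hz).symm
  · have hxs := mem_extChartAt_source (I := 𝓡∂ m) x
    have h1 := hψ x _ (mem_extChartAt_target (I := 𝓡∂ m) x)
    have h2 : HasMFDerivAt (𝓡∂ m) 𝓘(ℝ, EucM m) (extChartAt (𝓡∂ m) x) x
        (mfderiv (𝓡∂ m) 𝓘(ℝ, EucM m) (extChartAt (𝓡∂ m) x) x) :=
      (mdifferentiableAt_extChartAt (mem_chart_source _ x)).hasMFDerivAt
    have h3 := (h1.hasMFDerivWithinAt.comp x h2.hasMFDerivWithinAt (s := Set.univ)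
      fun z _ => Set.mem_range_self _).hasMFDerivAt Filter.univ_mem
    have h4 := h3.congr_of_eventuallyEq (f₁ := ψ) (by
      filter_upwards [extChartAt_source_mem_nhds (I := 𝓡∂ m) x] with z hz
      exact congrArg ψ ((extChartAt (𝓡∂ m) x).left_inv hz).symm)
    have h5 : (ψ ∘ (extChartAt (𝓡∂ m) x).symm) (extChartAt (𝓡∂ m) x x) = ψ x :=
      congrArg ψ ((extChartAt (𝓡∂ m) x).left_inv hxs)
    have h6 : mfderiv (𝓡∂ m) 𝓘(ℝ, EndC n) ψ x v = gaugeField A₁ A₂ x (extChartAt (𝓡∂ m) x x) (ψ x)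
        (tangentChart x (⟨x, v⟩ : TangentBundle (𝓡∂ m) M)).2 := by
      rw [h4.mfderiv, ← h5, tangentChart_apply hxs]
      rfl
    intro dφ
    rw [show dφ = _ from h6, gaugeField_apply,
      connectionForm_tangentChart A₁ (q := ⟨x, v⟩) hxs,
      connectionForm_tangentChart A₂ (q := ⟨x, v⟩) hxs, EndC.ringInverse_eq_star (hu x)]
    exact gauge_identity (Unitary.star_mul_self_of_mem (hu x))

/-- The ratio of the parallel transports of two connections is a gauge between them. -/
theorem IsTransportRatio.gaugeEquivalent [T2Space M] (h : IsTransportRatio g A₁ A₂ V φ) :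
    GaugeEquivalent A₁ A₂ := by
  refine gaugeEquivalent_of_hasFDerivWithinAt (ψ := boundaryExtension (m := m) φ) (fun x => ?_)
    (fun x hx => boundaryExtension_of_mem_boundary hx) (fun p y hy => h.hasFDerivWithinAt hy)
  by_cases hx : x ∈ (𝓡∂ m).interior M
  · rw [boundaryExtension_of_mem_interior hx]
    exact h.mem_unitary hx
  · rw [boundaryExtension_of_mem_boundary (by rw [← (𝓡∂ m).compl_interior]; exact hx)]
    exact one_mem _

/-- Gauge transformations intertwine the parallel transports. -/
lemma GaugeEquivalent.exists_eq_star_mul [T2Space M] (h : GaugeEquivalent A₁ A₂)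
    (g : SmoothMetric m M) :
    ∃ ψ : M → EndC n, ∀ q : TangentBundle (𝓡∂ m) M, IsNontangential g q.proj q.snd →
      ψ q.proj = star (geodesicTransport g A₁ q.proj q.snd) *
        geodesicTransport g A₂ q.proj q.snd := by
  obtain ⟨ψ, hψ, hu, hb, hg⟩ := h
  refine ⟨ψ, fun q hn => ?_⟩
  have hF : ∀ p : M, ∀ y ∈ (extChartAt (𝓡∂ m) p).target,
      HasFDerivWithinAt (ψ ∘ (extChartAt (𝓡∂ m) p).symm)
        (gaugeField A₁ A₂ p y (ψ ((extChartAt (𝓡∂ m) p).symm y))) (Set.range (𝓡∂ m)) y := by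
    intro p y hy
    have h1 : HasMFDerivAt (𝓡∂ m) 𝓘(ℝ, EndC n) ψ ((extChartAt (𝓡∂ m) p).symm y)
        (mfderiv (𝓡∂ m) 𝓘(ℝ, EndC n) ψ ((extChartAt (𝓡∂ m) p).symm y)) :=
      ((hψ _).mdifferentiableAt (by simp)).hasMFDerivAt
    have h2 := (mdifferentiableWithinAt_extChartAt_symm (I := 𝓡∂ m) hy).hasMFDerivWithinAt
    have h3 := (h1.comp_hasMFDerivWithinAt y h2).hasFDerivWithinAt
    refine h3.congr_fderiv ?_
    ext1 w
    have h4 := hg ((extChartAt (𝓡∂ m) p).symm y) (chartVector p y w)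
    have hux := hu ((extChartAt (𝓡∂ m) p).symm y)
    rw [EndC.ringInverse_eq_star hux] at h4
    have key : ∀ {u a b d : EndC n}, u ∈ unitary (EndC n) →
        b = star u * d + star u * a * u → d = u * b - a * u := by
      intro u a b d hu hb
      rw [hb, mul_add, ← mul_assoc, Unitary.mul_star_self_of_mem hu, one_mul, mul_assoc (star u),
        ← mul_assoc u, Unitary.mul_star_self_of_mem hu, one_mul, add_sub_cancel_right]
    exact key hux h4
  obtain ⟨τ, f₁, hf₁, h0₁, hτ₁, -⟩ := hn.exists_isExitCurve A₁
  obtain ⟨τ', f₂, hf₂, h0₂, hτ₂, -⟩ := hn.exists_isExitCurve A₂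
  obtain ⟨rfl, hff⟩ := hf₁.fst_eq hf₂ (by rw [h0₁, h0₂])
  have hL₂ : IsLinearSolution (fun r => A₂.eval (f₁ r).1) 0 τ (fun r => (f₂ r).2) := by
    intro r hr
    have := hf₂.isLinearSolution r hr
    simp only [hff r hr]
    exact this
  have hc := hf₁.isLinearSolution.conj_eq hL₂ (φ := fun r => ψ (f₁ r).1.proj)
    (fun r _ => A₁.star_eval _) (fun r hr => ?_) τ ⟨hf₁.lt.le, le_rfl⟩
  · simp only [h0₁, h0₂, hb _ hf₁.boundary, hτ₁, hτ₂, star_one, one_mul, mul_one] at hc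
    exact hc.symm
  · have hsrc := mem_extChartAt_source (I := 𝓡∂ m) (f₁ r).1.proj
    refine (hf₁.transport r hr).1.hasDerivWithinAt_gauge hsrc ?_
    have := hF (f₁ r).1.proj _ ((extChartAt (𝓡∂ m) _).map_source hsrc)
    rwa [(extChartAt (𝓡∂ m) _).left_inv hsrc] at this

lemma mul_star_eq_mul_star_iff {P₁ P₂ R₁ R₂ : EndC n}
    (hP₂ : P₂ ∈ unitary (EndC n)) (hR₁ : R₁ ∈ unitary (EndC n)) :
    R₁ * star P₁ = R₂ * star P₂ ↔ star P₁ * P₂ = star R₁ * R₂ := by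
  constructor
  · intro h
    calc star P₁ * P₂ = star R₁ * (R₁ * star P₁) * P₂ := by
          rw [← mul_assoc (star R₁), Unitary.star_mul_self_of_mem hR₁, one_mul]
      _ = star R₁ * R₂ := by
          rw [h, mul_assoc, mul_assoc R₂, Unitary.star_mul_self_of_mem hP₂, mul_one]
  · intro h
    calc R₁ * star P₁ = R₁ * (star P₁ * P₂) * star P₂ := by
          rw [mul_assoc, mul_assoc (star P₁), Unitary.mul_star_self_of_mem hP₂, mul_one]
      _ = R₂ * star P₂ := by
          rw [h, ← mul_assoc, Unitary.mul_star_self_of_mem hR₁, one_mul]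

/-- The broken X-ray transforms agree at `(x, v, w)` if and only if the ratios of the parallel
transports in the directions `v` and `w` agree. -/
lemma brokenXray_eq_iff [T2Space M] {x : M} {v w : TangentSpace (𝓡∂ m) x}
    (hv : IsNontangential g x v) (hw : IsNontangential g x w) :
    brokenXray g A₁ x v w = brokenXray g A₂ x v w ↔
      star (geodesicTransport g A₁ x v) * geodesicTransport g A₂ x v =
        star (geodesicTransport g A₁ x w) * geodesicTransport g A₂ x w := by
  have hu : ∀ (A : HermitianConnection m M n) (v : TangentSpace (𝓡∂ m) x), IsNontangential g x v →
      geodesicTransport g A x v ∈ unitary (EndC n) := fun A v hv =>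
    geodesicTransport_mem_unitary (q := ⟨x, v⟩) hv A
  rw [brokenXray, brokenXray, EndC.ringInverse_eq_star (hu A₁ v hv),
    EndC.ringInverse_eq_star (hu A₂ v hv)]
  exact mul_star_eq_mul_star_iff (hu A₂ v hv) (hu A₁ w hw)

/-- Gauge equivalent connections have the same broken X-ray transform. -/
theorem GaugeEquivalent.xrayAgree [T2Space M] (h : GaugeEquivalent A₁ A₂)
    (G : GeodesicGraph g) : G.XrayAgree A₁ A₂ := by
  obtain ⟨ψ, hψ⟩ := h.exists_eq_star_mul g
  intro x v w hE
  obtain ⟨hv, hw, -, -⟩ := G.edges x v w hE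
  have hv' := G.nontangential x v hv
  have hw' := G.nontangential x w hw
  rw [brokenXray_eq_iff hv' hw', ← hψ ⟨x, v⟩ hv', ← hψ ⟨x, w⟩ hw']

end GaugeBoundary

/-! ### Complete geodesic graph structures -/

section CompleteGraph

variable {m : ℕ} [NeZero m] {M : Type*} [TopologicalSpace M]
  [ChartedSpace (EuclideanHalfSpace m) M] [IsManifold (𝓡∂ m) ∞ M] {n : ℕ}
  {g : SmoothMetric m M} {A₁ A₂ : HermitianConnection m M n}

lemma secondCountableTopology_tangentBundle [CompactSpace M] :
    SecondCountableTopology (TangentBundle (𝓡∂ m) M) := by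
  obtain ⟨s, hs⟩ := isCompact_univ.elim_nhds_subcover
    (fun x : M => (chartAt (EuclideanHalfSpace m) x).source) fun x _ => chart_source_mem_nhds _ x
  have : SecondCountableTopology (EuclideanHalfSpace m) :=
    inferInstanceAs (SecondCountableTopology {x : EucM m // 0 ≤ x 0})
  have : SecondCountableTopology (ModelProd (EuclideanHalfSpace m) (EucM m)) :=
    inferInstanceAs (SecondCountableTopology (EuclideanHalfSpace m × EucM m))
  refine ChartedSpace.secondCountable_of_countable_cover (ModelProd (EuclideanHalfSpace m) (EucM m))
    (s := (fun x : M => (⟨x, 0⟩ : TangentBundle (𝓡∂ m) M)) '' (s : Set M)) ?_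
    (s.countable_toSet.image _)
  rw [Set.eq_univ_iff_forall]
  intro q
  obtain ⟨x, hx, hq⟩ := Set.mem_iUnion₂.1 (hs.2 (Set.mem_univ q.proj))
  refine Set.mem_iUnion₂.2 ⟨⟨x, 0⟩, ⟨x, hx, rfl⟩, ?_⟩
  exact (TangentBundle.mem_chart_source_iff (I := 𝓡∂ m) q ⟨x, 0⟩).2 hq

/-- Embedded submanifolds of the tangent bundle are countable unions of compact sets. -/
lemma IsEmbeddedSubmanifold.exists_isCompact_cover [CompactSpace M]
    {U : Set (TangentBundle (𝓡∂ m) M)} (hU : IsEmbeddedSubmanifold U) :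
    ∃ C : ℕ → Set (TangentBundle (𝓡∂ m) M), (∀ i, IsCompact (C i) ∧ C i ⊆ U) ∧ U ⊆ ⋃ i, C i := by
  have := secondCountableTopology_tangentBundle (m := m) (M := M)
  obtain ⟨k, hk⟩ := hU
  have hloc : ∀ q ∈ U, ∃ C : Set (TangentBundle (𝓡∂ m) M),
      (IsCompact C ∧ C ⊆ U) ∧ C ∈ 𝓝[U] q := by
    intro q hq
    obtain ⟨Φ, L, hqΦ, -, -, -, hL⟩ := hk q hq
    obtain ⟨r, hr, hball⟩ := Metric.nhds_basis_closedBall.mem_iff.1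
      (Φ.open_target.mem_nhds (Φ.map_source hqΦ))
    refine ⟨Φ.symm '' (Metric.closedBall (Φ q) r ∩ L), ⟨?_, ?_⟩, ?_⟩
    · exact
        ((isCompact_closedBall _ _).inter_right L.closed_of_finiteDimensional).image_of_continuousOn
        (Φ.continuousOn_symm.mono fun z hz => hball hz.1)
    · rintro _ ⟨z, hz, rfl⟩
      refine (hL _ (Φ.map_target (hball hz.1))).2 ?_
      rw [Φ.right_inv (hball hz.1)]
      exact hz.2
    · have h1 : Φ ⁻¹' Metric.closedBall (Φ q) r ∈ 𝓝 q :=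
        (Φ.continuousAt hqΦ).preimage_mem_nhds (Metric.closedBall_mem_nhds _ hr)
      filter_upwards [self_mem_nhdsWithin, mem_nhdsWithin_of_mem_nhds h1,
        mem_nhdsWithin_of_mem_nhds (Φ.open_source.mem_nhds hqΦ)] with z hz1 hz2 hz3
      exact ⟨Φ z, ⟨hz2, (hL z hz3).1 hz1⟩, Φ.left_inv hz3⟩
  choose! C hC hCn using hloc
  obtain ⟨t, htU, htc, hcov⟩ := TopologicalSpace.countable_cover_nhdsWithin hCn
  rcases t.eq_empty_or_nonempty with rfl | hne
  · exact ⟨fun _ => ∅, fun _ => ⟨isCompact_empty, Set.empty_subset _⟩, by simpa using hcov⟩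
  · obtain ⟨u, rfl⟩ := htc.exists_eq_range hne
    refine ⟨fun i => C (u i), fun i => hC _ (htU (Set.mem_range_self i)), ?_⟩
    rwa [Set.biUnion_range] at hcov

lemma continuousOn_image_of_isCompact {X Y Z : Type*} [TopologicalSpace X] [TopologicalSpace Y]
    [TopologicalSpace Z] [T2Space Y] {p : X → Y} {F : X → Z} {φ : Y → Z} {C : Set X}
    (hC : IsCompact C) (hp : ContinuousOn p C) (hF : ContinuousOn F C)
    (hφ : ∀ x ∈ C, φ (p x) = F x) : ContinuousOn φ (p '' C) := by
  rw [continuousOn_iff_isClosed]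
  intro t ht
  obtain ⟨u, hu, hut⟩ := continuousOn_iff_isClosed.1 hF t ht
  refine ⟨p '' (u ∩ C), ((hC.inter_left hu).image_of_continuousOn
    (hp.mono Set.inter_subset_right)).isClosed, ?_⟩
  rw [← hut]
  ext y
  constructor
  · rintro ⟨hy, x, hx, rfl⟩
    exact ⟨⟨x, ⟨by rw [Set.mem_preimage, ← hφ x hx]; exact hy, hx⟩, rfl⟩, ⟨x, hx, rfl⟩⟩
  · rintro ⟨⟨x, ⟨hx, hxC⟩, rfl⟩, hy⟩
    exact ⟨by rw [Set.mem_preimage, hφ x hxC]; exact hx, hy⟩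

variable (g A₁ A₂) in
open Classical in
/-- The ratio of the parallel transports at `x` in some direction of the set `V` (and `1` if there
is none). -/
noncomputable def transportRatio (V : Set (TangentBundle (𝓡∂ m) M)) (x : M) : EndC n :=
  if h : ∃ v : TangentSpace (𝓡∂ m) x, (⟨x, v⟩ : TangentBundle (𝓡∂ m) M) ∈ V then
    star (geodesicTransport g A₁ x h.choose) * geodesicTransport g A₂ x h.choose
  else 1

lemma transportRatio_eq {V : Set (TangentBundle (𝓡∂ m) M)}
    (h : ∀ (x : M) (v w : TangentSpace (𝓡∂ m) x), (⟨x, v⟩ : TangentBundle (𝓡∂ m) M) ∈ V →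
      (⟨x, w⟩ : TangentBundle (𝓡∂ m) M) ∈ V →
      star (geodesicTransport g A₁ x v) * geodesicTransport g A₂ x v =
        star (geodesicTransport g A₁ x w) * geodesicTransport g A₂ x w)
    {q : TangentBundle (𝓡∂ m) M} (hq : q ∈ V) :
    transportRatio g A₁ A₂ V q.proj =
      star (geodesicTransport g A₁ q.proj q.snd) * geodesicTransport g A₂ q.proj q.snd := by
  have hex : ∃ v : TangentSpace (𝓡∂ m) q.proj, (⟨q.proj, v⟩ : TangentBundle (𝓡∂ m) M) ∈ V :=
    ⟨q.snd, hq⟩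
  rw [transportRatio, dif_pos hex]
  exact h _ _ _ hex.choose_spec hq

lemma continuousOn_star_mul_geodesicTransport [T2Space M] (A₁ A₂ : HermitianConnection m M n) :
    ContinuousOn (fun q : TangentBundle (𝓡∂ m) M => star (geodesicTransport g A₁ q.proj q.snd) *
      geodesicTransport g A₂ q.proj q.snd) {q | IsNontangential g q.proj q.snd} := by
  have hc : Continuous (star : EndC n → EndC n) :=
    (NormedStarGroup.to_continuousStar (E := EndC n)).continuous_star
  exact (hc.comp_continuousOn (continuousOn_geodesicTransport A₁)).mul
    (continuousOn_geodesicTransport A₂)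

/-- For complete geodesic graph structures, agreement of the broken X-ray transforms implies
gauge equivalence. -/
theorem GeodesicGraph.IsComplete.gaugeEquivalent [T2Space M] [CompactSpace M]
    {G : GeodesicGraph g} (hG : G.IsComplete) (h : G.XrayAgree A₁ A₂) : GaugeEquivalent A₁ A₂ := by
  set V : Set (TangentBundle (𝓡∂ m) M) := {q | q.snd ∈ G.V q.proj} with hV
  have hn : ∀ q ∈ V, IsNontangential g q.proj q.snd := fun q hq => G.nontangential _ _ hq
  have hratio : ∀ (x : M) (v w : TangentSpace (𝓡∂ m) x), v ∈ G.V x → w ∈ G.V x →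
      star (geodesicTransport g A₁ x v) * geodesicTransport g A₂ x v =
        star (geodesicTransport g A₁ x w) * geodesicTransport g A₂ x w := by
    intro x v w hv hw
    by_cases hvw : v = w
    · rw [hvw]
    have hx : x ∈ (𝓡∂ m).interior M :=
      IsNontangential.mem_interior (q := ⟨x, v⟩) (G.nontangential x v hv)
    have hstep : ∀ a b : TangentSpace (𝓡∂ m) x, G.E x a b →
        star (geodesicTransport g A₁ x a) * geodesicTransport g A₂ x a =
        star (geodesicTransport g A₁ x b) * geodesicTransport g A₂ x b := fun a b hab => by
      obtain ⟨ha, hb, -, -⟩ := G.edges x a b hab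
      exact (brokenXray_eq_iff (G.nontangential x a ha) (G.nontangential x b hb)).1 (h x a b hab)
    have hpath := hG.connected x hx v hv w hw hvw
    clear hvw hw
    induction hpath with
    | single hab => exact hstep _ _ hab
    | tail _ hab ih => exact ih.trans (hstep _ _ hab)
  have heq := fun q (hq : q ∈ V) => transportRatio_eq (g := g) (A₁ := A₁) (A₂ := A₂) (V := V)
    (fun x v w hv hw => hratio x v w hv hw) hq
  refine IsTransportRatio.gaugeEquivalent (g := g) (V := V) (φ := transportRatio g A₁ A₂ V)
    ⟨hn, heq, fun x hx => ?_, fun x hx => ?_, ?_⟩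
  · obtain ⟨v, -, hspan, hv⟩ := hG.spanning x hx
    refine ⟨Set.range v, hspan, ?_⟩
    rintro _ ⟨i, rfl⟩
    obtain ⟨ε, hε, γ, hγ, hγ0, hγV⟩ := hv i
    exact ⟨ε, hε, tangentLift γ (Set.Ioo (-ε) ε), hγ0, fun t ht =>
      ⟨hγ.isSprayAt (uniqueDiffOn_Ioo _ _) ht, hγV t ht⟩⟩
  · obtain ⟨U, -, hUs, hUV, hxU⟩ := hG.submanifold x hx
    obtain ⟨C, hC, hcov⟩ := hUs.exists_isCompact_cover
    refine ⟨_, isOpen_interior, hxU, fun i => (fun p : TangentBundle (𝓡∂ m) M => p.proj) '' C i,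
      fun i => ((hC i).1.image continuous_tangentBundle_proj).isClosed, ?_, fun i => ?_⟩
    · rintro _ hy
      obtain ⟨q, hq, rfl⟩ := interior_subset hy
      obtain ⟨i, hi⟩ := Set.mem_iUnion.1 (hcov hq)
      exact Set.mem_iUnion.2 ⟨i, q, hi, rfl⟩
    · refine (continuousOn_image_of_isCompact (hC i).1 continuous_tangentBundle_proj.continuousOn
        ((continuousOn_star_mul_geodesicTransport (g := g) A₁ A₂).mono fun q hq =>
          hn q (hUV q ((hC i).2 hq))) fun q hq => ?_).mono Set.inter_subset_left
      exact heq q (hUV q ((hC i).2 hq))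
  · refine hG.dense_endpoints.trans (closure_mono ?_)
    rintro y ⟨x, v, hv, rfl⟩
    exact ⟨⟨x, v⟩, hv, rfl⟩

end CompleteGraph

/-! ### Short geodesics with given end points -/

section BoundaryValueProblem

variable {E : Type*} [NormedAddCommGroup E] [NormedSpace ℝ E]

lemma norm_primitive_sub_le {f h : ℝ → E} (hf : Continuous f) (hh : Continuous h) {C : ℝ}
    (hC : ∀ s ∈ Set.Icc (0 : ℝ) 1, ‖f s - h s‖ ≤ C) {t : ℝ} (ht : t ∈ Set.Icc (0 : ℝ) 1) :
    ‖(∫ s in (0 : ℝ)..t, f s) - ∫ s in (0 : ℝ)..t, h s‖ ≤ C := by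
  rw [← intervalIntegral.integral_sub (hf.intervalIntegrable _ _) (hh.intervalIntegrable _ _)]
  have h0 : 0 ≤ C := (norm_nonneg _).trans (hC t ht)
  refine (intervalIntegral.norm_integral_le_of_norm_le_const (C := C) fun s hs => ?_).trans ?_
  · rw [Set.uIoc_of_le ht.1] at hs
    exact hC s ⟨hs.1.le, hs.2.trans ht.2⟩
  · rw [sub_zero, abs_of_nonneg ht.1]
    exact mul_le_of_le_one_right h0 ht.2

/-- Solvability of the boundary value problem `σ'' = F(σ, σ')`, `σ(0) = a`, `σ(1) = b` for
nonlinearities `F` with a small Lipschitz constant, by a contraction argument for `σ'`. -/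
theorem exists_boundary_value_solution [CompleteSpace E] {F : E × E → E} {k : NNReal}
    (hF : LipschitzWith k F)
    (hk : (k : ℝ) ≤ 1 / 4) {y₀ : E} (hF0 : F (y₀, 0) = 0) {a b : E} {ρ : ℝ}
    (ha : ‖a - y₀‖ ≤ ρ) (hb : ‖b - y₀‖ ≤ ρ) :
    ∃ σ u : ℝ → E, σ 0 = a ∧ σ 1 = b ∧ ∀ t ∈ Set.Icc (0 : ℝ) 1,
      HasDerivWithinAt σ (u t) (Set.Icc 0 1) t ∧
      HasDerivWithinAt u (F (σ t, u t)) (Set.Icc 0 1) t ∧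
      ‖σ t - y₀‖ ≤ 6 * ρ ∧ ‖u t‖ ≤ 6 * ρ := by
  have h01 : (0 : ℝ) ≤ 1 := zero_le_one
  -- the curve with velocity `u` and the nonlinearity along it
  let e : C(Set.Icc (0 : ℝ) 1, E) → ℝ → E := fun u => Set.IccExtend h01 u
  have he : ∀ u, Continuous (e u) := fun u => u.continuous.Icc_extend'
  have hJ : ∀ {f : ℝ → E}, Continuous f → Continuous fun t => ∫ s in (0 : ℝ)..t, f s := fun hf =>
    intervalIntegral.continuous_primitive (fun _ _ => hf.intervalIntegrable _ _) 0
  let σ : C(Set.Icc (0 : ℝ) 1, E) → ℝ → E := fun u t => a + ∫ s in (0 : ℝ)..t, e u s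
  have hσ : ∀ u, Continuous (σ u) := fun u => continuous_const.add (hJ (he u))
  let f : C(Set.Icc (0 : ℝ) 1, E) → ℝ → E := fun u s => F (σ u s, e u s)
  have hf : ∀ u, Continuous (f u) := fun u => hF.continuous.comp ((hσ u).prodMk (he u))
  let U : C(Set.Icc (0 : ℝ) 1, E) → ℝ → E := fun u t => (b - a) + (∫ s in (0 : ℝ)..t, f u s) -
    ∫ r in (0 : ℝ)..1, ∫ s in (0 : ℝ)..r, f u s
  have hU : ∀ u, Continuous (U u) := fun u => (continuous_const.add (hJ (hf u))).sub
    continuous_const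
  let Φ : C(Set.Icc (0 : ℝ) 1, E) → C(Set.Icc (0 : ℝ) 1, E) := fun u =>
    ⟨fun t => U u t, (hU u).comp continuous_subtype_val⟩
  have heu : ∀ u, ∀ t (ht : t ∈ Set.Icc (0 : ℝ) 1), e u t = u ⟨t, ht⟩ := fun u t ht =>
    Set.IccExtend_of_mem h01 u ht
  have hdist : ∀ u v, ∀ t ∈ Set.Icc (0 : ℝ) 1, ‖e u t - e v t‖ ≤ dist u v := by
    intro u v t ht
    rw [heu u t ht, heu v t ht, ← dist_eq_norm]
    exact ContinuousMap.dist_apply_le_dist _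
  have hfd : ∀ u v, ∀ t ∈ Set.Icc (0 : ℝ) 1, ‖f u t - f v t‖ ≤ k * dist u v := by
    intro u v t ht
    rw [← dist_eq_norm]
    refine (hF.dist_le_mul _ _).trans (mul_le_mul_of_nonneg_left ?_ k.2)
    rw [Prod.dist_eq, dist_eq_norm, dist_eq_norm]
    refine max_le ?_ (hdist u v t ht)
    rw [add_sub_add_left_eq_sub]
    exact norm_primitive_sub_le (he u) (he v) (hdist u v) ht
  have hΦ : ContractingWith (1 / 2) Φ := by
    refine ⟨by norm_num, LipschitzWith.of_dist_le_mul fun u v => ?_⟩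
    refine (ContinuousMap.dist_le (by positivity)).2 fun t => ?_
    have h1 := norm_primitive_sub_le (hf u) (hf v) (hfd u v) t.2
    have h2 := norm_primitive_sub_le (hJ (hf u)) (hJ (hf v))
      (fun s hs => norm_primitive_sub_le (hf u) (hf v) (hfd u v) hs) (t := 1) ⟨h01, le_rfl⟩
    have h3 : ∀ c p q p' q' : E, c + p - q - (c + p' - q') = (p - p') - (q - q') := by
      intros; abel
    change dist (U u t) (U v t) ≤ _
    rw [dist_eq_norm, h3]
    refine (norm_sub_le _ _).trans ((add_le_add h1 h2).trans ?_)
    have h4 : (((1 / 2 : NNReal)) : ℝ) = 1 / 2 := by norm_num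
    rw [h4]
    nlinarith [dist_nonneg (x := u) (y := v)]
  obtain ⟨u, hu, -⟩ := hΦ.exists_fixedPoint (0 : C(Set.Icc (0 : ℝ) 1, E)) (edist_ne_top _ _)
  have hu' : ∀ t ∈ Set.Icc (0 : ℝ) 1, e u t = U u t := fun t ht => by
    rw [heu u t ht]
    exact (congrArg (fun w : C(Set.Icc (0 : ℝ) 1, E) => w ⟨t, ht⟩) hu).symm
  have hσu : ∀ t ∈ Set.Icc (0 : ℝ) 1, ‖σ u t - y₀‖ ≤ ρ + ‖u‖ := by
    intro t ht
    have h1 := norm_primitive_sub_le (he u) (continuous_const (y := (0 : E))) (C := ‖u‖)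
      (fun s hs => by rw [sub_zero, heu u s hs]; exact u.norm_coe_le_norm _) ht
    simp only [intervalIntegral.integral_zero, sub_zero] at h1
    have h2 : σ u t - y₀ = (a - y₀) + ∫ s in (0 : ℝ)..t, e u s := by
      simp only [σ]; abel
    rw [h2]
    exact (norm_add_le _ _).trans (add_le_add ha h1)
  have hnu : ‖u‖ ≤ 5 * ρ := by
    have hρ : 0 ≤ ρ := (norm_nonneg _).trans ha
    have hfu : ∀ s ∈ Set.Icc (0 : ℝ) 1, ‖f u s - 0‖ ≤ (ρ + ‖u‖) / 4 := by
      intro s hs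
      rw [← hF0, ← dist_eq_norm]
      refine (hF.dist_le_mul _ _).trans ?_
      have h1 : dist (σ u s, e u s) (y₀, 0) ≤ ρ + ‖u‖ := by
        rw [Prod.dist_eq, dist_eq_norm, dist_eq_norm]
        refine max_le (hσu s hs) ?_
        rw [sub_zero, heu u s hs]
        linarith [u.norm_coe_le_norm ⟨s, hs⟩]
      calc (k : ℝ) * dist (σ u s, e u s) (y₀, 0) ≤ 1 / 4 * (ρ + ‖u‖) :=
            mul_le_mul hk h1 dist_nonneg (by norm_num)
        _ = (ρ + ‖u‖) / 4 := by ring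
    have hJf := fun t (ht : t ∈ Set.Icc (0 : ℝ) 1) =>
      norm_primitive_sub_le (hf u) (continuous_const (y := (0 : E))) hfu ht
    have hJJ := norm_primitive_sub_le (hJ (hf u)) (continuous_const (y := (0 : E))) (fun t ht => by
      have := hJf t ht
      rwa [intervalIntegral.integral_zero] at this) (t := 1) ⟨h01, le_rfl⟩
    simp only [intervalIntegral.integral_zero, sub_zero] at hJf hJJ
    have hab : ‖b - a‖ ≤ 2 * ρ := by
      rw [← sub_sub_sub_cancel_right b a y₀]
      exact (norm_sub_le _ _).trans (by linarith)
    have h1 : ‖u‖ ≤ 2 * ρ + (ρ + ‖u‖) / 4 + (ρ + ‖u‖) / 4 := by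
      refine (ContinuousMap.norm_le _ (by positivity)).2 fun t => ?_
      rw [← heu u t t.2, hu' t t.2]
      refine (norm_sub_le _ _).trans (add_le_add ((norm_add_le _ _).trans
        (add_le_add hab (hJf t t.2))) hJJ)
    linarith
  refine ⟨σ u, e u, by simp [σ], ?_, fun t ht => ⟨?_, ?_, ?_, ?_⟩⟩
  · have h1 : ∫ s in (0 : ℝ)..1, e u s = ∫ s in (0 : ℝ)..1, U u s :=
      intervalIntegral.integral_congr fun s hs => hu' s (by rwa [Set.uIcc_of_le h01] at hs)
    have h2 : ∫ s in (0 : ℝ)..1, U u s = b - a := by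
      simp only [U]
      rw [intervalIntegral.integral_sub, intervalIntegral.integral_add]
      · simp
      · exact continuous_const.intervalIntegrable _ _
      · exact (hJ (hf u)).intervalIntegrable _ _
      · exact (continuous_const.add (hJ (hf u))).intervalIntegrable _ _
      · exact continuous_const.intervalIntegrable _ _
    simp only [σ]
    rw [h1, h2, add_sub_cancel]
  · exact (((he u).integral_hasStrictDerivAt 0 t).hasDerivAt.const_add a).hasDerivWithinAt
  · have h1 := (((hf u).integral_hasStrictDerivAt 0 t).hasDerivAt.const_add (b - a)).sub_const
      (∫ r in (0 : ℝ)..1, ∫ s in (0 : ℝ)..r, f u s)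
    exact h1.hasDerivWithinAt.congr (fun s hs => hu' s hs) (hu' t ht)
  · linarith [hσu t ht, (norm_nonneg (a - y₀)).trans ha]
  · rw [heu u t ht]
    linarith [u.norm_coe_le_norm ⟨t, ht⟩, (norm_nonneg (a - y₀)).trans ha]

end BoundaryValueProblem

section ShortGeodesics

variable {m : ℕ} [NeZero m] {M : Type*} [TopologicalSpace M]
  [ChartedSpace (EuclideanHalfSpace m) M] [IsManifold (𝓡∂ m) ∞ M] {g : SmoothMetric m M}

lemma christoffelForm_smul (g : SmoothMetric m M) (p : M) (y w : EucM m) (c : ℝ) :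
    christoffelForm g p y (c • w) = (c ^ 2) • christoffelForm g p y w := by
  ext b
  simp only [christoffelForm, map_smul, smul_apply, sub_apply, ContinuousLinearMap.flip_apply,
    smul_eq_mul]
  ring

lemma geodesicAcc_smul (g : SmoothMetric m M) (p : M) (y w : EucM m) (c : ℝ) :
    geodesicAcc g p y (c • w) = (c ^ 2) • geodesicAcc g p y w := by
  rw [geodesicAcc, geodesicAcc, christoffelForm_smul, map_smul, smul_neg]

lemma geodesicAcc_zero (g : SmoothMetric m M) (p : M) (y : EucM m) :
    geodesicAcc g p y 0 = 0 := by
  have := geodesicAcc_smul g p y 0 0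
  simpa using this

lemma contDiffAt_geodesicAcc (g : SmoothMetric m M) {p : M} {z : EucM m × EucM m}
    (hz : z.1 ∈ interior (extChartAt (𝓡∂ m) p).target) :
    ContDiffAt ℝ ∞ (fun z : EucM m × EucM m => geodesicAcc g p z.1 z.2) z := by
  refine (contDiffWithinAt_geodesicAcc g (interior_subset hz)).contDiffAt ?_
  refine prod_mem_nhds (mem_interior_iff_mem_nhds.1 (interior_mono ?_ hz)) Filter.univ_mem
  exact fun y hy => mem_range_of_mem_target hy

/-- The acceleration is quadratic in the velocity, so its derivative vanishes at zero velocity. -/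
lemma hasStrictFDerivAt_geodesicAcc (g : SmoothMetric m M) {p : M} {y : EucM m}
    (hy : y ∈ interior (extChartAt (𝓡∂ m) p).target) :
    HasStrictFDerivAt (fun z : EucM m × EucM m => geodesicAcc g p z.1 z.2)
      (0 : EucM m × EucM m →L[ℝ] EucM m) (y, 0) := by
  have h := (contDiffAt_geodesicAcc g (z := (y, 0)) hy).hasStrictFDerivAt (by simp)
  set D := fderiv ℝ (fun z : EucM m × EucM m => geodesicAcc g p z.1 z.2) (y, 0) with hD
  suffices hD0 : D = 0 by rwa [hD0] at h
  have hdir : ∀ v : EucM m × EucM m, HasDerivAt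
      (fun t : ℝ => geodesicAcc g p (y + t • v.1) (t • v.2)) (D v) 0 := by
    intro v
    have h1 : HasDerivAt (fun t : ℝ => (y, (0 : EucM m)) + t • v) v 0 := by
      simpa using ((hasDerivAt_id (0 : ℝ)).smul_const v).const_add (y, (0 : EucM m))
    have h2 := (HasFDerivAt.comp_hasDerivAt (0 : ℝ) (f := fun t : ℝ => (y, (0 : EucM m)) + t • v)
      (by simpa using h.hasFDerivAt) h1)
    simpa [Function.comp_def] using h2
  have h1 : ∀ v : EucM m, D (v, 0) = 0 := fun v => by
    refine (hdir (v, 0)).unique ?_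
    simp only [smul_zero, geodesicAcc_zero]
    exact hasDerivAt_const _ _
  have h2 : ∀ w : EucM m, D (0, w) = 0 := fun w => by
    refine (hdir (0, w)).unique ?_
    simp only [smul_zero, add_zero, geodesicAcc_smul]
    simpa using ((hasDerivAt_id (0 : ℝ)).pow 2).smul_const (geodesicAcc g p y w)
  refine ContinuousLinearMap.ext fun v => ?_
  rw [show v = (v.1, 0) + (0, v.2) by simp, map_add, h1, h2]
  simp

/-- In a chart, close points can be joined by short geodesics. -/
lemma exists_short_geodesic (g : SmoothMetric m M) {p : M} {y₀ : EucM m}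
    (hy : y₀ ∈ interior (extChartAt (𝓡∂ m) p).target) {r : ℝ} (hr : 0 < r) :
    ∃ ρ > 0, ∀ a b : EucM m, ‖a - y₀‖ ≤ ρ → ‖b - y₀‖ ≤ ρ →
      ∃ σ u : ℝ → EucM m, σ 0 = a ∧ σ 1 = b ∧ ∀ t ∈ Set.Icc (0 : ℝ) 1,
        HasDerivWithinAt σ (u t) (Set.Icc 0 1) t ∧
        HasDerivWithinAt u (geodesicAcc g p (σ t) (u t)) (Set.Icc 0 1) t ∧
        ‖σ t - y₀‖ ≤ r ∧ ‖u t‖ ≤ r := by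
  set κ := lipschitzExtensionConstant (EucM m) with hκ
  have hκpos : 0 < κ := lipschitzExtensionConstant_pos _
  obtain ⟨s, hs, hlip⟩ := (hasStrictFDerivAt_geodesicAcc g hy).exists_lipschitzOnWith_of_nnnorm_lt
    (1 / (4 * κ)) (by simpa using hκpos)
  obtain ⟨F, hF, hFs⟩ := hlip.extend_finite_dimension
  obtain ⟨r', hr', hball⟩ := Metric.nhds_basis_closedBall.mem_iff.1 hs
  have hFk : ((κ * (1 / (4 * κ)) : NNReal) : ℝ) ≤ 1 / 4 := by
    have : (κ : ℝ) ≠ 0 := by exact_mod_cast hκpos.ne'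
    push_cast
    field_simp
    norm_num
  have hF0 : F (y₀, 0) = 0 :=
    (hFs (hball (Metric.mem_closedBall_self hr'.le))).symm.trans (geodesicAcc_zero g p y₀)
  refine ⟨min r r' / 6, by positivity, fun a b ha hb => ?_⟩
  obtain ⟨σ, u, h0, h1, h⟩ := exists_boundary_value_solution hF hFk hF0 ha hb
  refine ⟨σ, u, h0, h1, fun t ht => ?_⟩
  obtain ⟨h2, h3, h4, h5⟩ := h t ht
  rw [mul_div_cancel₀ _ (by norm_num : (6 : ℝ) ≠ 0)] at h4 h5
  have h6 : (σ t, u t) ∈ s := by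
    refine hball ?_
    rw [Metric.mem_closedBall, Prod.dist_eq, dist_eq_norm, dist_eq_norm, sub_zero]
    exact max_le (h4.trans (min_le_right _ _)) (h5.trans (min_le_right _ _))
  refine ⟨h2, ?_, h4.trans (min_le_left _ _), h5.trans (min_le_left _ _)⟩
  have h7 := hFs h6
  rwa [← h7] at h3

end ShortGeodesics

/-! ### Short geodesics minimize the energy -/

section EnergyComparison

variable {m : ℕ} [NeZero m] {M : Type*} [TopologicalSpace M]
  [ChartedSpace (EuclideanHalfSpace m) M] [IsManifold (𝓡∂ m) ∞ M] {g : SmoothMetric m M}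

lemma hasFDerivAt_chartForm (g : SmoothMetric m M) {p : M} {y : EucM m}
    (hy : y ∈ interior (extChartAt (𝓡∂ m) p).target) :
    HasFDerivAt (chartForm g p) (chartFormDeriv g p y) y :=
  (hasFDerivWithinAt_chartForm g (interior_subset hy)).hasFDerivAt
    (mem_interior_iff_mem_nhds.1 (interior_mono (fun _ hz => mem_range_of_mem_target hz) hy))

lemma chartForm_geodesicAcc (g : SmoothMetric m M) {p : M} {y : EucM m}
    (hy : y ∈ (extChartAt (𝓡∂ m) p).target) (w b : EucM m) :
    chartForm g p y (geodesicAcc g p y w) b =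
      -(chartFormDeriv g p y w w b) + 1 / 2 * chartFormDeriv g p y b w w := by
  have h1 := (eq_geodesicAcc_iff g hy w _).1 rfl b
  rw [christoffel_eq g hy] at h1
  linarith

/-- The metric is bounded below by a multiple of the Euclidean metric. -/
lemma exists_le_chartForm (g : SmoothMetric m M) {p : M} {y : EucM m}
    (hy : y ∈ (extChartAt (𝓡∂ m) p).target) :
    ∃ μ > 0, ∀ w : EucM m, μ * ‖w‖ ^ 2 ≤ chartForm g p y w w := by
  have hc : Continuous fun w : EucM m => chartForm g p y w w :=
    (chartForm g p y).continuous.clm_apply continuous_id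
  obtain ⟨w₀, hw₀⟩ : ∃ w₀ : EucM m, w₀ ≠ 0 := exists_ne 0
  have hne : (Metric.sphere (0 : EucM m) 1).Nonempty := NormedSpace.sphere_nonempty.2 zero_le_one
  obtain ⟨v, hv, hmin⟩ := (isCompact_sphere (0 : EucM m) 1).exists_isMinOn hne hc.continuousOn
  have hv1 : ‖v‖ = 1 := by simpa using hv
  refine ⟨chartForm g p y v v, chartForm_pos g hy (by rintro rfl; simp at hv1), fun w => ?_⟩
  by_cases hw : w = 0
  · simp [hw]
  have hwn : ‖w‖ ≠ 0 := norm_ne_zero_iff.2 hw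
  have h1 : chartForm g p y v v ≤ chartForm g p y (‖w‖⁻¹ • w) (‖w‖⁻¹ • w) :=
    hmin (by simp [norm_smul, hwn])
  rw [map_smul, map_smul, smul_apply, smul_eq_mul, smul_eq_mul] at h1
  calc _ ≤ ‖w‖⁻¹ * (‖w‖⁻¹ * chartForm g p y w w) * ‖w‖ ^ 2 := by gcongr
    _ = chartForm g p y w w := by field_simp

lemma abs_apply_apply_le {E : Type*} [NormedAddCommGroup E] [NormedSpace ℝ E]
    (B : E →L[ℝ] E →L[ℝ] ℝ) {C : ℝ} (hB : ‖B‖ ≤ C) (v w : E) : |B v w| ≤ C * ‖v‖ * ‖w‖ := by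
  have h1 := B.le_opNorm₂ v w
  rw [Real.norm_eq_abs] at h1
  exact h1.trans (by gcongr)

/-- Uniform ellipticity and second order estimates for the metric near an interior point. -/
lemma exists_chartForm_bounds (g : SmoothMetric m M) {p : M} {y₀ : EucM m}
    (hy : y₀ ∈ interior (extChartAt (𝓡∂ m) p).target) :
    ∃ μ > 0, ∃ C > 0, ∃ r > 0,
      Metric.closedBall y₀ r ⊆ interior (extChartAt (𝓡∂ m) p).target ∧
      (∀ z ∈ Metric.closedBall y₀ r, ∀ w, μ * ‖w‖ ^ 2 ≤ chartForm g p z w w) ∧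
      (∀ z ∈ Metric.closedBall y₀ r, ∀ z' ∈ Metric.closedBall y₀ r,
        ‖chartForm g p z' - chartForm g p z‖ ≤ C * ‖z' - z‖ ∧
        ‖chartForm g p z' - chartForm g p z - chartFormDeriv g p z (z' - z)‖ ≤
          C * ‖z' - z‖ ^ 2) := by
  have hnhds : Set.range (𝓡∂ m) ∈ 𝓝 y₀ :=
    mem_interior_iff_mem_nhds.1 (interior_mono (fun _ hz => mem_range_of_mem_target hz) hy)
  obtain ⟨μ, hμ, hμw⟩ := exists_le_chartForm g (interior_subset hy)
  obtain ⟨K₁, s₁, hs₁, hK₁⟩ := ((contDiffWithinAt_chartForm g (interior_subset hy)).contDiffAt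
    hnhds).of_le (m := 1) (by simp) |>.exists_lipschitzOnWith
  obtain ⟨K₂, s₂, hs₂, hK₂⟩ := ((contDiffWithinAt_chartFormDeriv g (interior_subset hy)).contDiffAt
    hnhds).of_le (m := 1) (by simp) |>.exists_lipschitzOnWith
  have hclose : ∀ᶠ z in 𝓝 y₀, ‖chartForm g p z - chartForm g p y₀‖ < μ / 2 := by
    have := Metric.tendsto_nhds.1 (hasFDerivAt_chartForm g hy).continuousAt.tendsto _ (half_pos hμ)
    simpa only [dist_eq_norm] using this
  obtain ⟨r, hr, hball⟩ := Metric.nhds_basis_closedBall.mem_iff.1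
    (Filter.inter_mem (isOpen_interior.mem_nhds hy) (Filter.inter_mem hclose
      (Filter.inter_mem hs₁ hs₂)))
  refine ⟨μ / 2, half_pos hμ, K₁ + K₂ + 1, by positivity, r, hr, fun z hz => (hball hz).1,
    fun z hz w => ?_, fun z hz z' hz' => ⟨?_, ?_⟩⟩
  · have h1 := abs_apply_apply_le _ (hball hz).2.1.le w w
    rw [sub_apply, sub_apply, abs_le] at h1
    nlinarith [hμw w, h1.1]
  · have h1 := hK₁.dist_le_mul z' (hball hz').2.2.1 z (hball hz).2.2.1
    rw [dist_eq_norm, dist_eq_norm] at h1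
    refine h1.trans ?_
    have : (0 : ℝ) ≤ K₂ := K₂.2
    gcongr
    linarith
  · have hseg : segment ℝ z z' ⊆ Metric.closedBall y₀ r :=
      (convex_closedBall y₀ r).segment_subset hz hz'
    have h1 := (convex_segment z z').norm_image_sub_le_of_norm_hasFDerivWithin_le'
      (f := chartForm g p) (f' := chartFormDeriv g p) (φ := chartFormDeriv g p z)
      (C := K₂ * ‖z' - z‖)
      (fun x hx => (hasFDerivAt_chartForm g (hball (hseg hx)).1).hasFDerivWithinAt)
      (fun x hx => by
        have h2 := hK₂.dist_le_mul x (hball (hseg hx)).2.2.2 z (hball hz).2.2.2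
        rw [dist_eq_norm, dist_eq_norm] at h2
        refine h2.trans (mul_le_mul_of_nonneg_left ?_ K₂.2)
        exact norm_sub_le_of_mem_segment hx)
      (left_mem_segment ℝ z z') (right_mem_segment ℝ z z')
    refine h1.trans ?_
    have : (0 : ℝ) ≤ K₁ := K₁.2
    nlinarith [sq_nonneg ‖z' - z‖]

/-- A solution of the geodesic equation in the chart at `p`, on the interval `[0, 1]`. -/
def IsChartGeodesic (g : SmoothMetric m M) (p : M) (σ u : ℝ → EucM m) : Prop :=
  ∀ t ∈ Set.Icc (0 : ℝ) 1, σ t ∈ interior (extChartAt (𝓡∂ m) p).target ∧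
    HasDerivWithinAt σ (u t) (Set.Icc 0 1) t ∧
    HasDerivWithinAt u (geodesicAcc g p (σ t) (u t)) (Set.Icc 0 1) t

variable {p : M} {σ u : ℝ → EucM m}

lemma IsChartGeodesic.hasDerivWithinAt_form (h : IsChartGeodesic g p σ u) {t : ℝ}
    (ht : t ∈ Set.Icc (0 : ℝ) 1) :
    HasDerivWithinAt (fun t => chartForm g p (σ t) (u t))
      (chartFormDeriv g p (σ t) (u t) (u t) +
        chartForm g p (σ t) (geodesicAcc g p (σ t) (u t))) (Set.Icc 0 1) t := by
  obtain ⟨h1, h2, h3⟩ := h t ht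
  exact ((hasFDerivAt_chartForm g h1).comp_hasDerivWithinAt t h2).clm_apply h3

/-- The speed of a geodesic is constant. -/
lemma IsChartGeodesic.energy_eq (h : IsChartGeodesic g p σ u) {t : ℝ}
    (ht : t ∈ Set.Icc (0 : ℝ) 1) :
    chartForm g p (σ t) (u t) (u t) = chartForm g p (σ 0) (u 0) (u 0) := by
  have hd : ∀ s ∈ Set.Icc (0 : ℝ) 1,
      HasDerivWithinAt (fun s => chartForm g p (σ s) (u s) (u s)) 0 (Set.Icc 0 1) s := by
    intro s hs
    refine ((h.hasDerivWithinAt_form hs).clm_apply (h s hs).2.2).congr_deriv ?_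
    have hs' := interior_subset (h s hs).1
    rw [add_apply, chartForm_symm g p (σ s) (u s), chartForm_geodesicAcc g hs']
    ring
  have := norm_image_sub_le_of_norm_deriv_le_segment' (C := 0) hd (by simp) t ht
  rw [zero_mul] at this
  exact sub_eq_zero.1 (norm_le_zero_iff.1 this)

lemma lipschitzOnWith_clm_apply {E : Type*} [NormedAddCommGroup E] [NormedSpace ℝ E]
    {L : ℝ → E →L[ℝ] ℝ} {η : ℝ → E} {K₁ K₂ : NNReal} {s : Set ℝ} (hs : IsCompact s)
    (hL : LipschitzOnWith K₁ L s) (hη : LipschitzOnWith K₂ η s) :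
    ∃ K : NNReal, LipschitzOnWith K (fun t => L t (η t)) s := by
  obtain ⟨C₁, hC₁⟩ := hs.exists_bound_of_continuousOn hL.continuousOn
  obtain ⟨C₂, hC₂⟩ := hs.exists_bound_of_continuousOn hη.continuousOn
  refine ⟨(C₁ * K₂ + C₂ * K₁).toNNReal, LipschitzOnWith.of_dist_le_mul fun t ht t' ht' => ?_⟩
  have h1 := hL.dist_le_mul t ht t' ht'
  have h2 := hη.dist_le_mul t ht t' ht'
  rw [dist_eq_norm] at h1 h2
  have h3 : L t (η t) - L t' (η t') = L t (η t - η t') + (L t - L t') (η t') := by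
    rw [map_sub, sub_apply]; abel
  have h4 : ‖L t (η t - η t')‖ ≤ C₁ * (K₂ * dist t t') :=
    ((L t).le_opNorm _).trans (mul_le_mul (hC₁ t ht) h2 (norm_nonneg _)
      ((norm_nonneg _).trans (hC₁ t ht)))
  have h5 : ‖(L t - L t') (η t')‖ ≤ K₁ * dist t t' * C₂ :=
    ((L t - L t').le_opNorm _).trans (mul_le_mul h1 (hC₂ t' ht') (norm_nonneg _) (by positivity))
  rw [dist_eq_norm, h3]
  refine (norm_add_le _ _).trans ((add_le_add h4 h5).trans ?_)
  have h6 := Real.le_coe_toNNReal (C₁ * K₂ + C₂ * K₁)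
  have h7 := mul_le_mul_of_nonneg_right h6 (dist_nonneg (x := t) (y := t'))
  linarith

lemma IsChartGeodesic.exists_lipschitzOnWith_form (h : IsChartGeodesic g p σ u) :
    ∃ K : NNReal, LipschitzOnWith K (fun t => chartForm g p (σ t) (u t)) (Set.Icc 0 1) := by
  have hσ : ContinuousOn σ (Set.Icc 0 1) := fun t ht => (h t ht).2.1.continuousWithinAt
  have hu : ContinuousOn u (Set.Icc 0 1) := fun t ht => (h t ht).2.2.continuousWithinAt
  have hG : ContinuousOn (fun t => chartForm g p (σ t)) (Set.Icc 0 1) := fun t ht =>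
    (hasFDerivAt_chartForm g (h t ht).1).continuousAt.comp_continuousWithinAt (hσ t ht)
  have hD : ContinuousOn (fun t => chartFormDeriv g p (σ t)) (Set.Icc 0 1) := fun t ht => by
    have h1 := (contDiffWithinAt_chartFormDeriv g (interior_subset (h t ht).1)).contDiffAt
      (mem_interior_iff_mem_nhds.1 (interior_mono (fun _ hz => mem_range_of_mem_target hz)
        (h t ht).1))
    exact h1.continuousAt.comp_continuousWithinAt (hσ t ht)
  have hA : ContinuousOn (fun t => geodesicAcc g p (σ t) (u t)) (Set.Icc 0 1) := fun t ht =>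
    ContinuousAt.comp_continuousWithinAt (f := fun t => (σ t, u t))
      (contDiffAt_geodesicAcc g (z := (σ t, u t)) (h t ht).1).continuousAt
      ((hσ t ht).prodMk (hu t ht))
  obtain ⟨C, hC⟩ := isCompact_Icc.exists_bound_of_continuousOn
    (((hD.clm_apply hu).clm_apply hu).add (hG.clm_apply hA))
  refine ⟨C.toNNReal, (convex_Icc 0 1).lipschitzOnWith_of_nnnorm_hasDerivWithin_le
    (fun t ht => h.hasDerivWithinAt_form ht) fun t ht => ?_⟩
  rw [← NNReal.coe_le_coe, coe_nnnorm]
  exact (hC t ht).trans (Real.le_coe_toNNReal _)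

/-- The pointwise estimate behind the energy comparison: `y` is the distance of the curves and `x`
the difference of their velocities. -/
lemma quadratic_estimate {μ C r x y : ℝ} (hμ : 0 < μ) (hx : 0 ≤ x) (hy : 0 ≤ y)
    (hr : 0 ≤ r) (hr1 : r ≤ 1) (hC : 64 * (C * r) ≤ μ) (hC0 : 0 ≤ C) :
    -(μ / 4 * y ^ 2) + μ / 2 * (y * x) + μ / 32 * y ^ 2 ≤
      μ * x ^ 2 - 2 * (C * y * r * x) - C * y ^ 2 * r * r := by
  have h1 : C * y * r * x ≤ μ / 64 * (x * y) := by
    have := mul_le_mul_of_nonneg_right hC (mul_nonneg hx hy)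
    nlinarith
  have h2 : C * y ^ 2 * r * r ≤ μ / 64 * y ^ 2 := by
    have h3 : C * r * r ≤ C * r := mul_le_of_le_one_right (by positivity) hr1
    have := mul_le_mul_of_nonneg_right (h3.trans (by linarith : C * r ≤ μ / 64)) (sq_nonneg y)
    nlinarith
  nlinarith [mul_nonneg hμ.le (sq_nonneg (x - 3 / 8 * y)), mul_nonneg hμ.le (mul_nonneg hx hy),
    mul_nonneg hμ.le (sq_nonneg y)]

/-- **Minimality of short geodesics.** A Lipschitz curve with the same end points as a short
geodesic and whose speed is almost everywhere at most that of the geodesic coincides with it.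
With `η = c - σ`, the function `2 g_σ(σ', η) - (μ/4) t |η|²` vanishes at both end points, and
by the geodesic equation and the bound on the speed its derivative is at most
`-(μ/32) |η|²`. -/
theorem exists_eqOn_of_speed_le (g : SmoothMetric m M) {p : M} {y₀ : EucM m}
    (hy : y₀ ∈ interior (extChartAt (𝓡∂ m) p).target) :
    ∃ r > 0, Metric.closedBall y₀ r ⊆ interior (extChartAt (𝓡∂ m) p).target ∧
      ∀ σ u c : ℝ → EucM m, ∀ K : NNReal, IsChartGeodesic g p σ u →
      (∀ t ∈ Set.Icc (0 : ℝ) 1, ‖σ t - y₀‖ ≤ r ∧ ‖u t‖ ≤ r ∧ ‖c t - y₀‖ ≤ r) →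
      LipschitzOnWith K c (Set.Icc 0 1) → c 0 = σ 0 → c 1 = σ 1 →
      (∀ t ∈ Set.Ioo (0 : ℝ) 1, ∀ ξ, HasDerivAt c ξ t →
        chartForm g p (c t) ξ ξ ≤ chartForm g p (σ 0) (u 0) (u 0)) →
      Set.EqOn c σ (Set.Icc 0 1) := by
  obtain ⟨μ, hμ, C, hC, r₀, hr₀, hball, hlow, hbd⟩ := exists_chartForm_bounds g hy
  obtain ⟨r, hr, hrr₀, hr1, hrC⟩ : ∃ r > 0, r ≤ r₀ ∧ r ≤ 1 ∧ 64 * (C * r) ≤ μ := by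
    refine ⟨min r₀ (min 1 (μ / (64 * C))), by positivity, min_le_left _ _,
      (min_le_right _ _).trans (min_le_left _ _), ?_⟩
    have h1 : min r₀ (min 1 (μ / (64 * C))) ≤ μ / (64 * C) :=
      (min_le_right _ _).trans (min_le_right _ _)
    calc _ ≤ 64 * (C * (μ / (64 * C))) := by gcongr
      _ = μ := by field_simp
  refine ⟨r, hr, (Metric.closedBall_subset_closedBall hrr₀).trans hball,
    fun σ u c K hσ hb hc hc0 hc1 hspeed => ?_⟩
  set η : ℝ → EucM m := fun t => c t - σ t with hη
  set F : ℝ → ℝ := fun t => 2 * chartForm g p (σ t) (u t) (η t) -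
    μ / 4 * (t * inner ℝ (η t) (η t)) with hF
  have hcs : ∀ t ∈ Set.Icc (0 : ℝ) 1, c t ∈ Metric.closedBall y₀ r₀ := fun t ht => by
    rw [Metric.mem_closedBall, dist_eq_norm]; exact (hb t ht).2.2.trans hrr₀
  have hσs : ∀ t ∈ Set.Icc (0 : ℝ) 1, σ t ∈ Metric.closedBall y₀ r₀ := fun t ht => by
    rw [Metric.mem_closedBall, dist_eq_norm]; exact (hb t ht).1.trans hrr₀
  -- the derivative of `F`
  have hderiv : ∀ t ∈ Set.Ioo (0 : ℝ) 1, DifferentiableAt ℝ c t →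
      deriv F t ≤ -(μ / 32 * ‖η t‖ ^ 2) := by
    intro t ht hct
    have hti := Set.Ioo_subset_Icc_self ht
    have hnhds : Set.Icc (0 : ℝ) 1 ∈ 𝓝 t := Icc_mem_nhds ht.1 ht.2
    set ξ := deriv c t
    have hξ : HasDerivAt c ξ t := hct.hasDerivAt
    have hη' : HasDerivAt η (ξ - u t) t := hξ.sub ((hσ t hti).2.1.hasDerivAt hnhds)
    have hΨ := ((hσ.hasDerivWithinAt_form hti).hasDerivAt hnhds).clm_apply hη'
    have hΘ := (hasDerivAt_id t).mul (hη'.inner ℝ hη')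
    have hF' := (hΨ.const_mul 2).sub (hΘ.const_mul (μ / 4))
    have hF'' : HasDerivAt F _ t := hF'
    rw [hF''.deriv]
    have hst := interior_subset (hσ t hti).1
    obtain ⟨hb1, hb2⟩ := hbd _ (hσs t hti) _ (hcs t hti)
    have hsp := hspeed t ht ξ hξ
    rw [← hσ.energy_eq hti] at hsp
    have e1 := abs_apply_apply_le _ hb1 (u t) (ξ - u t)
    have e2 := abs_apply_apply_le _ hb2 (u t) (u t)
    have e3 := hlow _ (hcs t hti) (ξ - u t)
    have hur := (hb t hti).2.1
    set y := ‖c t - σ t‖ with hyy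
    set x := ‖ξ - u t‖ with hxx
    have hx0 : 0 ≤ x := norm_nonneg _
    have hy0 : 0 ≤ y := norm_nonneg _
    have e1' : C * y * ‖u t‖ * x ≤ C * y * r * x := by gcongr
    have e2' : C * y ^ 2 * ‖u t‖ * ‖u t‖ ≤ C * y ^ 2 * r * r := by gcongr
    have hq := quadratic_estimate hμ hx0 hy0 hr.le hr1 hrC hC.le
    have hin : |inner ℝ (η t) (ξ - u t)| ≤ y * x := abs_real_inner_le_norm _ _
    simp only [add_apply, sub_apply, chartForm_geodesicAcc g hst, id, map_sub,
      real_inner_self_eq_norm_sq] at e1 e2 e3 hin ⊢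
    have hsym : chartForm g p (c t) ξ (u t) = chartForm g p (c t) (u t) ξ :=
      chartForm_symm _ _ _ _ _
    have hcomm := real_inner_comm (η t) (ξ - u t)
    have hD : chartFormDeriv g p (σ t) (η t) (u t) (u t) =
        chartFormDeriv g p (σ t) (c t) (u t) (u t) -
          chartFormDeriv g p (σ t) (σ t) (u t) (u t) := by
      rw [hη, map_sub, sub_apply, sub_apply]
    have hty : -(y * x) ≤ t * inner ℝ (η t) (ξ - u t) := by
      have h1 := (abs_le.1 hin).1
      have h2 := mul_nonneg hy0 hx0
      nlinarith [ht.1, ht.2]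
    have hμt := mul_le_mul_of_nonneg_left hty hμ.le
    have hηy : ‖η t‖ = y := rfl
    rw [hD, hcomm, hηy]
    have f1 := (abs_le.1 e1).1
    have f2 := (abs_le.1 e2).1
    linarith
  obtain ⟨K₁, hK₁⟩ := hσ.exists_lipschitzOnWith_form
  have hσl : LipschitzOnWith r.toNNReal σ (Set.Icc 0 1) :=
    (convex_Icc 0 1).lipschitzOnWith_of_nnnorm_hasDerivWithin_le
      (fun t ht => (hσ t ht).2.1) fun t ht => by
        rw [← NNReal.coe_le_coe, coe_nnnorm]
        exact (hb t ht).2.1.trans (Real.le_coe_toNNReal _)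
  have hηl : LipschitzOnWith (K + r.toNNReal) η (Set.Icc 0 1) := hc.sub hσl
  obtain ⟨K₂, hK₂⟩ := lipschitzOnWith_clm_apply isCompact_Icc hK₁ hηl
  obtain ⟨K₃, hK₃⟩ := lipschitzOnWith_clm_apply isCompact_Icc
    ((innerSL ℝ (E := EucM m)).lipschitz.comp_lipschitzOnWith hηl) hηl
  have hab : Set.uIcc (0 : ℝ) 1 = Set.Icc 0 1 := Set.uIcc_of_le zero_le_one
  have hFac : AbsolutelyContinuousOnInterval F 0 1 := by
    refine ((hK₂.mono hab.subset).absolutelyContinuousOnInterval.const_mul 2).sub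
      (((AbsolutelyContinuousOnInterval.mul ?_
        (hK₃.mono hab.subset).absolutelyContinuousOnInterval)).const_mul (μ / 4))
    exact (contDiff_id (𝕜 := ℝ) (E := ℝ)).contDiffOn.absolutelyContinuousOnInterval
  have hint := hFac.integral_deriv_eq_sub
  have hη0 : η 0 = 0 := sub_eq_zero.2 hc0
  have hη1 : η 1 = 0 := sub_eq_zero.2 hc1
  have hF01 : F 1 - F 0 = 0 := by simp [hF, hη0, hη1]
  have hηc : ContinuousOn (fun t => μ / 32 * ‖η t‖ ^ 2) (Set.Icc 0 1) :=
    (hηl.continuousOn.norm.pow 2).const_smul (μ / 32)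
  have hle : ∫ t in (0 : ℝ)..1, deriv F t ≤ ∫ t in (0 : ℝ)..1, -(μ / 32 * ‖η t‖ ^ 2) := by
    refine intervalIntegral.integral_mono_ae_restrict zero_le_one hFac.intervalIntegrable_deriv
      (hηc.neg.intervalIntegrable_of_Icc zero_le_one) ?_
    have h0 : ∀ᵐ t : ℝ, t ≠ 0 := MeasureTheory.Measure.ae_ne MeasureTheory.volume 0
    have h1 : ∀ᵐ t : ℝ, t ≠ 1 := MeasureTheory.Measure.ae_ne MeasureTheory.volume 1
    refine (MeasureTheory.ae_restrict_iff' measurableSet_Icc).2 ?_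
    filter_upwards [hc.ae_differentiableWithinAt_of_mem_real, h0, h1] with t ht ht0 ht1 htm
    have htI : t ∈ Set.Ioo (0 : ℝ) 1 := ⟨lt_of_le_of_ne htm.1 (Ne.symm ht0),
      lt_of_le_of_ne htm.2 ht1⟩
    exact hderiv t htI ((ht htm).differentiableAt (Icc_mem_nhds htI.1 htI.2))
  rw [hint, hF01, intervalIntegral.integral_neg] at hle
  intro t ht
  by_contra hne
  have hpos := intervalIntegral.integral_pos zero_lt_one hηc (fun t _ => by positivity) ⟨t, ht, by
    have : 0 < ‖η t‖ := norm_pos_iff.2 (sub_ne_zero.2 hne)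
    positivity⟩
  linarith

end EnergyComparison

/-! ### The Riemannian distance -/

section Distance

variable {m : ℕ} [NeZero m] {M : Type*} [TopologicalSpace M]
  [ChartedSpace (EuclideanHalfSpace m) M] [IsManifold (𝓡∂ m) ∞ M] {g : SmoothMetric m M}

/-- The Riemannian distance of `g`: the infimum of the lengths of `C¹` curves. -/
noncomputable def riemannianDist (g : SmoothMetric m M) (x y : M) : ENNReal :=
  letI : Bundle.RiemannianBundle (fun x : M => TangentSpace (𝓡∂ m) x) := ⟨g.toRiemannianMetric⟩
  Manifold.riemannianEDist (𝓡∂ m) x y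

/-- The length of the curve `γ` on `[a, b]` with respect to `g`. -/
noncomputable def curveLength (g : SmoothMetric m M) (γ : ℝ → M) (a b : ℝ) : ENNReal :=
  letI : Bundle.RiemannianBundle (fun x : M => TangentSpace (𝓡∂ m) x) := ⟨g.toRiemannianMetric⟩
  Manifold.pathELength (𝓡∂ m) γ a b

lemma riemannianDist_self (g : SmoothMetric m M) (x : M) : riemannianDist g x x = 0 :=
  letI : Bundle.RiemannianBundle (fun x : M => TangentSpace (𝓡∂ m) x) := ⟨g.toRiemannianMetric⟩
  Manifold.riemannianEDist_self

lemma riemannianDist_comm (g : SmoothMetric m M) (x y : M) :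
    riemannianDist g x y = riemannianDist g y x :=
  letI : Bundle.RiemannianBundle (fun x : M => TangentSpace (𝓡∂ m) x) := ⟨g.toRiemannianMetric⟩
  Manifold.riemannianEDist_comm

lemma riemannianDist_triangle (g : SmoothMetric m M) (x y z : M) :
    riemannianDist g x z ≤ riemannianDist g x y + riemannianDist g y z :=
  letI : Bundle.RiemannianBundle (fun x : M => TangentSpace (𝓡∂ m) x) := ⟨g.toRiemannianMetric⟩
  Manifold.riemannianEDist_triangle

lemma riemannianDist_le_curveLength {γ : ℝ → M} {a b : ℝ} (hab : a ≤ b)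
    (hγ : ContMDiffOn 𝓘(ℝ, ℝ) (𝓡∂ m) 1 γ (Set.Icc a b)) :
    riemannianDist g (γ a) (γ b) ≤ curveLength g γ a b :=
  letI : Bundle.RiemannianBundle (fun x : M => TangentSpace (𝓡∂ m) x) := ⟨g.toRiemannianMetric⟩
  Manifold.riemannianEDist_le_pathELength hγ rfl rfl hab

lemma exists_curveLength_lt {x y : M} {r : ENNReal} (h : riemannianDist g x y < r) :
    ∃ γ : ℝ → M, γ 0 = x ∧ γ 1 = y ∧ ContMDiffOn 𝓘(ℝ, ℝ) (𝓡∂ m) 1 γ (Set.Icc 0 1) ∧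
      curveLength g γ 0 1 < r :=
  letI : Bundle.RiemannianBundle (fun x : M => TangentSpace (𝓡∂ m) x) := ⟨g.toRiemannianMetric⟩
  Manifold.exists_lt_of_riemannianEDist_lt h

lemma curveLength_add (g : SmoothMetric m M) (γ : ℝ → M) {a b c : ℝ} (hab : a ≤ b) (hbc : b ≤ c) :
    curveLength g γ a b + curveLength g γ b c = curveLength g γ a c :=
  letI : Bundle.RiemannianBundle (fun x : M => TangentSpace (𝓡∂ m) x) := ⟨g.toRiemannianMetric⟩
  Manifold.pathELength_add hab hbc

lemma eventually_riemannianDist_lt (g : SmoothMetric m M) (x : M) {c : ENNReal} (hc : 0 < c) :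
    ∀ᶠ y in 𝓝 x, riemannianDist g x y < c := by
  let : Bundle.RiemannianBundle (fun x : M => TangentSpace (𝓡∂ m) x) := ⟨g.toRiemannianMetric⟩
  have : IsContinuousRiemannianBundle (EucM m) (fun x : M => TangentSpace (𝓡∂ m) x) :=
    ⟨⟨g.inner, g.contMDiff.continuous, fun _ _ _ => rfl⟩⟩
  have : IsManifold (𝓡∂ m) 1 M := IsManifold.of_le (n := ∞) (by simp)
  exact eventually_riemannianEDist_lt (𝓡∂ m) x hc

lemma exists_riemannianDist_lt_subset [RegularSpace M] (g : SmoothMetric m M) {x : M} {s : Set M}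
    (hs : s ∈ 𝓝 x) : ∃ c > 0, ∀ y, riemannianDist g x y < c → y ∈ s := by
  let : Bundle.RiemannianBundle (fun x : M => TangentSpace (𝓡∂ m) x) := ⟨g.toRiemannianMetric⟩
  have : IsContinuousRiemannianBundle (EucM m) (fun x : M => TangentSpace (𝓡∂ m) x) :=
    ⟨⟨g.inner, g.contMDiff.continuous, fun _ _ _ => rfl⟩⟩
  have : IsManifold (𝓡∂ m) 1 M := IsManifold.of_le (n := ∞) (by simp)
  exact setOfPred_riemannianEDist_lt_subset_nhds' (𝓡∂ m) hs

lemma curveLength_eq (g : SmoothMetric m M) (γ : ℝ → M) (a b : ℝ) :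
    curveLength g γ a b = ∫⁻ t in Set.Icc a b, ENNReal.ofReal √(g.inner (γ t)
      (velocity γ (Set.Icc a b) t) (velocity γ (Set.Icc a b) t)) := by
  let : Bundle.RiemannianBundle (fun x : M => TangentSpace (𝓡∂ m) x) := ⟨g.toRiemannianMetric⟩
  refine (Manifold.pathELength_eq_lintegral_mfderivWithin_Icc).trans ?_
  refine MeasureTheory.lintegral_congr fun t => ?_
  rw [← ofReal_norm, norm_eq_sqrt_real_inner]
  rfl

/-- The metric in terms of the coordinates of a tangent vector. -/
lemma inner_eq_chartForm (g : SmoothMetric m M) {p : M} {q : TangentBundle (𝓡∂ m) M}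
    (hq : q.proj ∈ (extChartAt (𝓡∂ m) p).source) : g.inner q.proj q.snd q.snd =
      chartForm g p (extChartAt (𝓡∂ m) p q.proj) (tangentChart p q).2 (tangentChart p q).2 := by
  have h1 := inner_tangentChart_symm g ((extChartAt (𝓡∂ m) p).map_source hq) (tangentChart p q).2
  rw [← h1, ← tangentChart_fst hq, Prod.mk.eta]
  have h2 := (tangentChart p).left_inv (mem_tangentChart_source.2 hq)
  exact inner_congr_of_mk_eq g h2.symm h2.symm

lemma inner_velocity_eq (g : SmoothMetric m M) {γ : ℝ → M} {s : Set ℝ} {t : ℝ} {p : M}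
    (hγ : MDifferentiableWithinAt 𝓘(ℝ, ℝ) (𝓡∂ m) γ s t) (hs : UniqueDiffWithinAt ℝ s t)
    (hp : γ t ∈ (extChartAt (𝓡∂ m) p).source) :
    g.inner (γ t) (velocity γ s t) (velocity γ s t) =
      chartForm g p (extChartAt (𝓡∂ m) p (γ t))
        (derivWithin (fun r => extChartAt (𝓡∂ m) p (γ r)) s t)
        (derivWithin (fun r => extChartAt (𝓡∂ m) p (γ r)) s t) := by
  have h1 := inner_eq_chartForm g (q := tangentLift (m := m) γ s t) hp
  rw [tangentChart_tangentLift hγ hs hp] at h1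
  exact h1

/-- Upper bound for the distance by the maximal speed of a curve in a chart. -/
lemma riemannianDist_le_of_speed_le {p : M} {e u : ℝ → EucM m} {K : ℝ}
    (het : ∀ t ∈ Set.Icc (0 : ℝ) 1, e t ∈ (extChartAt (𝓡∂ m) p).target)
    (he : ∀ t ∈ Set.Icc (0 : ℝ) 1, HasDerivWithinAt e (u t) (Set.Icc 0 1) t)
    (hu : ContinuousOn u (Set.Icc 0 1))
    (hK : ∀ t ∈ Set.Icc (0 : ℝ) 1, √(chartForm g p (e t) (u t) (u t)) ≤ K) :
    riemannianDist g ((extChartAt (𝓡∂ m) p).symm (e 0)) ((extChartAt (𝓡∂ m) p).symm (e 1)) ≤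
      ENNReal.ofReal K := by
  have hun := uniqueDiffOn_Icc (zero_lt_one' ℝ)
  have hC : ContDiffOn ℝ 1 e (Set.Icc 0 1) := by
    refine (contDiffOn_one_iff_derivWithin hun).2 ⟨fun t ht => (he t ht).differentiableWithinAt, ?_⟩
    exact hu.congr fun t ht => (he t ht).derivWithin (hun t ht)
  set γ : ℝ → M := fun t => (extChartAt (𝓡∂ m) p).symm (e t) with hγ
  have hγC : ContMDiffOn 𝓘(ℝ, ℝ) (𝓡∂ m) 1 γ (Set.Icc 0 1) :=
    (contMDiffOn_extChartAt_symm (n := ∞) p |>.of_le (by simp)).comp hC.contMDiffOn het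
  refine (riemannianDist_le_curveLength zero_le_one hγC).trans ?_
  rw [curveLength_eq]
  have hb : ∀ t ∈ Set.Icc (0 : ℝ) 1, ENNReal.ofReal √(g.inner (γ t)
      (velocity γ (Set.Icc 0 1) t) (velocity γ (Set.Icc 0 1) t)) ≤ ENNReal.ofReal K := by
    intro t ht
    have hdist : Set.EqOn (fun r => extChartAt (𝓡∂ m) p (γ r)) e (Set.Icc 0 1) := fun r hr =>
      (extChartAt (𝓡∂ m) p).right_inv (het r hr)
    rw [inner_velocity_eq g ((hγC t ht).mdifferentiableWithinAt (by simp)) (hun t ht)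
      ((extChartAt (𝓡∂ m) p).map_target (het t ht)), derivWithin_congr hdist (hdist ht),
      (he t ht).derivWithin (hun t ht)]
    rw [show extChartAt (𝓡∂ m) p (γ t) = e t from hdist ht]
    exact ENNReal.ofReal_le_ofReal (hK t ht)
  refine (MeasureTheory.setLIntegral_mono' measurableSet_Icc hb).trans ?_
  rw [MeasureTheory.setLIntegral_const, Real.volume_Icc]
  simp

/-- Lower bound for the length of a curve in a chart by the variation of a linear function. -/
lemma enorm_sub_le_curveLength {p : M} {N : Set (EucM m)} {l : EucM m →L[ℝ] ℝ}
    (hl : ∀ z ∈ N, ∀ w, l w ^ 2 ≤ chartForm g p z w w) {γ : ℝ → M}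
    (hγ : ContMDiffOn 𝓘(ℝ, ℝ) (𝓡∂ m) 1 γ (Set.Icc 0 1))
    (hγN : ∀ t ∈ Set.Icc (0 : ℝ) 1, γ t ∈ (extChartAt (𝓡∂ m) p).source ∧
      extChartAt (𝓡∂ m) p (γ t) ∈ N) :
    ‖l (extChartAt (𝓡∂ m) p (γ 1)) - l (extChartAt (𝓡∂ m) p (γ 0))‖ₑ ≤ curveLength g γ 0 1 := by
  have hun := uniqueDiffOn_Icc (zero_lt_one' ℝ)
  have h1 : ContDiffOn ℝ 1 (fun t => extChartAt (𝓡∂ m) p (γ t)) (Set.Icc 0 1) := by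
    have : ContMDiffOn 𝓘(ℝ, ℝ) 𝓘(ℝ, EucM m) 1 (fun t => extChartAt (𝓡∂ m) p (γ t))
        (Set.Icc 0 1) :=
      (contMDiffOn_extChartAt (n := ∞) (I := 𝓡∂ m) |>.of_le (by simp)).comp hγ fun t ht => by
        rw [← extChartAt_source (𝓡∂ m)]
        exact (hγN t ht).1
    exact contMDiffOn_iff_contDiffOn.1 this
  have h2 : ContDiffOn ℝ 1 (fun t => l (extChartAt (𝓡∂ m) p (γ t))) (Set.Icc 0 1) :=
    l.contDiff.comp_contDiffOn h1
  refine (enorm_sub_le_lintegral_derivWithin_Icc_of_contDiffOn_Icc h2 zero_le_one).trans ?_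
  rw [curveLength_eq]
  refine MeasureTheory.setLIntegral_mono' measurableSet_Icc fun t ht => ?_
  have h3 := ((h1 t ht).differentiableWithinAt (by simp)).hasDerivWithinAt
  have h4 := (l.hasFDerivAt.comp_hasDerivWithinAt t h3).derivWithin (hun t ht)
  rw [inner_velocity_eq g ((hγ t ht).mdifferentiableWithinAt (by simp)) (hun t ht) (hγN t ht).1]
  rw [show derivWithin (fun t => l (extChartAt (𝓡∂ m) p (γ t))) (Set.Icc 0 1) t = _ from h4,
    ← ofReal_norm, Real.norm_eq_abs]
  refine ENNReal.ofReal_le_ofReal (Real.abs_le_sqrt ?_)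
  exact hl _ (hγN t ht).2 _

/-- Locally, linear functions bounded by the metric are bounded by the distance. -/
lemma exists_abs_sub_le_riemannianDist [RegularSpace M] {p x : M}
    (hx : x ∈ (extChartAt (𝓡∂ m) p).source) {N : Set (EucM m)}
    (hN : N ∈ 𝓝 (extChartAt (𝓡∂ m) p x)) :
    ∃ O ∈ 𝓝 x, ∀ y ∈ O, ∀ z ∈ O, ∀ l : EucM m →L[ℝ] ℝ,
      (∀ z ∈ N, ∀ w, l w ^ 2 ≤ chartForm g p z w w) →
      ENNReal.ofReal |l (extChartAt (𝓡∂ m) p z) - l (extChartAt (𝓡∂ m) p y)| ≤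
        riemannianDist g y z := by
  have hS : (extChartAt (𝓡∂ m) p).source ∩ extChartAt (𝓡∂ m) p ⁻¹' N ∈ 𝓝 x :=
    Filter.inter_mem ((isOpen_extChartAt_source p).mem_nhds hx)
      ((continuousAt_extChartAt' hx).preimage_mem_nhds hN)
  obtain ⟨c, hc, hcS⟩ := exists_riemannianDist_lt_subset g hS
  refine ⟨_, eventually_riemannianDist_lt g x
    (ENNReal.div_pos hc.ne' (by simp : (3 : ENNReal) ≠ ⊤)),
    fun y hy z hz l hl => ?_⟩
  refine le_of_forall_gt fun r hr => ?_
  have hyz : riemannianDist g y z < c / 3 + c / 3 :=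
    (riemannianDist_triangle g y x z).trans_lt (ENNReal.add_lt_add
      (by rw [riemannianDist_comm]; exact hy) hz)
  obtain ⟨γ, h0, h1, hγ, hγr⟩ := exists_curveLength_lt (lt_min hr hyz)
  have hγN : ∀ t ∈ Set.Icc (0 : ℝ) 1, γ t ∈ (extChartAt (𝓡∂ m) p).source ∧
      extChartAt (𝓡∂ m) p (γ t) ∈ N := by
    intro t ht
    refine hcS _ ((riemannianDist_triangle g x y _).trans_lt ?_)
    have h2 : riemannianDist g y (γ t) ≤ curveLength g γ 0 1 := by
      rw [← h0, ← curveLength_add g γ ht.1 ht.2]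
      exact (riemannianDist_le_curveLength ht.1
        (hγ.mono (Set.Icc_subset_Icc_right ht.2))).trans le_self_add
    have h3 := h2.trans_lt (hγr.trans_le (min_le_right _ _))
    refine (ENNReal.add_lt_add hy h3).trans_le ?_
    rw [← add_assoc, ENNReal.add_thirds]
  have h2 := enorm_sub_le_curveLength hl hγ hγN
  rw [h0, h1, ← ofReal_norm, Real.norm_eq_abs] at h2
  exact h2.trans_lt (hγr.trans_le (min_le_left _ _))

end Distance

/-! ### Curves that minimize the distance to a closed set -/

section Metric

open Metric ENNReal

variable {X : Type*} [PseudoEMetricSpace X] [CompactSpace X] {S : Set X}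

/-- In a compact length space, one can approach `S` at unit speed: the hypothesis `hmid` says that
almost minimizing curves to points of `S` exist. -/
lemma exists_infEDist_sub_eq
    (hmid : ∀ y, ∀ b ∈ S, ∀ r s : ENNReal, edist y b < r → s ≤ edist y b →
      ∃ z, edist y z = s ∧ s + edist z b ≤ r) {y : X} {a r : ℝ} (hr : 0 ≤ r) (hra : r ≤ a)
    (hy : infEDist y S = ENNReal.ofReal a) :
    ∃ z, edist y z ≤ ENNReal.ofReal r ∧ infEDist z S = ENNReal.ofReal (a - r) := by
  have hclosed : IsClosed {z | edist y z ≤ ENNReal.ofReal r} :=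
    isClosed_le (continuous_const.edist continuous_id) continuous_const
  obtain ⟨z, hz, hmin⟩ := hclosed.isCompact.exists_isMinOn ⟨y, by simp⟩
    (continuous_infEDist (s := S)).continuousOn
  refine ⟨z, hz, le_antisymm ?_ ?_⟩
  · refine ENNReal.le_of_forall_pos_le_add fun ε hε _ => ?_
    have h1 : infEDist y S < ENNReal.ofReal a + ε := by
      rw [hy]
      exact ENNReal.lt_add_right ENNReal.ofReal_ne_top (by exact_mod_cast hε.ne')
    obtain ⟨b, hb, hyb⟩ := infEDist_lt_iff.1 h1
    have h2 : ENNReal.ofReal r ≤ edist y b :=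
      (ENNReal.ofReal_le_ofReal hra).trans (hy ▸ infEDist_le_edist_of_mem hb)
    obtain ⟨w, hw, hwb⟩ := hmid y b hb _ _ hyb h2
    refine (hmin (show w ∈ _ from hw.le)).trans ((infEDist_le_edist_of_mem hb).trans ?_)
    have h3 : ENNReal.ofReal r + edist w b ≤
        ENNReal.ofReal r + (ENNReal.ofReal (a - r) + ε) := by
      rw [← add_assoc, ← ENNReal.ofReal_add hr (by linarith), add_sub_cancel]
      exact hwb
    exact (ENNReal.add_le_add_iff_left ENNReal.ofReal_ne_top).1 h3
  · have h1 := infEDist_le_edist_add_infEDist (x := y) (y := z) (s := S)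
    rw [hy] at h1
    rw [ENNReal.ofReal_sub _ hr]
    exact tsub_le_iff_left.2 (h1.trans (by gcongr; exact hz))

/-- Curves of unit speed along which the distance to `S` decreases at unit rate, first for finitely
many times. -/
lemma exists_finset_curve
    (hmid : ∀ y, ∀ b ∈ S, ∀ r s : ENNReal, edist y b < r → s ≤ edist y b →
      ∃ z, edist y z = s ∧ s + edist z b ≤ r) {x : X} {δ : ℝ} (hδ : 0 ≤ δ)
    (hx : infEDist x S = ENNReal.ofReal δ) (F : Finset ℝ) (hF : ∀ t ∈ F, t ∈ Set.Icc 0 δ) :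
    ∃ c : ℝ → X, (∀ t ∈ F, edist x (c t) ≤ ENNReal.ofReal t ∧
      infEDist (c t) S = ENNReal.ofReal (δ - t)) ∧
      (∀ s ∈ F, ∀ t ∈ F, s ≤ t → edist (c s) (c t) ≤ ENNReal.ofReal (t - s)) ∧
      ∃ z : X, ∃ t₀ ∈ Set.Icc 0 δ, (t₀ = 0 ∨ t₀ ∈ F) ∧ infEDist z S = ENNReal.ofReal (δ - t₀) ∧
        edist x z ≤ ENNReal.ofReal t₀ ∧
        ∀ s ∈ F, s ≤ t₀ ∧ edist (c s) z ≤ ENNReal.ofReal (t₀ - s) := by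
  induction F using Finset.induction_on_max with
  | empty => exact ⟨fun _ => x, by simp, by simp, x, 0, ⟨le_rfl, hδ⟩, Or.inl rfl, by simpa using hx,
      by simp, by simp⟩
  | insert t F ht ih =>
    obtain ⟨c, hc1, hc2, z, t₀, ht₀, h0, hz, hxz, hcz⟩ :=
      ih fun s hs => hF s (Finset.mem_insert_of_mem hs)
    have htI := hF t (Finset.mem_insert_self t F)
    have htt : t₀ ≤ t := by
      rcases h0 with rfl | h0
      · exact htI.1
      · exact (ht _ h0).le
    obtain ⟨w, hzw, hw⟩ := exists_infEDist_sub_eq hmid (r := t - t₀) (by linarith)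
      (by linarith [htI.2]) hz
    rw [sub_sub_sub_cancel_right] at hw
    have htri : ∀ y : X, ∀ s ≤ t₀, edist y z ≤ ENNReal.ofReal (t₀ - s) →
        edist y w ≤ ENNReal.ofReal (t - s) := fun y s hs h => by
      refine (edist_triangle y z w).trans ((add_le_add h hzw).trans ?_)
      rw [← ENNReal.ofReal_add (by linarith) (by linarith)]
      exact ENNReal.ofReal_le_ofReal (by linarith)
    have hxw : edist x w ≤ ENNReal.ofReal t := by
      simpa using htri x 0 ht₀.1 (by simpa using hxz)
    have hne : ∀ s ∈ F, s ≠ t := fun s hs => (ht s hs).ne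
    refine ⟨Function.update c t w, ?_, ?_, w, t, htI, Or.inr (Finset.mem_insert_self t F), hw,
      hxw, ?_⟩
    · intro s hs
      rcases Finset.mem_insert.1 hs with rfl | hs
      · simpa using ⟨hxw, hw⟩
      · simpa [Function.update_of_ne (hne s hs)] using hc1 s hs
    · intro s hs u hu hsu
      rcases Finset.mem_insert.1 hs with rfl | hsF
      · rcases Finset.mem_insert.1 hu with rfl | hu
        · simp
        · exact absurd (ht u hu) hsu.not_gt
      · rcases Finset.mem_insert.1 hu with rfl | hu
        · simpa [Function.update_of_ne (hne s hsF)] using htri (c s) s (hcz s hsF).1 (hcz s hsF).2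
        · simpa [Function.update_of_ne (hne s hsF), Function.update_of_ne (hne u hu)] using
            hc2 s hsF u hu hsu
    · intro s hs
      rcases Finset.mem_insert.1 hs with rfl | hs
      · simp
      · exact ⟨(ht s hs).le, by
          simpa [Function.update_of_ne (hne s hs)] using htri (c s) s (hcz s hs).1 (hcz s hs).2⟩

/-- In a compact length space, every point is joined to `S` by a curve of unit speed along which
the distance to `S` decreases at unit rate. It is a limit of the curves of
`exists_finset_curve` along an ultrafilter of finite sets of times. -/
theorem exists_curve_infEDist_eq
    (hmid : ∀ y, ∀ b ∈ S, ∀ r s : ENNReal, edist y b < r → s ≤ edist y b →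
      ∃ z, edist y z = s ∧ s + edist z b ≤ r) {x : X} {δ : ℝ} (hδ : 0 ≤ δ)
    (hx : infEDist x S = ENNReal.ofReal δ) :
    ∃ c : ℝ → X, edist x (c 0) = 0 ∧
      (∀ t ∈ Set.Icc 0 δ, infEDist (c t) S = ENNReal.ofReal (δ - t)) ∧
      ∀ s ∈ Set.Icc 0 δ, ∀ t ∈ Set.Icc 0 δ, s ≤ t →
        edist (c s) (c t) ≤ ENNReal.ofReal (t - s) := by
  classical
  have hF : ∀ F : Finset ℝ, ∀ t ∈ F.filter (· ∈ Set.Icc 0 δ), t ∈ Set.Icc 0 δ := fun F t ht =>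
    (Finset.mem_filter.1 ht).2
  choose C hC1 hC2 _ using fun F : Finset ℝ => exists_finset_curve hmid hδ hx _ (hF F)
  let 𝒰 : Ultrafilter (Finset ℝ) := Ultrafilter.of Filter.atTop
  have hmem : ∀ t ∈ Set.Icc 0 δ, ∀ᶠ F in (𝒰 : Filter (Finset ℝ)),
      t ∈ F.filter (· ∈ Set.Icc 0 δ) := fun t ht =>
    Ultrafilter.of_le Filter.atTop (by
      filter_upwards [Filter.eventually_ge_atTop {t}] with F hF
      exact Finset.mem_filter.2 ⟨hF (Finset.mem_singleton_self t), ht⟩)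
  have hlim : ∀ t, ∃ y, Filter.Tendsto (fun F => C F t) 𝒰 (𝓝 y) := fun t => by
    obtain ⟨y, -, hy⟩ := isCompact_univ.ultrafilter_le_nhds (𝒰.map fun F => C F t) (by simp)
    exact ⟨y, hy⟩
  choose c hc using hlim
  refine ⟨c, ?_, fun t ht => ?_, fun s hs t ht hst => ?_⟩
  · refine le_antisymm (le_of_tendsto (tendsto_const_nhds.edist (hc 0)) ?_) zero_le
    filter_upwards [hmem 0 ⟨le_rfl, hδ⟩] with F hF
    simpa using (hC1 F 0 hF).1
  · refine tendsto_nhds_unique ((continuous_infEDist.tendsto _).comp (hc t)) ?_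
    refine tendsto_const_nhds.congr' ?_
    filter_upwards [hmem t ht] with F hF
    exact (hC1 F t hF).2.symm
  · refine le_of_tendsto ((hc s).edist (hc t)) ?_
    filter_upwards [hmem s hs, hmem t ht] with F hFs hFt
    exact hC2 F s hFs t hFt hst

end Metric

section Distance

variable {m : ℕ} [NeZero m] {M : Type*} [TopologicalSpace M]
  [ChartedSpace (EuclideanHalfSpace m) M] [IsManifold (𝓡∂ m) ∞ M] {g : SmoothMetric m M}

/-- The distance to the boundary of `M`. -/
noncomputable def boundaryDist (g : SmoothMetric m M) (x : M) : ENNReal :=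
  ⨅ b ∈ (𝓡∂ m).boundary M, riemannianDist g x b

lemma boundaryDist_le {x b : M} (hb : b ∈ (𝓡∂ m).boundary M) :
    boundaryDist g x ≤ riemannianDist g x b :=
  iInf₂_le b hb

lemma boundaryDist_le_add (x y : M) :
    boundaryDist g x ≤ riemannianDist g x y + boundaryDist g y := by
  simp only [boundaryDist, ENNReal.add_iInf]
  exact le_iInf₂ fun b hb => (iInf₂_le b hb).trans (riemannianDist_triangle g x y b)

/-- The distance topology of a regular manifold is the given topology. -/
lemma exists_pseudoEMetricSpace [RegularSpace M] (g : SmoothMetric m M) :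
    ∃ E : PseudoEMetricSpace M, E.toUniformSpace.toTopologicalSpace = ‹TopologicalSpace M› ∧
      ∀ x y : M, edist x y = riemannianDist g x y := by
  let : Bundle.RiemannianBundle (fun x : M => TangentSpace (𝓡∂ m) x) := ⟨g.toRiemannianMetric⟩
  have : IsContinuousRiemannianBundle (EucM m) (fun x : M => TangentSpace (𝓡∂ m) x) :=
    ⟨⟨g.inner, g.contMDiff.continuous, fun _ _ _ => rfl⟩⟩
  have : IsManifold (𝓡∂ m) 1 M := IsManifold.of_le (n := ∞) (by simp)
  exact ⟨PseudoEMetricSpace.ofRiemannianMetric (𝓡∂ m) M, rfl, fun _ _ => rfl⟩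

lemma continuous_riemannianDist [RegularSpace M] (g : SmoothMetric m M) (x : M) :
    Continuous (riemannianDist g x) := by
  obtain ⟨E, rfl, hE⟩ := exists_pseudoEMetricSpace g
  simp only [← funext (hE x)]
  exact continuous_const.edist continuous_id

/-- Almost minimizing curves contain points at all intermediate distances. -/
lemma exists_riemannianDist_eq [RegularSpace M] {y b : M} {r s : ENNReal}
    (hr : riemannianDist g y b < r) (hs : s ≤ riemannianDist g y b) :
    ∃ z, riemannianDist g y z = s ∧ s + riemannianDist g z b ≤ r := by
  obtain ⟨γ, h0, h1, hγ, hγr⟩ := exists_curveLength_lt hr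
  have hcont : ContinuousOn (fun t => riemannianDist g y (γ t)) (Set.Icc 0 1) :=
    (continuous_riemannianDist g y).comp_continuousOn hγ.continuousOn
  obtain ⟨t, ht, hts⟩ := intermediate_value_Icc zero_le_one hcont
    (show s ∈ Set.Icc _ _ from ⟨by rw [h0, riemannianDist_self]; exact zero_le, by rwa [h1]⟩)
  refine ⟨γ t, hts, hγr.le.trans' ?_⟩
  rw [← curveLength_add g γ ht.1 ht.2]
  refine add_le_add ?_ ?_
  · rw [← hts, ← h0]
    exact riemannianDist_le_curveLength ht.1 (hγ.mono (Set.Icc_subset_Icc_right ht.2))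
  · rw [← h1]
    exact riemannianDist_le_curveLength ht.2 (hγ.mono (Set.Icc_subset_Icc_left ht.1))

/-- Points of a component which meets the boundary have finite distance to the boundary. -/
lemma boundaryDist_lt_top (g : SmoothMetric m M) {x : M}
    (hx : (connectedComponent x ∩ (𝓡∂ m).boundary M).Nonempty) : boundaryDist g x < ⊤ := by
  have hloc : ∀ y, ∀ᶠ z in 𝓝 y, (boundaryDist g z < ⊤ ↔ boundaryDist g y < ⊤) := fun y => by
    filter_upwards [eventually_riemannianDist_lt g y ENNReal.zero_lt_top] with z hz
    exact ⟨fun h => (boundaryDist_le_add y z).trans_lt (ENNReal.add_lt_top.2 ⟨hz, h⟩), fun h =>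
      (boundaryDist_le_add z y).trans_lt
        (ENNReal.add_lt_top.2 ⟨by rwa [riemannianDist_comm], h⟩)⟩
  have hclopen : IsClopen {y | boundaryDist g y < ⊤} := by
    refine ⟨⟨isOpen_iff_mem_nhds.2 fun y hy => ?_⟩, isOpen_iff_mem_nhds.2 fun y hy => ?_⟩
    · filter_upwards [hloc y] with z hz using fun h => hy (hz.1 h)
    · filter_upwards [hloc y] with z hz using hz.2 hy
  obtain ⟨b, hbx, hb⟩ := hx
  have hbD : b ∈ {y | boundaryDist g y < ⊤} :=
    (boundaryDist_le hb).trans_lt (by rw [riemannianDist_self]; exact ENNReal.zero_lt_top)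
  refine hclopen.connectedComponent_subset hbD ?_
  rw [← connectedComponent_eq hbx]
  exact mem_connectedComponent

/-- A curve of unit speed from `x` to the boundary along which the distance to the boundary
decreases at unit rate. -/
theorem exists_curve_boundaryDist_eq [CompactSpace M] [T2Space M] (g : SmoothMetric m M) {x : M}
    (hx : boundaryDist g x < ⊤) :
    ∃ c : ℝ → M, ∃ δ : ℝ, 0 ≤ δ ∧ c 0 = x ∧ boundaryDist g x = ENNReal.ofReal δ ∧
      (∀ t ∈ Set.Icc 0 δ, boundaryDist g (c t) = ENNReal.ofReal (δ - t)) ∧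
      ∀ s ∈ Set.Icc 0 δ, ∀ t ∈ Set.Icc 0 δ, s ≤ t →
        riemannianDist g (c s) (c t) ≤ ENNReal.ofReal (t - s) := by
  have h0 : ∀ y z : M, riemannianDist g y z = 0 → z = y := fun y z h => by
    by_contra hne
    obtain ⟨c, hc, hcs⟩ := exists_riemannianDist_lt_subset g
      (isOpen_compl_singleton.mem_nhds (show y ∈ ({z} : Set M)ᶜ from fun h => hne h.symm))
    exact hcs z (h ▸ hc) rfl
  have hmid : ∀ y, ∀ b ∈ (𝓡∂ m).boundary M, ∀ r s : ENNReal, riemannianDist g y b < r →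
      s ≤ riemannianDist g y b → ∃ z, riemannianDist g y z = s ∧ s + riemannianDist g z b ≤ r :=
    fun y b _ r s => exists_riemannianDist_eq
  have hδ : boundaryDist g x = ENNReal.ofReal (boundaryDist g x).toReal :=
    (ENNReal.ofReal_toReal hx.ne).symm
  obtain ⟨E, hE1, hE⟩ := exists_pseudoEMetricSpace g
  have hD : ∀ y, Metric.infEDist y ((𝓡∂ m).boundary M) = boundaryDist g y := fun y => by
    simp only [Metric.infEDist, boundaryDist, hE]
  have hcomp : @CompactSpace M E.toUniformSpace.toTopologicalSpace := by rw [hE1]; infer_instance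
  simp only [← hE, ← hD] at hmid hδ h0 ⊢
  obtain ⟨c, hc0, hc1, hc2⟩ := exists_curve_infEDist_eq hmid ENNReal.toReal_nonneg hδ
  exact ⟨c, _, ENNReal.toReal_nonneg, h0 _ _ hc0, hδ, hc1, hc2⟩

/-- Points with vanishing distance to the boundary are boundary points. -/
lemma mem_boundary_of_boundaryDist_eq_zero [CompactSpace M] [T2Space M] {x : M}
    (h : boundaryDist g x = 0) : x ∈ (𝓡∂ m).boundary M := by
  by_contra hx
  have hclosed : IsClosed ((𝓡∂ m).boundary M) :=
    ModelWithCorners.isClosed_boundary (n := ∞) (by simp)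
  obtain ⟨c, hc, hcs⟩ := exists_riemannianDist_lt_subset g (hclosed.isOpen_compl.mem_nhds hx)
  have h1 : boundaryDist g x < c := h ▸ hc
  simp only [boundaryDist, iInf_lt_iff] at h1
  obtain ⟨b, hb, hbc⟩ := h1
  exact hcs b hbc hb

end Distance

/-! ### Minimizing curves are geodesics in the interior -/

section Minimizing

variable {m : ℕ} [NeZero m] {M : Type*} [TopologicalSpace M]
  [ChartedSpace (EuclideanHalfSpace m) M] [IsManifold (𝓡∂ m) ∞ M] {g : SmoothMetric m M}

lemma chartForm_self_nonneg (g : SmoothMetric m M) {p : M} {y : EucM m}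
    (hy : y ∈ (extChartAt (𝓡∂ m) p).target) (a : EucM m) : 0 ≤ chartForm g p y a a := by
  by_cases ha : a = 0
  · simp [ha]
  · exact (chartForm_pos g hy ha).le

lemma chartForm_sq_le (g : SmoothMetric m M) {p : M} {y : EucM m}
    (hy : y ∈ (extChartAt (𝓡∂ m) p).target) (a b : EucM m) :
    chartForm g p y a b ^ 2 ≤ chartForm g p y a a * chartForm g p y b b := by
  by_cases ha : a = 0
  · simp [ha]
  have hpos := chartForm_pos g hy ha
  have h := chartForm_self_nonneg g hy
    (chartForm g p y a a • b - chartForm g p y a b • a)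
  simp only [map_sub, map_smul, sub_apply, smul_apply, smul_eq_mul, chartForm_symm g p y b a] at h
  have h2 : 0 ≤ chartForm g p y a a *
      (chartForm g p y a a * chartForm g p y b b - chartForm g p y a b ^ 2) := by
    refine h.trans_eq ?_
    ring
  linarith [nonneg_of_mul_nonneg_right h2 hpos]

lemma eventually_mul_le_chartForm (g : SmoothMetric m M) {p : M} {y : EucM m}
    (hy : y ∈ (extChartAt (𝓡∂ m) p).target) {θ : ℝ} (hθ : θ < 1) :
    ∀ᶠ z in 𝓝[Set.range (𝓡∂ m)] y, ∀ w, θ * chartForm g p y w w ≤ chartForm g p z w w := by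
  obtain ⟨μ, hμ, hμw⟩ := exists_le_chartForm g hy
  have hclose : ∀ᶠ z in 𝓝[Set.range (𝓡∂ m)] y,
      ‖chartForm g p z - chartForm g p y‖ < (1 - θ) * μ := by
    have := Metric.tendsto_nhds.1 (hasFDerivWithinAt_chartForm g hy).continuousWithinAt.tendsto _
      (mul_pos (sub_pos.2 hθ) hμ)
    simpa only [dist_eq_norm] using this
  filter_upwards [hclose] with z hz w
  have h1 := abs_apply_apply_le _ hz.le w w
  rw [sub_apply, sub_apply, abs_le] at h1
  nlinarith [mul_le_mul_of_nonneg_left (hμw w) (sub_pos.2 hθ).le, h1.1]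

/-- A curve which expands distances at most by the factor `T` has speed at most `T` at its points of
differentiability. -/
lemma chartForm_deriv_le [RegularSpace M] {e : ℝ → M} {p : M} {t T : ℝ} {ξ : EucM m}
    (hT0 : 0 ≤ T) (hp : e t ∈ (extChartAt (𝓡∂ m) p).source)
    (hint : extChartAt (𝓡∂ m) p (e t) ∈ interior (extChartAt (𝓡∂ m) p).target)
    (he : ContinuousAt e t) (hd : HasDerivAt (fun s => extChartAt (𝓡∂ m) p (e s)) ξ t)
    (hT : ∀ᶠ s in 𝓝 t, riemannianDist g (e t) (e s) ≤ ENNReal.ofReal (T * |s - t|)) :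
    chartForm g p (extChartAt (𝓡∂ m) p (e t)) ξ ξ ≤ T ^ 2 := by
  set y := extChartAt (𝓡∂ m) p (e t)
  set B := chartForm g p y ξ ξ with hB
  by_contra! hlt
  have hB0 : 0 < B := (sq_nonneg T).trans_lt hlt
  obtain ⟨θ, hθ1, hθ2⟩ := exists_between ((div_lt_one hB0).2 hlt)
  have hθ0 : 0 < θ := (div_nonneg (sq_nonneg T) hB0.le).trans_lt hθ1
  -- the functional dual to `ξ`, scaled so that it is dominated by the metric near `y`
  set l : EucM m →L[ℝ] ℝ := √(θ / B) • chartForm g p y ξ with hl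
  have hN := eventually_mul_le_chartForm g (interior_subset hint) hθ2
  rw [nhdsWithin_eq_nhds.2 (mem_interior_iff_mem_nhds.1
    (interior_mono (fun _ hz => mem_range_of_mem_target hz) hint))] at hN
  obtain ⟨O, hO, hOd⟩ := exists_abs_sub_le_riemannianDist (g := g) hp hN
  have hlN : ∀ z ∈ {z | ∀ w, θ * chartForm g p y w w ≤ chartForm g p z w w}, ∀ w,
      l w ^ 2 ≤ chartForm g p z w w := by
    intro z hz w
    refine le_trans ?_ (hz w)
    rw [hl, smul_apply, smul_eq_mul, mul_pow, Real.sq_sqrt (by positivity)]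
    calc _ ≤ θ / B * (B * chartForm g p y w w) := by
          gcongr
          exact chartForm_sq_le g (interior_subset hint) ξ w
      _ = _ := by field_simp
  have hlip : ∀ᶠ s in 𝓝 t, ‖l (extChartAt (𝓡∂ m) p (e s)) - l y‖ ≤ T * ‖s - t‖ := by
    filter_upwards [hT, he hO] with s hs hsO
    have h1 := (hOd _ (mem_of_mem_nhds hO) _ hsO l hlN).trans hs
    exact (ENNReal.ofReal_le_ofReal_iff (by positivity)).1 h1
  have h2 : HasDerivAt (fun s => l (extChartAt (𝓡∂ m) p (e s))) (l ξ) t :=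
    l.hasFDerivAt.comp_hasDerivAt t hd
  have h3 : ‖l ξ‖ ≤ T := by
    have := h2.hasFDerivAt.le_of_lip' hT0 hlip
    simpa using this
  have h4 : l ξ ^ 2 ≤ T ^ 2 := by
    rw [← sq_abs]
    exact pow_le_pow_left₀ (abs_nonneg _) h3 2
  rw [hl, smul_apply, smul_eq_mul, mul_pow, Real.sq_sqrt (by positivity), ← hB] at h4
  have h5 : θ / B * B ^ 2 = θ * B := by field_simp
  rw [h5] at h4
  rw [div_lt_iff₀ hB0] at hθ1
  linarith

/-- The curve `c` has unit speed and approaches the boundary at unit rate on `[0, δ]`. -/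
structure IsBoundaryMinimizing (g : SmoothMetric m M) (c : ℝ → M) (δ : ℝ) : Prop where
  boundaryDist_eq : ∀ t ∈ Set.Icc 0 δ, boundaryDist g (c t) = ENNReal.ofReal (δ - t)
  dist_le : ∀ s ∈ Set.Icc 0 δ, ∀ t ∈ Set.Icc 0 δ, s ≤ t →
    riemannianDist g (c s) (c t) ≤ ENNReal.ofReal (t - s)

variable {c : ℝ → M} {δ : ℝ}

lemma IsBoundaryMinimizing.dist_le_abs (h : IsBoundaryMinimizing g c δ) {s t : ℝ}
    (hs : s ∈ Set.Icc 0 δ) (ht : t ∈ Set.Icc 0 δ) :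
    riemannianDist g (c s) (c t) ≤ ENNReal.ofReal |t - s| := by
  rcases le_total s t with hst | hst
  · rw [abs_of_nonneg (sub_nonneg.2 hst)]
    exact h.dist_le s hs t ht hst
  · rw [riemannianDist_comm, abs_sub_comm, abs_of_nonneg (sub_nonneg.2 hst)]
    exact h.dist_le t ht s hs hst

lemma IsBoundaryMinimizing.le_dist (h : IsBoundaryMinimizing g c δ) {s t : ℝ}
    (hs : s ∈ Set.Icc 0 δ) (ht : t ∈ Set.Icc 0 δ) :
    ENNReal.ofReal (t - s) ≤ riemannianDist g (c s) (c t) := by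
  have h1 := boundaryDist_le_add (g := g) (c s) (c t)
  rw [h.boundaryDist_eq s hs, h.boundaryDist_eq t ht] at h1
  rw [show t - s = (δ - s) - (δ - t) by ring, ENNReal.ofReal_sub _ (by linarith [ht.2])]
  exact tsub_le_iff_right.2 h1

lemma IsBoundaryMinimizing.continuousOn [RegularSpace M] (h : IsBoundaryMinimizing g c δ) :
    ContinuousOn c (Set.Icc 0 δ) := by
  intro t ht s hs
  obtain ⟨r, hr, hrs⟩ := exists_riemannianDist_lt_subset g hs
  have h1 : Filter.Tendsto (fun s => ENNReal.ofReal |s - t|) (𝓝[Set.Icc 0 δ] t) (𝓝 0) := by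
    have : Continuous fun s => ENNReal.ofReal |s - t| :=
      ENNReal.continuous_ofReal.comp (by fun_prop)
    simpa using (this.tendsto t).mono_left nhdsWithin_le_nhds
  refine Filter.mem_map.2 ?_
  filter_upwards [h1.eventually_lt_const hr, self_mem_nhdsWithin] with u hu huI
  exact hrs _ ((h.dist_le_abs ht huI).trans_lt hu)

lemma IsBoundaryMinimizing.mem_interior (h : IsBoundaryMinimizing g c δ) {t : ℝ}
    (ht : t ∈ Set.Ico 0 δ) : c t ∈ (𝓡∂ m).interior M := by
  rw [← ModelWithCorners.compl_boundary]
  intro hb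
  have h1 := boundaryDist_le (g := g) (x := c t) hb
  rw [riemannianDist_self, h.boundaryDist_eq t ⟨ht.1, ht.2.le⟩, nonpos_iff_eq_zero,
    ENNReal.ofReal_eq_zero] at h1
  linarith [ht.2]

/-- In the interior, a minimizing curve coincides locally with the short geodesic between its
points, which has the same speed. -/
lemma IsBoundaryMinimizing.exists_hasDerivWithinAt [RegularSpace M]
    (h : IsBoundaryMinimizing g c δ) {t₀ : ℝ} (ht₀ : t₀ ∈ Set.Ico 0 δ) :
    ∃ I ∈ 𝓝[Set.Ico 0 δ] t₀, I ⊆ Set.Ico 0 δ ∧ ∃ w : ℝ → EucM m, ∀ t ∈ I,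
      c t ∈ (extChartAt (𝓡∂ m) (c t₀)).source ∧
      HasDerivWithinAt (fun s => extChartAt (𝓡∂ m) (c t₀) (c s)) (w t) I t ∧
      HasDerivWithinAt w
        (geodesicAcc g (c t₀) (extChartAt (𝓡∂ m) (c t₀) (c t)) (w t)) I t ∧
      chartForm g (c t₀) (extChartAt (𝓡∂ m) (c t₀) (c t)) (w t) (w t) = 1 := by
  set p := c t₀ with hp
  set φ := extChartAt (𝓡∂ m) p with hφ
  have hsrc : p ∈ φ.source := mem_extChartAt_source p
  have hy₀ : φ p ∈ interior φ.target := extChartAt_mem_interior_target hsrc (h.mem_interior ht₀)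
  obtain ⟨r, hr, hball, huniq⟩ := exists_eqOn_of_speed_le g hy₀
  obtain ⟨ρ, hρ, hshort⟩ := exists_short_geodesic g hy₀ hr
  obtain ⟨μ, hμ, -, -, r₁, hr₁, -, hlow, -⟩ := exists_chartForm_bounds g hy₀
  obtain ⟨O, hO, hOd⟩ := exists_abs_sub_le_riemannianDist (g := g) hsrc
    (Metric.closedBall_mem_nhds (φ p) hr₁)
  have hlip : ∀ y ∈ O, ∀ z ∈ O, ENNReal.ofReal (√μ * ‖φ z - φ y‖) ≤ riemannianDist g y z := by
    intro y hy z hz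
    by_cases hyz : φ z - φ y = 0
    · simp [hyz]
    have hn : ‖φ z - φ y‖ ≠ 0 := norm_ne_zero_iff.2 hyz
    refine le_trans (le_of_eq ?_) (hOd y hy z hz
      ((√μ * ‖φ z - φ y‖⁻¹) • innerSL ℝ (φ z - φ y)) fun x hx w => ?_)
    · rw [← map_sub, smul_apply, innerSL_apply_apply, real_inner_self_eq_norm_sq, smul_eq_mul,
        abs_of_nonneg (by positivity)]
      congr 1
      field_simp
    · refine le_trans ?_ (hlow x hx w)
      rw [smul_apply, innerSL_apply_apply, smul_eq_mul, mul_pow, mul_pow, Real.sq_sqrt hμ.le]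
      have h1 := abs_real_inner_le_norm (φ z - φ y) w
      have h2 : inner ℝ (φ z - φ y) w ^ 2 ≤ (‖φ z - φ y‖ * ‖w‖) ^ 2 := by
        rw [← sq_abs]
        exact pow_le_pow_left₀ (abs_nonneg _) h1 2
      calc _ ≤ μ * ‖φ z - φ y‖⁻¹ ^ 2 * (‖φ z - φ y‖ * ‖w‖) ^ 2 := by gcongr
        _ = _ := by field_simp
  -- a window around `t₀` on which the curve stays in all these neighbourhoods
  have hev : ∀ᶠ t in 𝓝[Set.Icc 0 δ] t₀, c t ∈ O ∩ φ.source ∧ ‖φ (c t) - φ p‖ ≤ min r ρ := by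
    have h1 := h.continuousOn t₀ ⟨ht₀.1, ht₀.2.le⟩
    have h2 : ContinuousWithinAt (fun t => φ (c t)) (Set.Icc 0 δ) t₀ :=
      (continuousAt_extChartAt p).comp_continuousWithinAt h1
    filter_upwards [h1 hO, h1 ((isOpen_extChartAt_source p).mem_nhds hsrc),
      h2 (Metric.closedBall_mem_nhds _ (lt_min hr hρ))] with t h3 h4 h5
    exact ⟨⟨h3, h4⟩, by rw [← dist_eq_norm]; exact h5⟩
  obtain ⟨η, hη, hηs⟩ := Metric.mem_nhdsWithin_iff.1 hev
  obtain ⟨η', hη', hη'1⟩ := exists_between (lt_min hη (sub_pos.2 ht₀.2))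
  obtain ⟨hη'η, hη'δ⟩ := lt_min_iff.1 hη'1
  set a := max 0 (t₀ - η') with ha
  set b := t₀ + η' with hb
  have hat : a ≤ t₀ := max_le ht₀.1 (by linarith)
  have hab : a < b := by linarith
  set T := b - a with hT
  have hT0 : 0 < T := sub_pos.2 hab
  have hI : Set.Icc a b ⊆ Set.Ico 0 δ := fun t ht =>
    ⟨(le_max_left _ _).trans ht.1, by linarith [ht.2]⟩
  have hIδ : ∀ t ∈ Set.Icc a b, t ∈ Set.Icc 0 δ := fun t ht => ⟨(hI ht).1, (hI ht).2.le⟩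
  have hIn : Set.Icc a b ∈ 𝓝[Set.Ico 0 δ] t₀ := by
    refine Filter.mem_of_superset (Filter.inter_mem self_mem_nhdsWithin
      (mem_nhdsWithin_of_mem_nhds (Icc_mem_nhds (show t₀ - η' < t₀ by linarith)
        (show t₀ < b by linarith)))) fun t ht => ⟨max_le ht.1.1 ht.2.1, ht.2.2⟩
  have hwin : ∀ t ∈ Set.Icc a b, c t ∈ O ∩ φ.source ∧ ‖φ (c t) - φ p‖ ≤ min r ρ := by
    intro t ht
    refine hηs ⟨?_, hIδ t ht⟩
    rw [Metric.mem_ball, Real.dist_eq, abs_lt]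
    have h1 := (le_max_right _ _).trans ht.1
    constructor <;> linarith [ht.2]
  have hmap : ∀ s ∈ Set.Icc (0 : ℝ) 1, a + s * T ∈ Set.Icc a b := fun s hs => by
    constructor <;> nlinarith [hs.1, hs.2]
  set k : ℝ → EucM m := fun s => φ (c (a + s * T)) with hk
  obtain ⟨σ, u, hσ0, hσ1, hσu⟩ := hshort (k 0) (k 1)
    ((hwin _ (hmap 0 (by simp))).2.trans (min_le_right _ _))
    ((hwin _ (hmap 1 (by simp))).2.trans (min_le_right _ _))
  have hgeo : IsChartGeodesic g p σ u := fun s hs =>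
    ⟨hball (by rw [Metric.mem_closedBall, dist_eq_norm]; exact (hσu s hs).2.2.1),
      (hσu s hs).1, (hσu s hs).2.1⟩
  have hucont : ContinuousOn u (Set.Icc 0 1) := fun s hs => (hσu s hs).2.1.continuousWithinAt
  have hcl : LipschitzOnWith (T / √μ).toNNReal k (Set.Icc 0 1) := by
    refine LipschitzOnWith.of_dist_le_mul fun s hs s' hs' => ?_
    have h1 := (hlip _ (hwin _ (hmap s' hs')).1.1 _ (hwin _ (hmap s hs)).1.1).trans
      (h.dist_le_abs (hIδ _ (hmap s' hs')) (hIδ _ (hmap s hs)))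
    rw [ENNReal.ofReal_le_ofReal_iff (abs_nonneg _)] at h1
    rw [Real.coe_toNNReal _ (by positivity), dist_eq_norm, Real.dist_eq, div_mul_eq_mul_div,
      le_div_iff₀ (Real.sqrt_pos.2 hμ), mul_comm]
    refine h1.trans_eq ?_
    rw [show a + s * T - (a + s' * T) = T * (s - s') by ring, abs_mul, abs_of_pos hT0]
  have hspeed : ∀ s ∈ Set.Ioo (0 : ℝ) 1, ∀ ξ, HasDerivAt k ξ s →
      chartForm g p (k s) ξ ξ ≤ T ^ 2 := by
    intro s hs ξ hξ
    have hs' := hmap s ⟨hs.1.le, hs.2.le⟩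
    have hnh : ∀ᶠ s' in 𝓝 s, s' ∈ Set.Icc (0 : ℝ) 1 := Icc_mem_nhds hs.1 hs.2
    refine chartForm_deriv_le (e := fun s => c (a + s * T)) hT0.le (hwin _ hs').1.2
      (extChartAt_mem_interior_target (hwin _ hs').1.2 (h.mem_interior (hI hs'))) ?_ hξ ?_
    · have h1 : ContinuousWithinAt (fun s => c (a + s * T)) (Set.Icc 0 1) s :=
        (h.continuousOn _ (hIδ _ hs')).comp (f := fun s => a + s * T)
          (by fun_prop) fun s hs => hIδ _ (hmap s hs)
      exact h1.continuousAt hnh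
    · filter_upwards [hnh] with s' hs''
      refine (h.dist_le_abs (hIδ _ hs') (hIδ _ (hmap s' hs''))).trans_eq ?_
      rw [show a + s' * T - (a + s * T) = T * (s' - s) by ring, abs_mul, abs_of_pos hT0]
  set E := chartForm g p (σ 0) (u 0) (u 0) with hE
  have hTE : T ≤ √E := by
    have h1 := riemannianDist_le_of_speed_le (g := g) (p := p) (e := σ) (u := u) (K := √E)
      (fun s hs => interior_subset (hgeo s hs).1) (fun s hs => (hgeo s hs).2.1) hucont
      (fun s hs => by rw [hgeo.energy_eq hs])
    rw [hσ0, hσ1, hk] at h1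
    simp only [zero_mul, add_zero, one_mul] at h1
    rw [show a + T = b by rw [hT]; ring,
      φ.left_inv (hwin a ⟨le_rfl, hab.le⟩).1.2, φ.left_inv (hwin b ⟨hab.le, le_rfl⟩).1.2] at h1
    have h2 := (h.le_dist (hIδ a ⟨le_rfl, hab.le⟩) (hIδ b ⟨hab.le, le_rfl⟩)).trans h1
    exact (ENNReal.ofReal_le_ofReal_iff (Real.sqrt_nonneg _)).1 h2
  have hTE2 : T ^ 2 ≤ E := (Real.le_sqrt' hT0).1 hTE
  have heq : Set.EqOn k σ (Set.Icc 0 1) :=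
    huniq σ u k _ hgeo (fun s hs => ⟨(hσu s hs).2.2.1, (hσu s hs).2.2.2,
      (hwin _ (hmap s hs)).2.trans (min_le_left _ _)⟩) hcl hσ0.symm hσ1.symm
      fun s hs ξ hξ => (hspeed s hs ξ hξ).trans hTE2
  have hEeq : E = T ^ 2 := by
    refine le_antisymm ?_ hTE2
    have hh : (1 / 2 : ℝ) ∈ Set.Ioo (0 : ℝ) 1 := by norm_num
    have hhI := Set.Ioo_subset_Icc_self hh
    have h1 : HasDerivAt k (u (1 / 2)) (1 / 2) :=
      (((hgeo _ hhI).2.1).congr heq (heq hhI)).hasDerivAt (Icc_mem_nhds hh.1 hh.2)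
    have h2 := hspeed _ hh _ h1
    rwa [heq hhI, hgeo.energy_eq hhI] at h2
  -- rescale to unit speed
  set ℓ : ℝ → ℝ := fun t => T⁻¹ * (t - a) with hℓ
  have hℓd : ∀ t, HasDerivWithinAt ℓ T⁻¹ (Set.Icc a b) t := fun t => by
    simpa using (((hasDerivAt_id t).sub_const a).const_mul T⁻¹).hasDerivWithinAt
  have hℓI : Set.MapsTo ℓ (Set.Icc a b) (Set.Icc 0 1) := fun t ht =>
    ⟨mul_nonneg (inv_nonneg.2 hT0.le) (sub_nonneg.2 ht.1), by
      rw [hℓ, inv_mul_le_iff₀ hT0]; linarith [ht.2]⟩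
  have hkℓ : ∀ t ∈ Set.Icc a b, φ (c t) = σ (ℓ t) := fun t ht => by
    rw [← heq (hℓI ht), hk, hℓ]
    congr 2
    field_simp
    ring
  refine ⟨Set.Icc a b, hIn, hI, fun t => T⁻¹ • u (ℓ t), fun t ht => ⟨(hwin t ht).1.2, ?_, ?_, ?_⟩⟩
  · exact ((hgeo _ (hℓI ht)).2.1.scomp t (hℓd t) hℓI).congr hkℓ (hkℓ t ht)
  · refine (((hgeo _ (hℓI ht)).2.2.scomp t (hℓd t) hℓI).const_smul T⁻¹).congr_deriv ?_
    rw [hkℓ t ht, geodesicAcc_smul, smul_smul, pow_two]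
  · rw [hkℓ t ht, map_smul, map_smul, smul_apply, smul_eq_mul, smul_eq_mul,
      hgeo.energy_eq (hℓI ht), ← hE, hEeq]
    field_simp

/-- The velocity of a minimizing curve is an integral curve of the spray, of unit speed. -/
theorem IsBoundaryMinimizing.isSprayAt [RegularSpace M] (h : IsBoundaryMinimizing g c δ) {t : ℝ}
    (ht : t ∈ Set.Ico 0 δ) :
    IsSprayAt g (tangentLift c (Set.Ico 0 δ)) (Set.Ico 0 δ) t ∧
      tangentLift c (Set.Ico 0 δ) t ∈ unitSphereBundle g := by
  obtain ⟨I, hI, hIs, w, hw⟩ := h.exists_hasDerivWithinAt ht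
  set p := c t with hp
  have hsrc : p ∈ (extChartAt (𝓡∂ m) p).source := mem_extChartAt_source p
  have hnI : ∀ᶠ s in 𝓝[Set.Ico 0 δ] t, s ∈ Set.Ico 0 δ ∧ I ∈ 𝓝[Set.Ico 0 δ] s :=
    Filter.Eventually.and self_mem_nhdsWithin (eventually_eventually_nhdsWithin.2 hI)
  have hlift : ∀ s ∈ Set.Ico 0 δ, I ∈ 𝓝[Set.Ico 0 δ] s →
      tangentChart p (tangentLift c (Set.Ico 0 δ) s) = (extChartAt (𝓡∂ m) p (c s), w s) := by
    intro s hs hIs'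
    have hsI : s ∈ I := mem_of_mem_nhdsWithin hs hIs'
    have hun : UniqueDiffWithinAt ℝ (Set.Ico 0 δ) s := uniqueDiffOn_Ico 0 δ s hs
    have h1 := (hw s hsI).2.1.mono_of_mem_nhdsWithin hIs'
    have hmd : MDifferentiableWithinAt 𝓘(ℝ, ℝ) (𝓡∂ m) c (Set.Ico 0 δ) s := by
      refine (mdifferentiableWithinAt_iff_target_of_mem_source (y := p)
        (by rw [← extChartAt_source (𝓡∂ m)]; exact (hw s hsI).1)).2
        ⟨(h.continuousOn s ⟨hs.1, hs.2.le⟩).mono Set.Ico_subset_Icc_self, ?_⟩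
      exact h1.differentiableWithinAt.mdifferentiableWithinAt
    rw [tangentChart_tangentLift hmd hun (hw s hsI).1, h1.derivWithin hun]
  have htI : t ∈ I := mem_of_mem_nhdsWithin ht hI
  have h1 := (hw t htI).2.1.mono_of_mem_nhdsWithin hI
  have h2 := (hw t htI).2.2.1.mono_of_mem_nhdsWithin hI
  have hQt := hlift t ht hI
  have hd : HasDerivWithinAt (fun s => tangentChart p (tangentLift c (Set.Ico 0 δ) s))
      (sprayField g p (tangentChart p (tangentLift c (Set.Ico 0 δ) t))) (Set.Ico 0 δ) t := by
    rw [hQt]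
    refine (h1.prodMk h2).congr_of_eventuallyEq ?_ hQt
    filter_upwards [hnI] with s hs using hlift s hs.1 hs.2
  have hc : ContinuousWithinAt (tangentLift (m := m) c (Set.Ico 0 δ)) (Set.Ico 0 δ) t := by
    have h3 : ContinuousAt (tangentChart (m := m) p).symm
        (tangentChart p (tangentLift c (Set.Ico 0 δ) t)) :=
      continuousAt_extChartAt_symm'' (by
        refine mem_tangentChart_target.2 ?_
        rw [hQt]
        exact (extChartAt (𝓡∂ m) p).map_source hsrc)
    refine (ContinuousAt.comp_continuousWithinAt
      (f := fun s => tangentChart p (tangentLift c (Set.Ico 0 δ) s)) h3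
      hd.continuousWithinAt).congr_of_eventuallyEq ?_ ?_
    · filter_upwards [hnI] with s hs
      exact ((tangentChart p).left_inv (mem_tangentChart_source.2
        (hw s (mem_of_mem_nhdsWithin hs.1 hs.2)).1)).symm
    · exact ((tangentChart p).left_inv (mem_tangentChart_source.2 hsrc)).symm
  refine ⟨IsSprayAt.of_hasDerivWithinAt hc hsrc hd, ?_⟩
  have h4 := inner_eq_chartForm g (p := p) (q := tangentLift c (Set.Ico 0 δ) t) hsrc
  rw [hQt] at h4
  exact h4.trans (hw t htI).2.2.2

end Minimizing

/-! ### Nontangential geodesics to the nearest boundary points -/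

section NearestPoint

variable {m : ℕ} [NeZero m] {M : Type*} [TopologicalSpace M]
  [ChartedSpace (EuclideanHalfSpace m) M] [IsManifold (𝓡∂ m) ∞ M] {g : SmoothMetric m M}

lemma norm_geodesicAcc_le (g : SmoothMetric m M) {p : M} {y : EucM m}
    (hy : y ∈ (extChartAt (𝓡∂ m) p).target) {μ : ℝ} (hμ : 0 < μ)
    (hμw : ∀ w, μ * ‖w‖ ^ 2 ≤ chartForm g p y w w) (w : EucM m) :
    ‖geodesicAcc g p y w‖ ≤ 2 * ‖chartFormDeriv g p y‖ * ‖w‖ ^ 2 / μ := by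
  set a := geodesicAcc g p y w with ha
  set D := chartFormDeriv g p y with hD
  have h1 := chartForm_geodesicAcc g hy w a
  have h2 := hμw a
  have h3 : |D w w a| ≤ ‖D‖ * ‖w‖ * ‖w‖ * ‖a‖ :=
    abs_apply_apply_le _ (D.le_opNorm w) w a
  have h4 : |D a w w| ≤ ‖D‖ * ‖a‖ * ‖w‖ * ‖w‖ := abs_apply_apply_le _ (D.le_opNorm a) w w
  rw [abs_le] at h3 h4
  rw [← ha] at h1
  have h5 : μ * ‖a‖ ^ 2 ≤ 2 * ‖D‖ * ‖w‖ ^ 2 * ‖a‖ := by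
    have h6 : 0 ≤ ‖D‖ * ‖w‖ ^ 2 * ‖a‖ := by positivity
    nlinarith [h3.1, h3.2, h4.1, h4.2]
  rw [le_div_iff₀ hμ]
  rcases (norm_nonneg a).eq_or_lt' with h0 | h0
  · rw [h0, zero_mul]
    positivity
  · refine le_of_mul_le_mul_right ?_ h0
    calc _ = μ * ‖a‖ ^ 2 := by ring
      _ ≤ _ := h5

/-- A unit speed geodesic on a half-open interval whose position converges extends to the closed
interval: in a chart, its velocity and acceleration are bounded. -/
lemma exists_isSprayAt_extend {Q : ℝ → TangentBundle (𝓡∂ m) M} {δ : ℝ} {b : M}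
    (hδ : 0 < δ) (hQ : ∀ t ∈ Set.Ico 0 δ, IsSprayAt g Q (Set.Ico 0 δ) t)
    (hunit : ∀ t ∈ Set.Ico 0 δ, Q t ∈ unitSphereBundle g)
    (hb : Filter.Tendsto (fun t => (Q t).proj) (𝓝[Set.Ico 0 δ] δ) (𝓝 b)) :
    ∃ Q' : ℝ → TangentBundle (𝓡∂ m) M, (∀ t ∈ Set.Ico 0 δ, Q' t = Q t) ∧ (Q' δ).proj = b ∧
      ∀ t ∈ Set.Icc 0 δ, IsSprayAt g Q' (Set.Icc 0 δ) t := by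
  set y := extChartAt (𝓡∂ m) b b with hy
  have hsrc : b ∈ (extChartAt (𝓡∂ m) b).source := mem_extChartAt_source b
  have hyt : y ∈ (extChartAt (𝓡∂ m) b).target := (extChartAt (𝓡∂ m) b).map_source hsrc
  obtain ⟨μ, hμ, hμw⟩ := exists_le_chartForm g hyt
  set D₀ := ‖chartFormDeriv g b y‖ + 1 with hD₀
  have hnear : ∀ᶠ z in 𝓝[Set.range (𝓡∂ m)] y, z ∈ (extChartAt (𝓡∂ m) b).target ∧
      (∀ w, μ / 2 * ‖w‖ ^ 2 ≤ chartForm g b z w w) ∧ ‖chartFormDeriv g b z‖ ≤ D₀ := by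
    have h1 := (contDiffWithinAt_chartFormDeriv g hyt).continuousWithinAt.norm
    filter_upwards [extChartAt_target_mem_nhdsWithin_of_mem hyt,
      eventually_mul_le_chartForm g hyt (show (1 / 2 : ℝ) < 1 by norm_num),
      h1.eventually_lt_const (show _ < D₀ from lt_add_one _)] with z h2 h3 h4
    exact ⟨h2, fun w => by linarith [h3 w, hμw w], h4.le⟩
  have hlim : Filter.Tendsto (fun t => extChartAt (𝓡∂ m) b (Q t).proj) (𝓝[Set.Ico 0 δ] δ)
      (𝓝[Set.range (𝓡∂ m)] y) :=
    tendsto_nhdsWithin_iff.2 ⟨(continuousAt_extChartAt b).tendsto.comp hb,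
      Filter.Eventually.of_forall fun t => mem_range_halfSpace.2 (extChartAt_zero_nonneg b _)⟩
  have hev := (hlim.eventually hnear).and (hb ((isOpen_extChartAt_source b).mem_nhds hsrc))
  obtain ⟨η, hη, hηs⟩ := Metric.mem_nhdsWithin_iff.1 hev
  set a := max 0 (δ - η / 2) with ha
  have haδ : a < δ := max_lt hδ (by linarith)
  have ha0 : 0 ≤ a := le_max_left _ _
  have hIco : Set.Ico a δ ⊆ Set.Ico 0 δ := Set.Ico_subset_Ico_left ha0
  have hwin : ∀ t ∈ Set.Ico a δ, (extChartAt (𝓡∂ m) b (Q t).proj ∈ (extChartAt (𝓡∂ m) b).target ∧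
      (∀ w, μ / 2 * ‖w‖ ^ 2 ≤ chartForm g b (extChartAt (𝓡∂ m) b (Q t).proj) w w) ∧
      ‖chartFormDeriv g b (extChartAt (𝓡∂ m) b (Q t).proj)‖ ≤ D₀) ∧
      (Q t).proj ∈ (extChartAt (𝓡∂ m) b).source := by
    intro t ht
    refine hηs ⟨?_, hIco ht⟩
    rw [Metric.mem_ball, Real.dist_eq, abs_lt]
    have h1 := (le_max_right _ _).trans ht.1
    constructor <;> linarith [ht.2]
  set z : ℝ → EucM m × EucM m := fun t => tangentChart b (Q t) with hz
  have hz1 : ∀ t ∈ Set.Ico a δ, (z t).1 = extChartAt (𝓡∂ m) b (Q t).proj := fun t ht =>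
    tangentChart_fst (hwin t ht).2
  have hzd : ∀ t ∈ Set.Ico a δ, HasDerivWithinAt z (sprayField g b (z t)) (Set.Ico a δ) t :=
    fun t ht => ((hQ t (hIco ht)).hasDerivWithinAt (hwin t ht).2).mono hIco
  have hw : ∀ t ∈ Set.Ico a δ, ‖(z t).2‖ ^ 2 ≤ 2 / μ := by
    intro t ht
    have h1 := inner_eq_chartForm g (p := b) (q := Q t) (hwin t ht).2
    have h2 : g.inner (Q t).proj (Q t).snd (Q t).snd = 1 := hunit t (hIco ht)
    rw [h2] at h1
    have h3 := (hwin t ht).1.2.1 (z t).2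
    rw [← h1] at h3
    rw [le_div_iff₀ hμ]
    linarith
  have hacc : ∀ t ∈ Set.Ico a δ, ‖geodesicAcc g b (z t).1 (z t).2‖ ≤
      2 * D₀ * (2 / μ) / (μ / 2) := by
    intro t ht
    have h1 := norm_geodesicAcc_le g (hwin t ht).1.1 (half_pos hμ) (hwin t ht).1.2.1 (z t).2
    rw [hz1 t ht]
    refine h1.trans ?_
    gcongr
    · exact (hwin t ht).1.2.2
    · exact hw t ht
  have hlip : LipschitzOnWith (2 * D₀ * (2 / μ) / (μ / 2)).toNNReal (fun t => (z t).2)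
      (Set.Ico a δ) := by
    refine (convex_Ico a δ).lipschitzOnWith_of_nnnorm_hasDerivWithin_le
      (f' := fun t => geodesicAcc g b (z t).1 (z t).2) (fun t ht => (hzd t ht).snd) fun t ht => ?_
    rw [← norm_toNNReal]
    exact Real.toNNReal_le_toNNReal (hacc t ht)
  obtain ⟨F, hF, hFe⟩ := hlip.extend_finite_dimension
  set ζ : EucM m × EucM m := (y, F δ) with hζ
  have hζt : ζ ∈ (tangentChart (m := m) b).target := mem_tangentChart_target.2 hyt
  have hIn : Set.Ico a δ ∈ 𝓝[<] δ := Ico_mem_nhdsLT haδ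
  have hnh : 𝓝[<] δ ≤ 𝓝[Set.Ico 0 δ] δ :=
    nhdsWithin_le_iff.2 (Filter.mem_of_superset hIn hIco)
  have hzlim : Filter.Tendsto z (𝓝[<] δ) (𝓝 ζ) := by
    have h1 : Filter.Tendsto (fun t => (z t).1) (𝓝[<] δ) (𝓝 y) := by
      refine (((tendsto_nhdsWithin_iff.1 hlim).1).mono_left hnh).congr' ?_
      filter_upwards [hIn] with t ht using (hz1 t ht).symm
    have h2 : Filter.Tendsto (fun t => (z t).2) (𝓝[<] δ) (𝓝 (F δ)) := by
      refine ((hF.continuous.tendsto δ).mono_left nhdsWithin_le_nhds).congr' ?_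
      filter_upwards [hIn] with t ht using (hFe ht).symm
    exact h1.prodMk_nhds h2
  set Q' : ℝ → TangentBundle (𝓡∂ m) M := fun t => if t < δ then Q t else (tangentChart b).symm ζ
    with hQ'
  have hQ'eq : ∀ t ∈ Set.Ico 0 δ, Q' t = Q t := fun t ht => if_pos ht.2
  have hQ'δ : Q' δ = (tangentChart b).symm ζ := if_neg (lt_irrefl δ)
  have hproj : (Q' δ).proj = b := by
    rw [hQ'δ, hζ, tangentChart_symm_apply hyt]
    exact (extChartAt (𝓡∂ m) b).left_inv hsrc
  have hchart : tangentChart b (Q' δ) = ζ := by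
    rw [hQ'δ]
    exact (tangentChart b).right_inv hζt
  refine ⟨Q', hQ'eq, hproj, fun t ht => ?_⟩
  rcases ht.2.lt_or_eq with htδ | rfl
  · have ht' : t ∈ Set.Ico 0 δ := ⟨ht.1, htδ⟩
    have hmem : Set.Ico 0 δ ∈ 𝓝[Set.Icc 0 δ] t := by
      refine Filter.mem_of_superset (Filter.inter_mem self_mem_nhdsWithin
        (mem_nhdsWithin_of_mem_nhds (Iio_mem_nhds htδ))) fun s hs => ⟨hs.1.1, hs.2⟩
    have h1 := hQ t ht'
    have hev' : Q' =ᶠ[𝓝[Set.Icc 0 δ] t] Q := by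
      filter_upwards [hmem] with s hs using hQ'eq s hs
    refine ⟨(h1.1.mono_of_mem_nhdsWithin hmem).congr_of_eventuallyEq hev' (hQ'eq t ht'), ?_⟩
    rw [hQ'eq t ht']
    refine (h1.2.mono_of_mem_nhdsWithin hmem).congr_of_eventuallyEq ?_ (by
      simp only [hQ'eq t ht'])
    filter_upwards [hev'] with s hs
    simp only [hs]
  · set z' : ℝ → EucM m × EucM m := fun s => tangentChart b (Q' s) with hz'
    have hzz' : ∀ s ∈ Set.Ico a t, z' s = z s := fun s hs => by
      rw [hz', hz]
      simp only [hQ'eq s (hIco hs)]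
    have hmem : Set.Iic t ∈ 𝓝[Set.Icc 0 t] t :=
      Filter.mem_of_superset self_mem_nhdsWithin fun s hs => hs.2
    have hcont : ContinuousWithinAt z' (Set.Iio t) t := by
      have : Filter.Tendsto z' (𝓝[<] t) (𝓝 ζ) := hzlim.congr' (by
        filter_upwards [hIn] with s hs using (hzz' s hs).symm)
      rw [← hchart] at this
      exact this
    have hIoo : Set.Ioo a t ∈ 𝓝[<] t := Ioo_mem_nhdsLT haδ
    have hderiv : ∀ s ∈ Set.Ioo a t, HasDerivAt z' (sprayField g b (z s)) s := fun s hs =>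
      ((hzd s ⟨hs.1.le, hs.2⟩).congr hzz' (hzz' s ⟨hs.1.le, hs.2⟩)).hasDerivAt
        (Ico_mem_nhds hs.1 hs.2)
    have hd : HasDerivWithinAt z' (sprayField g b ζ) (Set.Iic t) t := by
      refine hasDerivWithinAt_Iic_of_tendsto_deriv (s := Set.Ioo a t)
        (fun s hs => (hderiv s hs).differentiableAt.differentiableWithinAt)
        (hcont.mono fun s hs => hs.2) hIoo ?_
      have h1 : ContinuousWithinAt (sprayField g b) (Set.range (𝓡∂ m) ×ˢ Set.univ) ζ :=
        (contDiffWithinAt_sprayField g hyt).continuousWithinAt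
      have h2 : Filter.Tendsto z (𝓝[<] t) (𝓝[Set.range (𝓡∂ m) ×ˢ Set.univ] ζ) := by
        refine tendsto_nhdsWithin_iff.2 ⟨hzlim, ?_⟩
        filter_upwards [hIn] with s hs
        refine ⟨?_, trivial⟩
        rw [hz1 s hs]
        exact mem_range_halfSpace.2 (extChartAt_zero_nonneg b _)
      refine (h1.tendsto.comp h2).congr' ?_
      filter_upwards [hIoo] with s hs using (hderiv s hs).deriv.symm
    have hprojs : (Q' t).proj ∈ (extChartAt (𝓡∂ m) b).source := by rw [hproj]; exact hsrc
    have hd' : HasDerivWithinAt z' (sprayField g b (tangentChart b (Q' t))) (Set.Icc 0 t) t := by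
      rw [hchart]
      exact hd.mono_of_mem_nhdsWithin hmem
    refine IsSprayAt.of_hasDerivWithinAt ?_ hprojs hd'
    have h3 : ContinuousAt (tangentChart (m := m) b).symm (z' t) :=
      continuousAt_extChartAt_symm'' (by
        have h4 := hζt
        rw [← hchart] at h4
        exact h4)
    refine (ContinuousAt.comp_continuousWithinAt (f := z') h3
      hd'.continuousWithinAt).congr_of_eventuallyEq ?_
      ((tangentChart b).left_inv (mem_tangentChart_source.2 hprojs)).symm
    have hIcc : ∀ᶠ s in 𝓝[Set.Icc 0 t] t, s ∈ Set.Icc a t := by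
      filter_upwards [self_mem_nhdsWithin, mem_nhdsWithin_of_mem_nhds (Ioi_mem_nhds haδ)]
        with s hs hs' using ⟨le_of_lt hs', hs.2⟩
    filter_upwards [hIcc] with s hs
    have hss : (Q' s).proj ∈ (extChartAt (𝓡∂ m) b).source := by
      rcases hs.2.lt_or_eq with hst | rfl
      · rw [hQ'eq s (hIco ⟨hs.1, hst⟩)]
        exact (hwin s ⟨hs.1, hst⟩).2
      · exact hprojs
    exact ((tangentChart b).left_inv (mem_tangentChart_source.2 hss)).symm

/-- Near the boundary, the distance to the boundary is bounded by a multiple of the transversal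
coordinate. -/
lemma exists_boundaryDist_le (g : SmoothMetric m M) {b : M} (hb : b ∈ (𝓡∂ m).boundary M) :
    ∃ C > 0, ∀ᶠ x in 𝓝 b,
      boundaryDist g x ≤ ENNReal.ofReal (C * extChartAt (𝓡∂ m) b x 0) := by
  set y := extChartAt (𝓡∂ m) b b with hy
  have hsrc : b ∈ (extChartAt (𝓡∂ m) b).source := mem_extChartAt_source b
  have hyt : y ∈ (extChartAt (𝓡∂ m) b).target := (extChartAt (𝓡∂ m) b).map_source hsrc
  have hy0 : y 0 = 0 := (mem_boundary_iff_extChartAt hsrc).1 hb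
  set e₀ : EucM m := EuclideanSpace.single 0 1 with he₀
  set C := chartForm g b y e₀ e₀ + 1 with hC
  have hC0 : 0 < C := by linarith [chartForm_self_nonneg g hyt e₀]
  have hnear : ∀ᶠ z in 𝓝[Set.range (𝓡∂ m)] y, z ∈ (extChartAt (𝓡∂ m) b).target ∧
      chartForm g b z e₀ e₀ < C := by
    have h1 : ContinuousWithinAt (fun z => chartForm g b z e₀ e₀) (Set.range (𝓡∂ m)) y :=
      ((contDiffWithinAt_chartForm g hyt).continuousWithinAt.clm_apply
        continuousWithinAt_const).clm_apply continuousWithinAt_const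
    filter_upwards [extChartAt_target_mem_nhdsWithin_of_mem hyt,
      h1.eventually_lt_const (lt_add_one _)] with z h2 h3 using ⟨h2, h3⟩
  obtain ⟨r, hr, hrs⟩ := Metric.mem_nhdsWithin_iff.1 hnear
  refine ⟨√C, Real.sqrt_pos.2 hC0, ?_⟩
  have hx := (continuousAt_extChartAt (I := 𝓡∂ m) b).preimage_mem_nhds
    (Metric.ball_mem_nhds y (half_pos hr))
  filter_upwards [hx, (isOpen_extChartAt_source b).mem_nhds hsrc] with x hxr hxs
  set z := extChartAt (𝓡∂ m) b x with hz
  have hz0 : 0 ≤ z 0 := extChartAt_zero_nonneg b x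
  have hzr : ‖z - y‖ < r / 2 := by rw [← dist_eq_norm]; exact hxr
  have hz0r : z 0 < r / 2 := by
    have h1 := PiLp.norm_apply_le (z - y) 0
    rw [PiLp.sub_apply, hy0, sub_zero, Real.norm_eq_abs, abs_of_nonneg hz0] at h1
    exact h1.trans_lt hzr
  have he₀n : ‖e₀‖ = 1 := by simp [he₀]
  have he₀0 : e₀ 0 = 1 := by simp [he₀]
  -- the straight segment from `z` down to the boundary of the half-space
  set e : ℝ → EucM m := fun s => z - (s * z 0) • e₀ with he
  have he0 : ∀ s, e s 0 = (1 - s) * z 0 := fun s => by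
    rw [he]
    simp only [PiLp.sub_apply, PiLp.smul_apply, he₀0, smul_eq_mul]
    ring
  have hmem : ∀ s ∈ Set.Icc (0 : ℝ) 1, e s ∈ (extChartAt (𝓡∂ m) b).target ∧
      chartForm g b (e s) e₀ e₀ < C := fun s hs => by
    refine hrs ⟨?_, mem_range_halfSpace.2 ?_⟩
    · rw [Metric.mem_ball, dist_eq_norm]
      have h1 : e s - y = (z - y) - (s * z 0) • e₀ := sub_right_comm _ _ _
      rw [h1]
      refine (norm_sub_le _ _).trans_lt ?_
      rw [norm_smul, he₀n, mul_one, Real.norm_eq_abs, abs_of_nonneg (mul_nonneg hs.1 hz0)]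
      nlinarith [hs.2]
    · rw [he0]
      exact mul_nonneg (by linarith [hs.2]) hz0
  have hd : ∀ s, HasDerivAt e (-(z 0) • e₀) s := fun s => by
    have h1 := (((hasDerivAt_id s).mul_const (z 0)).smul_const e₀).const_sub z
    exact h1.congr_deriv (by simp)
  have h1 := riemannianDist_le_of_speed_le (g := g) (p := b) (e := e) (u := fun _ => -(z 0) • e₀)
    (K := √C * z 0) (fun s hs => (hmem s hs).1) (fun s _ => (hd s).hasDerivWithinAt)
    continuousOn_const fun s hs => by
      rw [map_smul, map_smul, smul_apply, smul_eq_mul, smul_eq_mul, ← mul_assoc, neg_mul_neg,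
        Real.sqrt_mul (mul_nonneg hz0 hz0), Real.sqrt_mul_self hz0, mul_comm]
      gcongr
      exact (hmem s hs).2.le
  rw [show e 0 = z by simp [he], hz, (extChartAt (𝓡∂ m) b).left_inv hxs] at h1
  refine (boundaryDist_le ?_).trans h1
  have h1t := (hmem 1 (by simp)).1
  rw [mem_boundary_iff_extChartAt ((extChartAt (𝓡∂ m) b).map_target h1t),
    (extChartAt (𝓡∂ m) b).right_inv h1t, he0]
  simp

/-- A minimizing curve to the boundary is a nontangential geodesic. -/
theorem exists_isNontangential_riemannianDist_le [T2Space M] [CompactSpace M] {n : ℕ}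
    (A : HermitianConnection m M n) {x : M} (hx : x ∈ (𝓡∂ m).interior M)
    (hD : boundaryDist g x < ⊤) :
    ∃ v : TangentSpace (𝓡∂ m) x, IsNontangential g x v ∧
      riemannianDist g x (scatteringMap g x v) ≤ boundaryDist g x := by
  obtain ⟨c, δ, hδ, rfl, hxδ, hc1, hc2⟩ := exists_curve_boundaryDist_eq g hD
  have hc : IsBoundaryMinimizing g c δ := ⟨hc1, hc2⟩
  have hδI : δ ∈ Set.Icc 0 δ := ⟨hδ, le_rfl⟩
  have hδ0 : 0 < δ := by
    refine hδ.lt_of_ne fun h0 => ?_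
    rw [← h0, ENNReal.ofReal_zero] at hxδ
    rw [← ModelWithCorners.compl_boundary] at hx
    exact hx (mem_boundary_of_boundaryDist_eq_zero hxδ)
  have hb : c δ ∈ (𝓡∂ m).boundary M :=
    mem_boundary_of_boundaryDist_eq_zero (g := g) (by rw [hc1 δ hδI]; simp)
  have hclim : Filter.Tendsto c (𝓝[Set.Icc 0 δ] δ) (𝓝 (c δ)) := hc.continuousOn δ hδI
  obtain ⟨Q, hQeq, hQb, hQ⟩ := exists_isSprayAt_extend hδ0 (fun t ht => (hc.isSprayAt ht).1)
    (fun t ht => (hc.isSprayAt ht).2)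
    (hclim.mono_left (nhdsWithin_mono _ Set.Ico_subset_Icc_self))
  have hproj : ∀ t ∈ Set.Ico 0 δ, (Q t).proj = c t := fun t ht => by rw [hQeq t ht]; rfl
  have hsrc : (Q δ).proj ∈ (extChartAt (𝓡∂ m) (c δ)).source := by
    rw [hQb]
    exact mem_extChartAt_source _
  have htrans : ¬ IsTangentToBoundary (Q δ).proj (Q δ).snd := by
    rw [isTangentToBoundary_iff hsrc (by rw [hQb]; exact hb)]
    intro h0
    obtain ⟨C, hC, hCD⟩ := exists_boundaryDist_le g hb
    have hd : HasDerivWithinAt (fun t => extChartAt (𝓡∂ m) (c δ) (Q t).proj 0)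
        ((tangentChart (c δ) (Q δ)).2 0) (Set.Icc 0 δ) δ :=
      (EuclideanSpace.proj (𝕜 := ℝ) (0 : Fin m)).hasFDerivAt.comp_hasDerivWithinAt δ
        ((hQ δ hδI).hasDerivWithinAt_position hsrc)
    rw [h0] at hd
    have hz0 : extChartAt (𝓡∂ m) (c δ) (Q δ).proj 0 = 0 := by
      rw [← mem_boundary_iff_extChartAt hsrc, hQb]
      exact hb
    have hlower : ∀ᶠ t in 𝓝[<] δ,
        slope (fun t => extChartAt (𝓡∂ m) (c δ) (Q t).proj 0) δ t ≤ -C⁻¹ := by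
      have hnh : Set.Ico 0 δ ∈ 𝓝[<] δ := Ico_mem_nhdsLT hδ0
      have h1 : ∀ᶠ t in 𝓝[<] δ, boundaryDist g (c t) ≤
          ENNReal.ofReal (C * extChartAt (𝓡∂ m) (c δ) (c t) 0) :=
        (hclim.mono_left (nhdsWithin_le_iff.2 (Filter.mem_of_superset hnh
          Set.Ico_subset_Icc_self))).eventually hCD
      filter_upwards [h1, hnh] with t ht htI
      rw [hc1 t ⟨htI.1, htI.2.le⟩, ENNReal.ofReal_le_ofReal_iff
        (mul_nonneg hC.le (extChartAt_zero_nonneg _ _)), ← hproj t htI] at ht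
      rw [slope_def_field, hz0, sub_zero, div_le_iff_of_neg (by linarith [htI.2])]
      have h2 : C⁻¹ * (δ - t) ≤ extChartAt (𝓡∂ m) (c δ) (Q t).proj 0 := by
        rw [inv_mul_le_iff₀ hC]
        exact ht
      linarith
    have hslope : Filter.Tendsto (slope (fun t => extChartAt (𝓡∂ m) (c δ) (Q t).proj 0) δ)
        (𝓝[<] δ) (𝓝 0) := by
      refine (hasDerivWithinAt_iff_tendsto_slope.1 hd).mono_left (nhdsWithin_le_iff.2 ?_)
      filter_upwards [Ico_mem_nhdsLT hδ0] with t ht using ⟨⟨ht.1, ht.2.le⟩, ht.2.ne⟩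
    have h3 := le_of_tendsto hslope hlower
    linarith [inv_pos.2 hC]
  obtain ⟨U, hU0, hU⟩ := IsSprayAt.exists_isExitCurve A hδ hQ
  have hexit : IsExitCurve g A (fun r => (Q r, U r)) 0 δ :=
    ⟨hδ0, hU, fun t ht => by rw [hproj t ht]; exact hc.mem_interior ht, by rw [hQb]; exact hb,
      htrans⟩
  have h0 : (0 : ℝ) ∈ Set.Ico 0 δ := ⟨le_rfl, hδ0⟩
  have hq := (hc.isSprayAt h0).2
  refine ⟨(tangentLift c (Set.Ico 0 δ) 0).snd,
    ⟨(δ, _), hexit.isNontangentialGeodesic (hQeq 0 h0) hq⟩, ?_⟩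
  have h1 := (hexit.geodesicTransport_eq (hQeq 0 h0) hq hU0).2
  have h2 : scatteringMap g (c 0) (tangentLift c (Set.Ico 0 δ) 0).snd = c δ := h1.trans hQb
  rw [h2, hxδ]
  simpa using hc2 0 ⟨le_rfl, hδ⟩ δ hδI hδ

lemma mem_closure_interior (b : M) : b ∈ closure ((𝓡∂ m).interior M) := by
  set y := extChartAt (𝓡∂ m) b b with hy
  have hsrc : b ∈ (extChartAt (𝓡∂ m) b).source := mem_extChartAt_source b
  have hyt : y ∈ (extChartAt (𝓡∂ m) b).target := (extChartAt (𝓡∂ m) b).map_source hsrc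
  set e : ℝ → EucM m := fun s => y + s • EuclideanSpace.single 0 1 with he
  have he0 : ∀ s, e s 0 = y 0 + s := fun s => by simp [he]
  have hy0 : 0 ≤ y 0 := extChartAt_zero_nonneg b b
  have hlim : Filter.Tendsto e (𝓝[>] 0) (𝓝[Set.range (𝓡∂ m)] y) := by
    refine tendsto_nhdsWithin_iff.2 ⟨?_, ?_⟩
    · have h1 : Continuous e := by fun_prop
      have h2 : e 0 = y := by simp [he]
      exact h2 ▸ (h1.tendsto 0).mono_left nhdsWithin_le_nhds
    · filter_upwards [self_mem_nhdsWithin] with s hs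
      exact mem_range_halfSpace.2 (by rw [he0]; exact add_nonneg hy0 (le_of_lt hs))
  have hsymm : Filter.Tendsto (fun s => (extChartAt (𝓡∂ m) b).symm (e s)) (𝓝[>] 0) (𝓝 b) := by
    have h1 : Filter.Tendsto (extChartAt (𝓡∂ m) b).symm (𝓝 y) (𝓝 b) := by
      have := (continuousAt_extChartAt_symm (I := 𝓡∂ m) b).tendsto
      rwa [extChartAt_to_inv] at this
    exact h1.comp (hlim.mono_right nhdsWithin_le_nhds)
  refine mem_closure_of_tendsto hsymm ?_
  filter_upwards [hlim.eventually (extChartAt_target_mem_nhdsWithin_of_mem hyt),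
    self_mem_nhdsWithin] with s hs hs0
  rw [mem_interior_iff_extChartAt ((extChartAt (𝓡∂ m) b).map_target hs),
    (extChartAt (𝓡∂ m) b).right_inv hs, he0]
  exact add_pos_of_nonneg_of_pos hy0 hs0

/-- The endpoints of the nontangential geodesics are dense in the boundary. -/
theorem boundary_subset_closure_scatteringMap [T2Space M] [CompactSpace M] {n : ℕ}
    (A : HermitianConnection m M n) (g : SmoothMetric m M) : (𝓡∂ m).boundary M ⊆
      closure {y | ∃ q ∈ {q : TangentBundle (𝓡∂ m) M | IsNontangential g q.proj q.snd},
        scatteringMap g q.proj q.snd = y} := by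
  intro b hb
  refine mem_closure_iff_nhds.2 fun s hs => ?_
  obtain ⟨r, hr, hrs⟩ := exists_riemannianDist_lt_subset g hs
  have hr2 : 0 < r / 2 := ENNReal.half_pos hr.ne'
  -- interior points accumulate at `b`
  obtain ⟨x, hxb, hxi⟩ : ∃ x, riemannianDist g b x < r / 2 ∧ x ∈ (𝓡∂ m).interior M := by
    obtain ⟨x, hx1, hx2⟩ := mem_closure_iff_nhds.1 (mem_closure_interior (m := m) b) _
      (eventually_riemannianDist_lt g b hr2)
    exact ⟨x, hx1, hx2⟩
  have hD : boundaryDist g x < r / 2 :=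
    (boundaryDist_le hb).trans_lt (by rwa [riemannianDist_comm])
  obtain ⟨v, hv, hvd⟩ := exists_isNontangential_riemannianDist_le A hxi (hD.trans_le le_top)
  refine ⟨scatteringMap g x v, hrs _ ?_, ⟨x, v⟩, hv, rfl⟩
  calc _ ≤ riemannianDist g b x + riemannianDist g x (scatteringMap g x v) :=
        riemannianDist_triangle g b x _
    _ < r / 2 + r / 2 := ENNReal.add_lt_add hxb (hvd.trans_lt hD)
    _ = r := ENNReal.add_halves r

end NearestPoint

/-! ### All nontangential directions -/

section AllDirections

variable {m : ℕ} [NeZero m] {M : Type*} [TopologicalSpace M]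
  [ChartedSpace (EuclideanHalfSpace m) M] [IsManifold (𝓡∂ m) ∞ M] {n : ℕ}
  {g : SmoothMetric m M} {A₁ A₂ : HermitianConnection m M n}

lemma sprayField_contDiffAt (g : SmoothMetric m M) {p : M} {z : EucM m × EucM m}
    (hz : z.1 ∈ interior (extChartAt (𝓡∂ m) p).target) : ContDiffAt ℝ ∞ (sprayField g p) z := by
  refine (contDiffWithinAt_sprayField g (interior_subset hz)).contDiffAt ?_
  rw [nhds_prod_eq]
  exact Filter.prod_mem_prod (mem_interior_iff_mem_nhds.1
    (interior_mono (fun _ hz => mem_range_of_mem_target hz) hz)) Filter.univ_mem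

/-- The speed of an integral curve of the spray in a chart is constant. -/
lemma chartForm_integralCurve_eq {p : M} {ε : ℝ} {α : ℝ → EucM m × EucM m}
    (hα : ∀ t ∈ Set.Ioo (-ε) ε, (α t).1 ∈ interior (extChartAt (𝓡∂ m) p).target ∧
      HasDerivAt α (sprayField g p (α t)) t) {t : ℝ} (ht : t ∈ Set.Ioo (-ε) ε) :
    chartForm g p (α t).1 (α t).2 (α t).2 = chartForm g p (α 0).1 (α 0).2 (α 0).2 := by
  by_cases ht0 : t = 0
  · rw [ht0]
  -- rescale the interval between `0` and `t` to `[0, 1]`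
  have hmem : ∀ s ∈ Set.Icc (0 : ℝ) 1, s * t ∈ Set.Ioo (-ε) ε := by
    intro s hs
    have h1 : |s * t| ≤ |t| := by
      rw [abs_mul, abs_of_nonneg hs.1]
      exact mul_le_of_le_one_left (abs_nonneg t) hs.2
    exact abs_lt.1 (h1.trans_lt (abs_lt.2 ht))
  have hgeo : IsChartGeodesic g p (fun s => (α (s * t)).1) (fun s => t • (α (s * t)).2) := by
    intro s hs
    have h1 : HasDerivAt (fun s => α (s * t)) (t • sprayField g p (α (s * t))) s := by
      have h2 : HasDerivAt (fun s : ℝ => s * t) t s := by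
        simpa using (hasDerivAt_id s).mul_const t
      exact HasDerivAt.scomp s (hα _ (hmem s hs)).2 h2
    have h2 : HasDerivAt (fun s => (α (s * t)).1) (t • (α (s * t)).2) s := h1.fst
    have h3 : HasDerivAt (fun s => (α (s * t)).2)
      (t • geodesicAcc g p (α (s * t)).1 (α (s * t)).2) s := h1.snd
    refine ⟨(hα _ (hmem s hs)).1, h2.hasDerivWithinAt,
      ((h3.const_smul t).congr_deriv ?_).hasDerivWithinAt⟩
    rw [geodesicAcc_smul, pow_two, mul_smul]
  have h1 := hgeo.energy_eq (t := 1) (by simp)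
  simp only [one_mul, zero_mul, map_smul, smul_apply, smul_eq_mul] at h1
  exact mul_left_cancel₀ ht0 (mul_left_cancel₀ ht0 h1)

/-- Every unit vector at an interior point is the velocity at time `0` of a unit speed geodesic. -/
lemma exists_isSprayAt_Ioo {x : M} (hx : x ∈ (𝓡∂ m).interior M) {v : TangentSpace (𝓡∂ m) x}
    (hv : (⟨x, v⟩ : TangentBundle (𝓡∂ m) M) ∈ unitSphereBundle g) :
    ∃ ε > 0, ∃ Q : ℝ → TangentBundle (𝓡∂ m) M, Q 0 = ⟨x, v⟩ ∧
      ∀ t ∈ Set.Ioo (-ε) ε, IsSprayAt g Q (Set.Ioo (-ε) ε) t ∧ Q t ∈ unitSphereBundle g := by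
  set q : TangentBundle (𝓡∂ m) M := ⟨x, v⟩ with hq
  have hsrc : q.proj ∈ (extChartAt (𝓡∂ m) x).source := mem_extChartAt_source x
  have hz : (tangentChart x q).1 ∈ interior (extChartAt (𝓡∂ m) x).target := by
    rw [tangentChart_fst hsrc]
    exact extChartAt_mem_interior_target hsrc hx
  obtain ⟨α, hα0, ε₁, hε₁, hα⟩ := ((sprayField_contDiffAt g hz).of_le (m := 1)
    (by simp)).exists_forall_mem_closedBall_exists_eq_forall_mem_Ioo_hasDerivAt₀ 0
  simp only [zero_sub, zero_add] at hα
  have hc : ∀ᶠ t in 𝓝 0, (α t).1 ∈ interior (extChartAt (𝓡∂ m) x).target := by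
    have h1 : ContinuousAt (fun t => (α t).1) 0 :=
      (hα 0 ⟨by linarith, hε₁⟩).continuousAt.fst
    have h2 : (α 0).1 ∈ interior (extChartAt (𝓡∂ m) x).target := by rwa [hα0]
    exact h1 (isOpen_interior.mem_nhds h2)
  obtain ⟨ε₂, hε₂, hball⟩ := Metric.mem_nhds_iff.1 hc
  set ε := min ε₁ ε₂ with hε
  have hε0 : 0 < ε := lt_min hε₁ hε₂
  have hαε : ∀ t ∈ Set.Ioo (-ε) ε, (α t).1 ∈ interior (extChartAt (𝓡∂ m) x).target ∧
      HasDerivAt α (sprayField g x (α t)) t := by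
    intro t ht
    refine ⟨hball ?_, hα t ?_⟩
    · rw [Metric.mem_ball, dist_zero_right, Real.norm_eq_abs]
      exact (abs_lt.2 ht).trans_le (min_le_right _ _)
    · exact abs_lt.1 ((abs_lt.2 ht).trans_le (min_le_left _ _))
  have hchart : ∀ t ∈ Set.Ioo (-ε) ε, tangentChart x ((tangentChart x).symm (α t)) = α t :=
    fun t ht => (tangentChart x).right_inv
      (mem_tangentChart_target.2 (interior_subset (hαε t ht).1))
  have hproj : ∀ t ∈ Set.Ioo (-ε) ε,
      ((tangentChart x).symm (α t)).proj ∈ (extChartAt (𝓡∂ m) x).source := fun t ht =>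
    mem_tangentChart_source.1 ((tangentChart x).map_target
      (mem_tangentChart_target.2 (interior_subset (hαε t ht).1)))
  refine ⟨ε, hε0, fun t => (tangentChart x).symm (α t), ?_, fun t ht => ⟨?_, ?_⟩⟩
  · simp only [hα0]
    exact (tangentChart x).left_inv (mem_tangentChart_source.2 hsrc)
  · have h1 : ContinuousAt (tangentChart (m := m) x).symm (α t) :=
      continuousAt_extChartAt_symm''
        (mem_tangentChart_target.2 (interior_subset (hαε t ht).1))
    refine IsSprayAt.of_hasDerivWithinAt
      (h1.comp (hαε t ht).2.continuousAt).continuousWithinAt (hproj t ht) ?_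
    rw [hchart t ht]
    exact (hαε t ht).2.hasDerivWithinAt.congr hchart (hchart t ht)
  · have h0 : (0 : ℝ) ∈ Set.Ioo (-ε) ε := ⟨by linarith, hε0⟩
    have h1 := inner_tangentChart_symm g (interior_subset (hαε t ht).1) (α t).2
    rw [Prod.mk.eta, chartForm_integralCurve_eq hαε ht, hα0] at h1
    have h2 := inner_eq_chartForm g hsrc
    rw [tangentChart_fst hsrc, ← h2] at h1
    exact h1.trans hv

lemma continuous_inner_self (g : SmoothMetric m M) (x : M) :
    Continuous fun v : TangentSpace (𝓡∂ m) x => g.inner x v v := by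
  have hsrc : ∀ v : TangentSpace (𝓡∂ m) x,
      (⟨x, v⟩ : TangentBundle (𝓡∂ m) M).proj ∈ (extChartAt (𝓡∂ m) x).source := fun _ =>
    mem_extChartAt_source x
  have h1 : Continuous fun v : TangentSpace (𝓡∂ m) x =>
      (tangentChart x (⟨x, v⟩ : TangentBundle (𝓡∂ m) M)).2 :=
    continuous_iff_continuousAt.2 fun v => (ContinuousAt.comp
      (f := fun v : TangentSpace (𝓡∂ m) x => (⟨x, v⟩ : TangentBundle (𝓡∂ m) M))
      (continuousAt_tangentChart (hsrc v))
      (FiberBundle.continuous_totalSpaceMk (EucM m) (TangentSpace (𝓡∂ m)) x).continuousAt).snd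
  have h2 : ∀ v : TangentSpace (𝓡∂ m) x, g.inner x v v =
      chartForm g x (extChartAt (𝓡∂ m) x x) (tangentChart x (⟨x, v⟩ : TangentBundle (𝓡∂ m) M)).2
        (tangentChart x (⟨x, v⟩ : TangentBundle (𝓡∂ m) M)).2 := fun v =>
    inner_eq_chartForm g (hsrc v)
  simp only [h2]
  exact ((chartForm g x _).continuous.comp h1).clm_apply h1

/-- Nontangential directions are stable under perturbation, hence they span the tangent space. -/
lemma IsNontangential.span_eq_top [T2Space M] (A : HermitianConnection m M n) {x : M}
    {v : TangentSpace (𝓡∂ m) x} (hv : IsNontangential g x v) :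
    Submodule.span ℝ {w : TangentSpace (𝓡∂ m) x | IsNontangential g x w} = ⊤ := by
  have hunit : g.inner x v v = 1 := IsNontangential.mem_unitSphereBundle (q := ⟨x, v⟩) hv
  have hcont := continuous_inner_self g x
  set N : TangentSpace (𝓡∂ m) x → TangentSpace (𝓡∂ m) x := fun a => (√(g.inner x a a))⁻¹ • a
    with hN
  have hNv : N v = v := by simp [hN, hunit]
  have hNc : ContinuousAt N v :=
    ((hcont.sqrt.continuousAt).inv₀ (by simp [hunit])).smul continuousAt_id
  have hpos : ∀ᶠ a in 𝓝 v, 0 < g.inner x a a :=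
    hcont.continuousAt.eventually_const_lt (show 0 < g.inner x v v by rw [hunit]; exact one_pos)
  have hlim : Filter.Tendsto (fun a => (⟨x, N a⟩ : TangentBundle (𝓡∂ m) M)) (𝓝 v)
      (𝓝[unitSphereBundle g] ⟨x, v⟩) := by
    refine tendsto_nhdsWithin_iff.2 ⟨?_, ?_⟩
    · have h1 := ((FiberBundle.continuous_totalSpaceMk (EucM m) (TangentSpace (𝓡∂ m))
        x).continuousAt (x := N v)).tendsto.comp hNc.tendsto
      rw [hNv] at h1
      exact h1
    · filter_upwards [hpos] with a ha
      change g.inner x (N a) (N a) = 1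
      rw [hN]
      simp only [map_smul, smul_apply, smul_eq_mul]
      rw [← mul_assoc, ← mul_inv, Real.mul_self_sqrt ha.le, inv_mul_cancel₀ ha.ne']
  have hev := hlim.eventually
    (IsNontangential.eventually (q := ⟨x, v⟩) hv A (𝒩 := Set.univ) Filter.univ_mem)
  refine Submodule.eq_top_of_nonempty_interior' _ ⟨v, mem_interior_iff_mem_nhds.2 ?_⟩
  filter_upwards [hev, hpos] with a ha hapos
  have h1 : N a ∈ Submodule.span ℝ {w : TangentSpace (𝓡∂ m) x | IsNontangential g x w} :=
    Submodule.subset_span ha.1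
  have h2 : a = √(g.inner x a a) • N a := by
    rw [hN]
    simp only [smul_smul]
    rw [mul_inv_cancel₀ (Real.sqrt_pos.2 hapos).ne', one_smul]
  rw [h2]
  exact Submodule.smul_mem _ _ h1

/-- In dimension at least two there is a nontangential direction different from `± v`. -/
lemma IsNontangential.exists_ne_ne_neg [T2Space M] (A : HermitianConnection m M n) (hm : 2 ≤ m)
    {x : M} {v : TangentSpace (𝓡∂ m) x} (hv : IsNontangential g x v) :
    ∃ u : TangentSpace (𝓡∂ m) x, IsNontangential g x u ∧ u ≠ v ∧ u ≠ -v := by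
  by_contra! h
  have hle : Submodule.span ℝ {w : TangentSpace (𝓡∂ m) x | IsNontangential g x w} ≤
      Submodule.span ℝ {v} := by
    refine Submodule.span_le.2 fun u hu => ?_
    by_cases huv : u = v
    · rw [huv]
      exact Submodule.mem_span_singleton_self v
    · rw [h u hu huv]
      exact Submodule.neg_mem _ (Submodule.mem_span_singleton_self v)
  rw [hv.span_eq_top A, top_le_iff] at hle
  have h1 : Module.finrank ℝ (TangentSpace (𝓡∂ m) x) ≤ 1 := finrank_le_one v fun w =>
    Submodule.mem_span_singleton.1 (hle ▸ Submodule.mem_top)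
  have h2 : Module.finrank ℝ (EucM m) = m := finrank_euclideanSpace_fin
  have h3 : Module.finrank ℝ (EucM m) ≤ 1 := h1
  omega

/-- Every nontangential direction extends to a continuous local section of the unit sphere bundle
which consists of nontangential directions. -/
lemma IsNontangential.exists_section [T2Space M] (A : HermitianConnection m M n) {x : M}
    {v : TangentSpace (𝓡∂ m) x} (hv : IsNontangential g x v) :
    ∃ O : Set M, IsOpen O ∧ x ∈ O ∧ ∃ s : M → TangentBundle (𝓡∂ m) M, ContinuousOn s O ∧
      ∀ y ∈ O, (s y).proj = y ∧ IsNontangential g (s y).proj (s y).snd := by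
  set q : TangentBundle (𝓡∂ m) M := ⟨x, v⟩ with hq
  set φ := extChartAt (𝓡∂ m) x with hφ
  have hsrc : q.proj ∈ φ.source := mem_extChartAt_source x
  have hx : x ∈ (𝓡∂ m).interior M := IsNontangential.mem_interior (q := q) hv
  set w := (tangentChart x q).2 with hw
  have hunit : chartForm g x (φ x) w w = 1 := by
    rw [← inner_eq_chartForm g hsrc]
    exact IsNontangential.mem_unitSphereBundle (q := q) hv
  have hw0 : w ≠ 0 := by
    rintro h0
    rw [h0] at hunit
    simp at hunit
  -- the coordinate vector field with the constant value `w`, normalized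
  set s : M → TangentBundle (𝓡∂ m) M := fun y =>
    (tangentChart x).symm (φ y, (√(chartForm g x (φ y) w w))⁻¹ • w) with hs
  have hsx : s x = q := by
    have h1 : (φ x, w) = tangentChart x q := Prod.ext (tangentChart_fst hsrc).symm rfl
    rw [hs]
    simp only [hunit, Real.sqrt_one, inv_one, one_smul]
    rw [h1]
    exact (tangentChart x).left_inv (mem_tangentChart_source.2 hsrc)
  set O₁ : Set M := φ.source ∩ (𝓡∂ m).interior M with hO₁
  have hO₁o : IsOpen O₁ := (isOpen_extChartAt_source x).inter
    (ModelWithCorners.isOpen_interior (n := ∞) (by simp))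
  have hint : ∀ y ∈ O₁, φ y ∈ interior φ.target := fun y hy =>
    extChartAt_mem_interior_target hy.1 hy.2
  have hpos : ∀ y ∈ O₁, 0 < chartForm g x (φ y) w w := fun y hy =>
    chartForm_pos g (interior_subset (hint y hy)) hw0
  have hsc : ∀ y ∈ O₁, ContinuousAt s y := by
    intro y hy
    have h1 : ContinuousAt φ y := continuousAt_extChartAt' hy.1
    have h2 : ContinuousAt (fun z => chartForm g x z w w) (φ y) :=
      ((hasFDerivAt_chartForm g (hint y hy)).continuousAt.clm_apply
        continuousAt_const).clm_apply continuousAt_const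
    have h3 : ContinuousAt (fun y => (√(chartForm g x (φ y) w w))⁻¹ • w) y :=
      (((ContinuousAt.comp (f := φ) h2 h1).sqrt).inv₀
        (Real.sqrt_pos.2 (hpos y hy)).ne').smul continuousAt_const
    have h4 : ContinuousAt (tangentChart (m := m) x).symm
        (φ y, (√(chartForm g x (φ y) w w))⁻¹ • w) :=
      continuousAt_extChartAt_symm''
        (mem_tangentChart_target.2 (interior_subset (hint y hy)))
    exact ContinuousAt.comp (f := fun y => (φ y, (√(chartForm g x (φ y) w w))⁻¹ • w)) h4
      (h1.prodMk h3)
  have hsp : ∀ y ∈ O₁, (s y).proj = y := fun y hy => by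
    rw [hs]
    simp only
    rw [tangentChart_symm_apply (interior_subset (hint y hy))]
    exact φ.left_inv hy.1
  have hsS : ∀ y ∈ O₁, s y ∈ unitSphereBundle g := fun y hy => by
    refine (inner_tangentChart_symm g (interior_subset (hint y hy)) _).trans ?_
    rw [map_smul, map_smul, smul_apply, smul_eq_mul, smul_eq_mul, ← mul_assoc, ← mul_inv,
      Real.mul_self_sqrt (hpos y hy).le, inv_mul_cancel₀ (hpos y hy).ne']
  have hxO₁ : x ∈ O₁ := ⟨hsrc, hx⟩
  have hlim : Filter.Tendsto s (𝓝 x) (𝓝[unitSphereBundle g] q) := by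
    refine tendsto_nhdsWithin_iff.2 ⟨hsx ▸ hsc x hxO₁, ?_⟩
    filter_upwards [hO₁o.mem_nhds hxO₁] with y hy using hsS y hy
  have hev := hlim.eventually
    (IsNontangential.eventually (q := q) hv A (𝒩 := Set.univ) Filter.univ_mem)
  obtain ⟨O, hO, hOo, hxO⟩ := mem_nhds_iff.1 (hev.and (hO₁o.mem_nhds hxO₁))
  exact ⟨O, hOo, hxO, s, fun y hy => (hsc y (hO hy).2).continuousWithinAt, fun y hy =>
    ⟨hsp y (hO hy).2, (hO hy).1.1⟩⟩

/-- If every component of `M` meets the boundary, and `m ≥ 2`, then agreement of the broken X-ray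
transforms for all nontangential directions implies gauge equivalence. -/
theorem gaugeEquivalent_of_xrayAgree_full [T2Space M] [CompactSpace M] (hm : 2 ≤ m)
    (hM : ∀ x : M, (connectedComponent x ∩ (𝓡∂ m).boundary M).Nonempty)
    (h : (fullGeodesicGraph g).XrayAgree A₁ A₂) : GaugeEquivalent A₁ A₂ := by
  set V : Set (TangentBundle (𝓡∂ m) M) := {q | IsNontangential g q.proj q.snd} with hV
  have hstep : ∀ (x : M) (v w : TangentSpace (𝓡∂ m) x), IsNontangential g x v →
      IsNontangential g x w → v ≠ w → v ≠ -w →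
      star (geodesicTransport g A₁ x v) * geodesicTransport g A₂ x v =
        star (geodesicTransport g A₁ x w) * geodesicTransport g A₂ x w :=
    fun x v w hv hw h1 h2 => (brokenXray_eq_iff hv hw).1 (h x v w ⟨hv, hw, h1, h2⟩)
  have hratio : ∀ (x : M) (v w : TangentSpace (𝓡∂ m) x), IsNontangential g x v →
      IsNontangential g x w →
      star (geodesicTransport g A₁ x v) * geodesicTransport g A₂ x v =
        star (geodesicTransport g A₁ x w) * geodesicTransport g A₂ x w := by
    intro x v w hv hw
    by_cases h1 : v = w
    · rw [h1]
    by_cases h2 : v = -w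
    · -- opposite directions are compared through a third one
      obtain ⟨u, hu, huv, huv'⟩ := hv.exists_ne_ne_neg A₁ hm
      have hwv : w = -v := by rw [h2, neg_neg]
      exact (hstep x u v hu hv huv huv').symm.trans (hstep x u w hu hw
        (by rwa [hwv]) (by rwa [hwv, neg_neg]))
    · exact hstep x v w hv hw h1 h2
  have heq := fun q (hq : q ∈ V) => transportRatio_eq (g := g) (A₁ := A₁) (A₂ := A₂) (V := V)
    (fun x v w hv hw => hratio x v w hv hw) hq
  have hex : ∀ x ∈ (𝓡∂ m).interior M, ∃ v : TangentSpace (𝓡∂ m) x, IsNontangential g x v := by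
    intro x hx
    obtain ⟨v, hv, -⟩ := exists_isNontangential_riemannianDist_le A₁ hx
      (boundaryDist_lt_top g (hM x))
    exact ⟨v, hv⟩
  refine IsTransportRatio.gaugeEquivalent (g := g) (V := V) (φ := transportRatio g A₁ A₂ V)
    ⟨fun q hq => hq, heq, fun x hx => ?_, fun x hx => ?_,
      boundary_subset_closure_scatteringMap A₁ g⟩
  · obtain ⟨v, hv⟩ := hex x hx
    refine ⟨{w | IsNontangential g x w}, hv.span_eq_top A₁, fun w hw => ?_⟩
    obtain ⟨ε, hε, Q, hQ0, hQ⟩ :=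
      exists_isSprayAt_Ioo hx (IsNontangential.mem_unitSphereBundle (q := ⟨x, w⟩) hw)
    have h0 : (0 : ℝ) ∈ Set.Ioo (-ε) ε := ⟨by linarith, hε⟩
    have hlim : Filter.Tendsto Q (𝓝[Set.Ioo (-ε) ε] 0) (𝓝[unitSphereBundle g] ⟨x, w⟩) := by
      refine tendsto_nhdsWithin_iff.2 ⟨hQ0 ▸ (hQ 0 h0).1.1, ?_⟩
      filter_upwards [self_mem_nhdsWithin] with t ht using (hQ t ht).2
    have hev := hlim.eventually
      (IsNontangential.eventually (q := ⟨x, w⟩) hw A₁ (𝒩 := Set.univ) Filter.univ_mem)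
    rw [nhdsWithin_eq_nhds.2 (Ioo_mem_nhds h0.1 h0.2)] at hev
    obtain ⟨ε', hε', hball⟩ := Metric.mem_nhds_iff.1 hev
    have hsub : Set.Ioo (-min ε ε') (min ε ε') ⊆ Set.Ioo (-ε) ε := fun t ht =>
      abs_lt.1 ((abs_lt.2 ht).trans_le (min_le_left _ _))
    refine ⟨min ε ε', lt_min hε hε', Q, hQ0, fun t ht => ⟨(hQ t (hsub ht)).1.mono hsub, ?_⟩⟩
    refine (hball ?_).1
    rw [Metric.mem_ball, dist_zero_right, Real.norm_eq_abs]
    exact (abs_lt.2 ht).trans_le (min_le_right _ _)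
  · obtain ⟨v, hv⟩ := hex x hx
    obtain ⟨O, hO, hxO, s, hs, hsO⟩ := hv.exists_section A₁
    refine ⟨O, hO, hxO, fun _ => Set.univ, fun _ => isClosed_univ,
      fun y _ => Set.mem_iUnion.2 ⟨0, trivial⟩, fun _ => ?_⟩
    rw [Set.univ_inter]
    refine ((continuousOn_star_mul_geodesicTransport (g := g) A₁ A₂).comp hs
      fun y hy => (hsO y hy).2).congr fun y hy => ?_
    exact (congrArg (transportRatio g A₁ A₂ V) (hsO y hy).1).symm.trans (heq (s y) (hsO y hy).2)

end AllDirections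

theorem theorem4 {m : ℕ} [NeZero m] {M : Type*} [TopologicalSpace M] [T2Space M] [CompactSpace M]
    [ChartedSpace (EuclideanHalfSpace m) M] [IsManifold (𝓡∂ m) ∞ M] (g : SmoothMetric m M)
    {n : ℕ} (A₁ A₂ : HermitianConnection m M n) :
    (∀ G : GeodesicGraph g, G.IsComplete → (G.XrayAgree A₁ A₂ ↔ GaugeEquivalent A₁ A₂)) ∧
    (2 ≤ m → (∀ x : M, (connectedComponent x ∩ (𝓡∂ m).boundary M).Nonempty) →
      ((fullGeodesicGraph g).XrayAgree A₁ A₂ ↔ GaugeEquivalent A₁ A₂)) :=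
  ⟨fun G hG => ⟨hG.gaugeEquivalent, fun h => h.xrayAgree G⟩, fun hm hM =>
    ⟨gaugeEquivalent_of_xrayAgree_full hm hM, fun h => h.xrayAgree (fullGeodesicGraph g)⟩⟩
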